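/- Let $Z$ be a compact Calabi--Yau threefold with boundary: a compact smooth $6$-manifold with boundary $M=\partial Z$, with a complex structure $J_Z$ (smooth up to the boundary) and a nowhere-zero holomorphic $3$-form $\Phi=\Psi+i\hat\Psi$, $d\Phi=0$, smooth up to the boundary. Assume that $M$ is strongly pseudoconvex and that every connected component of $Z$ meets $M$. All forms, functions and vector fields are smooth (up to the boundary). Notation. Let $r\le 0$ be a boundary defining function of $Z$ with positive definite Levi form, $\theta=-dr\circ J_Z|_M$ the corresponding contact form on $M$ (any contact form with kernel $H=TM\cap J_ZTM$ and the sign given by pseudoconvexity arises in this way), and $dz=dr-i\,dr\circ J_Z=2\partial r$, so that $dz|_{M}=i\theta$ on $TM$. * $\Omega^{p,q}$ is the space of $(p,q)$-forms on $Z$, and $H^{p,q}_Z$ is the cohomology of $(\Omega^{p,\bullet},\bar\partial)$. $\Omega^{p,q}_N\subset\Omega^{p,q}$ is the subspace of forms which at each point of $M$ have the shape $d\bar z\wedge\mu$ with $\mu$ of type $(p,q-1)$ (for $q=0$: which vanish at each point of $M$). $\Omega^{p,q}_T=\Omega^{p,q}/\Omega^{p,q}_N$ is the space of sections over $M$ of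 the quotient bundle $\Lambda^{p,q}_T=\Lambda^{p,q}_Z/\Lambda^{p,q}_N$, with the induced operator $\bar\partial_b$. $H^{p,q}_N$ and $H^{p,q}_T$ are the cohomologies of $(\Omega^{p,\bullet}_N,\bar\partial)$ and $(\Omega^{p,\bullet}_T,\bar\partial_b)$, and $\delta:H^{p,q}_T\to H^{p,q+1}_N$, $[\sigma]\mapsto[\bar\partial\sigma]$, is the connecting map of $0\to\Omega_N^{p,\bullet}\to\Omega^{p,\bullet}\to\Omega^{p,\bullet}_T\to0$. * $J$ is the operator on real $3$-forms on $Z$ whose complexification is $-i$ on types $(3,0),(2,1)$ and $i$ on types $(1,2),(0,3)$, and $$\hat{\mathcal K}=\frac{\{\rho\in\Omega^3(Z;\mathbb R): d\rho=0,\ dJ\rho=0,\ \rho|_M=0\}}{\{\mathcal L_w\Psi: w \text{ a vector field on } Z,\ w|_M=0\}} .$$ * $\mathcal H$ is the space of real $2$-forms $\gamma$ on $M$ annihilated by the Reeb field of $\theta$ (i.e. sections of $\Lambda^2_H$), of type $(1,1)$ on $H$, with $d_H\gamma=0$ and $d\theta\wedge\gamma=0$. * $b:\hat{\mathcal K}\to\mathcal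 H$ is given by $b[\rho]=\gamma$ where $J\rho|_M=\gamma\wedge\theta$; $\lambda:\ker b\to H^{2,1}_N$ is given by $\lambda[\rho]=[\rho_{2,1}]$, with $\rho_{2,1}$ the $(2,1)$-component of $\rho$; $\iota:\mathcal H\to H^{2,1}_T$ sends $\gamma$ to the class of $\gamma\wedge dz$; and $\mu=\delta\circ\iota:\mathcal H\to H^{2,2}_N$. Proposition. Suppose that $H^{3,1}_Z=0$ and that every function $f:M\to\mathbb C$ with $\bar\partial_bf=0$ is the restriction to $M$ of a holomorphic function on $Z$. Then the maps $b,\lambda,\iota,\delta$ are well defined and $\mathbb R$-linear, $\lambda:\ker b\to H^{2,1}_N$ is an isomorphism, and the image of $b:\hat{\mathcal K}\to\mathcal H$ is equal to $\ker\mu$. Consequently the sequence $$H^{2,1}_N\xrightarrow{\ \lambda^{-1}\ }\hat{\mathcal K}\xrightarrow{\ b\ }\mathcal H\xrightarrow{\ \mu\ }H^{2,2}_N$$ is exact at $\hat{\mathcal K}$ and at $\mathcal H$. -/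

import Mathlib

open scoped Manifold ContDiff
open Set

noncomputable section

namespace CYBoundary

/-! ### Differential forms on a manifold with boundary -/

section Forms

variable {E : Type*} [NormedAddCommGroup E] [NormedSpace ℝ E]
  {H : Type*} [TopologicalSpace H] (I : ModelWithCorners ℝ E H)
  {X : Type*} [TopologicalSpace X] [ChartedSpace H X]
  (F : Type*) [NormedAddCommGroup F] [NormedSpace ℝ F]

variable (X) in
/-- `F`-valued differential `k`-forms on `X`, not necessarily smooth (or even continuous). -/
def Form (k : ℕ) : Type _ := ∀ x : X, TangentSpace I x [⋀^Fin k]→L[ℝ] F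

instance (k : ℕ) : AddCommGroup (Form I X F k) :=
  inferInstanceAs (AddCommGroup (∀ x : X, TangentSpace I x [⋀^Fin k]→L[ℝ] F))

instance (k : ℕ) : Module ℝ (Form I X F k) :=
  inferInstanceAs (Module ℝ (∀ x : X, TangentSpace I x [⋀^Fin k]→L[ℝ] F))

variable {I F}

lemma Form.add_apply {k : ℕ} (φ ψ : Form I X F k) (x : X) : (φ + ψ) x = φ x + ψ x := rfl

lemma Form.smul_apply {k : ℕ} (c : ℝ) (φ : Form I X F k) (x : X) : (c • φ) x = c • φ x := rfl

lemma Form.zero_apply {k : ℕ} (x : X) : (0 : Form I X F k) x = 0 := rfl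

/-- The coordinate expression of the form `φ` in the preferred (extended) chart at `x₀`: its
pull-back to the model vector space by the inverse chart. -/
def chartRep {k : ℕ} (x₀ : X) (φ : Form I X F k) (p : E) : E [⋀^Fin k]→L[ℝ] F :=
  (φ ((extChartAt I x₀).symm p)).compContinuousLinearMap
    (mfderivWithin 𝓘(ℝ, E) I (extChartAt I x₀).symm (range I) p)

/-- A form is smooth (up to the boundary) if all its coordinate expressions are. -/
def IsSmoothForm {k : ℕ} (φ : Form I X F k) : Prop :=
  ∀ x₀ : X, ContDiffOn ℝ ∞ (chartRep x₀ φ) (extChartAt I x₀).target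

/-- The exterior derivative, computed in the preferred chart at each point. -/
def extD {k : ℕ} (φ : Form I X F k) : Form I X F (k + 1) := fun x =>
  (extDerivWithin (chartRep x φ) (range I) (extChartAt I x x)).compContinuousLinearMap
    (mfderiv I 𝓘(ℝ, E) (extChartAt I x) x)

/-- Interior product `i_w φ` with a vector field. -/
def interiorProd {k : ℕ} (w : ∀ x : X, TangentSpace I x) (φ : Form I X F (k + 1)) :
    Form I X F k := fun x =>
  ContinuousAlternatingMap.curryLeft (E := E) (φ x) (w x)

/-- The Lie derivative of a form along a vector field, `L_w = d i_w + i_w d`. -/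
def lieDeriv {k : ℕ} (w : ∀ x : X, TangentSpace I x) (φ : Form I X F (k + 1)) :
    Form I X F (k + 1) :=
  extD (interiorProd w φ) + interiorProd w (extD φ)

/-- A field of endomorphisms of the tangent spaces is smooth if it is so in charts. -/
def IsSmoothEnd (A : ∀ x : X, TangentSpace I x →L[ℝ] TangentSpace I x) : Prop :=
  ∀ x₀ : X, ContDiffOn ℝ ∞
    (fun p : E =>
      ((mfderiv I 𝓘(ℝ, E) (extChartAt I x₀) ((extChartAt I x₀).symm p)) ∘L
        (A ((extChartAt I x₀).symm p)) ∘L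
        (mfderivWithin 𝓘(ℝ, E) I (extChartAt I x₀).symm (range I) p) : E →L[ℝ] E))
    (extChartAt I x₀).target

lemma chartRep_add {k : ℕ} (x₀ : X) (φ η : Form I X F k) :
    chartRep x₀ (φ + η) = chartRep x₀ φ + chartRep x₀ η := rfl

lemma chartRep_smul {k : ℕ} (x₀ : X) (c : ℝ) (φ : Form I X F k) :
    chartRep x₀ (c • φ) = c • chartRep x₀ φ := rfl

lemma chartRep_zero {k : ℕ} (x₀ : X) : chartRep x₀ (0 : Form I X F k) = 0 := rfl

variable (I X F) in
/-- The real vector space of smooth `F`-valued `k`-forms. -/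
def SmoothForm (k : ℕ) : Submodule ℝ (Form I X F k) where
  carrier := {φ | IsSmoothForm φ}
  zero_mem' := fun x₀ => by rw [chartRep_zero]; exact contDiffOn_const
  add_mem' := fun h₁ h₂ x₀ => by rw [chartRep_add]; exact (h₁ x₀).add (h₂ x₀)
  smul_mem' := fun c _ h x₀ => by rw [chartRep_smul]; exact contDiffOn_const.smul (h x₀)

lemma IsSmoothForm.differentiableWithinAt {k : ℕ} {φ : Form I X F k} (h : IsSmoothForm φ)
    (x : X) : DifferentiableWithinAt ℝ (chartRep x φ) (range I) (extChartAt I x x) :=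
  (((h x).differentiableOn (by simp)) _ (mem_extChartAt_target x)).mono_of_mem_nhdsWithin
    (extChartAt_target_mem_nhdsWithin x)

lemma uniqueDiff_chart (x : X) : UniqueDiffWithinAt ℝ (range I) (extChartAt I x x) :=
  I.uniqueDiffOn _ (extChartAt_target_subset_range x (mem_extChartAt_target x))

variable (I X F) in
/-- The exterior derivative as a linear map on smooth forms. -/
def extDₗ (k : ℕ) : SmoothForm I X F k →ₗ[ℝ] Form I X F (k + 1) where
  toFun φ := extD φ.1
  map_add' φ η := by
    funext x
    have h := extDerivWithin_add (uniqueDiff_chart (I := I) x)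
      (IsSmoothForm.differentiableWithinAt φ.2 x) (IsSmoothForm.differentiableWithinAt η.2 x)
    change (extDerivWithin (chartRep x φ.1 + chartRep x η.1) _ _).compContinuousLinearMap _ = _
    rw [h]; rfl
  map_smul' c φ := by
    funext x
    have h := extDerivWithin_smul c (chartRep x φ.1) (uniqueDiff_chart (I := I) x)
    change (extDerivWithin (c • chartRep x φ.1) _ _).compContinuousLinearMap _ = _
    rw [h]; rfl

end Forms

/-! ### Linear algebra of `(p,q)`-forms -/

section LinearAlgebra

variable {V : Type*} [AddCommGroup V] [Module ℝ V] [TopologicalSpace V] [IsTopologicalAddGroup V]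
  [ContinuousConstSMul ℝ V]

/-- The rotation `e^{tJ} = cos t + (sin t) J` defined by a complex structure `J`. -/
def rot (J : V →L[ℝ] V) (t : ℝ) : V →L[ℝ] V :=
  Real.cos t • ContinuousLinearMap.id ℝ V + Real.sin t • J

/-- For a complex structure `J` on `V`, a complex-valued form `φ` of degree `p + q` is of type
`(p,q)` if `e^{tJ}` acts on it with weight `p - q`, i.e. by the scalar `e^{i(p-q)t}`: in degree
`p + q`, the spaces `Λ^{p',q'}` are the weight spaces of this circle action. -/
def IsOfType (J : V →L[ℝ] V) (p q : ℕ) {k : ℕ} (φ : V [⋀^Fin k]→L[ℝ] ℂ) : Prop :=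
  p + q = k ∧ ∀ t : ℝ, φ.compContinuousLinearMap (rot J t) =
    Complex.exp (Complex.I * (((p : ℂ) - (q : ℂ)) * (t : ℂ))) • φ

/-- The component of type `(p,q)` of a complex-valued form of degree `k = p + q`, as a Fourier
average of the circle action over the `(2k+1)`-st roots of unity; the weights in degree `k` all
lie between `-k` and `k`, so they are distinguished by these. -/
def typeProj (J : V →L[ℝ] V) (p q : ℕ) {k : ℕ} (φ : V [⋀^Fin k]→L[ℝ] ℂ) :
    V [⋀^Fin k]→L[ℝ] ℂ :=
  ((2 * k + 1 : ℕ) : ℂ)⁻¹ • ∑ j ∈ Finset.range (2 * k + 1),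
    Complex.exp (-(Complex.I * (((p : ℂ) - (q : ℂ)) *
      ((2 * Real.pi * j / (2 * k + 1 : ℕ) : ℝ) : ℂ)))) •
      φ.compContinuousLinearMap (rot J (2 * Real.pi * j / (2 * k + 1 : ℕ)))

/-- The wedge product `ζ ∧ μ` of a covector `ζ` and a `k`-form `μ`, as a function of `k + 1`
vectors. -/
def wedgeCovector {𝔽 : Type*} [NormedField 𝔽] [NormedSpace ℝ 𝔽] {k : ℕ} (ζ : V →L[ℝ] 𝔽)
    (μ : V [⋀^Fin k]→L[ℝ] 𝔽) (v : Fin (k + 1) → V) : 𝔽 :=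
  ∑ i : Fin (k + 1), (-1) ^ (i : ℕ) * ζ (v i) * μ (i.removeNth v)

/-- The wedge product of two real `2`-forms, as a function of four vectors. -/
def wedgeTwo (α β : V [⋀^Fin 2]→L[ℝ] ℝ) (v : Fin 4 → V) : ℝ :=
  α ![v 0, v 1] * β ![v 2, v 3] - α ![v 0, v 2] * β ![v 1, v 3]
    + α ![v 0, v 3] * β ![v 1, v 2] + α ![v 1, v 2] * β ![v 0, v 3]
    - α ![v 1, v 3] * β ![v 0, v 2] + α ![v 2, v 3] * β ![v 0, v 1]

lemma typeProj_add (J : V →L[ℝ] V) (p q : ℕ) {k : ℕ} (φ ψ : V [⋀^Fin k]→L[ℝ] ℂ) :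
    typeProj J p q (φ + ψ) = typeProj J p q φ + typeProj J p q ψ := by
  ext v
  simp [typeProj, ContinuousAlternatingMap.sum_apply, mul_add, Finset.sum_add_distrib]

lemma typeProj_smul (J : V →L[ℝ] V) (p q : ℕ) {k : ℕ} (c : ℝ) (φ : V [⋀^Fin k]→L[ℝ] ℂ) :
    typeProj J p q (c • φ) = c • typeProj J p q φ := by
  ext v
  simp only [typeProj, ContinuousAlternatingMap.smul_apply, ContinuousAlternatingMap.sum_apply,
    ContinuousAlternatingMap.compContinuousLinearMap_apply, smul_eq_mul, Complex.real_smul,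
    Finset.mul_sum]
  refine Finset.sum_congr rfl fun j _ => by ring

/-- A real form regarded as a complex-valued one. -/
def complexify {k : ℕ} (φ : V [⋀^Fin k]→L[ℝ] ℝ) : V [⋀^Fin k]→L[ℝ] ℂ :=
  Complex.ofRealCLM.compContinuousAlternatingMap φ

/-- The real part of a complex-valued form. -/
def rePart {k : ℕ} (φ : V [⋀^Fin k]→L[ℝ] ℂ) : V [⋀^Fin k]→L[ℝ] ℝ :=
  Complex.reCLM.compContinuousAlternatingMap φ

/-- The operator on real `3`-forms which, after complexification, acts as `-i` on types `(3,0)`,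
`(2,1)` and as `i` on types `(1,2)`, `(0,3)`. -/
def opJ (J : V →L[ℝ] V) (ρ : V [⋀^Fin 3]→L[ℝ] ℝ) : V [⋀^Fin 3]→L[ℝ] ℝ :=
  rePart ((-Complex.I) • typeProj J 3 0 (complexify ρ) + (-Complex.I) • typeProj J 2 1 (complexify ρ)
    + Complex.I • typeProj J 1 2 (complexify ρ) + Complex.I • typeProj J 0 3 (complexify ρ))

set_option linter.unusedSectionVars false in
lemma complexify_add {k : ℕ} (φ ψ : V [⋀^Fin k]→L[ℝ] ℝ) :
    complexify (φ + ψ) = complexify φ + complexify ψ := by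
  ext v; simp [complexify]

set_option linter.unusedSectionVars false in
lemma complexify_smul {k : ℕ} (c : ℝ) (φ : V [⋀^Fin k]→L[ℝ] ℝ) :
    complexify (c • φ) = c • complexify φ := by
  ext v; simp [complexify]

lemma opJ_add (J : V →L[ℝ] V) (ρ σ : V [⋀^Fin 3]→L[ℝ] ℝ) :
    opJ J (ρ + σ) = opJ J ρ + opJ J σ := by
  ext v
  simp [opJ, rePart, complexify_add, typeProj_add]
  ring

lemma opJ_smul (J : V →L[ℝ] V) (c : ℝ) (ρ : V [⋀^Fin 3]→L[ℝ] ℝ) :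
    opJ J (c • ρ) = c • opJ J ρ := by
  ext v
  simp [opJ, rePart, complexify_smul, typeProj_smul]
  ring

end LinearAlgebra

section SmoothOperator

lemma rot_comp {V W : Type*} [AddCommGroup V] [Module ℝ V] [TopologicalSpace V]
    [IsTopologicalAddGroup V] [ContinuousConstSMul ℝ V] [AddCommGroup W] [Module ℝ W]
    [TopologicalSpace W] [IsTopologicalAddGroup W] [ContinuousConstSMul ℝ W]
    {J : V →L[ℝ] V} {J' : W →L[ℝ] W} {D : W →L[ℝ] V} (h : ∀ w, J (D w) = D (J' w)) (t : ℝ)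
    (w : W) : rot J t (D w) = D (rot J' t w) := by
  simp [rot, h]

lemma typeProj_comp {V W : Type*} [AddCommGroup V] [Module ℝ V] [TopologicalSpace V]
    [IsTopologicalAddGroup V] [ContinuousConstSMul ℝ V] [AddCommGroup W] [Module ℝ W]
    [TopologicalSpace W] [IsTopologicalAddGroup W] [ContinuousConstSMul ℝ W]
    {J : V →L[ℝ] V} {J' : W →L[ℝ] W} {D : W →L[ℝ] V} (h : ∀ w, J (D w) = D (J' w))
    (p q : ℕ) {k : ℕ} (φ : V [⋀^Fin k]→L[ℝ] ℂ) :
    (typeProj J p q φ).compContinuousLinearMap D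
      = typeProj J' p q (φ.compContinuousLinearMap D) := by
  ext v
  simp [typeProj, ContinuousAlternatingMap.sum_apply, Function.comp_def, rot_comp h]

lemma opJ_comp {V W : Type*} [AddCommGroup V] [Module ℝ V] [TopologicalSpace V]
    [IsTopologicalAddGroup V] [ContinuousConstSMul ℝ V] [AddCommGroup W] [Module ℝ W]
    [TopologicalSpace W] [IsTopologicalAddGroup W] [ContinuousConstSMul ℝ W]
    {J : V →L[ℝ] V} {J' : W →L[ℝ] W} {D : W →L[ℝ] V} (h : ∀ w, J (D w) = D (J' w))
    (ρ : V [⋀^Fin 3]→L[ℝ] ℝ) :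
    (opJ J ρ).compContinuousLinearMap D = opJ J' (ρ.compContinuousLinearMap D) := by
  have hc : complexify (ρ.compContinuousLinearMap D)
      = (complexify ρ).compContinuousLinearMap D := rfl
  rw [opJ, opJ, hc, ← typeProj_comp h, ← typeProj_comp h, ← typeProj_comp h, ← typeProj_comp h]
  rfl

variable {E : Type*} [NormedAddCommGroup E] [NormedSpace ℝ E] [FiniteDimensional ℝ E]

lemma exists_leftInverse_toMultilinear (k : ℕ) :
    ∃ L : ContinuousMultilinearMap ℝ (fun _ : Fin k => E) ℂ →L[ℝ] E [⋀^Fin k]→L[ℝ] ℂ,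
      ∀ φ : E [⋀^Fin k]→L[ℝ] ℂ, L φ.toContinuousMultilinearMap = φ := by
  let toM : ContinuousMultilinearMap ℝ (fun _ : Fin k => E) ℂ →ₗ[ℝ]
      MultilinearMap ℝ (fun _ : Fin k => E) ℂ := ContinuousMultilinearMap.toMultilinearMapLinear
  have : FiniteDimensional ℝ (ContinuousMultilinearMap ℝ (fun _ : Fin k => E) ℂ) :=
    FiniteDimensional.of_injective toM ContinuousMultilinearMap.toMultilinearMap_injective
  obtain ⟨g, hg⟩ := LinearMap.exists_leftInverse_of_injective
    (ContinuousAlternatingMap.toContinuousMultilinearMapLinear (R := ℝ) (A := ℝ) (M := E) (N := ℂ)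
      (ι := Fin k))
    (LinearMap.ker_eq_bot.2 ContinuousAlternatingMap.toContinuousMultilinearMap_injective)
  exact ⟨LinearMap.toContinuousLinearMap g, fun φ => LinearMap.congr_fun hg φ⟩

lemma contDiffOn_comp_alternating {k : ℕ} {s : Set E} {f : E → E [⋀^Fin k]→L[ℝ] ℂ}
    {g : E → E →L[ℝ] E} (hf : ContDiffOn ℝ ∞ f s) (hg : ContDiffOn ℝ ∞ g s) :
    ContDiffOn ℝ ∞ (fun p => (f p).compContinuousLinearMap (g p)) s := by
  obtain ⟨L, hL⟩ := exists_leftInverse_toMultilinear (E := E) k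
  have h1 : ContDiffOn ℝ ∞ (fun p => ContinuousMultilinearMap.compContinuousLinearMapContinuousMultilinear ℝ
      (fun _ : Fin k => E) (fun _ : Fin k => E) ℂ (fun _ => g p)) s :=
    (ContinuousMultilinearMap.contDiff _).comp_contDiffOn (contDiffOn_pi.2 fun _ => hg)
  have h2 : ContDiffOn ℝ ∞ (fun p => (f p).toContinuousMultilinearMap) s :=
    (ContinuousAlternatingMap.toContinuousMultilinearMapCLM (E := E) (F := ℂ) (ι := Fin k)
      (𝕜 := ℝ) ℝ).contDiff.comp_contDiffOn hf
  have h3 := L.contDiff.comp_contDiffOn (h1.clm_apply h2)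
  refine h3.congr fun p _ => ?_
  exact (hL ((f p).compContinuousLinearMap (g p))).symm

set_option linter.unusedSectionVars false in
lemma contDiffOn_rot {s : Set E} {g : E → E →L[ℝ] E} (hg : ContDiffOn ℝ ∞ g s) (t : ℝ) :
    ContDiffOn ℝ ∞ (fun p => rot (g p) t) s :=
  contDiffOn_const.add (hg.const_smul (Real.sin t))

lemma contDiffOn_typeProj {k : ℕ} {s : Set E} {f : E → E [⋀^Fin k]→L[ℝ] ℂ} {g : E → E →L[ℝ] E}
    (hf : ContDiffOn ℝ ∞ f s) (hg : ContDiffOn ℝ ∞ g s) (p q : ℕ) :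
    ContDiffOn ℝ ∞ (fun x => typeProj (g x) p q (f x)) s := by
  unfold typeProj
  refine ContDiffOn.const_smul _ (ContDiffOn.sum fun j _ => ContDiffOn.const_smul _ ?_)
  exact contDiffOn_comp_alternating hf (contDiffOn_rot hg _)

lemma contDiffOn_opJ {s : Set E} {f : E → E [⋀^Fin 3]→L[ℝ] ℝ} {g : E → E →L[ℝ] E}
    (hf : ContDiffOn ℝ ∞ f s) (hg : ContDiffOn ℝ ∞ g s) :
    ContDiffOn ℝ ∞ (fun x => opJ (g x) (f x)) s := by
  have hc : ContDiffOn ℝ ∞ (fun x => complexify (f x)) s :=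
    (ContinuousLinearMap.compContinuousAlternatingMapCLM ℝ E _ _ (ι := Fin 3)
      Complex.ofRealCLM).contDiff.comp_contDiffOn hf
  refine (ContinuousLinearMap.compContinuousAlternatingMapCLM ℝ E _ _ (ι := Fin 3)
      Complex.reCLM).contDiff.comp_contDiffOn (g := fun φ => rePart φ) ?_
  exact (((ContDiffOn.const_smul _ (contDiffOn_typeProj hc hg 3 0)).add
    (ContDiffOn.const_smul _ (contDiffOn_typeProj hc hg 2 1))).add
    (ContDiffOn.const_smul _ (contDiffOn_typeProj hc hg 1 2))).add
    (ContDiffOn.const_smul _ (contDiffOn_typeProj hc hg 0 3))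

variable {H : Type*} [TopologicalSpace H] {I : ModelWithCorners ℝ E H}
  {X : Type*} [TopologicalSpace X] [ChartedSpace H X] [IsManifold I ∞ X]

/-- The operator `J` preserves smoothness of real `3`-forms. -/
lemma isSmoothForm_opJ {A : ∀ x : X, TangentSpace I x →L[ℝ] TangentSpace I x}
    (hA : IsSmoothEnd A) {ρ : Form I X ℝ 3} (hρ : IsSmoothForm ρ) :
    IsSmoothForm (fun x => opJ (A x) (ρ x) : Form I X ℝ 3) := by
  have : IsManifold I 1 X := IsManifold.of_le (n := ∞) (by simp)
  intro x₀
  refine (contDiffOn_opJ (hρ x₀) (hA x₀)).congr fun p hp => ?_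
  refine opJ_comp (fun w => ?_) _
  have h := mfderivWithin_extChartAt_symm_comp_mfderiv_extChartAt (I := I) hp
  exact (DFunLike.congr_fun h _).symm

end SmoothOperator

/-! ### Calabi-Yau threefolds with boundary -/

/-- The differential of a complex-valued function on a manifold, as a covector. -/
def dComplex {E : Type*} [NormedAddCommGroup E] [NormedSpace ℝ E] {H : Type*} [TopologicalSpace H]
    (I : ModelWithCorners ℝ E H) {X : Type*} [TopologicalSpace X] [ChartedSpace H X]
    (f : X → ℂ) (x : X) : TangentSpace I x →L[ℝ] ℂ :=
  (mfderiv I 𝓘(ℝ, ℂ) f x : TangentSpace I x →L[ℝ] ℂ)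

/-- A Calabi-Yau structure on a `6`-manifold with boundary: an almost complex structure `J` and a
nowhere zero closed complex `3`-form `Φ = Ψ + i Ψ'` of type `(3,0)`. The form `Φ` determines `J`,
and its closedness forces `J` to be integrable and `Φ` to be holomorphic. -/
structure CalabiYau (Z : Type*) [TopologicalSpace Z] [ChartedSpace (EuclideanHalfSpace 6) Z]
    [IsManifold (𝓡∂ 6) ∞ Z] where
  J : ∀ x : Z, TangentSpace (𝓡∂ 6) x →L[ℝ] TangentSpace (𝓡∂ 6) x
  J_smooth : IsSmoothEnd J
  J_sq : ∀ x v, J x (J x v) = -v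
  Φ : Form (𝓡∂ 6) Z ℂ 3
  Φ_smooth : IsSmoothForm Φ
  Φ_type : ∀ x, IsOfType (J x) 3 0 (Φ x)
  Φ_ne_zero : ∀ x, Φ x ≠ 0
  Φ_closed : extD Φ = 0

namespace CalabiYau

variable {Z : Type*} [TopologicalSpace Z] [ChartedSpace (EuclideanHalfSpace 6) Z]
  [IsManifold (𝓡∂ 6) ∞ Z] (C : CalabiYau Z)

/-- The real part `Ψ` of the holomorphic volume form. -/
def Ψ : Form (𝓡∂ 6) Z ℝ 3 := fun x => rePart (C.Φ x)

/-- Holomorphic functions on `Z`, smooth up to the boundary. -/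
def IsHolomorphic (F : Z → ℂ) : Prop :=
  ContMDiff (𝓡∂ 6) 𝓘(ℝ, ℂ) ∞ F ∧
    ∀ (x : Z) (v : TangentSpace (𝓡∂ 6) x),
      dComplex (𝓡∂ 6) F x (C.J x v) = Complex.I * dComplex (𝓡∂ 6) F x v

/-- The space `Ω^{p,q}` of smooth forms of type `(p,q)` on `Z` (up to the boundary). -/
def Omega (p q : ℕ) : Submodule ℝ (Form (𝓡∂ 6) Z ℂ (p + q)) where
  carrier := {φ | φ ∈ SmoothForm (𝓡∂ 6) Z ℂ (p + q) ∧ ∀ x, IsOfType (C.J x) p q (φ x)}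
  zero_mem' := ⟨zero_mem _, fun x => ⟨rfl, fun t => by ext v; simp [Form.zero_apply]⟩⟩
  add_mem' := fun h₁ h₂ => ⟨add_mem h₁.1 h₂.1, fun x => ⟨rfl, fun t => by
    have e₁ := (h₁.2 x).2 t
    have e₂ := (h₂.2 x).2 t
    rw [Form.add_apply, smul_add, ← e₁, ← e₂]; rfl⟩⟩
  smul_mem' := fun c _ h => ⟨Submodule.smul_mem _ c h.1, fun x => ⟨rfl, fun t => by
    have e := (h.2 x).2 t
    rw [Form.smul_apply, smul_comm, ← e]; rfl⟩⟩

/-- The operator `∂̄` on `Ω^{p,q}`: the component of type `(p,q+1)` of the exterior derivative. -/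
def dbar (p q : ℕ) : C.Omega p q →ₗ[ℝ] Form (𝓡∂ 6) Z ℂ (p + (q + 1)) where
  toFun φ := fun x => typeProj (C.J x) p (q + 1) (extD φ.1 x)
  map_add' φ ψ := by
    funext x
    have h := congrFun ((extDₗ (𝓡∂ 6) Z ℂ (p + q)).map_add ⟨φ.1, φ.2.1⟩ ⟨ψ.1, ψ.2.1⟩) x
    change extD (φ.1 + ψ.1) x = extD φ.1 x + extD ψ.1 x at h
    change typeProj (C.J x) p (q + 1) (extD (φ.1 + ψ.1) x) = _
    rw [h, typeProj_add]; rfl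
  map_smul' c φ := by
    funext x
    have h := congrFun ((extDₗ (𝓡∂ 6) Z ℂ (p + q)).map_smul c ⟨φ.1, φ.2.1⟩) x
    change extD (c • φ.1) x = c • extD φ.1 x at h
    change typeProj (C.J x) p (q + 1) (extD (c • φ.1) x) = _
    rw [h, typeProj_smul]; rfl

/-- The `∂̄`-exact forms of type `(p,q)`. -/
def exactForms (p : ℕ) : (q : ℕ) → Submodule ℝ (C.Omega p q)
  | 0 => ⊥
  | q + 1 => (LinearMap.range (C.dbar p q)).comap (C.Omega p (q + 1)).subtype

/-- The Dolbeault cohomology `H^{p,q}_Z` of forms smooth up to the boundary. -/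
abbrev Dolbeault (p q : ℕ) : Type _ :=
  (LinearMap.ker (C.dbar p q)) ⧸ (C.exactForms p q).submoduleOf (LinearMap.ker (C.dbar p q))

/-- The operator `J` on real `3`-forms. -/
def opJForm (ρ : Form (𝓡∂ 6) Z ℝ 3) : Form (𝓡∂ 6) Z ℝ 3 := fun x => opJ (C.J x) (ρ x)

end CalabiYau

/-! ### Strongly pseudoconvex boundary -/

section Boundary

variable {Z : Type*} [TopologicalSpace Z] [ChartedSpace (EuclideanHalfSpace 6) Z]
  [IsManifold (𝓡∂ 6) ∞ Z]
  {M : Type*} [TopologicalSpace M] [ChartedSpace (EuclideanSpace ℝ (Fin 5)) M]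
  [IsManifold (𝓡 5) ∞ M]

/-- The differential of a real function, as a covector. -/
def dReal (r : Z → ℝ) (x : Z) : TangentSpace (𝓡∂ 6) x →L[ℝ] ℝ :=
  (mfderiv (𝓡∂ 6) 𝓘(ℝ, ℝ) r x : TangentSpace (𝓡∂ 6) x →L[ℝ] ℝ)

/-- The differential of a map `M → Z`. -/
abbrev dIncl (i : M → Z) (y : M) : TangentSpace (𝓡 5) y →L[ℝ] TangentSpace (𝓡∂ 6) (i y) :=
  mfderiv (𝓡 5) (𝓡∂ 6) i y

/-- The `1`-form `θ = -dr ∘ J` restricted to `M`. -/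
def contactCovector (C : CalabiYau Z) (i : M → Z) (r : Z → ℝ) (y : M) :
    TangentSpace (𝓡 5) y →L[ℝ] ℝ :=
  -((dReal r (i y)) ∘L (C.J (i y)) ∘L (dIncl i y))

/-- The same as a differential form of degree one on `M`. -/
def contactForm (C : CalabiYau Z) (i : M → Z) (r : Z → ℝ) : Form (𝓡 5) M ℝ 1 := fun y =>
  ContinuousAlternatingMap.ofSubsingleton ℝ (TangentSpace (𝓡 5) y) ℝ (0 : Fin 1)
    (contactCovector C i r y)

/-- For tangent vectors `u`, `u'` of `M`: both lie in the complex tangent space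
`H = TM ∩ J TM`, and `u' = J u`. -/
def IsJPair (C : CalabiYau Z) (i : M → Z) (y : M) (u u' : TangentSpace (𝓡 5) y) : Prop :=
  dIncl i y u' = C.J (i y) (dIncl i y u)

/-- `M`, embedded by `incl`, is the boundary of `Z`, and it is strongly pseudoconvex: `r` is a
boundary defining function (negative in the interior) whose Levi form `dθ(u, Ju)`,
`θ = -dr ∘ J`, is positive definite on the complex tangent spaces of `M`. In particular `θ` is
a contact form on `M` with `ker θ = H`; every contact form with this kernel and sign arises from
some `r`. -/
structure StronglyPseudoconvexBoundary (C : CalabiYau Z) (M : Type*) [TopologicalSpace M]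
    [ChartedSpace (EuclideanSpace ℝ (Fin 5)) M] [IsManifold (𝓡 5) ∞ M] where
  incl : M → Z
  incl_smooth : ContMDiff (𝓡 5) (𝓡∂ 6) ∞ incl
  incl_embedding : Topology.IsEmbedding incl
  incl_immersion : ∀ y, Function.Injective (dIncl incl y)
  range_incl : range incl = (𝓡∂ 6).boundary Z
  r : Z → ℝ
  r_smooth : ContMDiff (𝓡∂ 6) 𝓘(ℝ, ℝ) ∞ r
  r_nonpos : ∀ x, r x ≤ 0
  r_eq_zero_iff : ∀ x, r x = 0 ↔ x ∈ (𝓡∂ 6).boundary Z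
  dr_ne_zero : ∀ x ∈ (𝓡∂ 6).boundary Z, dReal r x ≠ 0
  levi_pos : ∀ (y : M) (u u' : TangentSpace (𝓡 5) y), IsJPair C incl y u u' → u ≠ 0 →
    0 < extD (contactForm C incl r) y ![u, u']

namespace StronglyPseudoconvexBoundary

variable {C : CalabiYau Z} (B : StronglyPseudoconvexBoundary C M)

/-- The contact form `θ` at a point. -/
def θ (y : M) : TangentSpace (𝓡 5) y →L[ℝ] ℝ := contactCovector C B.incl B.r y

/-- The `2`-form `dθ` on `M`. -/
def dθ : Form (𝓡 5) M ℝ 2 := extD (contactForm C B.incl B.r)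

/-- `u` lies in the contact subspace `H`. -/
def MemH (y : M) (u : TangentSpace (𝓡 5) y) : Prop := ∃ u', IsJPair C B.incl y u u'

/-- The restriction `φ|_M` of a form to `M` as a form on `M` (pull-back). -/
def restrict {F : Type*} [NormedAddCommGroup F] [NormedSpace ℝ F] {k : ℕ}
    (φ : Form (𝓡∂ 6) Z F k) : Form (𝓡 5) M F k := fun y =>
  (φ (B.incl y)).compContinuousLinearMap (dIncl B.incl y)

/-- CR functions on `M`: smooth functions with `∂̄_b f = 0`. -/
def IsCR (f : M → ℂ) : Prop :=
  ContMDiff (𝓡 5) 𝓘(ℝ, ℂ) ∞ f ∧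
    ∀ (y : M) (u u' : TangentSpace (𝓡 5) y), IsJPair C B.incl y u u' →
      dComplex (𝓡 5) f y u' = Complex.I * dComplex (𝓡 5) f y u

/-- The complex linear covector `dz = dr - i dr ∘ J = 2 ∂r`. At a point of the boundary the kernel
of `Re dz = dr` is the tangent space of `M`, and `dz` restricts to `i θ` on `M`. -/
def dz (x : Z) : TangentSpace (𝓡∂ 6) x →L[ℝ] ℂ :=
  Complex.ofRealCLM ∘L (dReal B.r x) -
    Complex.I • (Complex.ofRealCLM ∘L (dReal B.r x) ∘L (C.J x))

/-- The complex conjugate covector. -/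
def dzbar (x : Z) : TangentSpace (𝓡∂ 6) x →L[ℝ] ℂ :=
  (Complex.conjCLE : ℂ →L[ℝ] ℂ) ∘L (B.dz x)

/-- The normal forms `Λ^{p,q}_N` at `x`: those of the shape `dz̄ ∧ μ` with `μ` of type
`(p,q-1)`; only zero if `q = 0`. -/
def IsNormal (x : Z) (p : ℕ) :
    (q : ℕ) → (TangentSpace (𝓡∂ 6) x [⋀^Fin (p + q)]→L[ℝ] ℂ) → Prop
  | 0, φ => φ = 0
  | q + 1, φ => ∃ μ : TangentSpace (𝓡∂ 6) x [⋀^Fin (p + q)]→L[ℝ] ℂ,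
      IsOfType (C.J x) p q μ ∧
        ∀ v : Fin (p + q + 1) → TangentSpace (𝓡∂ 6) x, φ v = wedgeCovector (B.dzbar x) μ v

lemma isNormal_zero (x : Z) (p q : ℕ) : B.IsNormal x p q 0 := by
  cases q with
  | zero => rfl
  | succ q =>
    exact ⟨0, ⟨rfl, fun t => by ext v; simp⟩, fun v => by simp [wedgeCovector]⟩

lemma isNormal_add {x : Z} {p q : ℕ} {φ ψ : TangentSpace (𝓡∂ 6) x [⋀^Fin (p + q)]→L[ℝ] ℂ}
    (h₁ : B.IsNormal x p q φ) (h₂ : B.IsNormal x p q ψ) : B.IsNormal x p q (φ + ψ) := by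
  cases q with
  | zero =>
    change φ = 0 at h₁
    change ψ = 0 at h₂
    change φ + ψ = 0
    rw [h₁, h₂]; exact add_zero _
  | succ q =>
    obtain ⟨μ, hμ, e₁⟩ := h₁
    obtain ⟨ν, hν, e₂⟩ := h₂
    refine ⟨μ + ν, ⟨rfl, fun t => ?_⟩, fun v => ?_⟩
    · rw [smul_add, ← hμ.2 t, ← hν.2 t]; rfl
    · change φ v + ψ v = _
      rw [e₁, e₂]
      simp [wedgeCovector, mul_add, Finset.sum_add_distrib]

lemma isNormal_smul {x : Z} {p q : ℕ} (c : ℝ)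
    {φ : TangentSpace (𝓡∂ 6) x [⋀^Fin (p + q)]→L[ℝ] ℂ}
    (h : B.IsNormal x p q φ) : B.IsNormal x p q (c • φ) := by
  cases q with
  | zero =>
    change φ = 0 at h
    refine (congrArg (c • ·) h).trans ?_
    ext v
    simp
  | succ q =>
    obtain ⟨μ, hμ, e⟩ := h
    refine ⟨c • μ, ⟨rfl, fun t => ?_⟩, fun v => ?_⟩
    · rw [smul_comm, ← hμ.2 t]; rfl
    · change c • φ v = _
      rw [e]
      simp only [wedgeCovector, ContinuousAlternatingMap.smul_apply, Finset.smul_sum,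
        Complex.real_smul]
      exact Finset.sum_congr rfl fun j _ => by ring

/-- The space `Ω^{p,q}_N` of smooth `(p,q)`-forms on `Z` which are normal along the boundary. -/
def OmegaN (p q : ℕ) : Submodule ℝ (C.Omega p q) where
  carrier := {φ | ∀ x ∈ (𝓡∂ 6).boundary Z, B.IsNormal x p q (φ.1 x)}
  zero_mem' := fun x _ => B.isNormal_zero x p q
  add_mem' := fun h₁ h₂ x hx => B.isNormal_add (h₁ x hx) (h₂ x hx)
  smul_mem' := fun c _ h x hx => B.isNormal_smul c (h x hx)

/-- The cocycles of the complex `Ω^{p,•}_N`. -/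
def cocyclesN (p q : ℕ) : Submodule ℝ (C.Omega p q) := LinearMap.ker (C.dbar p q) ⊓ B.OmegaN p q

/-- The coboundaries of the complex `Ω^{p,•}_N`. -/
def coboundariesN (p : ℕ) : (q : ℕ) → Submodule ℝ (C.Omega p q)
  | 0 => ⊥
  | q + 1 => ((B.OmegaN p q).map (C.dbar p q)).comap (C.Omega p (q + 1)).subtype

/-- The cohomology `H^{p,q}_N` of the complex `(Ω^{p,•}_N, ∂̄)`. -/
abbrev HN (p q : ℕ) : Type _ :=
  B.cocyclesN p q ⧸ (B.coboundariesN p q).submoduleOf (B.cocyclesN p q)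

/-- Since sections over `M` extend to `Z`, the space `Ω^{p,q}_T` of smooth sections over `M` of
`Λ^{p,q}_T = Λ^{p,q}_Z / Λ^{p,q}_N` is the quotient `Ω^{p,q} / Ω^{p,q}_N`, with `∂̄_b` induced
by `∂̄`. These are the forms in `Ω^{p,q}` representing a `∂̄_b`-closed section. -/
def cocyclesT (p q : ℕ) : Submodule ℝ (C.Omega p q) :=
  ((B.OmegaN p (q + 1)).map (C.Omega p (q + 1)).subtype).comap (C.dbar p q)

/-- The forms in `Ω^{p,q}` representing a `∂̄_b`-exact section of `Λ^{p,q}_T`. -/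
def coboundariesT (p q : ℕ) : Submodule ℝ (C.Omega p q) := C.exactForms p q ⊔ B.OmegaN p q

/-- The tangential cohomology `H^{p,q}_T` of the quotient complex `(Ω^{p,•}_T, ∂̄_b)`. -/
abbrev HT (p q : ℕ) : Type _ :=
  B.cocyclesT p q ⧸ (B.coboundariesT p q).submoduleOf (B.cocyclesT p q)

/-! #### The space of infinitesimal deformations -/

lemma restrict_add {F : Type*} [NormedAddCommGroup F] [NormedSpace ℝ F] {k : ℕ}
    (φ ψ : Form (𝓡∂ 6) Z F k) : B.restrict (φ + ψ) = B.restrict φ + B.restrict ψ := rfl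

lemma restrict_smul {F : Type*} [NormedAddCommGroup F] [NormedSpace ℝ F] {k : ℕ} (c : ℝ)
    (φ : Form (𝓡∂ 6) Z F k) : B.restrict (c • φ) = c • B.restrict φ := rfl

/-- The real `3`-forms `ρ` on `Z` with `dρ = 0`, `dJρ = 0` and `ρ|_M = 0`. -/
def infDef : Submodule ℝ (Form (𝓡∂ 6) Z ℝ 3) where
  carrier := {ρ | IsSmoothForm ρ ∧ extD ρ = 0 ∧ extD (C.opJForm ρ) = 0 ∧ B.restrict ρ = 0}
  zero_mem' := by
    have h0 : C.opJForm 0 = 0 := by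
      funext x
      have h := opJ_smul (C.J x) 0 0
      rw [zero_smul, zero_smul] at h
      exact h
    have hd : extD (0 : Form (𝓡∂ 6) Z ℝ 3) = 0 := (extDₗ (𝓡∂ 6) Z ℝ 3).map_zero
    exact ⟨zero_mem (SmoothForm (𝓡∂ 6) Z ℝ 3), hd, by rw [h0, hd], rfl⟩
  add_mem' := by
    rintro ρ σ ⟨s₁, d₁, j₁, r₁⟩ ⟨s₂, d₂, j₂, r₂⟩
    have hJ : C.opJForm (ρ + σ) = C.opJForm ρ + C.opJForm σ := funext fun x => opJ_add _ _ _
    refine ⟨add_mem (S := Submodule ℝ (Form (𝓡∂ 6) Z ℝ 3)) (s := SmoothForm (𝓡∂ 6) Z ℝ 3) s₁ s₂,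
      ?_, ?_, by rw [restrict_add, r₁, r₂, add_zero]⟩
    · exact ((extDₗ (𝓡∂ 6) Z ℝ 3).map_add ⟨ρ, s₁⟩ ⟨σ, s₂⟩).trans
        ((congrArg₂ (· + ·) d₁ d₂).trans (add_zero _))
    · rw [hJ]
      exact ((extDₗ (𝓡∂ 6) Z ℝ 3).map_add ⟨_, isSmoothForm_opJ C.J_smooth s₁⟩
        ⟨_, isSmoothForm_opJ C.J_smooth s₂⟩).trans
        ((congrArg₂ (· + ·) j₁ j₂).trans (add_zero _))
  smul_mem' := by
    rintro c ρ ⟨s, d, j, r⟩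
    have hJ : C.opJForm (c • ρ) = c • C.opJForm ρ := funext fun x => opJ_smul _ _ _
    refine ⟨Submodule.smul_mem (SmoothForm (𝓡∂ 6) Z ℝ 3) c s, ?_, ?_,
      by rw [restrict_smul, r, smul_zero]⟩
    · exact ((extDₗ (𝓡∂ 6) Z ℝ 3).map_smul c ⟨ρ, s⟩).trans
        ((congrArg (c • ·) d).trans (smul_zero _))
    · rw [hJ]
      exact ((extDₗ (𝓡∂ 6) Z ℝ 3).map_smul c ⟨_, isSmoothForm_opJ C.J_smooth s⟩).trans
        ((congrArg (c • ·) j).trans (smul_zero _))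

variable (C) in
/-- The (span of the) Lie derivatives `L_w Ψ` along smooth vector fields `w` on `Z` vanishing on
the boundary. -/
def gauge : Submodule ℝ (Form (𝓡∂ 6) Z ℝ 3) :=
  Submodule.span ℝ {ρ | ∃ w : ∀ x : Z, TangentSpace (𝓡∂ 6) x,
    ContMDiff (𝓡∂ 6) (𝓡∂ 6).tangent ∞ (fun x => (⟨x, w x⟩ : TangentBundle (𝓡∂ 6) Z)) ∧
    (∀ x ∈ (𝓡∂ 6).boundary Z, w x = 0) ∧ ρ = lieDeriv w C.Ψ}

/-- The space `𝒦̂` of infinitesimal deformations (ignoring the enhancement). -/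
abbrev KHat : Type _ := B.infDef ⧸ (gauge C).submoduleOf B.infDef

/-! #### The space attached to the contact structure on the boundary -/

/-- The space `ℋ` of real `γ ∈ Ω^{1,1}_H` with `d_H γ = 0` and `dθ ∧ γ = 0`. A section of
`Λ²_H` is a `2`-form `γ` on `M` with `i_v γ = 0` for the Reeb field `v`. The equation
`d_H γ = 0` says that `dγ` vanishes on `H`. -/
def HSpace : Submodule ℝ (Form (𝓡 5) M ℝ 2) where
  carrier := {γ | IsSmoothForm γ ∧
    (∀ (y : M) (v : TangentSpace (𝓡 5) y), B.θ y v = 1 → (∀ u, B.dθ y ![v, u] = 0) →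
      ∀ u, γ y ![v, u] = 0) ∧
    (∀ (y : M) (u₁ u₁' u₂ u₂' : TangentSpace (𝓡 5) y),
      IsJPair C B.incl y u₁ u₁' → IsJPair C B.incl y u₂ u₂' →
        γ y ![u₁', u₂'] = γ y ![u₁, u₂]) ∧
    (∀ (y : M) (u : Fin 3 → TangentSpace (𝓡 5) y), (∀ j, B.MemH y (u j)) → extD γ y u = 0) ∧
    (∀ (y : M) (u : Fin 4 → TangentSpace (𝓡 5) y), wedgeTwo (B.dθ y) (γ y) u = 0)}
  zero_mem' := by
    have hd : extD (0 : Form (𝓡 5) M ℝ 2) = 0 := (extDₗ (𝓡 5) M ℝ 2).map_zero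
    refine ⟨zero_mem (SmoothForm (𝓡 5) M ℝ 2), fun _ _ _ _ _ => rfl, fun _ _ _ _ _ _ _ => rfl,
      fun y u _ => by rw [hd]; rfl, fun y u => by simp [wedgeTwo, Form.zero_apply]⟩
  add_mem' := by
    rintro γ η ⟨s₁, a₁, b₁, c₁, e₁⟩ ⟨s₂, a₂, b₂, c₂, e₂⟩
    have hd : extD (γ + η) = extD γ + extD η := (extDₗ (𝓡 5) M ℝ 2).map_add ⟨γ, s₁⟩ ⟨η, s₂⟩
    refine ⟨add_mem (S := Submodule ℝ (Form (𝓡 5) M ℝ 2)) (s := SmoothForm (𝓡 5) M ℝ 2) s₁ s₂,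
      fun y v h h' u => ?_, fun y u₁ u₁' u₂ u₂' h h' => ?_, fun y u h => ?_, fun y u => ?_⟩
    · simp [Form.add_apply, a₁ y v h h' u, a₂ y v h h' u]
    · simp [Form.add_apply, b₁ y _ _ _ _ h h', b₂ y _ _ _ _ h h']
    · rw [hd]; simp [Form.add_apply, c₁ y u h, c₂ y u h]
    · have h₁ := e₁ y u
      have h₂ := e₂ y u
      simp only [wedgeTwo, Form.add_apply, ContinuousAlternatingMap.add_apply] at h₁ h₂ ⊢
      linarith
  smul_mem' := by
    rintro c γ ⟨s, a, b, d, e⟩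
    have hd : extD (c • γ) = c • extD γ := (extDₗ (𝓡 5) M ℝ 2).map_smul c ⟨γ, s⟩
    refine ⟨Submodule.smul_mem (SmoothForm (𝓡 5) M ℝ 2) c s,
      fun y v h h' u => ?_, fun y u₁ u₁' u₂ u₂' h h' => ?_, fun y u h => ?_, fun y u => ?_⟩
    · simp [Form.smul_apply, a y v h h' u]
    · simp [Form.smul_apply, b y _ _ _ _ h h']
    · rw [hd]; simp [Form.smul_apply, d y u h]
    · have h := e y u
      simp only [wedgeTwo, Form.smul_apply, ContinuousAlternatingMap.smul_apply, smul_eq_mul]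
        at h ⊢
      linear_combination c * h

/-! #### The maps -/

/-- `b` is the map `[ρ] ↦ γ` with `Jρ|_M = γ ∧ θ` (which is `θ ∧ γ`, as `γ` has even degree). -/
def IsBoundaryMap (b : B.KHat →ₗ[ℝ] B.HSpace) : Prop :=
  ∀ (ρ : B.infDef) (y : M) (v : Fin 3 → TangentSpace (𝓡 5) y),
    B.restrict (C.opJForm ρ.1) y v =
      wedgeCovector (B.θ y) ((b (Submodule.Quotient.mk ρ)).1 y) v

/-- `l` is the map `[ρ] ↦ [ρ_{2,1}]` on the kernel of `b`. -/
def IsLambda {b : B.KHat →ₗ[ℝ] B.HSpace} (l : LinearMap.ker b →ₗ[ℝ] B.HN 2 1) : Prop :=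
  ∀ (ρ : B.infDef) (h : (Submodule.Quotient.mk ρ : B.KHat) ∈ LinearMap.ker b),
    ∃ σ : B.cocyclesN 2 1,
      (∀ x, σ.1.1 x = typeProj (C.J x) 2 1 (complexify (ρ.1 x))) ∧
        l ⟨Submodule.Quotient.mk ρ, h⟩ = Submodule.Quotient.mk σ

/-- The section of `Λ^{2,1}_T` over `M` defined by `σ ∈ Ω^{2,1}` is `γ ∧ dz`: at every point of
`M`, `σ` equals `g ∧ dz` modulo normal forms, where `g` is a `(1,1)`-form restricting to `γ`
on `H`. -/
def Represents (σ : C.Omega 2 1) (γ : Form (𝓡 5) M ℝ 2) : Prop :=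
  ∀ y : M, ∃ (g : TangentSpace (𝓡∂ 6) (B.incl y) [⋀^Fin 2]→L[ℝ] ℂ)
    (ν : TangentSpace (𝓡∂ 6) (B.incl y) [⋀^Fin (2 + 1)]→L[ℝ] ℂ),
    IsOfType (C.J (B.incl y)) 1 1 g ∧
    (∀ u u', B.MemH y u → B.MemH y u' →
      g ![dIncl B.incl y u, dIncl B.incl y u'] = (γ y ![u, u'] : ℂ)) ∧
    B.IsNormal (B.incl y) 2 1 ν ∧
    ∀ v : Fin 3 → TangentSpace (𝓡∂ 6) (B.incl y),
      σ.1 (B.incl y) v = wedgeCovector (B.dz (B.incl y)) g v + ν v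

/-- `i` is the map `ℋ → H^{2,1}_T` sending `γ` to the class of the section `γ ∧ dz`. -/
def IsIota (i : B.HSpace →ₗ[ℝ] B.HT 2 1) : Prop :=
  (∀ γ : B.HSpace, ∃ σ : C.Omega 2 1, B.Represents σ γ.1) ∧
  ∀ (γ : B.HSpace) (σ : C.Omega 2 1), B.Represents σ γ.1 →
    ∃ h : σ ∈ B.cocyclesT 2 1, i γ = Submodule.Quotient.mk ⟨σ, h⟩

/-- `δ` is the coboundary map of the long exact cohomology sequence of
`0 → Ω^{p,•}_N → Ω^{p,•} → Ω^{p,•}_T → 0`: it sends the class of a tangential cocycle represented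
by `σ ∈ Ω^{p,q}` to the class of `∂̄σ`. -/
def IsCoboundary (p q : ℕ) (δ : B.HT p q →ₗ[ℝ] B.HN p (q + 1)) : Prop :=
  ∀ σ : B.cocyclesT p q, ∃ τ : B.cocyclesN p (q + 1),
    τ.1.1 = C.dbar p q σ.1 ∧ δ (Submodule.Quotient.mk σ) = Submodule.Quotient.mk τ

end StronglyPseudoconvexBoundary

end Boundary

end CYBoundary

end

/-!
# Deformations of a Calabi-Yau threefold with boundary and the contact structure of the boundary

Types are treated as weights of the circle action `e^{tJ}`: a form of type `(p,q)` has weight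
`p - q`, and in degree three the weights `3, 1, -1, -3` are distinct. Closedness of `Φ` forces the
Nijenhuis tensor of `J` to vanish (`nijenhuis_eq_zero`), so that `d` changes weights by `±1`
(`CalabiYau.exists_extD_eq`), `∂̄² = 0` (`CalabiYau.dbar_dbar`), and the pointwise complex linear
algebra of `Φ` carries over to forms.

A deformation `ρ` is the same as the closed form `χ = ρ_{3,0} + ρ_{2,1}`, with `ρ = 2 Re χ` and
`Jρ = 2 Im χ`. If `ρ|_M = 0`, then `χ|_M` is imaginary; a computation at a boundary point shows that
`Jρ|_M = θ ∧ γ` with `γ` of type `(1,1)` on the contact planes, and that the section `γ ∧ dz` is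
given by `2 ρ_{2,1}` (`representsAt_bdry`). The equations for `γ` in `ℋ` say exactly that `θ ∧ γ`
is closed (`of_extD_wedge_eq_zero`, `extD_wedge_eq_zero`). The Lie derivatives `L_w Ψ` are the forms
`2 Re dν`, where `ν = ½ i_w Φ` is an arbitrary form of type `(2,0)` vanishing along `M`, because
contraction identifies vector fields with such forms (`exists_of_mem_gauge`,
`CalabiYau.twoRe_extD_mem_gauge`).

The main construction is `exists_deformation`. Let `σ` be a `∂̄`-closed `(2,1)`-form giving the
section `γ ∧ dz`. Then `dσ` is of type `(3,1)` and closed, so `H^{3,1}_Z = 0` yields `dσ = dτ` with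
`τ` of type `(3,0)`. Along the boundary `σ - τ = iθ ∧ γ + fΦ|_M`, and closedness makes `f` a CR
function. If `F` is its holomorphic extension, then `χ = σ - τ - FΦ` is closed with
`χ|_M = iθ ∧ γ`, and `ρ = 2 Re χ` is a deformation with boundary value `2γ` and `(2,1)`-part `σ`.
For `γ = 0` this is the surjectivity of `λ`; for general `γ` it gives `ker μ ⊆ im b`, since
`μ(γ) = 0` means that the form giving `γ ∧ dz` can be corrected by a normal one to be `∂̄`-closed.
The converse inclusion holds because `2 ρ_{2,1}` gives `b[ρ] ∧ dz` and is `∂̄`-closed.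

For the injectivity of `λ`, a deformation with `ρ_{2,1} = ∂̄ν` and `ν|_M = 0` differs from
`2 Re dν` by the real part of `hΦ`, where `h` is holomorphic and vanishes on `M`; so `h = 0`
(`eq_zero_of_boundary`). This is the strong maximum principle for `Re h`. In charts, a function
`w` with `dw ∘ J = i dw` satisfies a second order identity without zeroth order term
(`hessian_identity`), and the barrier argument of Hopf applies to it directly
(`no_local_max_add_barrier`, `eventually_re_eq_of_max`).

The map `ι` is defined on all of `ℋ` because forms on `M` extend to `Z` (`exists_extension`), and
it takes values in tangential cocycles because the boundary value of `dσ` is a multiple `df ∧ Φ|_M`,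
whose `(2,2)`-part is normal (`dbar_normal`).
-/

noncomputable section

namespace CYBoundary

/-! ### Differential forms in charts -/

section FormCalculus

variable {E : Type*} [NormedAddCommGroup E] [NormedSpace ℝ E]
  {H : Type*} [TopologicalSpace H] {I : ModelWithCorners ℝ E H}
  {X : Type*} [TopologicalSpace X] [ChartedSpace H X]
  {E' : Type*} [NormedAddCommGroup E'] [NormedSpace ℝ E']
  {H' : Type*} [TopologicalSpace H'] {I' : ModelWithCorners ℝ E' H'}
  {Y : Type*} [TopologicalSpace Y] [ChartedSpace H' Y]
  {F : Type*} [NormedAddCommGroup F] [NormedSpace ℝ F]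
  {F' : Type*} [NormedAddCommGroup F'] [NormedSpace ℝ F']

/-- The value of a form at a point, with the tangent space spelled out as the model space `E`.
This makes the type independent of the point. -/
def Form.val {k : ℕ} (φ : Form I X F k) (x : X) : E [⋀^Fin k]→L[ℝ] F := φ x

variable (I) in
/-- The derivative of the preferred chart at `x₀`, as an endomorphism of the model space. -/
def dChart (x₀ x : X) : E →L[ℝ] E := mfderiv I 𝓘(ℝ, E) (extChartAt I x₀) x

variable (I) in
/-- The derivative of the inverse of the preferred chart at `x₀`. -/
def dChartSymm (x₀ : X) (p : E) : E →L[ℝ] E :=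
  mfderivWithin 𝓘(ℝ, E) I (extChartAt I x₀).symm (range I) p

lemma chartRep_eq {k : ℕ} (x₀ : X) (φ : Form I X F k) (p : E) :
    chartRep x₀ φ p =
      (φ.val ((extChartAt I x₀).symm p)).compContinuousLinearMap (dChartSymm I x₀ p) := rfl

/-- The derivative of a map between manifolds, as a linear map between the model spaces. -/
def dMap (I' : ModelWithCorners ℝ E' H') (I : ModelWithCorners ℝ E H) (f : Y → X) (y : Y) :
    E' →L[ℝ] E := mfderiv I' I f y

/-- The pull-back of a form along a map. -/
def pullback (f : Y → X) {k : ℕ} (φ : Form I X F k) : Form I' Y F k := fun y =>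
  (φ (f y)).compContinuousLinearMap (mfderiv I' I f y)

lemma pullback_val (f : Y → X) {k : ℕ} (φ : Form I X F k) (y : Y) :
    (pullback f φ : Form I' Y F k).val y =
      (φ.val (f y)).compContinuousLinearMap (dMap I' I f y) := rfl

section

variable [IsManifold I ∞ X] [IsManifold I' ∞ Y]

lemma dChart_comp_dChartSymm {x₀ : X} {p : E} (hp : p ∈ (extChartAt I x₀).target) :
    dChart I x₀ ((extChartAt I x₀).symm p) ∘L dChartSymm I x₀ p = ContinuousLinearMap.id ℝ E :=
  mfderiv_extChartAt_comp_mfderivWithin_extChartAt_symm hp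

lemma dChartSymm_comp_dChart {x₀ : X} {p : E} (hp : p ∈ (extChartAt I x₀).target) :
    dChartSymm I x₀ p ∘L dChart I x₀ ((extChartAt I x₀).symm p) = ContinuousLinearMap.id ℝ E :=
  mfderivWithin_extChartAt_symm_comp_mfderiv_extChartAt hp

lemma dChartSymm_comp_dChart' {x₀ x : X} (hx : x ∈ (extChartAt I x₀).source) :
    dChartSymm I x₀ (extChartAt I x₀ x) ∘L dChart I x₀ x = ContinuousLinearMap.id ℝ E :=
  mfderivWithin_extChartAt_symm_comp_mfderiv_extChartAt' hx

variable (I) in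
lemma dChart_self (x : X) : dChart I x x = ContinuousLinearMap.id ℝ E :=
  mfderiv_extChartAt_self

variable (I) in
lemma dChartSymm_self (x : X) :
    dChartSymm I x (extChartAt I x x) = ContinuousLinearMap.id ℝ E :=
  mfderivWithin_range_extChartAt_symm

/-- Since the chart at `x` has derivative the identity at `x`, no change of coordinates is needed
in the definition of the exterior derivative. -/
lemma extD_val {k : ℕ} (φ : Form I X F k) (x : X) :
    (extD φ).val x = extDerivWithin (chartRep x φ) (range I) (extChartAt I x x) := by
  have h : (extD φ).val x = (extDerivWithin (chartRep x φ) (range I)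
    (extChartAt I x x)).compContinuousLinearMap (dChart I x x) := rfl
  rw [h, dChart_self]
  ext v; rfl

lemma val_eq_chartRep {k : ℕ} (φ : Form I X F k) {x₀ x : X} (hx : x ∈ (extChartAt I x₀).source) :
    φ.val x = (chartRep x₀ φ (extChartAt I x₀ x)).compContinuousLinearMap (dChart I x₀ x) := by
  rw [chartRep_eq, (extChartAt I x₀).left_inv hx]
  have h := dChartSymm_comp_dChart' hx
  ext v
  change _ = φ.val x (fun i => (dChartSymm I x₀ (extChartAt I x₀ x) ∘L dChart I x₀ x) (v i))
  rw [h]; rfl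

lemma chartRep_self {k : ℕ} (φ : Form I X F k) (x : X) :
    chartRep x φ (extChartAt I x x) = φ.val x := by
  rw [chartRep_eq, extChartAt_to_inv, dChartSymm_self]
  ext v; rfl

/-- The coordinate expression of a map in the preferred charts at `y₀` and `x₀`. -/
def mapRep (I' : ModelWithCorners ℝ E' H') (I : ModelWithCorners ℝ E H) (y₀ : Y) (x₀ : X)
    (f : Y → X) : E' → E :=
  extChartAt I x₀ ∘ f ∘ (extChartAt I' y₀).symm

omit [IsManifold I ∞ X] [IsManifold I' ∞ Y] in
lemma mapRep_mapsTo (y₀ : Y) (x₀ : X) (f : Y → X) :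
    MapsTo (mapRep I' I y₀ x₀ f) (range I') (range I) := fun p _ => by
  simp [mapRep, extChartAt]

lemma fderivWithin_mapRep {f : Y → X} (hf : MDifferentiable I' I f) {y₀ : Y} {x₀ : X} {p : E'}
    (hp : p ∈ (extChartAt I' y₀).target)
    (hfp : f ((extChartAt I' y₀).symm p) ∈ (extChartAt I x₀).source) :
    fderivWithin ℝ (mapRep I' I y₀ x₀ f) (range I') p =
      dChart I x₀ (f ((extChartAt I' y₀).symm p)) ∘L
        dMap I' I f ((extChartAt I' y₀).symm p) ∘L dChartSymm I' y₀ p := by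
  have h1 := (mdifferentiableWithinAt_extChartAt_symm (I := I') hp).hasMFDerivWithinAt
  have h2 := (hf ((extChartAt I' y₀).symm p)).hasMFDerivAt
  have h3 := (mdifferentiableAt_extChartAt (I := I) (x := x₀)
    (by rwa [extChartAt_source] at hfp)).hasMFDerivAt
  have h4 := (h3.comp _ h2).comp_hasMFDerivWithinAt _ h1
  rw [← mfderivWithin_eq_fderivWithin]
  exact h4.mfderivWithin (I'.uniqueMDiffOn _ (extChartAt_target_subset_range _ hp))

lemma contDiffWithinAt_mapRep {f : Y → X} (hf : ContMDiff I' I ∞ f) {y₀ : Y} {x₀ : X} {p : E'}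
    (hp : p ∈ (extChartAt I' y₀).target)
    (hfp : f ((extChartAt I' y₀).symm p) ∈ (extChartAt I x₀).source) :
    ContDiffWithinAt ℝ ∞ (mapRep I' I y₀ x₀ f) (range I') p := by
  rw [← contMDiffWithinAt_iff_contDiffWithinAt]
  have h1 := contMDiffWithinAt_extChartAt_symm_range (I := I') (n := ∞) y₀ hp
  have h3 := contMDiffAt_extChartAt' (I := I) (n := ∞) (x := x₀)
    (by rwa [extChartAt_source] at hfp)
  exact (h3.comp _ (hf _)).comp_contMDiffWithinAt _ h1

lemma chartRep_pullback {f : Y → X} (hf : MDifferentiable I' I f) {k : ℕ} (φ : Form I X F k)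
    {y₀ : Y} {x₀ : X} {p : E'}
    (hp : p ∈ (extChartAt I' y₀).target)
    (hfp : f ((extChartAt I' y₀).symm p) ∈ (extChartAt I x₀).source) :
    chartRep y₀ (pullback f φ : Form I' Y F k) p =
      (chartRep x₀ φ (mapRep I' I y₀ x₀ f p)).compContinuousLinearMap
        (fderivWithin ℝ (mapRep I' I y₀ x₀ f) (range I') p) := by
  rw [fderivWithin_mapRep hf hp hfp, chartRep_eq, pullback_val, val_eq_chartRep φ hfp]
  rfl

omit [IsManifold I ∞ X] in
lemma eventually_mapRep_mem {f : Y → X} (hf : Continuous f) {y₀ : Y} {x₀ : X} {p : E'}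
    (hp : p ∈ (extChartAt I' y₀).target)
    (hfp : f ((extChartAt I' y₀).symm p) ∈ (extChartAt I x₀).source) :
    ∀ᶠ q in nhdsWithin p (range I'), q ∈ (extChartAt I' y₀).target ∧
      f ((extChartAt I' y₀).symm q) ∈ (extChartAt I x₀).source := by
  have h1 : ContinuousWithinAt (f ∘ (extChartAt I' y₀).symm) (range I') p :=
    hf.continuousAt.comp_continuousWithinAt
      (mdifferentiableWithinAt_extChartAt_symm (I := I') hp).continuousWithinAt
  exact Filter.Eventually.and (extChartAt_target_mem_nhdsWithin_of_mem hp)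
    (h1 ((isOpen_extChartAt_source x₀).mem_nhds hfp))

omit [IsManifold I ∞ X] in
lemma IsSmoothForm.contDiffWithinAt {k : ℕ} {φ : Form I X F k} (h : IsSmoothForm φ) {x₀ : X}
    {p : E} (hp : p ∈ (extChartAt I x₀).target) :
    ContDiffWithinAt ℝ ∞ (chartRep x₀ φ) (range I) p :=
  (h x₀ p hp).mono_of_mem_nhdsWithin (extChartAt_target_mem_nhdsWithin_of_mem hp)

lemma minSmoothness_two_le_infty : minSmoothness ℝ 2 ≤ (∞ : WithTop ℕ∞) := by
  rw [minSmoothness_of_isRCLikeNormedField]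
  exact WithTop.coe_le_coe.2 (le_top (a := (2 : ℕ∞)))

/-- The derivative of a pull-back in charts, for forms differentiable in one chart. -/
lemma extDerivWithin_chartRep_pullback {f : Y → X} (hf : ContMDiff I' I ∞ f) {k : ℕ}
    {φ : Form I X F k} {y₀ : Y} {x₀ : X} {p : E'}
    (hφ : DifferentiableWithinAt ℝ (chartRep x₀ φ) (range I) (mapRep I' I y₀ x₀ f p))
    (hp : p ∈ (extChartAt I' y₀).target)
    (hfp : f ((extChartAt I' y₀).symm p) ∈ (extChartAt I x₀).source) :
    extDerivWithin (chartRep y₀ (pullback f φ : Form I' Y F k)) (range I') p =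
      (extDerivWithin (chartRep x₀ φ) (range I)
        (mapRep I' I y₀ x₀ f p)).compContinuousLinearMap
        (fderivWithin ℝ (mapRep I' I y₀ x₀ f) (range I') p) := by
  have hpr := extChartAt_target_subset_range _ hp
  rw [← extDerivWithin_pullback hφ
    (contDiffWithinAt_mapRep hf hp hfp) minSmoothness_two_le_infty
    I'.uniqueDiffOn (I'.range_subset_closure_interior hpr) hpr (mapRep_mapsTo _ _ _)]
  refine Filter.EventuallyEq.extDerivWithin_eq_of_mem ?_ hpr
  filter_upwards [eventually_mapRep_mem hf.continuous hp hfp] with q hq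
  exact chartRep_pullback (hf.mdifferentiable (by simp)) φ hq.1 hq.2

omit [IsManifold I ∞ X] in
lemma pullback_id {k : ℕ} (φ : Form I X F k) : pullback id φ = φ := by
  funext x
  change ContinuousAlternatingMap.compContinuousLinearMap (φ x) (mfderiv I I id x) = φ x
  rw [mfderiv_id]
  ext v; rfl

omit [IsManifold I ∞ X] in
lemma mapRep_id_apply {x₁ x₀ : X} {p : E} :
    mapRep I I x₁ x₀ id p = extChartAt I x₀ ((extChartAt I x₁).symm p) := rfl

/-- The exterior derivative may be computed in any preferred chart. -/
lemma chartRep_extD {k : ℕ} {φ : Form I X F k} {x₀ : X} {p : E}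
    (hp : p ∈ (extChartAt I x₀).target)
    (hφ : DifferentiableWithinAt ℝ (chartRep x₀ φ) (range I) p) :
    chartRep x₀ (extD φ) p = extDerivWithin (chartRep x₀ φ) (range I) p := by
  set x := (extChartAt I x₀).symm p with hx
  have hxs : x ∈ (extChartAt I x₀).source := (extChartAt I x₀).map_target hp
  have hT : mapRep I I x x₀ id (extChartAt I x x) = p := by
    rw [mapRep_id_apply, extChartAt_to_inv, hx, (extChartAt I x₀).right_inv hp]
  have h := extDerivWithin_chartRep_pullback (f := id) (y₀ := x) (x₀ := x₀) (φ := φ)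
    (p := extChartAt I x x) contMDiff_id (by rwa [hT]) (mem_extChartAt_target x)
    (by simpa using hxs)
  rw [pullback_id, hT, fderivWithin_mapRep mdifferentiable_id (mem_extChartAt_target x)
    (by simpa using hxs)] at h
  rw [chartRep_eq, ← hx, extD_val, h, dChartSymm_self]
  have e1 : dChart I x₀ (id ((extChartAt I x).symm (extChartAt I x x))) = dChart I x₀ x := by
    simp
  have e2 : dMap I I (id : X → X) ((extChartAt I x).symm (extChartAt I x x)) =
      ContinuousLinearMap.id ℝ E := mfderiv_id
  rw [e1, e2]
  have h3 := dChart_comp_dChartSymm hp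
  rw [← hx] at h3
  ext v
  change extDerivWithin (chartRep x₀ φ) (range I) p
    (fun i => (dChart I x₀ x ∘L dChartSymm I x₀ p) (v i)) = _
  rw [h3]; rfl

lemma IsSmoothForm.chartRep_extD {k : ℕ} {φ : Form I X F k} (hφ : IsSmoothForm φ) {x₀ : X} {p : E}
    (hp : p ∈ (extChartAt I x₀).target) :
    chartRep x₀ (extD φ) p = extDerivWithin (chartRep x₀ φ) (range I) p :=
  CYBoundary.chartRep_extD hp ((hφ.contDiffWithinAt hp).differentiableWithinAt (by simp))

lemma IsSmoothForm.extD {k : ℕ} {φ : Form I X F k} (hφ : IsSmoothForm φ) :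
    IsSmoothForm (extD φ) := fun x₀ p hp => by
  have hpr := extChartAt_target_subset_range _ hp
  have h1 : ContDiffWithinAt ℝ ∞ (fderivWithin ℝ (chartRep x₀ φ) (range I)) (range I) p :=
    (hφ.contDiffWithinAt hp).fderivWithin_right I.uniqueDiffOn (by simp) hpr
  have h2 : ContDiffWithinAt ℝ ∞ (extDerivWithin (chartRep x₀ φ) (range I)) (range I) p := by
    have h := ((ContinuousAlternatingMap.alternatizeUncurryFinCLM (n := k) ℝ E F).contDiff
      (n := ∞)).comp_contDiffWithinAt h1
    exact h
  refine (h2.mono (extChartAt_target_subset_range x₀)).congr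
    (fun q hq => hφ.chartRep_extD hq) (hφ.chartRep_extD hp)

lemma extD_extD {k : ℕ} {φ : Form I X F k} (hφ : IsSmoothForm φ) :
    CYBoundary.extD (CYBoundary.extD φ) = 0 := by
  funext x
  change (CYBoundary.extD (CYBoundary.extD φ)).val x = 0
  have hp := mem_extChartAt_target (I := I) x
  have hpr := extChartAt_target_subset_range _ hp
  rw [extD_val, ← extDerivWithin_extDerivWithin_apply (hφ.contDiffWithinAt hp)
    minSmoothness_two_le_infty I.uniqueDiffOn (I.range_subset_closure_interior hpr) hpr]
  refine Filter.EventuallyEq.extDerivWithin_eq_of_mem ?_ hpr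
  filter_upwards [extChartAt_target_mem_nhdsWithin_of_mem hp] with q hq
  exact hφ.chartRep_extD hq

lemma extD_pullback {f : Y → X} (hf : ContMDiff I' I ∞ f) {k : ℕ} {φ : Form I X F k}
    (hφ : IsSmoothForm φ) :
    CYBoundary.extD (pullback f φ : Form I' Y F k) = pullback f (CYBoundary.extD φ) := by
  funext y
  change (CYBoundary.extD (pullback f φ : Form I' Y F k)).val y =
    (pullback f (CYBoundary.extD φ) : Form I' Y F (k + 1)).val y
  have hp := mem_extChartAt_target (I := I') y
  have hm : f ((extChartAt I' y).symm (extChartAt I' y y)) ∈ (extChartAt I (f y)).source := by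
    simp
  have hT : mapRep I' I y (f y) f (extChartAt I' y y) = extChartAt I (f y) (f y) := by
    simp [mapRep]
  rw [extD_val, extDerivWithin_chartRep_pullback hf (x₀ := f y) _ hp hm, pullback_val,
    fderivWithin_mapRep (hf.mdifferentiable (by simp)) hp hm, dChartSymm_self, hT, extD_val,
    extChartAt_to_inv, dChart_self]
  · ext v; rfl
  · rw [hT]
    exact hφ.differentiableWithinAt (f y)

end

section Smooth

variable [IsManifold I ∞ X] [IsManifold I' ∞ Y] [FiniteDimensional ℝ E] [FiniteDimensional ℝ E']
  [FiniteDimensional ℝ F]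

omit [FiniteDimensional ℝ E] in
lemma contDiffWithinAt_compContinuousLinearMap {k : ℕ} {s : Set E'} {p : E'}
    {f : E' → E [⋀^Fin k]→L[ℝ] F}
    {g : E' → E' →L[ℝ] E} (hf : ContDiffWithinAt ℝ ∞ f s p) (hg : ContDiffWithinAt ℝ ∞ g s p) :
    ContDiffWithinAt ℝ ∞ (fun p => (f p).compContinuousLinearMap (g p)) s p := by
  have : FiniteDimensional ℝ (ContinuousMultilinearMap ℝ (fun _ : Fin k => E') F) :=
    let toM' : ContinuousMultilinearMap ℝ (fun _ : Fin k => E') F →ₗ[ℝ]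
      MultilinearMap ℝ (fun _ : Fin k => E') F := ContinuousMultilinearMap.toMultilinearMapLinear
    FiniteDimensional.of_injective toM' ContinuousMultilinearMap.toMultilinearMap_injective
  obtain ⟨L, hL⟩ := LinearMap.exists_leftInverse_of_injective
    (ContinuousAlternatingMap.toContinuousMultilinearMapLinear (R := ℝ) (A := ℝ) (M := E') (N := F)
      (ι := Fin k))
    (LinearMap.ker_eq_bot.2 ContinuousAlternatingMap.toContinuousMultilinearMap_injective)
  have h1 : ContDiffWithinAt ℝ ∞ (fun p =>
      ContinuousMultilinearMap.compContinuousLinearMapContinuousMultilinear ℝ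
      (fun _ : Fin k => E') (fun _ : Fin k => E) F (fun _ => g p)) s p :=
    (ContinuousMultilinearMap.contDiff _).comp_contDiffWithinAt (contDiffWithinAt_pi.2 fun _ => hg)
  have h2 : ContDiffWithinAt ℝ ∞ (fun p => (f p).toContinuousMultilinearMap) s p :=
    (ContinuousAlternatingMap.toContinuousMultilinearMapCLM (E := E) (F := F) (ι := Fin k)
      (𝕜 := ℝ) ℝ).contDiff.comp_contDiffWithinAt hf
  have h3 := (LinearMap.toContinuousLinearMap L).contDiff.comp_contDiffWithinAt (h1.clm_apply h2)
  refine h3.congr_of_eventuallyEq (Filter.Eventually.of_forall fun p => ?_) ?_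
  · exact (LinearMap.congr_fun hL ((f p).compContinuousLinearMap (g p))).symm
  · exact (LinearMap.congr_fun hL ((f p).compContinuousLinearMap (g p))).symm

/-- A form is smooth as soon as, near every point, its expression in some preferred chart is. -/
lemma isSmoothForm_of_chart {k : ℕ} {φ : Form I X F k}
    (h : ∀ x : X, ∃ x₀ : X, x ∈ (extChartAt I x₀).source ∧
      ContDiffWithinAt ℝ ∞ (chartRep x₀ φ) (range I) (extChartAt I x₀ x)) : IsSmoothForm φ := by
  intro x₁ p hp
  obtain ⟨x₀, hx₀, hs⟩ := h ((extChartAt I x₁).symm p)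
  have hx₀' : id ((extChartAt I x₁).symm p) ∈ (extChartAt I x₀).source := hx₀
  have hT := contDiffWithinAt_mapRep (contMDiff_id (I := I) (M := X)) hp hx₀'
  have hD : ContDiffWithinAt ℝ ∞ (fderivWithin ℝ (mapRep I I x₁ x₀ id) (range I)) (range I) p :=
    hT.fderivWithin_right I.uniqueDiffOn (by simp) (extChartAt_target_subset_range _ hp)
  have hc := hs.comp p (f := mapRep I I x₁ x₀ id) hT (mapRep_mapsTo _ _ _)
  have h4 := contDiffWithinAt_compContinuousLinearMap hc hD
  have h5 : ContDiffWithinAt ℝ ∞ (chartRep x₁ φ) (range I) p := by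
    refine h4.congr_of_eventuallyEq_of_mem ?_ (extChartAt_target_subset_range _ hp)
    filter_upwards [eventually_mapRep_mem continuous_id hp hx₀'] with q hq
    have h6 := chartRep_pullback (mdifferentiable_id (I := I) (M := X)) φ hq.1 hq.2
    rwa [pullback_id] at h6
  exact h5.mono (extChartAt_target_subset_range _)

omit [FiniteDimensional ℝ E] in
lemma IsSmoothForm.pullback {f : Y → X} (hf : ContMDiff I' I ∞ f) {k : ℕ} {φ : Form I X F k}
    (hφ : IsSmoothForm φ) : IsSmoothForm (CYBoundary.pullback f φ : Form I' Y F k) := by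
  refine isSmoothForm_of_chart fun y => ⟨y, mem_extChartAt_source y, ?_⟩
  have hp := mem_extChartAt_target (I := I') y
  have hm : f ((extChartAt I' y).symm (extChartAt I' y y)) ∈ (extChartAt I (f y)).source := by
    simp
  have hT : mapRep I' I y (f y) f (extChartAt I' y y) = extChartAt I (f y) (f y) := by
    simp [mapRep]
  have hpr := extChartAt_target_subset_range (I := I') y hp
  have h1 := contDiffWithinAt_mapRep hf hp hm
  have h2 := h1.fderivWithin_right I'.uniqueDiffOn (m := ∞) (by simp) hpr
  have h3 : ContDiffWithinAt ℝ ∞ (chartRep (f y) φ) (range I) (mapRep I' I y (f y) f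
      (extChartAt I' y y)) := by
    rw [hT]; exact hφ.contDiffWithinAt (mem_extChartAt_target _)
  have h4 := contDiffWithinAt_compContinuousLinearMap
    (h3.comp _ h1 (mapRep_mapsTo _ _ _)) h2
  refine h4.congr_of_eventuallyEq_of_mem ?_ hpr
  filter_upwards [eventually_mapRep_mem hf.continuous hp hm] with q hq
  exact chartRep_pullback (hf.mdifferentiable (by simp)) φ hq.1 hq.2

end Smooth

end FormCalculus

/-! ### Weights of the circle action and types -/

section Weights

variable {V : Type*} [AddCommGroup V] [Module ℝ V] [TopologicalSpace V] [IsTopologicalAddGroup V]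
  [ContinuousConstSMul ℝ V] {J : V →L[ℝ] V}

/-- The form `φ` is an eigenvector of weight `m` of the circle action `e^{tJ}`. -/
def HasWeight (J : V →L[ℝ] V) (m : ℂ) {k : ℕ} (φ : V [⋀^Fin k]→L[ℝ] ℂ) : Prop :=
  ∀ t : ℝ, φ.compContinuousLinearMap (rot J t) = Complex.exp (Complex.I * (m * (t : ℂ))) • φ

lemma isOfType_iff {p q k : ℕ} {φ : V [⋀^Fin k]→L[ℝ] ℂ} :
    IsOfType J p q φ ↔ p + q = k ∧ HasWeight J ((p : ℂ) - q) φ := Iff.rfl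

lemma HasWeight.apply {m : ℂ} {k : ℕ} {φ : V [⋀^Fin k]→L[ℝ] ℂ} (h : HasWeight J m φ) (t : ℝ)
    (v : Fin k → V) :
    φ (fun i => rot J t (v i)) = Complex.exp (Complex.I * (m * (t : ℂ))) * φ v :=
  congrArg (fun ψ : V [⋀^Fin k]→L[ℝ] ℂ => ψ v) (h t)

lemma hasWeight_of_apply {m : ℂ} {k : ℕ} {φ : V [⋀^Fin k]→L[ℝ] ℂ}
    (h : ∀ (t : ℝ) (v : Fin k → V),
      φ (fun i => rot J t (v i)) = Complex.exp (Complex.I * (m * (t : ℂ))) * φ v) :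
    HasWeight J m φ := fun t => by
  ext v; exact h t v

lemma HasWeight.add {m : ℂ} {k : ℕ} {φ ψ : V [⋀^Fin k]→L[ℝ] ℂ} (h₁ : HasWeight J m φ)
    (h₂ : HasWeight J m ψ) : HasWeight J m (φ + ψ) :=
  hasWeight_of_apply fun t v => by
    simp only [ContinuousAlternatingMap.add_apply, h₁.apply, h₂.apply]; ring

lemma HasWeight.smul {m : ℂ} {k : ℕ} {φ : V [⋀^Fin k]→L[ℝ] ℂ} (h : HasWeight J m φ) (c : ℂ) :
    HasWeight J m (c • φ) :=
  hasWeight_of_apply fun t v => by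
    simp only [ContinuousAlternatingMap.smul_apply, h.apply, smul_eq_mul]; ring

lemma HasWeight.sub {m : ℂ} {k : ℕ} {φ ψ : V [⋀^Fin k]→L[ℝ] ℂ} (h₁ : HasWeight J m φ)
    (h₂ : HasWeight J m ψ) : HasWeight J m (φ - ψ) :=
  hasWeight_of_apply fun t v => by
    simp only [ContinuousAlternatingMap.sub_apply, h₁.apply, h₂.apply]; ring

lemma rot_rot (hJ : ∀ v, J (J v) = -v) (s t : ℝ) (v : V) :
    rot J s (rot J t v) = rot J (s + t) v := by
  simp only [rot, add_apply, smul_apply,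
    ContinuousLinearMap.id_apply, map_add, map_smul, hJ, Real.cos_add, Real.sin_add]
  module

lemma rot_zero (v : V) : rot J 0 v = v := by simp [rot]

lemma rot_pi_div_two (v : V) : rot J (Real.pi / 2) v = J v := by simp [rot]

/-- A form whose orbit under the circle action is `e^{imt} (cos t η + sin t X)` is the sum of a
form of weight `m + 1` and one of weight `m - 1`. -/
lemma exists_weight_decomp (hJ : ∀ v, J (J v) = -v) {k : ℕ} {m : ℂ} {η X : V [⋀^Fin k]→L[ℝ] ℂ}
    (h : ∀ t : ℝ, η.compContinuousLinearMap (rot J t) =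
      Complex.exp (Complex.I * (m * (t : ℂ))) •
        ((Real.cos t : ℂ) • η + (Real.sin t : ℂ) • X)) :
    ∃ a b, η = a + b ∧ HasWeight J (m + 1) a ∧ HasWeight J (m - 1) b := by
  have key : ∀ (t : ℝ) (v : Fin k → V), η (fun i => rot J t (v i)) =
      Complex.exp (Complex.I * (m * (t : ℂ))) *
        ((Real.cos t : ℂ) * η v + (Real.sin t : ℂ) * X v) := fun t v =>
    congrArg (fun ψ : V [⋀^Fin k]→L[ℝ] ℂ => ψ v) (h t)
  -- the case `t = π / 2` expresses `X` through `η`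
  have keyX : ∀ v : Fin k → V, η (fun i => J (v i)) =
      Complex.exp (Complex.I * (m * ((Real.pi / 2 : ℝ) : ℂ))) * X v := fun v => by
    have := key (Real.pi / 2) v
    simpa [rot_pi_div_two, Real.cos_pi_div_two] using this
  have hX : ∀ (t : ℝ) (v : Fin k → V), X (fun i => rot J t (v i)) =
      Complex.exp (Complex.I * (m * (t : ℂ))) *
        ((Real.cos t : ℂ) * X v - (Real.sin t : ℂ) * η v) := by
    intro t v
    have h1 := keyX (fun i => rot J t (v i))
    have h2 := key (Real.pi / 2 + t) v
    simp only [← rot_pi_div_two (J := J), rot_rot hJ] at h1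
    rw [h1] at h2
    have hne := Complex.exp_ne_zero (Complex.I * (m * ((Real.pi / 2 : ℝ) : ℂ)))
    have he : Complex.exp (Complex.I * (m * ((Real.pi / 2 + t : ℝ) : ℂ))) =
        Complex.exp (Complex.I * (m * ((Real.pi / 2 : ℝ) : ℂ))) *
          Complex.exp (Complex.I * (m * (t : ℂ))) := by
      rw [← Complex.exp_add]; congr 1; push_cast; ring
    rw [he, mul_assoc] at h2
    have h3 := mul_left_cancel₀ hne h2
    rw [h3, add_comm (Real.pi / 2) t, Real.cos_add_pi_div_two, Real.sin_add_pi_div_two]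
    push_cast; ring
  have hexp : ∀ t : ℝ, Complex.exp (Complex.I * t) = Real.cos t + Real.sin t * Complex.I := by
    intro t; rw [mul_comm, Complex.exp_mul_I]; simp
  have hexp' : ∀ t : ℝ, Complex.exp (-(Complex.I * t)) = Real.cos t - Real.sin t * Complex.I := by
    intro t
    rw [show -(Complex.I * (t : ℂ)) = (-t : ℂ) * Complex.I by ring, Complex.exp_mul_I,
      Complex.cos_neg, Complex.sin_neg]
    simp; ring
  refine ⟨(2⁻¹ : ℂ) • (η - Complex.I • X), (2⁻¹ : ℂ) • (η + Complex.I • X), ?_,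
    hasWeight_of_apply fun t v => ?_, hasWeight_of_apply fun t v => ?_⟩
  · ext v; simp; ring
  · have he : Complex.exp (Complex.I * ((m + 1) * (t : ℂ))) =
        Complex.exp (Complex.I * (m * (t : ℂ))) * Complex.exp (Complex.I * t) := by
      rw [← Complex.exp_add]; congr 1; ring
    simp only [ContinuousAlternatingMap.smul_apply, ContinuousAlternatingMap.sub_apply,
      smul_eq_mul, key, hX, he, hexp]
    linear_combination ((1 / 2) * Complex.exp (Complex.I * (m * (t : ℂ))) *
      (Real.sin t : ℂ) * X v) * Complex.I_sq
  · have he : Complex.exp (Complex.I * ((m - 1) * (t : ℂ))) =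
        Complex.exp (Complex.I * (m * (t : ℂ))) * Complex.exp (-(Complex.I * t)) := by
      rw [← Complex.exp_add]; congr 1; ring
    simp only [ContinuousAlternatingMap.smul_apply, ContinuousAlternatingMap.add_apply,
      smul_eq_mul, key, hX, he, hexp']
    linear_combination ((1 / 2) * Complex.exp (Complex.I * (m * (t : ℂ))) *
      (Real.sin t : ℂ) * X v) * Complex.I_sq

/-- Orthogonality of the characters of the `n`-th roots of unity. -/
lemma sum_exp_roots {n : ℕ} {d : ℤ} (hd : d ≠ 0) (hn : |d| < n) :
    ∑ j ∈ Finset.range n,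
      Complex.exp (Complex.I * (d * ((2 * Real.pi * j / n : ℝ) : ℂ))) = 0 := by
  have hn0 : (n : ℂ) ≠ 0 := by
    have : 0 < (n : ℤ) := (abs_nonneg d).trans_lt hn
    have : n ≠ 0 := by omega
    exact_mod_cast this
  set ζ := Complex.exp (2 * Real.pi * Complex.I * (d / n)) with hζ
  have h1 : ∀ j ∈ Finset.range n,
      Complex.exp (Complex.I * (d * ((2 * Real.pi * j / n : ℝ) : ℂ))) = ζ ^ j := by
    intro j _
    rw [hζ, ← Complex.exp_nat_mul]
    congr 1
    push_cast
    field_simp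
  have hne : ζ ≠ 1 := by
    rw [hζ, Ne, Complex.exp_eq_one_iff]
    rintro ⟨a, ha⟩
    have hpi : (2 * Real.pi * Complex.I : ℂ) ≠ 0 := Complex.two_pi_I_ne_zero
    have h2 : (d : ℂ) / n = a := by
      apply mul_left_cancel₀ hpi
      rw [ha]; ring
    have h3 : (d : ℂ) = a * n := by rw [← h2]; field_simp
    have h4 : d = a * n := by exact_mod_cast h3
    have ha0 : a ≠ 0 := by rintro rfl; simp at h4; exact hd h4
    have : (n : ℤ) ≤ |d| := by
      rw [h4, abs_mul, Nat.abs_cast]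
      have := Int.one_le_abs ha0
      nlinarith [abs_nonneg a, (Nat.cast_nonneg n : (0:ℤ) ≤ n)]
    omega
  have hpow : ζ ^ n = 1 := by
    rw [hζ, ← Complex.exp_nat_mul, Complex.exp_eq_one_iff]
    exact ⟨d, by field_simp⟩
  rw [Finset.sum_congr rfl h1, geom_sum_eq hne, hpow]
  simp

/-- The Fourier coefficient of a character with respect to the roots of unity. -/
lemma fourier_roots {k : ℕ} (p q : ℕ) (m : ℤ) (hm : |m - ((p : ℤ) - q)| ≤ 2 * k) (c : ℂ) :
    ((2 * k + 1 : ℕ) : ℂ)⁻¹ * ∑ j ∈ Finset.range (2 * k + 1),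
      Complex.exp (-(Complex.I * (((p : ℂ) - (q : ℂ)) *
        ((2 * Real.pi * j / (2 * k + 1 : ℕ) : ℝ) : ℂ)))) *
        (Complex.exp (Complex.I * (m * ((2 * Real.pi * j / (2 * k + 1 : ℕ) : ℝ) : ℂ))) * c) =
      if m = (p : ℤ) - q then c else 0 := by
  have h0 : ((2 * k + 1 : ℕ) : ℂ) ≠ 0 := by exact Nat.cast_ne_zero.2 (Nat.succ_ne_zero _)
  have h1 : ∀ j ∈ Finset.range (2 * k + 1),
      Complex.exp (-(Complex.I * (((p : ℂ) - (q : ℂ)) *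
        ((2 * Real.pi * j / (2 * k + 1 : ℕ) : ℝ) : ℂ)))) *
        (Complex.exp (Complex.I * (m * ((2 * Real.pi * j / (2 * k + 1 : ℕ) : ℝ) : ℂ))) * c) =
      Complex.exp (Complex.I * ((m - ((p : ℤ) - q) : ℤ) *
        ((2 * Real.pi * j / (2 * k + 1 : ℕ) : ℝ) : ℂ))) * c := by
    intro j _
    rw [← mul_assoc, ← Complex.exp_add]
    congr 2
    push_cast; ring
  rw [Finset.sum_congr rfl h1, ← Finset.sum_mul]
  split_ifs with h
  · rw [h]
    simp only [sub_self, Int.cast_zero, zero_mul, mul_zero, Complex.exp_zero, Finset.sum_const,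
      Finset.card_range, nsmul_eq_mul, mul_one]
    rw [← mul_assoc, inv_mul_cancel₀ h0, one_mul]
  · rw [sum_exp_roots (sub_ne_zero.2 h) (n := 2 * k + 1) (by push_cast; omega)]
    simp

lemma typeProj_apply (p q : ℕ) {k : ℕ} (φ : V [⋀^Fin k]→L[ℝ] ℂ) (v : Fin k → V) :
    typeProj J p q φ v = ((2 * k + 1 : ℕ) : ℂ)⁻¹ * ∑ j ∈ Finset.range (2 * k + 1),
      Complex.exp (-(Complex.I * (((p : ℂ) - (q : ℂ)) *
        ((2 * Real.pi * j / (2 * k + 1 : ℕ) : ℝ) : ℂ)))) *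
        φ (fun i => rot J (2 * Real.pi * j / (2 * k + 1 : ℕ)) (v i)) := by
  simp only [typeProj, ContinuousAlternatingMap.smul_apply, ContinuousAlternatingMap.sum_apply,
    smul_eq_mul]
  rfl

lemma typeProj_of_isOfType {p q k : ℕ} {φ : V [⋀^Fin k]→L[ℝ] ℂ} (h : IsOfType J p q φ) :
    typeProj J p q φ = φ := by
  ext v
  have := fourier_roots (k := k) p q ((p : ℤ) - q) (by simp) (φ v)
  rw [if_pos rfl] at this
  rw [typeProj_apply, ← this]
  push_cast [HasWeight.apply h.2]
  rfl

lemma typeProj_of_isOfType_ne {p q p' q' k : ℕ} {φ : V [⋀^Fin k]→L[ℝ] ℂ}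
    (h : IsOfType J p' q' φ) (hk : p + q = k) (hne : p ≠ p') :
    typeProj J p q φ = 0 := by
  ext v
  have h1 := h.1
  have := fourier_roots (k := k) p q ((p' : ℤ) - q') (by rw [abs_le]; constructor <;> omega) (φ v)
  rw [if_neg (by omega)] at this
  rw [typeProj_apply]
  refine Eq.trans ?_ this
  push_cast [HasWeight.apply h.2]
  rfl

section Slots

variable {F : Type*} [NormedAddCommGroup F] [NormedSpace ℝ F]

omit [IsTopologicalAddGroup V] [ContinuousConstSMul ℝ V]

lemma form_add₀ {k : ℕ} (φ : V [⋀^Fin (k + 1)]→L[ℝ] F) (a b : V) (w : Fin k → V) :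
    φ (Matrix.vecCons (a + b) w) = φ (Matrix.vecCons a w) + φ (Matrix.vecCons b w) :=
  φ.toMultilinearMap.cons_add w a b

lemma form_smul₀ {k : ℕ} (φ : V [⋀^Fin (k + 1)]→L[ℝ] F) (c : ℝ) (a : V) (w : Fin k → V) :
    φ (Matrix.vecCons (c • a) w) = c • φ (Matrix.vecCons a w) :=
  φ.toMultilinearMap.cons_smul w c a

lemma form_neg₀ {k : ℕ} (φ : V [⋀^Fin (k + 1)]→L[ℝ] F) (a : V) (w : Fin k → V) :
    φ (Matrix.vecCons (-a) w) = -φ (Matrix.vecCons a w) := by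
  have := form_smul₀ φ (-1) a w
  simpa using this

lemma form_sub₀ {k : ℕ} (φ : V [⋀^Fin (k + 1)]→L[ℝ] F) (a b : V) (w : Fin k → V) :
    φ (Matrix.vecCons (a - b) w) = φ (Matrix.vecCons a w) - φ (Matrix.vecCons b w) := by
  rw [sub_eq_add_neg, form_add₀, form_neg₀, sub_eq_add_neg]

lemma form_swap₀ {k : ℕ} (φ : V [⋀^Fin (k + 2)]→L[ℝ] F) (a b : V) (w : Fin k → V) :
    φ (Matrix.vecCons b (Matrix.vecCons a w)) = -φ (Matrix.vecCons a (Matrix.vecCons b w)) := by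
  have h := φ.toAlternatingMap.map_swap (Matrix.vecCons a (Matrix.vecCons b w))
    (i := 0) (j := 1) (by simp)
  refine Eq.trans ?_ h
  change φ _ = φ _
  congr 1
  ext i
  refine Fin.cases ?_ (fun i => Fin.cases ?_ (fun i => ?_) i) i
  · simp
  · simp
  · have h : Equiv.swap (0 : Fin (k + 2)) 1 i.succ.succ = i.succ.succ :=
      Equiv.swap_apply_of_ne_of_ne (Fin.succ_ne_zero _) (by simp [Fin.ext_iff])
    simp [h]

lemma form_swap₁ {k : ℕ} (φ : V [⋀^Fin (k + 3)]→L[ℝ] F) (x a b : V) (w : Fin k → V) :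
    φ (Matrix.vecCons x (Matrix.vecCons b (Matrix.vecCons a w))) =
      -φ (Matrix.vecCons x (Matrix.vecCons a (Matrix.vecCons b w))) := by
  have hne : (Fin.succ 0 : Fin (k + 3)) ≠ Fin.succ (Fin.succ 0) := fun h =>
    Fin.succ_ne_zero _ (Fin.succ_injective _ h).symm
  have h := φ.toAlternatingMap.map_swap
    (Matrix.vecCons x (Matrix.vecCons a (Matrix.vecCons b w))) hne
  refine Eq.trans ?_ h
  change φ _ = φ _
  congr 1
  ext i
  refine Fin.cases ?_ (fun i => Fin.cases ?_ (fun i => Fin.cases ?_ (fun i => ?_) i) i) i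
  · rw [Function.comp_apply, Equiv.swap_apply_of_ne_of_ne (Fin.succ_ne_zero _).symm
      (Fin.succ_ne_zero _).symm]
    rfl
  · rw [Function.comp_apply, Equiv.swap_apply_left]
    rfl
  · rw [Function.comp_apply, Equiv.swap_apply_right]
    rfl
  · rw [Function.comp_apply, Equiv.swap_apply_of_ne_of_ne]
    · rfl
    · exact fun h => Fin.succ_ne_zero _ (Fin.succ_injective _ h)
    · exact fun h => Fin.succ_ne_zero _ (Fin.succ_injective _ (Fin.succ_injective _ h))

lemma form_add₁ {k : ℕ} (φ : V [⋀^Fin (k + 2)]→L[ℝ] F) (x a b : V) (w : Fin k → V) :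
    φ (Matrix.vecCons x (Matrix.vecCons (a + b) w)) =
      φ (Matrix.vecCons x (Matrix.vecCons a w)) + φ (Matrix.vecCons x (Matrix.vecCons b w)) := by
  rw [form_swap₀, form_add₀, form_swap₀ φ a, form_swap₀ φ b, neg_add]

lemma form_smul₁ {k : ℕ} (φ : V [⋀^Fin (k + 2)]→L[ℝ] F) (c : ℝ) (x a : V) (w : Fin k → V) :
    φ (Matrix.vecCons x (Matrix.vecCons (c • a) w)) =
      c • φ (Matrix.vecCons x (Matrix.vecCons a w)) := by
  rw [form_swap₀, form_smul₀, form_swap₀ φ a, smul_neg]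

lemma form_neg₁ {k : ℕ} (φ : V [⋀^Fin (k + 2)]→L[ℝ] F) (x a : V) (w : Fin k → V) :
    φ (Matrix.vecCons x (Matrix.vecCons (-a) w)) =
      -φ (Matrix.vecCons x (Matrix.vecCons a w)) := by
  rw [form_swap₀, form_neg₀, form_swap₀ φ a]

lemma form_add₂ {k : ℕ} (φ : V [⋀^Fin (k + 3)]→L[ℝ] F) (x y a b : V) (w : Fin k → V) :
    φ (Matrix.vecCons x (Matrix.vecCons y (Matrix.vecCons (a + b) w))) =
      φ (Matrix.vecCons x (Matrix.vecCons y (Matrix.vecCons a w))) +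
        φ (Matrix.vecCons x (Matrix.vecCons y (Matrix.vecCons b w))) := by
  rw [form_swap₁, form_add₁, form_swap₁ φ x a, form_swap₁ φ x b, neg_add]

lemma form_smul₂ {k : ℕ} (φ : V [⋀^Fin (k + 3)]→L[ℝ] F) (c : ℝ) (x y a : V) (w : Fin k → V) :
    φ (Matrix.vecCons x (Matrix.vecCons y (Matrix.vecCons (c • a) w))) =
      c • φ (Matrix.vecCons x (Matrix.vecCons y (Matrix.vecCons a w))) := by
  rw [form_swap₁, form_smul₁, form_swap₁ φ x a, smul_neg]

lemma form_neg₂ {k : ℕ} (φ : V [⋀^Fin (k + 3)]→L[ℝ] F) (x y a : V) (w : Fin k → V) :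
    φ (Matrix.vecCons x (Matrix.vecCons y (Matrix.vecCons (-a) w))) =
      -φ (Matrix.vecCons x (Matrix.vecCons y (Matrix.vecCons a w))) := by
  rw [form_swap₁, form_neg₁, form_swap₁ φ x a]

end Slots

lemma cos_eq_exp (t : ℝ) : (Real.cos t : ℂ) =
    (Complex.exp (Complex.I * t) + Complex.exp (-(Complex.I * t))) / 2 := by
  rw [Complex.ofReal_cos, Complex.cos]; ring_nf

lemma sin_eq_exp (t : ℝ) : (Real.sin t : ℂ) =
    (Complex.exp (-(Complex.I * t)) - Complex.exp (Complex.I * t)) * Complex.I / 2 := by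
  rw [Complex.ofReal_sin, Complex.sin]; ring_nf

/-- The orbit of a `3`-form under the circle action is a trigonometric polynomial. -/
lemma exists_trig_expansion (φ : V [⋀^Fin 3]→L[ℝ] ℂ) (v : Fin 3 → V) :
    ∃ c : ℤ → ℂ, ∀ t : ℝ, φ (fun i => rot J t (v i)) =
      Complex.exp (Complex.I * ((3 : ℤ) * (t : ℂ))) * c 3 +
      Complex.exp (Complex.I * ((1 : ℤ) * (t : ℂ))) * c 1 +
      Complex.exp (Complex.I * ((-1 : ℤ) * (t : ℂ))) * c (-1) +
      Complex.exp (Complex.I * ((-3 : ℤ) * (t : ℂ))) * c (-3) := by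
  -- the coefficients of `cos³`, `cos² sin`, `cos sin²`, `sin³` in the expansion of the orbit
  obtain ⟨A, hA⟩ : ∃ A, A = φ ![v 0, v 1, v 2] := ⟨_, rfl⟩
  obtain ⟨B, hB⟩ : ∃ B, B = φ ![J (v 0), v 1, v 2] + φ ![v 0, J (v 1), v 2] +
    φ ![v 0, v 1, J (v 2)] := ⟨_, rfl⟩
  obtain ⟨D, hD⟩ : ∃ D, D = φ ![v 0, J (v 1), J (v 2)] + φ ![J (v 0), v 1, J (v 2)] +
    φ ![J (v 0), J (v 1), v 2] := ⟨_, rfl⟩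
  obtain ⟨G, hG⟩ : ∃ G, G = φ ![J (v 0), J (v 1), J (v 2)] := ⟨_, rfl⟩
  let c : ℤ → ℂ := fun m =>
    if m = 3 then (A - D - Complex.I * B + Complex.I * G) / 8 else
    if m = 1 then (3 * A + D - Complex.I * B - 3 * Complex.I * G) / 8 else
    if m = -1 then (3 * A + D + Complex.I * B + 3 * Complex.I * G) / 8 else
    (A - D + Complex.I * B - Complex.I * G) / 8
  refine ⟨c, fun t => ?_⟩
  have h1 : φ (fun i => rot J t (v i)) = φ ![rot J t (v 0), rot J t (v 1), rot J t (v 2)] := by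
    congr 1; ext i; fin_cases i <;> rfl
  have h2 : φ ![rot J t (v 0), rot J t (v 1), rot J t (v 2)] =
      (Real.cos t : ℂ) ^ 3 * A + (Real.cos t : ℂ) ^ 2 * (Real.sin t) * B +
      (Real.cos t : ℂ) * (Real.sin t : ℂ) ^ 2 * D + (Real.sin t : ℂ) ^ 3 * G := by
    simp only [rot, add_apply, smul_apply, ContinuousLinearMap.id_apply, form_add₀, form_add₁,
      form_add₂, form_smul₀, form_smul₁, form_smul₂, Complex.real_smul, hA, hB, hD, hG]
    ring
  have e3 : Complex.exp (Complex.I * ((3 : ℤ) * (t : ℂ))) = Complex.exp (Complex.I * t) ^ 3 := by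
    rw [← Complex.exp_nat_mul]; congr 1; push_cast; ring
  have e1 : Complex.exp (Complex.I * ((1 : ℤ) * (t : ℂ))) = Complex.exp (Complex.I * t) := by
    congr 1; push_cast; ring
  have em1 : Complex.exp (Complex.I * ((-1 : ℤ) * (t : ℂ))) = Complex.exp (-(Complex.I * t)) := by
    congr 1; push_cast; ring
  have em3 : Complex.exp (Complex.I * ((-3 : ℤ) * (t : ℂ))) =
      Complex.exp (-(Complex.I * t)) ^ 3 := by
    rw [← Complex.exp_nat_mul]; congr 1; push_cast; ring
  have hee : Complex.exp (Complex.I * t) * Complex.exp (-(Complex.I * t)) = 1 := by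
    rw [← Complex.exp_add]; simp
  have c3 : c 3 = (A - D - Complex.I * B + Complex.I * G) / 8 := rfl
  have c1 : c 1 = (3 * A + D - Complex.I * B - 3 * Complex.I * G) / 8 := rfl
  have cm1 : c (-1) = (3 * A + D + Complex.I * B + 3 * Complex.I * G) / 8 := rfl
  have cm3 : c (-3) = (A - D + Complex.I * B - Complex.I * G) / 8 := rfl
  rw [h1, h2, e3, e1, em1, em3, cos_eq_exp, sin_eq_exp, c3, c1, cm1, cm3]
  generalize Complex.exp (Complex.I * t) = x at *
  generalize Complex.exp (-(Complex.I * t)) = y at *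
  linear_combination ((3 / 8) * (x + y) * A + (1 / 8) * Complex.I * (y - x) * B +
    (1 / 8) * (x + y) * D + (3 / 8) * Complex.I * (y - x) * G) * hee +
    ((1 / 8) * (y ^ 3 - x * y ^ 2 - x ^ 2 * y + x ^ 3) * D +
      (1 / 8) * Complex.I * (y - x) ^ 3 * G) * Complex.I_sq

lemma typeProj_three_apply {p q : ℕ} (hpq : p + q = 3) (φ : V [⋀^Fin 3]→L[ℝ] ℂ)
    (v : Fin 3 → V) {c : ℤ → ℂ} (hc : ∀ t : ℝ, φ (fun i => rot J t (v i)) =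
      Complex.exp (Complex.I * ((3 : ℤ) * (t : ℂ))) * c 3 +
      Complex.exp (Complex.I * ((1 : ℤ) * (t : ℂ))) * c 1 +
      Complex.exp (Complex.I * ((-1 : ℤ) * (t : ℂ))) * c (-1) +
      Complex.exp (Complex.I * ((-3 : ℤ) * (t : ℂ))) * c (-3)) :
    typeProj J p q φ v = c ((p : ℤ) - q) := by
  have hf : ∀ m : ℤ, |m| ≤ 3 → _ := fun m hm =>
    fourier_roots (k := 3) p q m (by rw [abs_le] at *; constructor <;> push_cast <;> omega) (c m)
  have h3 := hf 3 (by norm_num)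
  have h1 := hf 1 (by norm_num)
  have hm1 := hf (-1) (by norm_num)
  have hm3 := hf (-3) (by norm_num)
  rw [typeProj_apply]
  simp only [hc, mul_add, Finset.sum_add_distrib]
  rw [h3, h1, hm1, hm3]
  obtain ⟨rfl, rfl⟩ | ⟨rfl, rfl⟩ | ⟨rfl, rfl⟩ | ⟨rfl, rfl⟩ :
      (p = 3 ∧ q = 0) ∨ (p = 2 ∧ q = 1) ∨ (p = 1 ∧ q = 2) ∨ (p = 0 ∧ q = 3) := by omega
  all_goals norm_num

lemma sum_typeProj_three (φ : V [⋀^Fin 3]→L[ℝ] ℂ) :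
    typeProj J 3 0 φ + typeProj J 2 1 φ + typeProj J 1 2 φ + typeProj J 0 3 φ = φ := by
  ext v
  obtain ⟨c, hc⟩ := exists_trig_expansion (J := J) φ v
  have h0 := hc 0
  simp only [rot_zero, Complex.ofReal_zero, mul_zero, Complex.exp_zero, one_mul] at h0
  simp only [ContinuousAlternatingMap.add_apply]
  rw [typeProj_three_apply (by norm_num) φ v hc, typeProj_three_apply (by norm_num) φ v hc,
    typeProj_three_apply (by norm_num) φ v hc, typeProj_three_apply (by norm_num) φ v hc, h0]
  norm_num

lemma isOfType_typeProj_three (hJ : ∀ v, J (J v) = -v) {p q : ℕ} (hpq : p + q = 3)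
    (φ : V [⋀^Fin 3]→L[ℝ] ℂ) : IsOfType J p q (typeProj J p q φ) := by
  refine ⟨hpq, hasWeight_of_apply fun s v => ?_⟩
  obtain ⟨c, hc⟩ := exists_trig_expansion (J := J) φ v
  have hs : ∀ t : ℝ, φ (fun i => rot J t (rot J s (v i))) =
      Complex.exp (Complex.I * ((3 : ℤ) * (t : ℂ))) *
        (fun m : ℤ => Complex.exp (Complex.I * (m * (s : ℂ))) * c m) 3 +
      Complex.exp (Complex.I * ((1 : ℤ) * (t : ℂ))) *
        (fun m : ℤ => Complex.exp (Complex.I * (m * (s : ℂ))) * c m) 1 +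
      Complex.exp (Complex.I * ((-1 : ℤ) * (t : ℂ))) *
        (fun m : ℤ => Complex.exp (Complex.I * (m * (s : ℂ))) * c m) (-1) +
      Complex.exp (Complex.I * ((-3 : ℤ) * (t : ℂ))) *
        (fun m : ℤ => Complex.exp (Complex.I * (m * (s : ℂ))) * c m) (-3) := by
    intro t
    have h : ∀ m : ℤ, Complex.exp (Complex.I * (m * ((t + s : ℝ) : ℂ))) =
        Complex.exp (Complex.I * (m * (t : ℂ))) * Complex.exp (Complex.I * (m * (s : ℂ))) := by
      intro m; rw [← Complex.exp_add]; congr 1; push_cast; ring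
    simp only [rot_rot hJ, hc (t + s), h]
    ring
  rw [typeProj_three_apply (c := fun m : ℤ => Complex.exp (Complex.I * (m * (s : ℂ))) * c m)
    hpq φ _ hs, typeProj_three_apply hpq φ v hc]
  push_cast
  rfl

end Weights

/-! ### Linear algebra of types: complex-linear forms -/

section ComplexLinear

variable {V : Type*} [NormedAddCommGroup V] [NormedSpace ℝ V] {J : V →L[ℝ] V}

/-- A form on `V` is complex linear (in its first argument, hence in all of them). -/
def CLin (J : V →L[ℝ] V) {k : ℕ} (φ : V [⋀^Fin (k + 1)]→L[ℝ] ℂ) : Prop :=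
  ∀ (u : V) (w : Fin k → V),
    φ (Matrix.vecCons (J u) w) = Complex.I * φ (Matrix.vecCons u w)

/-- The structure of a complex vector space defined by `J`. -/
abbrev complexModule (J : V →L[ℝ] V) (hJ : ∀ v, J (J v) = -v) : Module ℂ V :=
  Module.compHom V (Complex.lift (A := Module.End ℝ V)
    ⟨J.toLinearMap, by ext v; exact hJ v⟩ : ℂ →+* Module.End ℝ V)

lemma complexModule_smul (hJ : ∀ v, J (J v) = -v) (z : ℂ) (v : V) :
    letI := complexModule J hJ
    z • v = z.re • v + z.im • J v := by
  change (Complex.lift (A := Module.End ℝ V) ⟨J.toLinearMap, _⟩ z) v = _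
  rw [Complex.lift_apply, Complex.liftAux_apply]
  rfl

lemma complexModule_tower (hJ : ∀ v, J (J v) = -v) :
    letI := complexModule J hJ
    IsScalarTower ℝ ℂ V := by
  let _ := complexModule J hJ
  refine ⟨fun r z v => ?_⟩
  rw [complexModule_smul hJ, complexModule_smul hJ]
  simp [mul_smul]

lemma CLin.update {k : ℕ} {φ : V [⋀^Fin (k + 1)]→L[ℝ] ℂ} (h : CLin J φ) (v : Fin (k + 1) → V)
    (i : Fin (k + 1)) (u : V) :
    φ (Function.update v i (J u)) = Complex.I * φ (Function.update v i u) := by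
  have h0 : ∀ (v : Fin (k + 1) → V) (u : V),
      φ (Function.update v 0 (J u)) = Complex.I * φ (Function.update v 0 u) := by
    intro v u
    have hv : ∀ x, Function.update v 0 x = Matrix.vecCons x (Fin.tail v) := by
      intro x; ext j; refine Fin.cases ?_ (fun j => ?_) j <;> simp [Fin.tail]
    rw [hv, hv]; exact h _ _
  by_cases hi : i = 0
  · subst hi; exact h0 v u
  have hs : ∀ x, φ (Function.update v i x) =
      -φ (Function.update (v ∘ Equiv.swap 0 i) 0 x) := by
    intro x
    have h1 := φ.toAlternatingMap.map_swap (Function.update (v ∘ Equiv.swap 0 i) 0 x) (Ne.symm hi)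
    refine Eq.trans ?_ h1
    change φ _ = φ _
    congr 1
    ext j
    by_cases hj : j = i
    · subst hj; simp
    · have : Equiv.swap 0 i j ≠ 0 := by
        intro h2
        apply hj
        have := congrArg (Equiv.swap 0 i) h2
        simpa using this
      simp [hj, this]
  rw [hs, hs, h0]; ring

/-- A complex-linear form as an alternating map over `ℂ`. -/
def CLin.toComplex {k : ℕ} {φ : V [⋀^Fin (k + 1)]→L[ℝ] ℂ} (h : CLin J φ)
    (hJ : ∀ v, J (J v) = -v) :
    letI := complexModule J hJ
    V [⋀^Fin (k + 1)]→ₗ[ℂ] ℂ :=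
  letI := complexModule J hJ
  { toFun := φ
    map_update_add' := fun v i x y => φ.toAlternatingMap.map_update_add v i x y
    map_update_smul' := @fun inst v i z x => by
      obtain rfl : inst = instDecidableEqFin (k + 1) := Subsingleton.elim _ _
      have h1 : ∀ x y, φ (Function.update v i (x + y)) =
        φ (Function.update v i x) + φ (Function.update v i y) := fun x y =>
          φ.toAlternatingMap.map_update_add v i x y
      have h2 : ∀ (r : ℝ) x, φ (Function.update v i (r • x)) =
        r • φ (Function.update v i x) := fun r x => φ.toAlternatingMap.map_update_smul v i r x
      rw [complexModule_smul hJ, h1, h2, h2, h.update]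
      simp only [Complex.real_smul, smul_eq_mul]
      conv_rhs => rw [← Complex.re_add_im z]
      ring
    map_eq_zero_of_eq' := fun v i j hv hij => φ.toAlternatingMap.map_eq_zero_of_eq v hv hij }

/-- A complex-linear form of degree `k` has weight `k`. -/
lemma CLin.hasWeight {k : ℕ} {φ : V [⋀^Fin (k + 1)]→L[ℝ] ℂ} (h : CLin J φ)
    (hJ : ∀ v, J (J v) = -v) : HasWeight J ((k + 1 : ℕ) : ℂ) φ := by
  let _ := complexModule J hJ
  refine hasWeight_of_apply fun t v => ?_
  have h1 : (fun i => rot J t (v i)) = fun i => Complex.exp (Complex.I * t) • v i := by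
    ext i
    rw [complexModule_smul hJ, mul_comm, Complex.exp_ofReal_mul_I_re, Complex.exp_ofReal_mul_I_im]
    rfl
  rw [h1]
  have h2 := (h.toComplex hJ).toMultilinearMap.map_smul_univ
    (fun _ => Complex.exp (Complex.I * t)) v
  refine h2.trans ?_
  rw [Finset.prod_const, Finset.card_univ, Fintype.card_fin, ← Complex.exp_nat_mul, smul_eq_mul]
  have he : ((k + 1 : ℕ) : ℂ) * (Complex.I * t) = Complex.I * (((k + 1 : ℕ) : ℂ) * t) := by ring
  rw [he]
  rfl

lemma finrank_complexModule (hJ : ∀ v, J (J v) = -v) (hV : Module.finrank ℝ V = 6) :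
    letI := complexModule J hJ
    Module.finrank ℂ V = 3 := by
  let _ := complexModule J hJ
  have := complexModule_tower hJ
  have h := Module.finrank_mul_finrank ℝ ℂ V
  rw [Complex.finrank_real_complex, hV] at h
  omega

/-- A basis of `V` over `ℂ`. -/
lemma exists_complex_basis (hJ : ∀ v, J (J v) = -v) (hV : Module.finrank ℝ V = 6) :
    letI := complexModule J hJ
    Nonempty (Module.Basis (Fin 3) ℂ V) := by
  let _ := complexModule J hJ
  have := complexModule_tower hJ
  have : FiniteDimensional ℝ V := FiniteDimensional.of_finrank_pos (by omega)
  have : FiniteDimensional ℂ V := FiniteDimensional.right ℝ ℂ V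
  exact ⟨Module.finBasisOfFinrankEq ℂ V (finrank_complexModule hJ hV)⟩

/-- In complex dimension three, complex-linear `4`-forms vanish. -/
lemma CLin.eq_zero_of_four {φ : V [⋀^Fin 4]→L[ℝ] ℂ} (h : CLin J φ)
    (hJ : ∀ v, J (J v) = -v) (hV : Module.finrank ℝ V = 6) : φ = 0 := by
  let _ := complexModule J hJ
  obtain ⟨e⟩ := exists_complex_basis hJ hV
  have h0 : h.toComplex hJ = 0 := by
    refine e.ext_alternating fun v hv => ?_
    have := Fintype.card_le_of_injective v hv
    simp at this
  ext v
  exact congrArg (fun ψ : V [⋀^Fin 4]→ₗ[ℂ] ℂ => ψ v) h0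

/-- In complex dimension three, complex-linear `3`-forms are multiples of any nonzero one. -/
lemma CLin.exists_eq_smul {Φ τ : V [⋀^Fin 3]→L[ℝ] ℂ} (hΦ : CLin J Φ) (hΦ0 : Φ ≠ 0)
    (hτ : CLin J τ) (hJ : ∀ v, J (J v) = -v) (hV : Module.finrank ℝ V = 6) :
    ∃ c : ℂ, τ = c • Φ := by
  let _ := complexModule J hJ
  obtain ⟨e⟩ := exists_complex_basis hJ hV
  have h1 := AlternatingMap.eq_smul_basis_det e (hΦ.toComplex hJ)
  have h2 := AlternatingMap.eq_smul_basis_det e (hτ.toComplex hJ)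
  have hne : hΦ.toComplex hJ e ≠ 0 := by
    intro h0
    rw [h0, zero_smul] at h1
    apply hΦ0
    ext v
    exact congrArg (fun ψ : V [⋀^Fin 3]→ₗ[ℂ] ℂ => ψ v) h1
  refine ⟨hτ.toComplex hJ e / hΦ.toComplex hJ e, ?_⟩
  ext v
  have h1v := congrArg (fun ψ : V [⋀^Fin 3]→ₗ[ℂ] ℂ => ψ v) h1
  have h2v := congrArg (fun ψ : V [⋀^Fin 3]→ₗ[ℂ] ℂ => ψ v) h2
  change Φ v = (hΦ.toComplex hJ e) * e.det v at h1v
  change τ v = (hτ.toComplex hJ e) * e.det v at h2v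
  change τ v = (hτ.toComplex hJ e / hΦ.toComplex hJ e) * Φ v
  rw [h1v, h2v]
  field_simp

/-- Contraction with a nonzero complex volume form identifies `V` with the complex-linear
`2`-forms. -/
lemma CLin.existsUnique_contraction {Φ : V [⋀^Fin 3]→L[ℝ] ℂ} (hΦ : CLin J Φ) (hΦ0 : Φ ≠ 0)
    {ν : V [⋀^Fin 2]→L[ℝ] ℂ}
    (hν : CLin J ν) (hJ : ∀ v, J (J v) = -v) (hV : Module.finrank ℝ V = 6) :
    ∃! w : V, ∀ u v, Φ ![w, u, v] = ν ![u, v] := by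
  let _ := complexModule J hJ
  obtain ⟨e⟩ := exists_complex_basis hJ hV
  set c := Φ ![e 0, e 1, e 2] with hc
  have hce : hΦ.toComplex hJ e = c := by
    change Φ e = _
    rw [hc]; congr 1; ext i; fin_cases i <;> rfl
  have hc0 : c ≠ 0 := by
    intro h0
    have h1 := AlternatingMap.eq_smul_basis_det e (hΦ.toComplex hJ)
    rw [hce, h0, zero_smul] at h1
    apply hΦ0
    ext v
    exact congrArg (fun ψ : V [⋀^Fin 3]→ₗ[ℂ] ℂ => ψ v) h1
  have c1 : Φ ![e 1, e 0, e 2] = -c := form_swap₀ _ _ _ _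
  have c2 : Φ ![e 2, e 0, e 1] = c := by rw [form_swap₀, form_swap₁, neg_neg]
  have z1 : ∀ x y, Φ ![x, x, y] = 0 := fun x y =>
    Φ.toAlternatingMap.map_eq_zero_of_eq ![x, x, y] (i := 0) (j := 1) rfl (by decide)
  have z2 : ∀ x y, Φ ![x, y, x] = 0 := fun x y =>
    Φ.toAlternatingMap.map_eq_zero_of_eq ![x, y, x] (i := 0) (j := 2) rfl (by decide)
  have hs : ∀ (z : ℂ) (x u v : V), Φ ![z • x, u, v] = z * Φ ![x, u, v] := fun z x u v =>
    (hΦ.toComplex hJ).map_vecCons_smul _ z x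
  have key : ∀ a b d : ℂ, (Φ ![a • e 0 + b • e 1 + d • e 2, e 1, e 2] = a * c) ∧
      (Φ ![a • e 0 + b • e 1 + d • e 2, e 0, e 2] = -(b * c)) ∧
      (Φ ![a • e 0 + b • e 1 + d • e 2, e 0, e 1] = d * c) := by
    intro a b d
    simp only [form_add₀, hs, c1, c2, z1, z2, ← hc]
    refine ⟨by ring, by ring, by ring⟩
  -- the coordinates of `w` in the basis `e` are the values of `ν` on pairs of basis vectors,
  -- divided by `c = Φ(e₀, e₁, e₂)`
  refine ⟨(ν ![e 1, e 2] / c) • e 0 + (-(ν ![e 0, e 2] / c)) • e 1 + (ν ![e 0, e 1] / c) • e 2,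
    ?_, fun w hw => ?_⟩
  · obtain ⟨k1, k2, k3⟩ := key (ν ![e 1, e 2] / c) (-(ν ![e 0, e 2] / c)) (ν ![e 0, e 1] / c)
    generalize (ν ![e 1, e 2] / c) • e 0 + (-(ν ![e 0, e 2] / c)) • e 1 +
      (ν ![e 0, e 1] / c) • e 2 = w at *
    have k1' : Φ ![w, e 1, e 2] = ν ![e 1, e 2] := by rw [k1]; field_simp
    have k2' : Φ ![w, e 0, e 2] = ν ![e 0, e 2] := by rw [k2]; field_simp
    have k3' : Φ ![w, e 0, e 1] = ν ![e 0, e 1] := by rw [k3]; field_simp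
    have hext : (hΦ.toComplex hJ).curryLeft w = hν.toComplex hJ := by
      refine e.ext_alternating fun v hv => ?_
      have hvv : (fun i => e (v i)) = ![e (v 0), e (v 1)] := by
        ext i; fin_cases i <;> rfl
      rw [hvv]
      change Φ ![w, e (v 0), e (v 1)] = ν ![e (v 0), e (v 1)]
      have hne : v 0 ≠ v 1 := fun h => by simpa using hv h
      generalize v 0 = a at *
      generalize v 1 = b at *
      have sw : ∀ x y, Φ ![w, x, y] = ν ![x, y] → Φ ![w, y, x] = ν ![y, x] := by
        intro x y h
        rw [form_swap₁, form_swap₀ ν, h]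
      fin_cases a <;> fin_cases b
      · exact absurd rfl hne
      · exact k3'
      · exact k2'
      · exact sw _ _ k3'
      · exact absurd rfl hne
      · exact k1'
      · exact sw _ _ k2'
      · exact sw _ _ k1'
      · exact absurd rfl hne
    intro u v
    exact congrArg (fun ψ : V [⋀^Fin 2]→ₗ[ℂ] ℂ => ψ ![u, v]) hext
  · have hr := e.sum_repr w
    rw [Fin.sum_univ_three] at hr
    obtain ⟨k1, k2, k3⟩ := key (e.repr w 0) (e.repr w 1) (e.repr w 2)
    rw [hr, hw] at k1 k2 k3
    rw [← hr, k1, k2, k3]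
    congr 1
    · congr 1
      · congr 1; field_simp
      · congr 1; field_simp
    · congr 1; field_simp

end ComplexLinear

/-! ### Linear algebra of types: contraction with `(0,1)`-vectors and normal forms -/

section Insertion

variable {V : Type*} [NormedAddCommGroup V] [NormedSpace ℝ V] {J : V →L[ℝ] V}

/-- The contraction of a form with the `(0,1)`-vector `u + i J u` (twice the `(0,1)`-part of the
real vector `u`). -/
def ins01 (J : V →L[ℝ] V) {k : ℕ} (φ : V [⋀^Fin (k + 1)]→L[ℝ] ℂ) (u : V) : V [⋀^Fin k]→L[ℝ] ℂ :=
  φ.curryLeft u + Complex.I • φ.curryLeft (J u)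

lemma ins01_apply {k : ℕ} (φ : V [⋀^Fin (k + 1)]→L[ℝ] ℂ) (u : V) (w : Fin k → V) :
    ins01 J φ u w =
      φ (Matrix.vecCons u w) + Complex.I * φ (Matrix.vecCons (J u) w) := rfl

lemma ins01_sub {k : ℕ} (φ ψ : V [⋀^Fin (k + 1)]→L[ℝ] ℂ) (u : V) :
    ins01 J (φ - ψ) u = ins01 J φ u - ins01 J ψ u := by
  ext w
  simp only [ins01_apply, ContinuousAlternatingMap.sub_apply]
  ring

lemma ins01_add {k : ℕ} (φ ψ : V [⋀^Fin (k + 1)]→L[ℝ] ℂ) (u : V) :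
    ins01 J (φ + ψ) u = ins01 J φ u + ins01 J ψ u := by
  ext w
  simp only [ins01_apply, ContinuousAlternatingMap.add_apply]
  ring

lemma ins01_smul {k : ℕ} (c : ℂ) (φ : V [⋀^Fin (k + 1)]→L[ℝ] ℂ) (u : V) :
    ins01 J (c • φ) u = c • ins01 J φ u := by
  ext w
  simp only [ins01_apply, ContinuousAlternatingMap.smul_apply, smul_eq_mul]
  ring

lemma ins01_add_vec {k : ℕ} (φ : V [⋀^Fin (k + 1)]→L[ℝ] ℂ) (u v : V) :
    ins01 J φ (u + v) = ins01 J φ u + ins01 J φ v := by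
  ext w
  simp only [ins01_apply, ContinuousAlternatingMap.add_apply, map_add, form_add₀]
  ring

lemma ins01_smul_vec {k : ℕ} (φ : V [⋀^Fin (k + 1)]→L[ℝ] ℂ) (c : ℝ) (u : V) :
    ins01 J φ (c • u) = (c : ℂ) • ins01 J φ u := by
  ext w
  simp only [ins01_apply, ContinuousAlternatingMap.smul_apply, map_smul, form_smul₀,
    Complex.real_smul, smul_eq_mul]
  ring

lemma ins01_J (hJ : ∀ v, J (J v) = -v) {k : ℕ} (φ : V [⋀^Fin (k + 1)]→L[ℝ] ℂ) (u : V) :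
    ins01 J φ (J u) = (-Complex.I) • ins01 J φ u := by
  ext w
  simp only [ins01_apply, ContinuousAlternatingMap.smul_apply, hJ, form_neg₀, smul_eq_mul]
  linear_combination φ (Matrix.vecCons (J u) w) * Complex.I_sq

/-- Contraction with a `(0,1)`-vector raises the weight by one. -/
lemma HasWeight.ins01 (hJ : ∀ v, J (J v) = -v) {k : ℕ} {m : ℂ} {φ : V [⋀^Fin (k + 1)]→L[ℝ] ℂ}
    (h : HasWeight J m φ) (u : V) : HasWeight J (m + 1) (ins01 J φ u) := by
  refine hasWeight_of_apply fun t w => ?_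
  have h1 : ∀ x, φ (Matrix.vecCons x (fun i => rot J t (w i))) =
      Complex.exp (Complex.I * (m * (t : ℂ))) * φ (Matrix.vecCons (rot J (-t) x) w) := by
    intro x
    rw [← h.apply]
    congr 1
    ext i
    refine Fin.cases ?_ (fun i => ?_) i
    · simp [rot_rot hJ, rot_zero]
    · simp
  have he : Complex.exp (Complex.I * ((m + 1) * (t : ℂ))) =
      Complex.exp (Complex.I * (m * (t : ℂ))) * (Real.cos t + Real.sin t * Complex.I) := by
    have h2 : Complex.exp (Complex.I * t) = Real.cos t + Real.sin t * Complex.I := by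
      rw [mul_comm, Complex.exp_mul_I]; simp
    rw [← h2, ← Complex.exp_add]; congr 1; ring
  simp only [ins01_apply, h1, he]
  simp only [rot, add_apply, smul_apply, ContinuousLinearMap.id_apply, form_add₀, form_smul₀,
    Complex.real_smul, Real.cos_neg, Real.sin_neg, hJ, form_neg₀]
  push_cast
  linear_combination (-(Complex.exp (Complex.I * (m * (t : ℂ)))) * (Complex.sin t) *
    φ (Matrix.vecCons (J u) w)) * Complex.I_sq

lemma clin_iff {k : ℕ} {φ : V [⋀^Fin (k + 1)]→L[ℝ] ℂ} :
    CLin J φ ↔ ∀ u, ins01 J φ u = 0 := by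
  constructor
  · intro h u
    ext w
    rw [ins01_apply, h]
    change _ = (0 : ℂ)
    linear_combination φ (Matrix.vecCons u w) * Complex.I_sq
  · intro h u w
    have h1 : ins01 J φ u w = 0 := by rw [h]; rfl
    rw [ins01_apply] at h1
    linear_combination (-Complex.I) * h1 + φ (Matrix.vecCons (J u) w) * Complex.I_sq

lemma exp_weight_half_pi (m : ℂ) : Complex.exp (Complex.I * (m * ((Real.pi / 2 : ℝ) : ℂ))) =
    Complex.exp (m * (Real.pi / 2 * Complex.I)) := by
  congr 1; push_cast; ring

lemma exp_pi_div_four : Complex.exp (Complex.I * ((Real.pi / 4 : ℝ) : ℂ)) =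
    (Real.sqrt 2 / 2 : ℝ) * (1 + Complex.I) := by
  rw [mul_comm, Complex.exp_mul_I, ← Complex.ofReal_cos, ← Complex.ofReal_sin,
    Real.cos_pi_div_four, Real.sin_pi_div_four]
  ring

lemma HasWeight.eq_zero_of_ne {k : ℕ} {m m' : ℂ} {φ : V [⋀^Fin k]→L[ℝ] ℂ} (t : ℝ)
    (h : HasWeight J m φ) (h' : HasWeight J m' φ)
    (hne : Complex.exp (Complex.I * (m * (t : ℂ))) ≠ Complex.exp (Complex.I * (m' * (t : ℂ)))) :
    φ = 0 := by
  ext v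
  have h1 := h.apply t v
  rw [h'.apply t v] at h1
  change φ v = 0
  have h2 : (Complex.exp (Complex.I * (m * (t : ℂ))) - Complex.exp (Complex.I * (m' * (t : ℂ)))) *
      φ v = 0 := by rw [sub_mul, h1, sub_self]
  exact (mul_eq_zero.1 h2).resolve_left (sub_ne_zero.2 hne)

/-- Forms of type `(2,0)` are complex linear. -/
lemma HasWeight.clin_two (hJ : ∀ v, J (J v) = -v) {φ : V [⋀^Fin 2]→L[ℝ] ℂ}
    (h : HasWeight J 2 φ) : CLin J φ := by
  have e2 : ∀ t : ℝ, Complex.exp (Complex.I * (2 * (t : ℂ))) = Complex.exp (Complex.I * t) ^ 2 := by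
    intro t; rw [← Complex.exp_nat_mul]; congr 1; push_cast; ring
  have hap : ∀ (t : ℝ) (u v : V), φ ![rot J t u, rot J t v] =
      Complex.exp (Complex.I * t) ^ 2 * φ ![u, v] := by
    intro t u v
    rw [← e2, ← h.apply]
    congr 1; ext i; fin_cases i <;> rfl
  have hJJ : ∀ u v : V, φ ![J u, J v] = -φ ![u, v] := by
    intro u v
    have := hap (Real.pi / 2) u v
    rw [rot_pi_div_two, rot_pi_div_two, mul_comm Complex.I] at this
    push_cast at this
    rw [Complex.exp_pi_div_two_mul_I, Complex.I_sq] at this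
    rw [this]; ring
  have hq : ∀ u v : V, φ ![J u, v] + φ ![u, J v] = 2 * Complex.I * φ ![u, v] := by
    intro u v
    have h4 := hap (Real.pi / 4) u v
    rw [exp_pi_div_four] at h4
    simp only [rot, add_apply, smul_apply, ContinuousLinearMap.id_apply, form_add₀, form_add₁,
      form_smul₀, form_smul₁, Complex.real_smul, Real.cos_pi_div_four, Real.sin_pi_div_four,
      hJJ] at h4
    have hs : ((Real.sqrt 2 / 2 : ℝ) : ℂ) ^ 2 = 1 / 2 := by
      rw [← Complex.ofReal_pow, div_pow, Real.sq_sqrt (by norm_num)]; norm_num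
    linear_combination 2 * h4 - 2 * (φ ![J u, v] + φ ![u, J v] -
      (2 * Complex.I + 1 + Complex.I ^ 2) * φ ![u, v]) * hs + φ ![u, v] * Complex.I_sq
  intro u w
  have hw : w = ![w 0] := by ext i; fin_cases i; rfl
  rw [hw]
  change φ ![J u, w 0] = Complex.I * φ ![u, w 0]
  have h1 : φ ![J u, w 0] = φ ![u, J (w 0)] := by
    have := hJJ u (J (w 0))
    rw [hJ, form_neg₁] at this
    linear_combination -this
  linear_combination (1 / 2) * hq u (w 0) + (1 / 2) * h1

/-- Forms of type `(3,0)` are complex linear. -/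
lemma HasWeight.clin_three (hJ : ∀ v, J (J v) = -v) {φ : V [⋀^Fin 3]→L[ℝ] ℂ}
    (h : HasWeight J 3 φ) : CLin J φ := by
  have e2 : ∀ t : ℝ, Complex.exp (Complex.I * (3 * (t : ℂ))) = Complex.exp (Complex.I * t) ^ 3 := by
    intro t; rw [← Complex.exp_nat_mul]; congr 1; push_cast; ring
  have hap : ∀ (t : ℝ) (u v w : V), φ ![rot J t u, rot J t v, rot J t w] =
      Complex.exp (Complex.I * t) ^ 3 * φ ![u, v, w] := by
    intro t u v w
    rw [← e2, ← h.apply]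
    congr 1; ext i; fin_cases i <;> rfl
  have hI3 : Complex.I ^ 3 = -Complex.I := by rw [pow_succ, Complex.I_sq]; ring
  have hJJJ : ∀ u v w : V, φ ![J u, J v, J w] = -Complex.I * φ ![u, v, w] := by
    intro u v w
    have := hap (Real.pi / 2) u v w
    rw [rot_pi_div_two, rot_pi_div_two, rot_pi_div_two, mul_comm Complex.I] at this
    push_cast at this
    rw [Complex.exp_pi_div_two_mul_I, hI3] at this
    rw [this]
  have hJJ : ∀ u v w : V, φ ![J u, J v, w] = Complex.I * φ ![u, v, J w] := by
    intro u v w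
    have := hJJJ u v (J w)
    rw [hJ, form_neg₂] at this
    linear_combination -this
  -- the action of `e^{tJ}` at `t = π/2` gives `hJJ`; at `t = π/4` it then gives the derivation
  -- property `hq`
  have hq : ∀ u v w : V, φ ![J u, v, w] + φ ![u, J v, w] + φ ![u, v, J w] =
      3 * Complex.I * φ ![u, v, w] := by
    intro u v w
    have h4 := hap (Real.pi / 4) u v w
    have hJJ' : φ ![J u, v, J w] = Complex.I * φ ![u, J v, w] := by
      rw [form_swap₁, hJJ, form_swap₁]; ring
    have hJJ'' : φ ![u, J v, J w] = Complex.I * φ ![J u, v, w] := by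
      rw [form_swap₀, form_swap₁, hJJ, form_swap₁, form_swap₀]; ring
    rw [exp_pi_div_four] at h4
    simp only [rot, add_apply, smul_apply, ContinuousLinearMap.id_apply, form_add₀, form_add₁,
      form_add₂, form_smul₀, form_smul₁, form_smul₂, Complex.real_smul, Real.cos_pi_div_four,
      Real.sin_pi_div_four, hJJJ, hJJ, hJJ', hJJ''] at h4
    have hs : ((Real.sqrt 2 / 2 : ℝ) : ℂ) ≠ 0 := by
      rw [Ne, Complex.ofReal_eq_zero]; positivity
    generalize ((Real.sqrt 2 / 2 : ℝ) : ℂ) = s at *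
    have h5 : s ^ 3 * ((1 + Complex.I) * (φ ![J u, v, w] + φ ![u, J v, w] + φ ![u, v, J w]) +
        (1 - Complex.I) * φ ![u, v, w] - (1 + Complex.I) ^ 3 * φ ![u, v, w]) = 0 := by
      linear_combination h4
    have h6 := (mul_eq_zero.1 h5).resolve_left (pow_ne_zero 3 hs)
    have hI : (1 + Complex.I) * (1 - Complex.I) = 2 := by
      linear_combination -Complex.I_sq
    linear_combination ((1 - Complex.I) / 2) * h6 -
      (1 / 2) * (φ ![J u, v, w] + φ ![u, J v, w] + φ ![u, v, J w]
        - (1 + Complex.I) ^ 2 * φ ![u, v, w]) * hI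
      + φ ![u, v, w] * (1 / 2) * Complex.I_sq
  intro u w
  have hw : w = ![w 0, w 1] := by ext i; fin_cases i <;> rfl
  rw [hw]
  change φ ![J u, w 0, w 1] = Complex.I * φ ![u, w 0, w 1]
  have h1 := hq (J u) (w 0) (w 1)
  rw [hJ, form_neg₀, hJJ] at h1
  have hJJ' : φ ![J u, w 0, J (w 1)] = Complex.I * φ ![u, J (w 0), w 1] := by
    rw [form_swap₁, hJJ, form_swap₁]; ring
  rw [hJJ'] at h1
  have h2 := hq u (w 0) (w 1)
  linear_combination (Complex.I / 4) * h1 + (1 / 4) * h2 +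
    (1 / 4) * (3 * φ ![J u, w 0, w 1] - φ ![u, J (w 0), w 1] - φ ![u, w 0, J (w 1)]) * Complex.I_sq

/-- The wedge product `ζ ∧ μ` with a covector, as a form. -/
def wedge {𝔽 : Type*} [NormedField 𝔽] [NormedAlgebra ℝ 𝔽] {k : ℕ} (ζ : V →L[ℝ] 𝔽)
    (μ : V [⋀^Fin k]→L[ℝ] 𝔽) : V [⋀^Fin (k + 1)]→L[ℝ] 𝔽 :=
  ContinuousAlternatingMap.alternatizeUncurryFin (ζ.smulRight μ)

lemma wedge_apply {𝔽 : Type*} [NormedField 𝔽] [NormedAlgebra ℝ 𝔽] {k : ℕ} (ζ : V →L[ℝ] 𝔽)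
    (μ : V [⋀^Fin k]→L[ℝ] 𝔽) (v : Fin (k + 1) → V) : wedge ζ μ v = wedgeCovector ζ μ v := by
  simp only [wedge, wedgeCovector, ContinuousAlternatingMap.alternatizeUncurryFin_apply,
    ContinuousLinearMap.smulRight_apply, ContinuousAlternatingMap.smul_apply, smul_eq_mul,
    zsmul_eq_mul, mul_assoc]
  push_cast
  rfl

/-- Contraction is an antiderivation. -/
lemma wedge_cons {𝔽 : Type*} [NormedField 𝔽] [NormedAlgebra ℝ 𝔽] {k : ℕ} (ζ : V →L[ℝ] 𝔽)
    (μ : V [⋀^Fin (k + 1)]→L[ℝ] 𝔽) (u : V) (w : Fin (k + 1) → V) :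
    wedge ζ μ (Matrix.vecCons u w) = ζ u * μ w - wedge ζ (μ.curryLeft u) w := by
  rw [wedge_apply, wedge_apply, wedgeCovector, Fin.sum_univ_succ, wedgeCovector, sub_eq_add_neg,
    ← Finset.sum_neg_distrib]
  congr 1
  · simp
  · refine Finset.sum_congr rfl fun i _ => ?_
    have h : Fin.removeNth i.succ (Matrix.vecCons u w) = Matrix.vecCons u (Fin.removeNth i w) := by
      ext j; refine Fin.cases ?_ (fun j => ?_) j <;> simp [Fin.removeNth]
    rw [h]
    simp [pow_succ]

lemma wedge_add {𝔽 : Type*} [NormedField 𝔽] [NormedAlgebra ℝ 𝔽] {k : ℕ} (ζ : V →L[ℝ] 𝔽)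
    (μ ν : V [⋀^Fin k]→L[ℝ] 𝔽) : wedge ζ (μ + ν) = wedge ζ μ + wedge ζ ν := by
  ext v
  rw [ContinuousAlternatingMap.add_apply, wedge_apply, wedge_apply, wedge_apply]
  simp [wedgeCovector, mul_add, Finset.sum_add_distrib]

lemma wedge_zero {𝔽 : Type*} [NormedField 𝔽] [NormedAlgebra ℝ 𝔽] {k : ℕ} (ζ : V →L[ℝ] 𝔽) :
    wedge ζ (0 : V [⋀^Fin k]→L[ℝ] 𝔽) = 0 := by
  ext v
  rw [wedge_apply]
  simp [wedgeCovector]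

lemma wedge_smul {𝔽 : Type*} [NormedField 𝔽] [NormedAlgebra ℝ 𝔽] {k : ℕ} (ζ : V →L[ℝ] 𝔽) (c : 𝔽)
    (μ : V [⋀^Fin k]→L[ℝ] 𝔽) : wedge ζ (c • μ) = c • wedge ζ μ := by
  ext v
  rw [ContinuousAlternatingMap.smul_apply, wedge_apply, wedge_apply]
  simp only [wedgeCovector, ContinuousAlternatingMap.smul_apply, smul_eq_mul, Finset.mul_sum]
  exact Finset.sum_congr rfl fun i _ => by ring

/-- The wedge product of a `(1,0)`- or `(0,1)`-covector (for `ε = 1` and `ε = -1`) with a form of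
weight `m` has weight `m + ε`. -/
lemma HasWeight.wedge {k : ℕ} {m : ℂ} {ε : ℤ} (hε : ε = 1 ∨ ε = -1) {ζ : V →L[ℝ] ℂ}
    (hζ : ∀ v, ζ (J v) = ε * Complex.I * ζ v) {μ : V [⋀^Fin k]→L[ℝ] ℂ} (h : HasWeight J m μ) :
    HasWeight J (m + ε) (wedge ζ μ) := by
  refine hasWeight_of_apply fun t v => ?_
  rw [wedge_apply, wedge_apply, wedgeCovector, wedgeCovector, Finset.mul_sum]
  refine Finset.sum_congr rfl fun i _ => ?_
  have h1 : μ (i.removeNth fun i => rot J t (v i)) =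
      Complex.exp (Complex.I * (m * (t : ℂ))) * μ (i.removeNth v) := h.apply t _
  have h2 : ζ (rot J t (v i)) = Complex.exp (Complex.I * (ε * (t : ℂ))) * ζ (v i) := by
    have h3 : Complex.exp (Complex.I * (ε * (t : ℂ))) =
        Real.cos t + Real.sin t * (ε * Complex.I) := by
      rcases hε with rfl | rfl
      · rw [show Complex.I * (((1 : ℤ) : ℂ) * (t : ℂ)) = t * Complex.I by push_cast; ring,
          Complex.exp_mul_I]
        simp
      · rw [show Complex.I * (((-1 : ℤ) : ℂ) * (t : ℂ)) = (-t : ℂ) * Complex.I by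
          push_cast; ring, Complex.exp_mul_I]
        simp
    rw [h3]
    simp only [rot, add_apply, smul_apply, ContinuousLinearMap.id_apply, map_add, map_smul, hζ,
      Complex.real_smul]
    ring
  rw [h1, h2, show Complex.I * ((m + ε) * (t : ℂ)) =
    Complex.I * (m * (t : ℂ)) + Complex.I * (ε * (t : ℂ)) by ring, Complex.exp_add]
  ring

/-- Contraction of a wedge product with a `(0,1)`-vector. -/
lemma ins01_wedge {k : ℕ} (ζ : V →L[ℝ] ℂ) (μ : V [⋀^Fin (k + 1)]→L[ℝ] ℂ) (u : V) :
    ins01 J (wedge ζ μ) u = (ζ u + Complex.I * ζ (J u)) • μ - wedge ζ (ins01 J μ u) := by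
  ext w
  rw [ins01_apply, wedge_cons, wedge_cons, ContinuousAlternatingMap.sub_apply,
    ContinuousAlternatingMap.smul_apply, ins01, wedge_add, wedge_smul]
  simp only [ContinuousAlternatingMap.add_apply, ContinuousAlternatingMap.smul_apply, smul_eq_mul]
  ring

/-- A form of type `(p, q)` with `q = 1` is determined by its contractions with
`(0,1)`-vectors. -/
lemma HasWeight.eq_zero_of_clin_three (hJ : ∀ v, J (J v) = -v) {φ : V [⋀^Fin 3]→L[ℝ] ℂ}
    (h : HasWeight J 1 φ) (hc : CLin J φ) : φ = 0 := by
  refine h.eq_zero_of_ne (Real.pi / 2) (hc.hasWeight hJ) ?_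
  rw [exp_weight_half_pi, exp_weight_half_pi, one_mul, Complex.exp_nat_mul,
    Complex.exp_pi_div_two_mul_I]
  intro h
  have : Complex.I = -Complex.I := by
    conv_lhs => rw [h]
    rw [pow_succ, Complex.I_sq]; ring
  have h2 := congrArg Complex.im this
  norm_num at h2

lemma HasWeight.eq_zero_of_clin_four (hJ : ∀ v, J (J v) = -v) {φ : V [⋀^Fin 4]→L[ℝ] ℂ}
    (h : HasWeight J 0 φ) (hc : CLin J φ) : φ = 0 := by
  refine h.eq_zero_of_ne (Real.pi / 4) (hc.hasWeight hJ) ?_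
  have h4 : Complex.I * (((3 + 1 : ℕ) : ℂ) * ((Real.pi / 4 : ℝ) : ℂ)) = Real.pi * Complex.I := by
    push_cast; ring
  rw [h4, Complex.exp_pi_mul_I]
  norm_num

end Insertion

section Normal

variable {V : Type*} [NormedAddCommGroup V] [NormedSpace ℝ V] {J : V →L[ℝ] V} {α : V →L[ℝ] ℝ}

/-- The complex-linear covector `α - i α ∘ J` with real part `α`. -/
def dzOf (J : V →L[ℝ] V) (α : V →L[ℝ] ℝ) : V →L[ℝ] ℂ :=
  Complex.ofRealCLM ∘L α - Complex.I • (Complex.ofRealCLM ∘L α ∘L J)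

lemma dzOf_apply (v : V) : dzOf J α v = (α v : ℂ) - Complex.I * α (J v) := rfl

/-- The conjugate covector. -/
def dzbarOf (J : V →L[ℝ] V) (α : V →L[ℝ] ℝ) : V →L[ℝ] ℂ :=
  (Complex.conjCLE : ℂ →L[ℝ] ℂ) ∘L dzOf J α

lemma dzbarOf_apply (v : V) : dzbarOf J α v = (α v : ℂ) + Complex.I * α (J v) := by
  change (starRingEnd ℂ) ((α v : ℂ) - Complex.I * α (J v)) = _
  simp

lemma dzOf_J (hJ : ∀ v, J (J v) = -v) (v : V) :
    dzOf J α (J v) = (1 : ℤ) * Complex.I * dzOf J α v := by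
  rw [dzOf_apply, dzOf_apply, hJ, map_neg]
  push_cast
  linear_combination (α (J v) : ℂ) * Complex.I_sq

lemma dzbarOf_J (hJ : ∀ v, J (J v) = -v) (v : V) :
    dzbarOf J α (J v) = (-1 : ℤ) * Complex.I * dzbarOf J α v := by
  rw [dzbarOf_apply, dzbarOf_apply, hJ, map_neg]
  push_cast
  linear_combination (α (J v) : ℂ) * Complex.I_sq

/-- `v` decomposes as a complex multiple of `n` and a vector annihilated by `dz`. -/
lemma exists_decomp (hJ : ∀ v, J (J v) = -v) {n : V} (hn : α n = 1) (hn' : α (J n) = 0) (v : V) :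
    ∃ h : V, α h = 0 ∧ α (J h) = 0 ∧ v = h + (α v • n + (-α (J v)) • J n) := by
  refine ⟨v - (α v • n + (-α (J v)) • J n), ?_, ?_, by abel⟩
  · simp [hn, hn']
  · simp [hn, hn', hJ]

lemma ins01_decomp (hJ : ∀ v, J (J v) = -v) {n : V} (hn : α n = 1) (hn' : α (J n) = 0) (v : V)
    {k : ℕ} (φ : V [⋀^Fin (k + 1)]→L[ℝ] ℂ) : ∃ h : V, α h = 0 ∧ α (J h) = 0 ∧
      ins01 J φ v = ins01 J φ h + dzbarOf J α v • ins01 J φ n := by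
  obtain ⟨h, h1, h2, h3⟩ := exists_decomp hJ hn hn' v
  refine ⟨h, h1, h2, ?_⟩
  conv_lhs => rw [h3]
  rw [ins01_add_vec, ins01_add_vec, ins01_smul_vec, ins01_smul_vec, ins01_J hJ, dzbarOf_apply]
  ext w
  simp only [ContinuousAlternatingMap.add_apply, ContinuousAlternatingMap.smul_apply, smul_eq_mul]
  push_cast
  ring

/-- A form of type `(2,1)` all of whose contractions with `(0,1)`-vectors of the boundary vanish
is divisible by `dz̄`. -/
lemma exists_normal_three (hJ : ∀ v, J (J v) = -v) {n : V} (hn : α n = 1) (hn' : α (J n) = 0)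
    {φ : V [⋀^Fin 3]→L[ℝ] ℂ} (hφ : HasWeight J 1 φ)
    (h : ∀ u, α u = 0 → α (J u) = 0 → ins01 J φ u = 0) :
    ∃ μ : V [⋀^Fin 2]→L[ℝ] ℂ, HasWeight J 2 μ ∧ φ = wedge (dzbarOf J α) μ := by
  have hμ : HasWeight J 2 ((2⁻¹ : ℂ) • ins01 J φ n) := by
    have := (hφ.ins01 hJ n).smul 2⁻¹
    rwa [show (1 : ℂ) + 1 = 2 by norm_num] at this
  refine ⟨(2⁻¹ : ℂ) • ins01 J φ n, hμ, ?_⟩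
  rw [← sub_eq_zero]
  have hw := HasWeight.wedge (Or.inr rfl) (dzbarOf_J (α := α) hJ) hμ
  have hw' : HasWeight J 1 (wedge (dzbarOf J α) ((2⁻¹ : ℂ) • ins01 J φ n)) := by
    rwa [show (2 : ℂ) + ((-1 : ℤ) : ℂ) = 1 by push_cast; norm_num] at hw
  refine (hφ.sub hw').eq_zero_of_clin_three hJ (clin_iff.2 fun u => ?_)
  rw [ins01_sub, ins01_wedge, clin_iff.1 (hμ.clin_two hJ) u, dzbarOf_J hJ]
  obtain ⟨h', h1, h2, h3⟩ := ins01_decomp hJ hn hn' u φ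
  rw [h3, h h' h1 h2]
  ext w
  rw [wedge_zero]
  simp only [ContinuousAlternatingMap.add_apply, ContinuousAlternatingMap.sub_apply,
    ContinuousAlternatingMap.smul_apply, smul_eq_mul, ContinuousAlternatingMap.coe_zero,
    Pi.zero_apply]
  push_cast
  linear_combination (1 / 2) * dzbarOf J α u * ins01 J φ n w * Complex.I_sq

lemma ins01_ins01_comm {k : ℕ} (φ : V [⋀^Fin (k + 2)]→L[ℝ] ℂ) (u v : V) :
    ins01 J (ins01 J φ u) v = -ins01 J (ins01 J φ v) u := by
  ext w
  simp only [ins01_apply, ContinuousAlternatingMap.neg_apply]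
  rw [form_swap₀ φ v u, form_swap₀ φ (J v) u, form_swap₀ φ v (J u), form_swap₀ φ (J v) (J u)]
  ring

/-- A form of type `(2,2)` all of whose double contractions with `(0,1)`-vectors of the boundary
vanish is divisible by `dz̄`. -/
lemma exists_normal_four (hJ : ∀ v, J (J v) = -v) {n : V} (hn : α n = 1) (hn' : α (J n) = 0)
    {φ : V [⋀^Fin 4]→L[ℝ] ℂ} (hφ : HasWeight J 0 φ)
    (h : ∀ u v, α u = 0 → α (J u) = 0 → α v = 0 → α (J v) = 0 →
      ins01 J (ins01 J φ u) v = 0) :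
    ∃ μ : V [⋀^Fin 3]→L[ℝ] ℂ, HasWeight J 1 μ ∧ φ = wedge (dzbarOf J α) μ := by
  -- the factor `1/2` is there because `dz̄` takes the value `2` on `n + iJn`
  have hμ : HasWeight J 1 ((2⁻¹ : ℂ) • ins01 J φ n) := by
    have := (hφ.ins01 hJ n).smul 2⁻¹
    rwa [zero_add] at this
  refine ⟨(2⁻¹ : ℂ) • ins01 J φ n, hμ, ?_⟩
  rw [← sub_eq_zero]
  have hw := HasWeight.wedge (Or.inr rfl) (dzbarOf_J (α := α) hJ) hμ
  have hw' : HasWeight J 0 (wedge (dzbarOf J α) ((2⁻¹ : ℂ) • ins01 J φ n)) := by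
    rwa [show (1 : ℂ) + ((-1 : ℤ) : ℂ) = 0 by push_cast; norm_num] at hw
  have hψ := hφ.sub hw'
  refine hψ.eq_zero_of_clin_four hJ (clin_iff.2 fun u => ?_)
  have hψu : HasWeight J 1 (ins01 J (φ - wedge (dzbarOf J α) ((2⁻¹ : ℂ) • ins01 J φ n)) u) := by
    have := hψ.ins01 hJ u
    rwa [zero_add] at this
  refine hψu.eq_zero_of_clin_three hJ (clin_iff.2 fun v => ?_)
  have hμ2 : ins01 J (ins01 J ((2⁻¹ : ℂ) • ins01 J φ n) u) v = 0 := by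
    have h2 : HasWeight J 2 (ins01 J ((2⁻¹ : ℂ) • ins01 J φ n) u) := by
      have := hμ.ins01 hJ u
      rwa [show (1 : ℂ) + 1 = 2 by norm_num] at this
    exact clin_iff.1 (h2.clin_two hJ) v
  rw [ins01_sub, ins01_wedge, ins01_sub, ins01_sub, ins01_smul, ins01_wedge, hμ2, wedge_zero,
    dzbarOf_J hJ, dzbarOf_J hJ, ins01_smul, ins01_smul]
  -- the antilinear antisymmetric expression `G(u, v)` is determined by its values `G(n, ·)`
  have hG : ins01 J (ins01 J φ u) v = dzbarOf J α u • ins01 J (ins01 J φ n) v -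
      dzbarOf J α v • ins01 J (ins01 J φ n) u := by
    obtain ⟨a, a1, a2, a3⟩ := ins01_decomp hJ hn hn' u φ
    obtain ⟨b, b1, b2, b3⟩ := ins01_decomp hJ hn hn' v (ins01 J φ a)
    have hnn : ins01 J (ins01 J φ n) n = 0 := by
      ext w
      have h1 := congrArg (fun ψ => ψ w) (ins01_ins01_comm (J := J) φ n n)
      change ins01 J (ins01 J φ n) n w = 0
      change ins01 J (ins01 J φ n) n w = -ins01 J (ins01 J φ n) n w at h1
      linear_combination (1 / 2) * h1
    rw [ins01_ins01_comm φ n u, a3, ins01_add, ins01_add, ins01_smul, ins01_smul, b3,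
      h a b a1 a2 b1 b2, hnn]
    ext w
    simp only [ContinuousAlternatingMap.add_apply, ContinuousAlternatingMap.sub_apply,
      ContinuousAlternatingMap.smul_apply, smul_eq_mul, ContinuousAlternatingMap.coe_zero,
      Pi.zero_apply, ContinuousAlternatingMap.neg_apply]
    ring
  rw [hG]
  ext w
  simp only [ContinuousAlternatingMap.sub_apply,
    ContinuousAlternatingMap.smul_apply, smul_eq_mul, ContinuousAlternatingMap.coe_zero,
    Pi.zero_apply]
  push_cast
  linear_combination (1 / 2) * (dzbarOf J α u * ins01 J (ins01 J φ n) v w -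
    dzbarOf J α v * ins01 J (ins01 J φ n) u w) * Complex.I_sq

end Normal

/-! ### Types and the exterior derivative -/

section Flat

variable {E : Type*} [NormedAddCommGroup E] [NormedSpace ℝ E]

lemma HasWeight.comp {V W : Type*} [NormedAddCommGroup V] [NormedSpace ℝ V]
    [NormedAddCommGroup W] [NormedSpace ℝ W] {J : V →L[ℝ] V} {J' : W →L[ℝ] W} {D : W →L[ℝ] V}
    (h : ∀ w, J (D w) = D (J' w)) {m : ℂ} {k : ℕ} {φ : V [⋀^Fin k]→L[ℝ] ℂ}
    (hφ : HasWeight J m φ) : HasWeight J' m (φ.compContinuousLinearMap D) := by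
  refine hasWeight_of_apply fun t v => ?_
  have := hφ.apply t (fun i => D (v i))
  simp only [rot_comp h] at this
  exact this

/-- Differentiating the defining equation of the weight spaces, for a variable endomorphism
field. -/
lemma fderivWithin_hasWeight {s : Set E} {x : E} (hs : UniqueDiffWithinAt ℝ s x) (hx : x ∈ s)
    {A : E → E →L[ℝ] E} {k : ℕ} {φ : E → E [⋀^Fin k]→L[ℝ] ℂ} {m : ℂ}
    (hA : DifferentiableWithinAt ℝ A s x) (hφ : DifferentiableWithinAt ℝ φ s x)
    (hw : ∀ᶠ p in nhdsWithin x s, HasWeight (A p) m (φ p)) (t : ℝ) (a : E) (w : Fin k → E) :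
    fderivWithin ℝ φ s x a (fun i => rot (A x) t (w i)) +
      Real.sin t * (φ x).fderivCompContinuousLinearMap (rot (A x) t) (fderivWithin ℝ A s x a) w =
    Complex.exp (Complex.I * (m * (t : ℂ))) * fderivWithin ℝ φ s x a w := by
  have hR : DifferentiableWithinAt ℝ (fun p => rot (A p) t) s x :=
    DifferentiableWithinAt.add (differentiableWithinAt_const _)
      (DifferentiableWithinAt.fun_const_smul hA (Real.sin t))
  have hR' : fderivWithin ℝ (fun p => rot (A p) t) s x = Real.sin t • fderivWithin ℝ A s x := by
    simp only [rot]
    rw [fderivWithin_const_add]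
    exact (hA.hasFDerivWithinAt.const_smul (Real.sin t)).fderivWithin hs
  have h1 := fderivWithin_continuousAlternatingMapCompContinuousLinearMap hφ hR hs
  have h2 : fderivWithin ℝ (fun p => (φ p).compContinuousLinearMap (rot (A p) t)) s x =
      fderivWithin ℝ (fun p => Complex.exp (Complex.I * (m * (t : ℂ))) • φ p) s x :=
    Filter.EventuallyEq.fderivWithin_eq_of_mem (hw.mono fun p hp => hp t) hx
  have h4 : fderivWithin ℝ (fun p => Complex.exp (Complex.I * (m * (t : ℂ))) • φ p) s x =
      Complex.exp (Complex.I * (m * (t : ℂ))) • fderivWithin ℝ φ s x :=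
    (hφ.hasFDerivWithinAt.const_smul (Complex.exp (Complex.I * (m * (t : ℂ))))).fderivWithin hs
  rw [h2, h4, hR'] at h1
  have h3 := congrArg (fun L : E →L[ℝ] E [⋀^Fin k]→L[ℝ] ℂ => L a w) h1
  change Complex.exp (Complex.I * (m * (t : ℂ))) * fderivWithin ℝ φ s x a w =
    fderivWithin ℝ φ s x a (fun i => rot (A x) t (w i)) +
      (φ x).fderivCompContinuousLinearMap (rot (A x) t) (Real.sin t • fderivWithin ℝ A s x a) w
    at h3
  rw [map_smul] at h3
  rw [h3]
  rfl

/-- If the Nijenhuis tensor of `A` vanishes at `x`, the exterior derivative at `x` of a form of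
weight `m` is the sum of forms of weights `m + 1` and `m - 1`. -/
lemma exists_weight_decomp_extDerivWithin {s : Set E} {x : E} (hs : UniqueDiffWithinAt ℝ s x)
    (hx : x ∈ s) {A : E → E →L[ℝ] E} {k : ℕ} {φ : E → E [⋀^Fin k]→L[ℝ] ℂ} {m : ℂ}
    (hA : DifferentiableWithinAt ℝ A s x) (hφ : DifferentiableWithinAt ℝ φ s x)
    (hw : ∀ᶠ p in nhdsWithin x s, HasWeight (A p) m (φ p))
    (hJ : ∀ v, A x (A x v) = -v)
    (hN : ∀ u v, fderivWithin ℝ A s x (A x u) v - fderivWithin ℝ A s x (A x v) u =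
      A x (fderivWithin ℝ A s x u v) - A x (fderivWithin ℝ A s x v u)) :
    ∃ a b, extDerivWithin φ s x = a + b ∧ HasWeight (A x) (m + 1) a ∧
      HasWeight (A x) (m - 1) b := by
  set K := fderivWithin ℝ A s x with hK
  set D := fderivWithin ℝ φ s x with hD
  have hdiff := fderivWithin_hasWeight hs hx hA hφ hw
  have hw0 : HasWeight (A x) m (φ x) := hw.self_of_nhdsWithin hx
  rw [← hK, ← hD] at hdiff
  refine exists_weight_decomp (X := ContinuousAlternatingMap.alternatizeUncurryFin (D ∘L A x) -
    ContinuousAlternatingMap.alternatizeUncurryFin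
      ((φ x).fderivCompContinuousLinearMap (ContinuousLinearMap.id ℝ E) ∘L K)) hJ fun t => ?_
  set c := Complex.exp (Complex.I * (m * (t : ℂ)))
  set R := rot (A x) t with hR
  -- the part of `K (R u) v` which does not come from `R (K u v)` is symmetric
  have hsymm : ∀ u v, (K ∘L R - (ContinuousLinearMap.compL ℝ E E E R) ∘L K) u v =
      (K ∘L R - (ContinuousLinearMap.compL ℝ E E E R) ∘L K) v u := by
    intro u v
    have h := hN u v
    simp only [hR, rot, sub_apply, add_apply, smul_apply, ContinuousLinearMap.comp_apply,
      ContinuousLinearMap.compL_apply, ContinuousLinearMap.id_apply, map_add, map_smul]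
    linear_combination (norm := module) Real.sin t • h
  have hkill := ContinuousAlternatingMap.alternatizeUncurryFin_fderivCompContinuousLinearMap_eq_zero
    (φ x) R hsymm
  -- as `φ x` has weight `m`, rotating all of its arguments costs the factor `c`
  have hRK : ∀ (a : E) (w : Fin k → E),
      (φ x).fderivCompContinuousLinearMap R (R ∘L K a) w =
        c * (φ x).fderivCompContinuousLinearMap (ContinuousLinearMap.id ℝ E) (K a) w := by
    intro a w
    rw [ContinuousAlternatingMap.fderivCompContinuousLinearMap_apply,
      ContinuousAlternatingMap.fderivCompContinuousLinearMap_apply, Finset.mul_sum]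
    refine Finset.sum_congr rfl fun i _ => ?_
    rw [← hw0.apply t]
    congr 1
    funext j
    by_cases hj : j = i
    · subst hj; simp [hR]
    · simp [Function.update_of_ne hj, hR]
  ext v
  have h1 := congrArg (fun ψ : E [⋀^Fin (k + 1)]→L[ℝ] ℂ => ψ v) hkill
  simp only [ContinuousAlternatingMap.alternatizeUncurryFin_apply, ContinuousLinearMap.comp_sub,
    sub_apply, ContinuousAlternatingMap.sub_apply, ContinuousLinearMap.comp_apply,
    ContinuousLinearMap.compL_apply, hRK, smul_sub, Finset.sum_sub_distrib,
    ContinuousAlternatingMap.coe_zero, Pi.zero_apply] at h1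
  simp only [ContinuousAlternatingMap.compContinuousLinearMap_apply,
    ContinuousAlternatingMap.smul_apply, ContinuousAlternatingMap.add_apply,
    ContinuousAlternatingMap.sub_apply, extDerivWithin,
    ContinuousAlternatingMap.alternatizeUncurryFin_apply, ContinuousLinearMap.comp_apply,
    smul_eq_mul]
  rw [← hD]
  have h2 : ∀ i : Fin (k + 1), D ((R ∘ v) i) (i.removeNth (R ∘ v)) =
      c * (Real.cos t * D (v i) (i.removeNth v) + Real.sin t * D (A x (v i)) (i.removeNth v)) -
      Real.sin t * (φ x).fderivCompContinuousLinearMap R (K (R (v i))) (i.removeNth v) := by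
    intro i
    have h3 := hdiff t (R (v i)) (i.removeNth v)
    have h4 : D (R (v i)) (i.removeNth v) =
        Real.cos t * D (v i) (i.removeNth v) + Real.sin t * D (A x (v i)) (i.removeNth v) := by
      simp only [hR, rot, add_apply, smul_apply, ContinuousLinearMap.id_apply, map_add, map_smul,
        ContinuousAlternatingMap.add_apply, ContinuousAlternatingMap.smul_apply,
        Complex.real_smul]
    rw [← h4, ← h3]
    change D (R (v i)) (fun j => R (i.removeNth v j)) = _
    ring
  have h5 : ∑ i : Fin (k + 1), (-1 : ℤ) ^ (i : ℕ) • D ((R ∘ v) i) (i.removeNth (R ∘ v)) =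
      c * (Real.cos t * ∑ i : Fin (k + 1), (-1 : ℤ) ^ (i : ℕ) • D (v i) (i.removeNth v) +
        Real.sin t * ∑ i : Fin (k + 1), (-1 : ℤ) ^ (i : ℕ) • D (A x (v i)) (i.removeNth v)) -
      Real.sin t * ∑ i : Fin (k + 1), (-1 : ℤ) ^ (i : ℕ) •
        (φ x).fderivCompContinuousLinearMap R (K (R (v i))) (i.removeNth v) := by
    simp only [Finset.mul_sum, ← Finset.sum_add_distrib, ← Finset.sum_sub_distrib]
    refine Finset.sum_congr rfl fun i _ => ?_
    rw [h2]
    simp only [zsmul_eq_mul]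
    ring
  have h6 : ∑ i : Fin (k + 1), (-1 : ℤ) ^ (i : ℕ) • (c *
      (φ x).fderivCompContinuousLinearMap (ContinuousLinearMap.id ℝ E) (K (v i)) (i.removeNth v)) =
      c * ∑ i : Fin (k + 1), (-1 : ℤ) ^ (i : ℕ) •
      (φ x).fderivCompContinuousLinearMap (ContinuousLinearMap.id ℝ E) (K (v i))
        (i.removeNth v) := by
    rw [Finset.mul_sum]
    exact Finset.sum_congr rfl fun i _ => by simp only [zsmul_eq_mul]; ring
  rw [h6] at h1
  refine h5.trans ?_
  linear_combination (-(Real.sin t : ℂ)) * h1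

lemma sum_four {M : Type*} [AddCommGroup M] (f : Fin 4 → M) :
    ∑ i : Fin 4, (-1 : ℤ) ^ (i : ℕ) • f i = f 0 - f 1 + f 2 - f 3 := by
  simp [Fin.sum_univ_four]
  abel

lemma extDerivWithin_three {s : Set E} {x : E} {F : Type*} [NormedAddCommGroup F]
    [NormedSpace ℝ F] (φ : E → E [⋀^Fin 3]→L[ℝ] F) (a b c d : E) :
    extDerivWithin φ s x ![a, b, c, d] =
      fderivWithin ℝ φ s x a ![b, c, d] - fderivWithin ℝ φ s x b ![a, c, d] +
      fderivWithin ℝ φ s x c ![a, b, d] - fderivWithin ℝ φ s x d ![a, b, c] := by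
  rw [extDerivWithin, ContinuousAlternatingMap.alternatizeUncurryFin_apply, sum_four]
  have h0 : (0 : Fin 4).removeNth ![a, b, c, d] = ![b, c, d] := by
    ext i; fin_cases i <;> rfl
  have h1 : (1 : Fin 4).removeNth ![a, b, c, d] = ![a, c, d] := by
    ext i; fin_cases i <;> rfl
  have h2 : (2 : Fin 4).removeNth ![a, b, c, d] = ![a, b, d] := by
    ext i; fin_cases i <;> rfl
  have h3 : (3 : Fin 4).removeNth ![a, b, c, d] = ![a, b, c] := by
    ext i; fin_cases i <;> rfl
  rw [h0, h1, h2, h3]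
  rfl

/-- The vanishing of the Nijenhuis tensor: the `(2,2)`-part of `dΦ` is the contraction of `Φ` with
the Nijenhuis tensor. -/
lemma nijenhuis_eq_zero {s : Set E} {x : E} (hs : UniqueDiffWithinAt ℝ s x)
    (hx : x ∈ s) {A : E → E →L[ℝ] E} {Φ : E → E [⋀^Fin 3]→L[ℝ] ℂ}
    (hA : DifferentiableWithinAt ℝ A s x) (hΦ : DifferentiableWithinAt ℝ Φ s x)
    (hc : ∀ᶠ p in nhdsWithin x s, CLin (A p) (Φ p))
    (hJ : ∀ v, A x (A x v) = -v) (hV : Module.finrank ℝ E = 6) (hΦ0 : Φ x ≠ 0)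
    (hd : extDerivWithin Φ s x = 0) (u v : E) :
    fderivWithin ℝ A s x (A x u) v - fderivWithin ℝ A s x (A x v) u =
      A x (fderivWithin ℝ A s x u v) - A x (fderivWithin ℝ A s x v u) := by
  have hc0 : CLin (A x) (Φ x) := hc.self_of_nhdsWithin hx
  set K := fderivWithin ℝ A s x with hK
  set D := fderivWithin ℝ Φ s x with hD
  set J := A x with hJdef
  have hcl : ∀ u c d, Φ x ![J u, c, d] = Complex.I * Φ x ![u, c, d] := fun u c d => hc0 u ![c, d]
  -- differentiate the complex linearity of `Φ` in its first slot
  have h0 : ∀ a b c d, D a ![J b, c, d] + Φ x ![K a b, c, d] = Complex.I * D a ![b, c, d] := by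
    intro a b c d
    let L : E →L[ℝ] (E [⋀^Fin 3]→L[ℝ] ℂ) →L[ℝ] ℂ :=
      LinearMap.mkContinuousOfExistsBound₂
        (LinearMap.mk₂ ℝ (fun (e : E) (ψ : E [⋀^Fin 3]→L[ℝ] ℂ) => ψ ![e, c, d])
          (fun _ _ _ => form_add₀ _ _ _ _) (fun _ _ _ => form_smul₀ _ _ _ _)
          (fun _ _ _ => rfl) (fun _ _ _ => rfl))
        ⟨‖c‖ * ‖d‖, fun e ψ => by
          refine (ψ.le_opNorm _).trans (le_of_eq ?_)
          simp [Fin.prod_univ_three]; ring⟩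
    have e1 : HasFDerivWithinAt (fun p => L (A p b) (Φ p))
        (L.precompR _ (A x b) D + L.precompL _ (K.flip b) (Φ x)) s x := by
      have := L.hasFDerivWithinAt_of_bilinear
        ((hA.hasFDerivWithinAt).clm_apply (hasFDerivWithinAt_const b x s)) hΦ.hasFDerivWithinAt
      rwa [ContinuousLinearMap.comp_zero, zero_add] at this
    have e2 : HasFDerivWithinAt (fun p => Complex.I * L b (Φ p)) (Complex.I • (L b ∘L D)) s x :=
      ((L b).hasFDerivWithinAt (s := univ) (x := Φ x) |>.comp x hΦ.hasFDerivWithinAt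
        (mapsTo_univ _ _)).const_smul Complex.I
    have e3 := HasFDerivWithinAt.congr_of_eventuallyEq e1 (f₁ := fun p => Complex.I * L b (Φ p))
      (hc.mono fun p hp => (hp b ![c, d]).symm) (hc0 b ![c, d]).symm
    have e4 := congrArg (fun T : E →L[ℝ] ℂ => T a) (hs.eq e3 e2)
    exact e4
  have s1 : ∀ a b c d, D a ![b, J c, d] + Φ x ![b, K a c, d] = Complex.I * D a ![b, c, d] := by
    intro a b c d
    rw [form_swap₀ (D a) (J c) b, form_swap₀ (Φ x) (K a c) b, form_swap₀ (D a) c b]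
    linear_combination -h0 a c b d
  -- in this combination of the values of `dΦ` on `(u, v)`, `(Ju, v)`, `(u, Jv)`, `(Ju, Jv)` all
  -- derivatives of `Φ` cancel, and only derivatives of `J` remain
  have key : ∀ c d, Φ x ![K u v + J (K (J u) v) - K v u - J (K (J v) u), c, d] = 0 := by
    intro c d
    have hdd : ∀ a b c d, D a ![b, c, d] - D b ![a, c, d] + D c ![a, b, d] - D d ![a, b, c] = 0 := by
      intro a b c d
      rw [← extDerivWithin_three, hd]; rfl
    have q1 := hdd u v c d
    have q2 := hdd (J u) v c d
    have q3 := hdd u (J v) c d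
    have q4 := hdd (J u) (J v) c d
    have r1 := h0 (J u) v c d
    have r2 := h0 (J v) u c d
    have r3 := h0 u v c d
    have r4 := h0 v u c d
    have t : ∀ e f, D e ![u, v, f] + Complex.I * D e ![J u, v, f] + Complex.I * D e ![u, J v, f] -
        D e ![J u, J v, f] = 0 := by
      intro e f
      have a1 := h0 e u v f
      have a2 := h0 e u (J v) f
      have a3 := s1 e u v f
      have a5 : Φ x ![K e u, J v, f] = Complex.I * Φ x ![K e u, v, f] := by
        rw [form_swap₀, hcl, form_swap₀]; ring
      rw [a5] at a2
      linear_combination Complex.I * a1 - a2 + D e ![u, v, f] * Complex.I_sq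
    have t1 := t c d
    have t2 := t d c
    rw [form_sub₀, form_sub₀, form_add₀, hcl, hcl]
    linear_combination Complex.I * q1 - q2 - q3 - Complex.I * q4 +
      r3 - r4 + Complex.I * r1 - Complex.I * r2 - Complex.I * t1 + Complex.I * t2 +
      (D (J u) ![v, c, d] + D c ![J u, v, d] - D d ![J u, v, c] - D (J v) ![u, c, d] +
        D c ![u, J v, d] - D d ![u, J v, c]) * Complex.I_sq
  obtain ⟨w, _, huniq⟩ := CLin.existsUnique_contraction hc0 hΦ0
    (ν := (0 : E [⋀^Fin 2]→L[ℝ] ℂ)) (fun _ _ => by change (0 : ℂ) = _ * 0; simp) hJ hV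
  have e1 := huniq _ key
  have e2 := huniq 0 (fun c d => by
    have := form_smul₀ (Φ x) 0 (0 : E) ![c, d]
    rw [zero_smul, zero_smul] at this
    exact this)
  have e3 := e1.trans e2.symm
  have e4 := congrArg J e3
  simp only [map_sub, map_add, hJ, map_zero] at e4
  linear_combination (norm := module) -e4

end Flat

section Manifold

variable {E : Type*} [NormedAddCommGroup E] [NormedSpace ℝ E]
  {H : Type*} [TopologicalSpace H] {I : ModelWithCorners ℝ E H}
  {X : Type*} [TopologicalSpace X] [ChartedSpace H X]

/-- The value of a field of endomorphisms, as an endomorphism of the model space. -/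
def endVal (A : ∀ x : X, TangentSpace I x →L[ℝ] TangentSpace I x) (x : X) : E →L[ℝ] E := A x

/-- The coordinate expression of a field of endomorphisms in the preferred chart at `x₀`. -/
def endRep (A : ∀ x : X, TangentSpace I x →L[ℝ] TangentSpace I x) (x₀ : X) (p : E) : E →L[ℝ] E :=
  dChart I x₀ ((extChartAt I x₀).symm p) ∘L endVal A ((extChartAt I x₀).symm p) ∘L
    dChartSymm I x₀ p

variable {A : ∀ x : X, TangentSpace I x →L[ℝ] TangentSpace I x}

lemma IsSmoothEnd.contDiffWithinAt (hA : IsSmoothEnd A) {x₀ : X} {p : E}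
    (hp : p ∈ (extChartAt I x₀).target) : ContDiffWithinAt ℝ ∞ (endRep A x₀) (range I) p :=
  (hA x₀ p hp).mono_of_mem_nhdsWithin (extChartAt_target_mem_nhdsWithin_of_mem hp)

lemma eventually_mem_target {x₀ : X} {p : E} (hp : p ∈ (extChartAt I x₀).target) :
    ∀ᶠ q in nhdsWithin p (range I), q ∈ (extChartAt I x₀).target :=
  extChartAt_target_mem_nhdsWithin_of_mem hp

variable [IsManifold I ∞ X]

lemma endRep_comm {x₀ : X} {p : E} (hp : p ∈ (extChartAt I x₀).target) (w : E) :
    endVal A ((extChartAt I x₀).symm p) (dChartSymm I x₀ p w) = dChartSymm I x₀ p (endRep A x₀ p w) :=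
  (DFunLike.congr_fun (dChartSymm_comp_dChart hp) _).symm

lemma endRep_sq (hJ : ∀ x v, endVal A x (endVal A x v) = -v) {x₀ : X} {p : E}
    (hp : p ∈ (extChartAt I x₀).target) (v : E) : endRep A x₀ p (endRep A x₀ p v) = -v := by
  have h1 : endRep A x₀ p (endRep A x₀ p v) = dChart I x₀ ((extChartAt I x₀).symm p)
      (endVal A ((extChartAt I x₀).symm p) (dChartSymm I x₀ p (endRep A x₀ p v))) := rfl
  rw [h1, ← endRep_comm hp]
  have h2 := hJ ((extChartAt I x₀).symm p) (dChartSymm I x₀ p v)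
  refine (congrArg (dChart I x₀ ((extChartAt I x₀).symm p)) h2).trans ?_
  have h3 := DFunLike.congr_fun (dChart_comp_dChartSymm hp) v
  refine (map_neg _ _).trans (congrArg Neg.neg h3)

lemma endRep_self (x : X) (v : E) : endRep A x (extChartAt I x x) v = endVal A x v := by
  have h1 : endRep A x (extChartAt I x x) v = dChart I x
    ((extChartAt I x).symm (extChartAt I x x)) (endVal A ((extChartAt I x).symm (extChartAt I x x))
      (dChartSymm I x (extChartAt I x x) v)) := rfl
  rw [h1, dChartSymm_self, extChartAt_to_inv, dChart_self]
  rfl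

lemma hasWeight_chartRep {k : ℕ} {m : ℂ} {φ : Form I X ℂ k}
    (h : ∀ x, HasWeight (endVal A x) m (φ.val x)) {x₀ : X} {p : E}
    (hp : p ∈ (extChartAt I x₀).target) : HasWeight (endRep A x₀ p) m (chartRep x₀ φ p) :=
  HasWeight.comp (fun w => endRep_comm hp w) (h ((extChartAt I x₀).symm p))

end Manifold

section CY

variable {Z : Type*} [TopologicalSpace Z] [ChartedSpace (EuclideanHalfSpace 6) Z]
  [IsManifold (𝓡∂ 6) ∞ Z] (C : CalabiYau Z)

/-- The complex structure at `x`, as an endomorphism of the model space. -/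
def CalabiYau.Jv (x : Z) : EuclideanSpace ℝ (Fin 6) →L[ℝ] EuclideanSpace ℝ (Fin 6) :=
  endVal C.J x

lemma CalabiYau.Jv_sq (x : Z) (v : EuclideanSpace ℝ (Fin 6)) : C.Jv x (C.Jv x v) = -v :=
  C.J_sq x v

lemma finrank_model : Module.finrank ℝ (EuclideanSpace ℝ (Fin 6)) = 6 := by simp

lemma CalabiYau.Φ_weight (x : Z) : HasWeight (C.Jv x) 3 (C.Φ.val x) := by
  have h := (C.Φ_type x).2
  have h3 : (((3 : ℕ) : ℂ) - ((0 : ℕ) : ℂ)) = 3 := by norm_num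
  rw [h3] at h
  exact h

lemma CalabiYau.Φ_clin (x : Z) : CLin (C.Jv x) (C.Φ.val x) :=
  (C.Φ_weight x).clin_three (C.Jv_sq x)

/-- The exterior derivative of a form of weight `m` has components of weights `m + 1` and
`m - 1` only. -/
lemma CalabiYau.exists_weight_decomp_extD {k : ℕ} {m : ℂ} {φ : Form (𝓡∂ 6) Z ℂ k}
    (hφ : IsSmoothForm φ) (h : ∀ x, HasWeight (C.Jv x) m (φ.val x)) (x : Z) :
    ∃ a b, (extD φ).val x = a + b ∧ HasWeight (C.Jv x) (m + 1) a ∧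
      HasWeight (C.Jv x) (m - 1) b := by
  have hp := mem_extChartAt_target (I := 𝓡∂ 6) x
  have hpr := extChartAt_target_subset_range _ hp
  have hs : UniqueDiffWithinAt ℝ (range (𝓡∂ 6)) (extChartAt (𝓡∂ 6) x x) :=
    (𝓡∂ 6).uniqueDiffOn _ hpr
  have hself : endRep C.J x (extChartAt (𝓡∂ 6) x x) = C.Jv x := by
    ext1 v; exact endRep_self x v
  have hA : DifferentiableWithinAt ℝ (endRep C.J x) (range (𝓡∂ 6)) (extChartAt (𝓡∂ 6) x x) :=
    (C.J_smooth.contDiffWithinAt hp).differentiableWithinAt (by simp)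
  have hJ : ∀ v, endRep C.J x (extChartAt (𝓡∂ 6) x x) (endRep C.J x (extChartAt (𝓡∂ 6) x x) v)
      = -v := endRep_sq C.Jv_sq hp
  have hN := nijenhuis_eq_zero hs hpr hA
    ((C.Φ_smooth.contDiffWithinAt hp).differentiableWithinAt (by simp))
    ((eventually_mem_target hp).mono fun q hq =>
      (hasWeight_chartRep C.Φ_weight hq).clin_three (endRep_sq C.Jv_sq hq))
    hJ finrank_model
    (by rw [chartRep_self]; exact C.Φ_ne_zero x)
    (by rw [← extD_val, C.Φ_closed]; rfl)
  have := exists_weight_decomp_extDerivWithin hs hpr hA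
    ((hφ.contDiffWithinAt hp).differentiableWithinAt (by simp))
    ((eventually_mem_target hp).mono fun q hq => hasWeight_chartRep h hq) hJ hN
  rw [hself] at this
  rw [extD_val]
  exact this

end CY

/-! ### Operations on forms: functions, covectors, vector fields -/

section FormOps

variable {E : Type*} [NormedAddCommGroup E] [NormedSpace ℝ E]
  {H : Type*} [TopologicalSpace H] {I : ModelWithCorners ℝ E H}
  {X : Type*} [TopologicalSpace X] [ChartedSpace H X]
  {F F' : Type*} [NormedAddCommGroup F] [NormedSpace ℝ F] [NormedAddCommGroup F']
  [NormedSpace ℝ F']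

/-- The form with given values. -/
def Form.ofVal {k : ℕ} (φ : X → E [⋀^Fin k]→L[ℝ] F) : Form I X F k := φ

lemma Form.ext_val {k : ℕ} {φ ψ : Form I X F k} (h : ∀ x, φ.val x = ψ.val x) : φ = ψ :=
  funext h

lemma Form.val_add {k : ℕ} (φ ψ : Form I X F k) (x : X) : (φ + ψ).val x = φ.val x + ψ.val x := rfl

lemma Form.val_smul {k : ℕ} (c : ℝ) (φ : Form I X F k) (x : X) : (c • φ).val x = c • φ.val x := rfl

lemma Form.val_zero {k : ℕ} (x : X) : (0 : Form I X F k).val x = 0 := rfl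

lemma Form.val_sub {k : ℕ} (φ ψ : Form I X F k) (x : X) : (φ - ψ).val x = φ.val x - ψ.val x := rfl

lemma Form.val_neg {k : ℕ} (φ : Form I X F k) (x : X) : (-φ).val x = -φ.val x := rfl

lemma isSmoothForm_iff {k : ℕ} {φ : Form I X F k} : IsSmoothForm φ ↔
    ∀ (x₀ : X) (p : E), p ∈ (extChartAt I x₀).target →
      ContDiffWithinAt ℝ ∞ (chartRep x₀ φ) (range I) p :=
  ⟨fun h _ _ hp => h.contDiffWithinAt hp, fun h x₀ p hp =>
    (h x₀ p hp).mono (extChartAt_target_subset_range x₀)⟩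

lemma IsSmoothForm.add {k : ℕ} {φ ψ : Form I X F k} (h₁ : IsSmoothForm φ) (h₂ : IsSmoothForm ψ) :
    IsSmoothForm (φ + ψ) := (SmoothForm I X F k).add_mem h₁ h₂

lemma IsSmoothForm.sub {k : ℕ} {φ ψ : Form I X F k} (h₁ : IsSmoothForm φ) (h₂ : IsSmoothForm ψ) :
    IsSmoothForm (φ - ψ) := (SmoothForm I X F k).sub_mem h₁ h₂

lemma IsSmoothForm.smul {k : ℕ} {φ : Form I X F k} (c : ℝ) (h : IsSmoothForm φ) :
    IsSmoothForm (c • φ) := (SmoothForm I X F k).smul_mem c h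

lemma extD_add {k : ℕ} {φ ψ : Form I X F k} (h₁ : IsSmoothForm φ) (h₂ : IsSmoothForm ψ) :
    extD (φ + ψ) = extD φ + extD ψ := (extDₗ I X F k).map_add ⟨φ, h₁⟩ ⟨ψ, h₂⟩

lemma extD_sub {k : ℕ} {φ ψ : Form I X F k} (h₁ : IsSmoothForm φ) (h₂ : IsSmoothForm ψ) :
    extD (φ - ψ) = extD φ - extD ψ := (extDₗ I X F k).map_sub ⟨φ, h₁⟩ ⟨ψ, h₂⟩

lemma extD_smul {k : ℕ} {φ : Form I X F k} (c : ℝ) (h : IsSmoothForm φ) :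
    extD (c • φ) = c • extD φ := (extDₗ I X F k).map_smul c ⟨φ, h⟩

/-- The composition of a form with a linear map between coefficient spaces. -/
def Form.mapL {k : ℕ} (L : F →L[ℝ] F') (φ : Form I X F k) : Form I X F' k :=
  Form.ofVal fun x => L.compContinuousAlternatingMap (φ.val x)

lemma Form.mapL_val {k : ℕ} (L : F →L[ℝ] F') (φ : Form I X F k) (x : X) :
    (φ.mapL L).val x = L.compContinuousAlternatingMap (φ.val x) := rfl

lemma IsSmoothForm.mapL {k : ℕ} (L : F →L[ℝ] F') {φ : Form I X F k} (h : IsSmoothForm φ) :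
    IsSmoothForm (φ.mapL L) := fun x₀ =>
  (ContinuousLinearMap.compContinuousAlternatingMapCLM ℝ E F F' (ι := Fin k)
    L).contDiff.comp_contDiffOn (h x₀)

lemma extD_mapL [IsManifold I ∞ X] {k : ℕ} (L : F →L[ℝ] F') {φ : Form I X F k} (h : IsSmoothForm φ) :
    extD (φ.mapL L) = (extD φ).mapL L := by
  refine Form.ext_val fun x => ?_
  rw [extD_val, Form.mapL_val, extD_val]
  have hd := h.differentiableWithinAt x
  have h1 : fderivWithin ℝ (chartRep x (φ.mapL L)) (range I) (extChartAt I x x) =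
      (ContinuousLinearMap.compContinuousAlternatingMapCLM ℝ E F F' (ι := Fin k) L) ∘L
        fderivWithin ℝ (chartRep x φ) (range I) (extChartAt I x x) :=
    (((ContinuousLinearMap.compContinuousAlternatingMapCLM ℝ E F F' (ι := Fin k)
      L).hasFDerivAt).comp_hasFDerivWithinAt _ hd.hasFDerivWithinAt).fderivWithin
      (uniqueDiff_chart x)
  rw [extDerivWithin, extDerivWithin, h1]
  ext v
  simp [ContinuousAlternatingMap.alternatizeUncurryFin_apply]

/-! #### Covector fields -/

variable (I) in
/-- The coordinate expression of a field of covectors. -/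
def covRep (x₀ : X) (c : X → E →L[ℝ] F) (p : E) : E →L[ℝ] F :=
  c ((extChartAt I x₀).symm p) ∘L dChartSymm I x₀ p

variable (I) in
/-- Smoothness of a field of covectors, up to the boundary. -/
def IsSmoothCov (c : X → E →L[ℝ] F) : Prop :=
  ∀ (x₀ : X) (p : E), p ∈ (extChartAt I x₀).target →
    ContDiffWithinAt ℝ ∞ (covRep I x₀ c) (range I) p

variable (I) in
/-- The differential of a function with values in a vector space. -/
def dFun (f : X → F) (x : X) : E →L[ℝ] F := dMap I 𝓘(ℝ, F) f x

/-- A function is smooth if its coordinate expressions are. -/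
lemma contMDiff_of_chart {f : X → F}
    (h : ∀ x : X, ContDiffWithinAt ℝ ∞ (f ∘ (extChartAt I x).symm) (range I) (extChartAt I x x)) :
    ContMDiff I 𝓘(ℝ, F) ∞ f := by
  intro x
  have h1 : ContMDiffAt I 𝓘(ℝ, E) ∞ (extChartAt I x) x := contMDiffAt_extChartAt
  have h2 : ContMDiffWithinAt 𝓘(ℝ, E) 𝓘(ℝ, F) ∞ (f ∘ (extChartAt I x).symm) (range I)
      (extChartAt I x x) := (h x).contMDiffWithinAt
  have h3 := ContMDiffWithinAt.comp (t := range I) (s := univ) x h2 h1.contMDiffWithinAt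
    (fun y _ => by simp [extChartAt])
  rw [contMDiffWithinAt_univ] at h3
  refine h3.congr_of_eventuallyEq ?_
  filter_upwards [extChartAt_source_mem_nhds (I := I) x] with y hy
  simp only [Function.comp_apply, (extChartAt I x).left_inv hy]


section
variable [IsManifold I ∞ X]

lemma fderivWithin_comp_symm {f : X → F} (hf : MDifferentiable I 𝓘(ℝ, F) f) {x₀ : X} {p : E}
    (hp : p ∈ (extChartAt I x₀).target) :
    fderivWithin ℝ (f ∘ (extChartAt I x₀).symm) (range I) p = covRep I x₀ (dFun I f) p := by
  have h := fderivWithin_mapRep (x₀ := f ((extChartAt I x₀).symm p)) hf hp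
    (mem_extChartAt_source _)
  rw [dChart_self] at h
  exact h

lemma dFun_apply_self {f : X → F} (hf : MDifferentiable I 𝓘(ℝ, F) f) (x : X) :
    dFun I f x = fderivWithin ℝ (f ∘ (extChartAt I x).symm) (range I) (extChartAt I x x) := by
  rw [fderivWithin_comp_symm hf (mem_extChartAt_target x), covRep, dChartSymm_self,
    extChartAt_to_inv]
  rfl

lemma contDiffWithinAt_comp_symm {f : X → F} (hf : ContMDiff I 𝓘(ℝ, F) ∞ f) {x₀ : X} {p : E}
    (hp : p ∈ (extChartAt I x₀).target) :
    ContDiffWithinAt ℝ ∞ (f ∘ (extChartAt I x₀).symm) (range I) p :=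
  contDiffWithinAt_mapRep (x₀ := f ((extChartAt I x₀).symm p)) hf hp (mem_extChartAt_source _)

lemma isSmoothCov_dFun {f : X → F} (hf : ContMDiff I 𝓘(ℝ, F) ∞ f) : IsSmoothCov I (dFun I f) := by
  intro x₀ p hp
  have h1 : ContDiffWithinAt ℝ ∞ (fderivWithin ℝ (f ∘ (extChartAt I x₀).symm) (range I))
      (range I) p := (contDiffWithinAt_comp_symm hf hp).fderivWithin_right I.uniqueDiffOn
        (by simp) (extChartAt_target_subset_range _ hp)
  refine h1.congr_of_eventuallyEq ?_ ?_
  · filter_upwards [eventually_mem_target hp] with q hq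
    exact (fderivWithin_comp_symm (hf.mdifferentiable (by simp)) hq).symm
  · exact (fderivWithin_comp_symm (hf.mdifferentiable (by simp)) hp).symm

lemma IsSmoothCov.comp_end {c : X → E →L[ℝ] F} (hc : IsSmoothCov I c)
    {A : ∀ x : X, TangentSpace I x →L[ℝ] TangentSpace I x} (hA : IsSmoothEnd A) :
    IsSmoothCov I (fun x => c x ∘L endVal A x) := by
  intro x₀ p hp
  have h := (hc x₀ p hp).clm_comp (hA.contDiffWithinAt hp)
  have he : ∀ q ∈ (extChartAt I x₀).target, covRep I x₀ (fun x => c x ∘L endVal A x) q =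
      covRep I x₀ c q ∘L endRep A x₀ q := by
    intro q hq
    ext v
    change c _ (endVal A ((extChartAt I x₀).symm q) (dChartSymm I x₀ q v)) = _
    rw [endRep_comm hq]; rfl
  exact h.congr_of_eventuallyEq ((eventually_mem_target hp).mono he) (he p hp)

end

lemma IsSmoothCov.comp_left {c : X → E →L[ℝ] F} (hc : IsSmoothCov I c) (L : F →L[ℝ] F') :
    IsSmoothCov I (fun x => L ∘L c x) := fun x₀ p hp =>
  contDiffWithinAt_const.clm_comp (hc x₀ p hp)

lemma IsSmoothCov.add {c d : X → E →L[ℝ] F} (hc : IsSmoothCov I c) (hd : IsSmoothCov I d) :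
    IsSmoothCov I (fun x => c x + d x) := fun x₀ p hp => (hc x₀ p hp).add (hd x₀ p hp)

variable (I) in
/-- A field of covectors as a form of degree one. -/
def Form.ofCov (c : X → E →L[ℝ] F) : Form I X F 1 :=
  Form.ofVal fun x => ContinuousAlternatingMap.ofSubsingleton ℝ E F (0 : Fin 1) (c x)

lemma isSmoothForm_ofCov {c : X → E →L[ℝ] F} (hc : IsSmoothCov I c) :
    IsSmoothForm (Form.ofCov I c) := by
  rw [isSmoothForm_iff]
  intro x₀ p hp
  have h := (ContinuousAlternatingMap.ofSubsingletonLIE (𝕜 := ℝ) (E := E) (F := F)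
    (0 : Fin 1)).contDiff.comp_contDiffWithinAt (hc x₀ p hp)
  exact h

/-! #### Wedge products with covectors and multiplication by functions -/

variable {𝔽 : Type*} [NormedField 𝔽] [NormedAlgebra ℝ 𝔽]

/-- The wedge product of a field of covectors with a form. -/
def wedgeForm {k : ℕ} (c : X → E →L[ℝ] 𝔽) (φ : Form I X 𝔽 k) : Form I X 𝔽 (k + 1) :=
  Form.ofVal fun x => wedge (c x) (φ.val x)

lemma wedgeForm_val {k : ℕ} (c : X → E →L[ℝ] 𝔽) (φ : Form I X 𝔽 k) (x : X) :
    (wedgeForm c φ).val x = wedge (c x) (φ.val x) := rfl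

lemma wedge_comp {V W : Type*} [NormedAddCommGroup V] [NormedSpace ℝ V] [NormedAddCommGroup W]
    [NormedSpace ℝ W] {k : ℕ} (ζ : V →L[ℝ] 𝔽) (μ : V [⋀^Fin k]→L[ℝ] 𝔽) (D : W →L[ℝ] V) :
    (wedge ζ μ).compContinuousLinearMap D = wedge (ζ ∘L D) (μ.compContinuousLinearMap D) := by
  ext v
  rw [ContinuousAlternatingMap.compContinuousLinearMap_apply, wedge_apply, wedge_apply]
  rfl

lemma chartRep_wedgeForm {k : ℕ} (c : X → E →L[ℝ] 𝔽) (φ : Form I X 𝔽 k) (x₀ : X) (p : E) :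
    chartRep x₀ (wedgeForm c φ) p = wedge (covRep I x₀ c p) (chartRep x₀ φ p) := by
  rw [chartRep_eq, wedgeForm_val, wedge_comp]
  rfl

lemma contDiffWithinAt_wedge {W V : Type*} [NormedAddCommGroup V] [NormedSpace ℝ V]
    [NormedAddCommGroup W] [NormedSpace ℝ W] {k : ℕ} {c : W → V →L[ℝ] 𝔽}
    {φ : W → V [⋀^Fin k]→L[ℝ] 𝔽} {s : Set W} {p : W} (hc : ContDiffWithinAt ℝ ∞ c s p)
    (hφ : ContDiffWithinAt ℝ ∞ φ s p) : ContDiffWithinAt ℝ ∞ (fun q => wedge (c q) (φ q)) s p := by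
  have h1 : ContDiffWithinAt ℝ ∞ (fun q => ((ContinuousLinearMap.lsmul ℝ 𝔽
      (E := V [⋀^Fin k]→L[ℝ] 𝔽)).flip (φ q)) ∘L c q) s p :=
    (contDiffWithinAt_const.clm_apply hφ).clm_comp hc
  exact (ContinuousAlternatingMap.alternatizeUncurryFinCLM (n := k) ℝ V
    𝔽).contDiff.comp_contDiffWithinAt h1

lemma IsSmoothForm.wedgeForm {k : ℕ} {c : X → E →L[ℝ] 𝔽} (hc : IsSmoothCov I c)
    {φ : Form I X 𝔽 k} (hφ : IsSmoothForm φ) : IsSmoothForm (wedgeForm c φ) := by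
  rw [isSmoothForm_iff] at hφ ⊢
  intro x₀ p hp
  have := contDiffWithinAt_wedge (hc x₀ p hp) (hφ x₀ p hp)
  simp only [← chartRep_wedgeForm] at this
  exact this

/-- The product of a function and a form. -/
def smulForm {k : ℕ} (f : X → 𝔽) (φ : Form I X 𝔽 k) : Form I X 𝔽 k :=
  Form.ofVal fun x => f x • φ.val x

lemma smulForm_val {k : ℕ} (f : X → 𝔽) (φ : Form I X 𝔽 k) (x : X) :
    (smulForm f φ).val x = f x • φ.val x := rfl

lemma chartRep_smulForm {k : ℕ} (f : X → 𝔽) (φ : Form I X 𝔽 k) (x₀ : X) (p : E) :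
    chartRep x₀ (smulForm f φ) p = (f ∘ (extChartAt I x₀).symm) p • chartRep x₀ φ p := rfl

variable [IsManifold I ∞ X]

lemma IsSmoothForm.smulForm {k : ℕ} {f : X → 𝔽} (hf : ContMDiff I 𝓘(ℝ, 𝔽) ∞ f)
    {φ : Form I X 𝔽 k} (hφ : IsSmoothForm φ) : IsSmoothForm (smulForm f φ) := by
  rw [isSmoothForm_iff] at hφ ⊢
  intro x₀ p hp
  exact (contDiffWithinAt_comp_symm hf hp).smul (hφ x₀ p hp)

/-- The Leibniz rule `d(f φ) = df ∧ φ + f dφ`. -/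
lemma extD_smulForm {k : ℕ} {f : X → 𝔽} (hf : ContMDiff I 𝓘(ℝ, 𝔽) ∞ f)
    {φ : Form I X 𝔽 k} (hφ : IsSmoothForm φ) :
    extD (smulForm f φ) = wedgeForm (dFun I f) φ + smulForm f (extD φ) := by
  refine Form.ext_val fun x => ?_
  rw [Form.val_add, extD_val, wedgeForm_val, smulForm_val, extD_val,
    dFun_apply_self (hf.mdifferentiable (by simp))]
  have hd := hφ.differentiableWithinAt x
  have hfd : DifferentiableWithinAt ℝ (f ∘ (extChartAt I x).symm) (range I) (extChartAt I x x) :=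
    (contDiffWithinAt_comp_symm hf (mem_extChartAt_target x)).differentiableWithinAt (by simp)
  have h1 := fderivWithin_smul (uniqueDiff_chart (I := I) x) hfd hd
  have h2 : fderivWithin ℝ (chartRep x (smulForm f φ)) (range I) (extChartAt I x x) = _ := h1
  rw [extDerivWithin, h2, ContinuousAlternatingMap.alternatizeUncurryFin_add]
  refine (add_comm _ _).trans ?_
  refine congrArg₂ (· + ·) ?_ ?_
  · rw [chartRep_self]; rfl
  · ext v
    simp [ContinuousAlternatingMap.alternatizeUncurryFin_apply, extDerivWithin, Finset.mul_sum]

end FormOps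

section InverseSmooth

lemma finiteDimensional_alternating (V F : Type*) [NormedAddCommGroup V] [NormedSpace ℝ V]
    [NormedAddCommGroup F] [NormedSpace ℝ F] [FiniteDimensional ℝ V] [FiniteDimensional ℝ F]
    (k : ℕ) : FiniteDimensional ℝ (V [⋀^Fin k]→L[ℝ] F) := by
  have h1 : FiniteDimensional ℝ (ContinuousMultilinearMap ℝ (fun _ : Fin k => V) F) :=
    let toM : ContinuousMultilinearMap ℝ (fun _ : Fin k => V) F →ₗ[ℝ]
      MultilinearMap ℝ (fun _ : Fin k => V) F := ContinuousMultilinearMap.toMultilinearMapLinear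
    FiniteDimensional.of_injective toM ContinuousMultilinearMap.toMultilinearMap_injective
  exact FiniteDimensional.of_injective
    (ContinuousAlternatingMap.toContinuousMultilinearMapLinear (R := ℝ) (A := ℝ) (M := V) (N := F)
      (ι := Fin k)) ContinuousAlternatingMap.toContinuousMultilinearMap_injective

/-- The solution `w` of a linear equation `T w = ν` with smooth coefficients is smooth at a point
where `T` is injective. -/
lemma contDiffWithinAt_of_injective {G V W : Type*} [NormedAddCommGroup G] [NormedSpace ℝ G]
    [NormedAddCommGroup V] [NormedSpace ℝ V] [NormedAddCommGroup W] [NormedSpace ℝ W]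
    [FiniteDimensional ℝ V] [FiniteDimensional ℝ W] {T : G → V →L[ℝ] W} {w : G → V} {ν : G → W}
    {s : Set G} {p : G} (hp : p ∈ s) (hT : ContDiffWithinAt ℝ ∞ T s p)
    (hν : ContDiffWithinAt ℝ ∞ ν s p) (hinj : Function.Injective (T p))
    (h : ∀ᶠ q in nhdsWithin p s, T q (w q) = ν q) : ContDiffWithinAt ℝ ∞ w s p := by
  obtain ⟨L, hL⟩ := (T p).toLinearMap.exists_leftInverse_of_injective
    (LinearMap.ker_eq_bot.2 hinj)
  let L' : W →L[ℝ] V := LinearMap.toContinuousLinearMap L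
  have hLp : L' ∘L T p = (ContinuousLinearEquiv.refl ℝ V : V →L[ℝ] V) := by
    ext v; exact LinearMap.congr_fun hL v
  have hB : ContDiffWithinAt ℝ ∞ (fun q => L' ∘L T q) s p := contDiffWithinAt_const.clm_comp hT
  have hinv : ContDiffWithinAt ℝ ∞ (fun q => ContinuousLinearMap.inverse (L' ∘L T q)) s p := by
    have h1 := contDiffAt_map_inverse (n := ∞) (ContinuousLinearEquiv.refl ℝ V)
    rw [← hLp] at h1
    exact h1.comp_contDiffWithinAt p hB
  have hw := hinv.clm_apply (contDiffWithinAt_const.clm_apply hν (f := fun _ => L'))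
  have hev : ∀ᶠ q in nhdsWithin p s, w q =
      ContinuousLinearMap.inverse (L' ∘L T q) (L' (ν q)) := by
    have h1 := ContinuousLinearEquiv.nhds (ContinuousLinearEquiv.refl ℝ V)
    rw [← hLp] at h1
    filter_upwards [hB.continuousWithinAt h1, h] with q ⟨e, he⟩ hq
    rw [← hq]
    change w q = ContinuousLinearMap.inverse (L' ∘L T q) ((L' ∘L T q) (w q))
    have he' : L' ∘L T q = e := he.symm
    rw [he', ContinuousLinearMap.inverse_equiv]
    exact (e.symm_apply_apply _).symm
  exact hw.congr_of_eventuallyEq hev (hev.self_of_nhdsWithin hp)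

end InverseSmooth

section FormOps

variable {E : Type*} [NormedAddCommGroup E] [NormedSpace ℝ E]
  {H : Type*} [TopologicalSpace H] {I : ModelWithCorners ℝ E H}
  {X : Type*} [TopologicalSpace X] [ChartedSpace H X]
  {F : Type*} [NormedAddCommGroup F] [NormedSpace ℝ F]

/-! #### Vector fields -/

variable (I) in
/-- The coordinate expression of a vector field. -/
def vecRep (x₀ : X) (w : X → E) (p : E) : E :=
  dChart I x₀ ((extChartAt I x₀).symm p) (w ((extChartAt I x₀).symm p))

/-- The interior product with a vector field, in terms of values in the model space. -/
def insForm {k : ℕ} (w : X → E) (φ : Form I X F (k + 1)) : Form I X F k :=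
  Form.ofVal fun x => (φ.val x).curryLeft (w x)

lemma contDiffWithinAt_curryLeft {k : ℕ} {φ : E → E [⋀^Fin (k + 1)]→L[ℝ] F} {s : Set E} {p : E}
    (hφ : ContDiffWithinAt ℝ ∞ φ s p) :
    ContDiffWithinAt ℝ ∞ (fun q => (φ q).curryLeft) s p := by
  let L : (E [⋀^Fin (k + 1)]→L[ℝ] F) →L[ℝ] E →L[ℝ] E [⋀^Fin k]→L[ℝ] F :=
    (ContinuousAlternatingMap.curryLeftLI (𝕜 := ℝ) (E := E) (F := F)
      (n := k)).toContinuousLinearMap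
  have hL : ContDiff ℝ ∞ L := ContinuousLinearMap.contDiff (𝕜 := ℝ) (E := E [⋀^Fin (k + 1)]→L[ℝ] F)
    (F := E →L[ℝ] E [⋀^Fin k]→L[ℝ] F) L
  exact hL.comp_contDiffWithinAt hφ

variable [IsManifold I ∞ X]

lemma chartRep_insForm {k : ℕ} (w : X → E) (φ : Form I X F (k + 1)) {x₀ : X} {p : E}
    (hp : p ∈ (extChartAt I x₀).target) :
    chartRep x₀ (insForm w φ) p = (chartRep x₀ φ p).curryLeft (vecRep I x₀ w p) := by
  ext v
  have h := DFunLike.congr_fun (dChartSymm_comp_dChart hp) (w ((extChartAt I x₀).symm p))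
  have h' : dChartSymm I x₀ p (vecRep I x₀ w p) = w ((extChartAt I x₀).symm p) := h
  change (φ.val _) (Matrix.vecCons (w ((extChartAt I x₀).symm p)) (fun i => dChartSymm I x₀ p (v i)))
    = (φ.val _) (fun i => dChartSymm I x₀ p (Matrix.vecCons (vecRep I x₀ w p) v i))
  congr 1
  ext1 i
  refine Fin.cases ?_ (fun i => ?_) i
  · exact h'.symm
  · rfl

lemma isSmoothForm_insForm [FiniteDimensional ℝ E] [FiniteDimensional ℝ F] {k : ℕ} {w : X → E}
    (hw : ∀ x : X, ContDiffWithinAt ℝ ∞ (vecRep I x w) (range I) (extChartAt I x x))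
    {φ : Form I X F (k + 1)} (hφ : IsSmoothForm φ) : IsSmoothForm (insForm w φ) := by
  refine isSmoothForm_of_chart fun x => ⟨x, mem_extChartAt_source x, ?_⟩
  have hp := mem_extChartAt_target (I := I) x
  have h1 : ContDiffWithinAt ℝ ∞ (fun q => (chartRep x φ q).curryLeft) (range I)
      (extChartAt I x x) :=
    contDiffWithinAt_curryLeft (hφ.contDiffWithinAt hp)
  refine (h1.clm_apply (hw x)).congr_of_eventuallyEq ?_ (chartRep_insForm w φ hp)
  exact (eventually_mem_target hp).mono fun q hq => chartRep_insForm w φ hq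

/-- A vector field solving a linear equation with smooth injective coefficients is smooth. -/
lemma contDiffWithinAt_vecRep_of_insForm [FiniteDimensional ℝ E] [FiniteDimensional ℝ F] {k : ℕ}
    {w : X → E} {φ : Form I X F (k + 1)} (hφ : IsSmoothForm φ)
    (hinj : ∀ x, Function.Injective (φ.val x).curryLeft)
    (hν : IsSmoothForm (insForm w φ)) (x : X) :
    ContDiffWithinAt ℝ ∞ (vecRep I x w) (range I) (extChartAt I x x) := by
  have hp := mem_extChartAt_target (I := I) x
  have h1 : ContDiffWithinAt ℝ ∞ (fun q => (chartRep x φ q).curryLeft) (range I)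
      (extChartAt I x x) :=
    contDiffWithinAt_curryLeft (hφ.contDiffWithinAt hp)
  have := finiteDimensional_alternating E F k
  refine contDiffWithinAt_of_injective (extChartAt_target_subset_range _ hp) h1
    (hν.contDiffWithinAt hp) ?_ ?_
  · rw [chartRep_self]; exact hinj x
  · exact (eventually_mem_target hp).mono fun q hq => (chartRep_insForm w φ hq).symm

/-- Smoothness of a section of the tangent bundle, in terms of its coordinate expressions. -/
lemma contMDiff_section_iff {w : ∀ x : X, TangentSpace I x} [IsManifold I 1 X] :
    ContMDiff I I.tangent ∞ (fun x => (⟨x, w x⟩ : TangentBundle I X)) ↔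
      ∀ x : X, ContDiffWithinAt ℝ ∞ (vecRep I x w) (range I) (extChartAt I x x) := by
  refine forall_congr' fun x => ?_
  rw [show (fun x => (⟨x, w x⟩ : TangentBundle I X)) =
    fun x => Bundle.TotalSpace.mk' E x (w x) from rfl]
  refine (Bundle.contMDiffAt_section (IB := I) (n := ∞) (F := E) (E := TangentSpace I) x).trans ?_
  have he : ∀ y ∈ (extChartAt I x).source,
      (trivializationAt E (TangentSpace I) x ⟨y, w y⟩).2 = dChart I x y (w y) := by
    intro y hy
    rw [extChartAt_source] at hy
    have hb : y ∈ (trivializationAt E (TangentSpace I : X → Type _) x).baseSet := by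
      rw [TangentBundle.trivializationAt_baseSet]; exact hy
    rw [← Bundle.Trivialization.continuousLinearMapAt_apply_of_mem ℝ _ hb,
      TangentBundle.continuousLinearMapAt_trivializationAt hy]
    rfl
  have h1 : ContMDiffAt I 𝓘(ℝ, E) ∞
      (fun y => (trivializationAt E (TangentSpace I) x ⟨y, w y⟩).2) x ↔
      ContMDiffAt I 𝓘(ℝ, E) ∞ (fun y => dChart I x y (w y)) x := by
    refine Filter.EventuallyEq.contMDiffAt_iff ?_
    filter_upwards [extChartAt_source_mem_nhds (I := I) x] with y hy using he y hy
  rw [h1]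
  constructor
  · intro h
    have h2 := contMDiffWithinAt_extChartAt_symm_range (I := I) (n := ∞) x
      (mem_extChartAt_target (I := I) x)
    rw [← contMDiffWithinAt_iff_contDiffWithinAt]
    have h3 := ContMDiffAt.comp_contMDiffWithinAt (f := (extChartAt I x).symm)
      (g := fun y => dChart I x y (w y)) (extChartAt I x x) (by rwa [extChartAt_to_inv]) h2
    exact h3
  · intro h
    have h4 : ContMDiffAt I 𝓘(ℝ, E) ∞ (extChartAt I x) x := contMDiffAt_extChartAt
    have h3 := ContMDiffWithinAt.comp (t := range I) (s := univ) x h.contMDiffWithinAt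
      h4.contMDiffWithinAt (fun y _ => by simp [extChartAt])
    rw [contMDiffWithinAt_univ] at h3
    refine h3.congr_of_eventuallyEq ?_
    filter_upwards [extChartAt_source_mem_nhds (I := I) x] with y hy
    have h5 : ∀ z, z = y → dChart I x z (w z) = dChart I x y (w y) := by rintro z rfl; rfl
    exact (h5 _ ((extChartAt I x).left_inv hy)).symm

end FormOps

section Leibniz

lemma wedge_two_apply {𝔽 V : Type*} [NormedAddCommGroup V] [NormedSpace ℝ V] [NormedField 𝔽]
    [NormedAlgebra ℝ 𝔽] (ζ : V →L[ℝ] 𝔽) (μ : V [⋀^Fin 2]→L[ℝ] 𝔽) (a b c : V) :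
    wedge ζ μ ![a, b, c] = ζ a * μ ![b, c] - ζ b * μ ![a, c] + ζ c * μ ![a, b] := by
  rw [wedge_apply, wedgeCovector, Fin.sum_univ_three]
  have h0 : (0 : Fin 3).removeNth ![a, b, c] = ![b, c] := by ext i; fin_cases i <;> rfl
  have h1 : (1 : Fin 3).removeNth ![a, b, c] = ![a, c] := by ext i; fin_cases i <;> rfl
  have h2 : (2 : Fin 3).removeNth ![a, b, c] = ![a, b] := by ext i; fin_cases i <;> rfl
  rw [h0, h1, h2]
  simp
  ring

lemma wedge_three_apply {𝔽 V : Type*} [NormedAddCommGroup V] [NormedSpace ℝ V] [NormedField 𝔽]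
    [NormedAlgebra ℝ 𝔽] (ζ : V →L[ℝ] 𝔽) (μ : V [⋀^Fin 3]→L[ℝ] 𝔽) (a b c d : V) :
    wedge ζ μ ![a, b, c, d] =
      ζ a * μ ![b, c, d] - ζ b * μ ![a, c, d] + ζ c * μ ![a, b, d] - ζ d * μ ![a, b, c] := by
  rw [wedge_apply, wedgeCovector, Fin.sum_univ_four]
  have h0 : (0 : Fin 4).removeNth ![a, b, c, d] = ![b, c, d] := by
    ext i; fin_cases i <;> rfl
  have h1 : (1 : Fin 4).removeNth ![a, b, c, d] = ![a, c, d] := by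
    ext i; fin_cases i <;> rfl
  have h2 : (2 : Fin 4).removeNth ![a, b, c, d] = ![a, b, d] := by
    ext i; fin_cases i <;> rfl
  have h3 : (3 : Fin 4).removeNth ![a, b, c, d] = ![a, b, c] := by
    ext i; fin_cases i <;> rfl
  rw [h0, h1, h2, h3]
  simp
  ring

lemma wedgeTwo_apply {V : Type*} [NormedAddCommGroup V] [NormedSpace ℝ V]
    (α β : V [⋀^Fin 2]→L[ℝ] ℝ) (a b c d : V) : wedgeTwo α β ![a, b, c, d] =
      α ![a, b] * β ![c, d] - α ![a, c] * β ![b, d] + α ![a, d] * β ![b, c] +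
        α ![b, c] * β ![a, d] - α ![b, d] * β ![a, c] + α ![c, d] * β ![a, b] := rfl

variable {E : Type*} [NormedAddCommGroup E] [NormedSpace ℝ E]

lemma extDerivWithin_two {s : Set E} {x : E} {F : Type*} [NormedAddCommGroup F]
    [NormedSpace ℝ F] (φ : E → E [⋀^Fin 2]→L[ℝ] F) (a b c : E) :
    extDerivWithin φ s x ![a, b, c] =
      fderivWithin ℝ φ s x a ![b, c] - fderivWithin ℝ φ s x b ![a, c] +
      fderivWithin ℝ φ s x c ![a, b] := by
  rw [extDerivWithin, ContinuousAlternatingMap.alternatizeUncurryFin_apply, Fin.sum_univ_three]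
  have h0 : (0 : Fin 3).removeNth ![a, b, c] = ![b, c] := by ext i; fin_cases i <;> rfl
  have h1 : (1 : Fin 3).removeNth ![a, b, c] = ![a, c] := by ext i; fin_cases i <;> rfl
  have h2 : (2 : Fin 3).removeNth ![a, b, c] = ![a, b] := by ext i; fin_cases i <;> rfl
  rw [h0, h1, h2]
  simp
  abel

lemma extDerivWithin_ofSubsingleton {s : Set E} {x : E} (hs : UniqueDiffWithinAt ℝ s x)
    {c : E → E →L[ℝ] ℝ} (hc : DifferentiableWithinAt ℝ c s x) (a b : E) :
    extDerivWithin (fun p => ContinuousAlternatingMap.ofSubsingleton ℝ E ℝ (0 : Fin 1) (c p))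
      s x ![a, b] = fderivWithin ℝ c s x a b - fderivWithin ℝ c s x b a := by
  have h := ((ContinuousAlternatingMap.ofSubsingletonLIE (𝕜 := ℝ) (E := E) (F := ℝ)
    (0 : Fin 1)).toContinuousLinearEquiv.toContinuousLinearMap.hasFDerivAt.comp_hasFDerivWithinAt x
    hc.hasFDerivWithinAt).fderivWithin hs
  have h' : fderivWithin ℝ (fun p => ContinuousAlternatingMap.ofSubsingleton ℝ E ℝ (0 : Fin 1)
    (c p)) s x = _ := h
  rw [extDerivWithin, h', ContinuousAlternatingMap.alternatizeUncurryFin_apply, Fin.sum_univ_two]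
  have e : ∀ u v w : E, ((ContinuousAlternatingMap.ofSubsingletonLIE (𝕜 := ℝ) (E := E) (F := ℝ)
    (0 : Fin 1)).toContinuousLinearEquiv.toContinuousLinearMap ∘L fderivWithin ℝ c s x) u ![w] =
      fderivWithin ℝ c s x u w := fun _ _ _ => rfl
  have h0 : (0 : Fin 2).removeNth ![a, b] = ![b] := by ext i; fin_cases i; rfl
  have h1 : (1 : Fin 2).removeNth ![a, b] = ![a] := by ext i; fin_cases i; rfl
  rw [h0, h1]
  simp
  ring

/-- The Leibniz rule for the wedge product of a covector field and a `2`-form. -/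
lemma extDerivWithin_wedge {s : Set E} {x : E} (hs : UniqueDiffWithinAt ℝ s x)
    {c : E → E →L[ℝ] ℝ} (hc : DifferentiableWithinAt ℝ c s x)
    {φ : E → E [⋀^Fin 2]→L[ℝ] ℝ} (hφ : DifferentiableWithinAt ℝ φ s x)
    (hw : DifferentiableWithinAt ℝ (fun p => wedge (c p) (φ p)) s x) (v : Fin 4 → E) :
    extDerivWithin (fun p => wedge (c p) (φ p)) s x v =
      wedgeTwo (extDerivWithin (fun p =>
        ContinuousAlternatingMap.ofSubsingleton ℝ E ℝ (0 : Fin 1) (c p)) s x) (φ x) v -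
      wedge (c x) (extDerivWithin φ s x) v := by
  have hv : v = ![v 0, v 1, v 2, v 3] := by ext i; fin_cases i <;> rfl
  have hD : ∀ a b₁ b₂ b₃, fderivWithin ℝ (fun p => wedge (c p) (φ p)) s x a ![b₁, b₂, b₃] =
      (fderivWithin ℝ c s x a b₁ * φ x ![b₂, b₃] + c x b₁ * fderivWithin ℝ φ s x a ![b₂, b₃]) -
      (fderivWithin ℝ c s x a b₂ * φ x ![b₁, b₃] + c x b₂ * fderivWithin ℝ φ s x a ![b₁, b₃]) +
      (fderivWithin ℝ c s x a b₃ * φ x ![b₁, b₂] + c x b₃ * fderivWithin ℝ φ s x a ![b₁, b₂]) := by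
    intro a b₁ b₂ b₃
    have hap : ∀ {k : ℕ} {ψ : E → E [⋀^Fin k]→L[ℝ] ℝ} (_ : DifferentiableWithinAt ℝ ψ s x)
        (u : Fin k → E), HasFDerivWithinAt (fun p => ψ p u)
          ((ContinuousAlternatingMap.apply ℝ E ℝ u) ∘L fderivWithin ℝ ψ s x) s x := by
      intro k ψ hψ u
      exact (ContinuousAlternatingMap.apply ℝ E ℝ u).hasFDerivAt.comp_hasFDerivWithinAt x
        hψ.hasFDerivWithinAt
    have hcb : ∀ b, HasFDerivWithinAt (fun p => c p b)
        ((ContinuousLinearMap.apply ℝ ℝ b) ∘L fderivWithin ℝ c s x) s x := fun b =>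
      (ContinuousLinearMap.apply ℝ ℝ b).hasFDerivAt.comp_hasFDerivWithinAt x hc.hasFDerivWithinAt
    have e1 := hap hw ![b₁, b₂, b₃]
    have e2 := (((hcb b₁).mul (hap hφ ![b₂, b₃])).sub ((hcb b₂).mul (hap hφ ![b₁, b₃]))).add
      ((hcb b₃).mul (hap hφ ![b₁, b₂]))
    have e3 := e2.congr_of_eventuallyEq (f₁ := fun p => wedge (c p) (φ p) ![b₁, b₂, b₃])
      (Filter.Eventually.of_forall fun p => wedge_two_apply _ _ _ _ _) (wedge_two_apply _ _ _ _ _)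
    have e4 := congrArg (fun L : E →L[ℝ] ℝ => L a) (hs.eq e1 e3)
    refine e4.trans ?_
    simp
    ring
  rw [hv, extDerivWithin_three, wedge_three_apply, wedgeTwo_apply]
  simp only [hD, extDerivWithin_two, extDerivWithin_ofSubsingleton hs hc]
  ring

variable {H : Type*} [TopologicalSpace H] {I : ModelWithCorners ℝ E H}
  {X : Type*} [TopologicalSpace X] [ChartedSpace H X] [IsManifold I ∞ X]

/-- The Leibniz rule `d(θ ∧ γ) = dθ ∧ γ - θ ∧ dγ` for a `1`-form `θ` and a `2`-form `γ`. -/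
lemma extD_wedgeForm {c : X → E →L[ℝ] ℝ} (hc : IsSmoothCov I c) {φ : Form I X ℝ 2}
    (hφ : IsSmoothForm φ) (x : X) (v : Fin 4 → E) :
    (extD (wedgeForm c φ)).val x v = wedgeTwo ((extD (Form.ofCov I c)).val x) (φ.val x) v -
      wedge (c x) ((extD φ).val x) v := by
  have hp := mem_extChartAt_target (I := I) x
  have hself : covRep I x c (extChartAt I x x) = c x := by
    rw [covRep, dChartSymm_self, extChartAt_to_inv]; rfl
  have hwf := IsSmoothForm.wedgeForm hc hφ
  have he : chartRep x (wedgeForm c φ) = fun p => wedge (covRep I x c p) (chartRep x φ p) :=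
    funext fun p => chartRep_wedgeForm c φ x p
  have hw := hwf.differentiableWithinAt x
  rw [he] at hw
  rw [extD_val, extD_val, extD_val, he, extDerivWithin_wedge (uniqueDiff_chart x)
    ((hc x _ hp).differentiableWithinAt (by simp)) (hφ.differentiableWithinAt x) hw, hself,
    chartRep_self]
  rfl

end Leibniz

/-! ### Linear algebra at a boundary point -/

section Contact

variable {W : Type*} [NormedAddCommGroup W] [NormedSpace ℝ W] {𝔽 : Type*} [NormedField 𝔽]
  [NormedAlgebra ℝ 𝔽]

/-- A form vanishing on `ker θ` and annihilated by a vector `R` with `θ(R) = 1` is zero. -/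
lemma form_eq_zero_of_ker {θ : W →L[ℝ] ℝ} {R : W} (hR : θ R = 1) :
    ∀ {k : ℕ} {f : W [⋀^Fin (k + 1)]→L[ℝ] 𝔽}, (∀ w, f (Matrix.vecCons R w) = 0) →
      (∀ w, (∀ i, θ (w i) = 0) → f w = 0) → f = 0 := by
  intro k
  induction k with
  | zero =>
    intro f h1 h2
    ext v
    have e : v = Matrix.vecCons ((v 0 - θ (v 0) • R) + θ (v 0) • R) (fun i => i.elim0) := by
      ext i; fin_cases i; simp
    rw [e, form_add₀, form_smul₀, h1, smul_zero, add_zero]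
    refine h2 _ fun i => ?_
    fin_cases i
    simp [hR]
  | succ k ih =>
    intro f h1 h2
    have h3 : ∀ u, θ u = 0 → f.curryLeft u = 0 := by
      intro u hu
      refine ih (fun w => ?_) (fun w hw => h2 _ fun i => ?_)
      · change f (Matrix.vecCons u (Matrix.vecCons R w)) = 0
        rw [form_swap₀, h1, neg_zero]
      · refine Fin.cases ?_ (fun i => ?_) i
        · exact hu
        · exact hw i
    ext v
    have e : v = Matrix.vecCons ((v 0 - θ (v 0) • R) + θ (v 0) • R) (fun i => v i.succ) := by
      ext i; refine Fin.cases ?_ (fun i => ?_) i <;> simp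
    rw [e, form_add₀, form_smul₀, h1, smul_zero, add_zero]
    have h4 := congrArg (fun ψ : W [⋀^Fin (k + 1)]→L[ℝ] 𝔽 => ψ (fun i => v i.succ))
      (h3 (v 0 - θ (v 0) • R) (by simp [hR]))
    exact h4

lemma wedge_apply_of_ker {ζ : W →L[ℝ] 𝔽} {k : ℕ} {μ : W [⋀^Fin k]→L[ℝ] 𝔽} {w : Fin (k + 1) → W}
    (hw : ∀ i, ζ (w i) = 0) : wedge ζ μ w = 0 := by
  rw [wedge_apply, wedgeCovector]
  exact Finset.sum_eq_zero fun i _ => by rw [hw]; ring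

/-- The complexification of a real covector. -/
def toC (θ : W →L[ℝ] ℝ) : W →L[ℝ] ℂ := Complex.ofRealCLM ∘L θ

lemma toC_apply (θ : W →L[ℝ] ℝ) (u : W) : toC θ u = (θ u : ℂ) := rfl

/-- A form vanishing on `ker θ` is divisible by `θ`. -/
lemma eq_wedge_of_ker {θ : W →L[ℝ] ℝ} {R : W} (hR : θ R = 1) {ζ : W →L[ℝ] 𝔽}
    (hζ : ∀ u, ζ u = algebraMap ℝ 𝔽 (θ u)) {k : ℕ} {f : W [⋀^Fin (k + 1)]→L[ℝ] 𝔽}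
    (h : ∀ w, (∀ i, θ (w i) = 0) → f w = 0) : f = wedge ζ (f.curryLeft R) := by
  rw [← sub_eq_zero]
  refine form_eq_zero_of_ker hR (fun w => ?_) (fun w hw => ?_)
  · rw [ContinuousAlternatingMap.sub_apply]
    cases k with
    | zero =>
      rw [wedge_apply, wedgeCovector, Fin.sum_univ_one]
      have e : (0 : Fin 1).removeNth (Matrix.vecCons R w) = w := by ext i; exact i.elim0
      simp only [e, Matrix.cons_val_zero, hζ, hR, map_one]
      simp
    | succ k =>
      rw [wedge_cons, hζ, hR, map_one, one_mul, ContinuousAlternatingMap.curryLeft_same, wedge_zero]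
      change f _ - (f _ - 0) = 0
      rw [sub_zero]
      exact sub_self _
  · rw [ContinuousAlternatingMap.sub_apply, h w hw, wedge_apply_of_ker, sub_zero]
    intro i; rw [hζ, hw, map_zero]

/-- The product `θ ∧ f` depends only on the restriction of `f` to `ker θ`. -/
lemma wedge_eq_zero_of_ker {θ : W →L[ℝ] ℝ} {R : W} (hR : θ R = 1) {ζ : W →L[ℝ] 𝔽}
    (hζ : ∀ u, ζ u = algebraMap ℝ 𝔽 (θ u)) {k : ℕ} {f : W [⋀^Fin (k + 1)]→L[ℝ] 𝔽}
    (h : ∀ w, (∀ i, θ (w i) = 0) → f w = 0) : wedge ζ f = 0 := by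
  refine form_eq_zero_of_ker hR (fun w => ?_) (fun w hw => wedge_apply_of_ker fun i => ?_)
  · rw [wedge_cons, hζ, hR, map_one, one_mul, ← eq_wedge_of_ker hR hζ h, sub_self]
  · rw [hζ, hw, map_zero]

end Contact

section Frame

variable {V : Type*} [NormedAddCommGroup V] [NormedSpace ℝ V]
  {W : Type*} [NormedAddCommGroup W] [NormedSpace ℝ W]

/-- The linear algebra at a boundary point: `V` is the tangent space of `Z` with complex structure
`J`, `ι` identifies `W` with the kernel of the covector `α` (the tangent space of the boundary),
and `R` is a vector with `θ(R) = 1`, where `θ = -α ∘ J ∘ ι`. -/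
structure IsBoundaryFrame (J : V →L[ℝ] V) (α : V →L[ℝ] ℝ) (ι : W →L[ℝ] V) (R : W) : Prop where
  sq : ∀ v, J (J v) = -v
  finrank : Module.finrank ℝ V = 6
  tangent : ∀ u, α (ι u) = 0
  surj : ∀ v, α v = 0 → ∃ u, ι u = v
  inj : Function.Injective ι
  reeb : α (J (ι R)) = -1

variable {J : V →L[ℝ] V} {α : V →L[ℝ] ℝ} {ι : W →L[ℝ] V} {R : W}

/-- Multiplication of a complex linear form by a complex linear covector. -/
lemma CLin.wedge {k : ℕ} {ζ : V →L[ℝ] ℂ} (hζ : ∀ v, ζ (J v) = Complex.I * ζ v)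
    {A : V [⋀^Fin (k + 1)]→L[ℝ] ℂ} (hA : CLin J A) : CLin J (wedge ζ A) := by
  refine clin_iff.2 fun u => ?_
  rw [ins01_wedge, clin_iff.1 hA, wedge_zero, hζ, ← mul_assoc, Complex.I_mul_I]
  ext w
  simp

lemma dzOf_J' (hJ : ∀ v, J (J v) = -v) (v : V) : dzOf J α (J v) = Complex.I * dzOf J α v := by
  rw [dzOf_J hJ]; push_cast; ring

namespace IsBoundaryFrame

variable (h : IsBoundaryFrame J α ι R)
include h

lemma exists_tangent (v : V) : ∃ u, v = ι u + (-α v) • J (ι R) := by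
  obtain ⟨u, hu⟩ := h.surj (v - (-α v) • J (ι R)) (by simp [h.reeb])
  exact ⟨u, by rw [hu]; abel⟩

lemma normal_apply : α (-J (ι R)) = 1 := by simp [h.reeb]

lemma normal_J_apply : α (J (-J (ι R))) = 0 := by simp [h.sq, h.tangent]

/-- A complex linear form vanishes if it does so on vectors tangent to the boundary. -/
lemma clin_cons_eq_zero {k : ℕ} {φ : V [⋀^Fin (k + 1)]→L[ℝ] ℂ} (hφ : CLin J φ) {w : Fin k → V}
    (hw : ∀ u, φ (Matrix.vecCons (ι u) w) = 0) (v : V) : φ (Matrix.vecCons v w) = 0 := by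
  obtain ⟨u, hu⟩ := h.exists_tangent v
  rw [hu, form_add₀, form_smul₀, hφ, hw, hw]
  simp

lemma clin_two_eq_zero {φ : V [⋀^Fin 2]→L[ℝ] ℂ} (hφ : CLin J φ)
    (hw : ∀ a b, φ ![ι a, ι b] = 0) : φ = 0 := by
  ext v
  have hv : v = ![v 0, v 1] := by ext i; fin_cases i <;> rfl
  rw [hv]
  refine h.clin_cons_eq_zero hφ (fun a => ?_) _
  rw [form_swap₀, h.clin_cons_eq_zero hφ (fun b => ?_), neg_zero]
  exact hw b a

lemma clin_three_eq_zero {φ : V [⋀^Fin 3]→L[ℝ] ℂ} (hφ : CLin J φ)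
    (hw : ∀ a b c, φ ![ι a, ι b, ι c] = 0) : φ = 0 := by
  ext v
  have hv : v = ![v 0, v 1, v 2] := by ext i; fin_cases i <;> rfl
  rw [hv]
  refine h.clin_cons_eq_zero hφ (fun a => ?_) _
  rw [form_swap₀, h.clin_cons_eq_zero hφ (fun b => ?_), neg_zero]
  rw [form_swap₁, form_swap₀, neg_neg, h.clin_cons_eq_zero hφ (fun c => ?_)]
  exact hw c b a

/-- Complex linear `3`-forms vanish on complex tangent vectors. -/
lemma clin_three_horizontal {A : V [⋀^Fin 3]→L[ℝ] ℂ} (hA : CLin J A) {a b c : V}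
    (ha : dzOf J α a = 0) (hb : dzOf J α b = 0) (hc : dzOf J α c = 0) : A ![a, b, c] = 0 := by
  have h1 := (CLin.wedge (dzOf_J' (α := α) h.sq) hA).eq_zero_of_four h.sq h.finrank
  have h2 := wedge_three_apply (dzOf J α) A (-J (ι R)) a b c
  rw [h1, ha, hb, hc] at h2
  have h3 : dzOf J α (-J (ι R)) = 1 := by
    rw [dzOf_apply, h.normal_apply, h.normal_J_apply]; simp
  rw [h3] at h2
  simpa using h2.symm

omit h in
lemma dz_eq_zero_iff (v : V) : dzOf J α v = 0 ↔ α v = 0 ∧ α (J v) = 0 := by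
  rw [dzOf_apply, Complex.ext_iff]
  simp

/-- The projection onto the complex tangent space of the boundary along the normal direction. -/
lemma exists_horizontal_projection : ∃ π : V →L[ℝ] V, (∀ v, π (J v) = J (π v)) ∧
    (∀ v, dzOf J α (π v) = 0) ∧ (∀ v, dzOf J α v = 0 → π v = v) ∧
    ∀ v, v = π v + ((-α (J v)) • ι R + (-α v) • J (ι R)) := by
  refine ⟨ContinuousLinearMap.id ℝ V + (α ∘L J).smulRight (ι R) + α.smulRight (J (ι R)),
    fun v => ?_, fun v => ?_, fun v hv => ?_, fun v => ?_⟩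
  · simp only [add_apply, ContinuousLinearMap.id_apply, ContinuousLinearMap.smulRight_apply,
      ContinuousLinearMap.comp_apply, h.sq, map_add, map_smul, map_neg]
    module
  · rw [dz_eq_zero_iff]
    simp only [add_apply, ContinuousLinearMap.id_apply, ContinuousLinearMap.smulRight_apply,
      ContinuousLinearMap.comp_apply, h.sq, map_add, map_smul, map_neg, h.reeb, h.tangent,
      smul_eq_mul]
    constructor <;> ring
  · rw [dz_eq_zero_iff] at hv
    simp [hv.1, hv.2]
  · simp only [add_apply, ContinuousLinearMap.id_apply, ContinuousLinearMap.smulRight_apply,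
      ContinuousLinearMap.comp_apply]
    module

end IsBoundaryFrame

/-- A `2`-form invariant under `J` has weight zero. -/
lemma hasWeight_zero_of_invariant (hJ : ∀ v, J (J v) = -v) {g : V [⋀^Fin 2]→L[ℝ] ℂ}
    (hg : ∀ u v, g ![J u, J v] = g ![u, v]) : HasWeight J 0 g := by
  refine hasWeight_of_apply fun t v => ?_
  have h1 : (fun i => rot J t (v i)) = ![rot J t (v 0), rot J t (v 1)] := by
    ext i; fin_cases i <;> rfl
  have hv : v = ![v 0, v 1] := by ext i; fin_cases i <;> rfl
  have h2 : g ![J (v 0), v 1] + g ![v 0, J (v 1)] = 0 := by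
    have := hg (v 0) (J (v 1))
    rw [hJ, form_neg₁] at this
    linear_combination -this
  have hcs : (Complex.cos t) ^ 2 + (Complex.sin t) ^ 2 = 1 := by
    rw [add_comm]; exact Complex.sin_sq_add_cos_sq _
  rw [h1]
  conv_rhs => rw [hv]
  simp only [rot, add_apply, smul_apply, ContinuousLinearMap.id_apply, form_add₀, form_add₁,
    form_smul₀, form_smul₁, Complex.real_smul, hg, zero_mul, mul_zero, Complex.exp_zero, one_mul]
  push_cast
  linear_combination (Complex.cos t * Complex.sin t) * h2 + g ![v 0, v 1] * hcs

/-- The pointwise version of the statement that the section of `Λ^{2,1}_T` given by `σ` is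
`γ ∧ dz`. -/
def RepresentsAt (J : V →L[ℝ] V) (α : V →L[ℝ] ℝ) (ι : W →L[ℝ] V) (σ : V [⋀^Fin 3]→L[ℝ] ℂ)
    (γ : W [⋀^Fin 2]→L[ℝ] ℝ) : Prop :=
  ∃ (g μ : V [⋀^Fin 2]→L[ℝ] ℂ), HasWeight J 0 g ∧ HasWeight J 2 μ ∧
    (∀ u u', α (J (ι u)) = 0 → α (J (ι u')) = 0 → g ![ι u, ι u'] = (γ ![u, u'] : ℂ)) ∧
    σ = wedge (dzOf J α) g + wedge (dzbarOf J α) μ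

namespace IsBoundaryFrame

variable (h : IsBoundaryFrame J α ι R)
include h

lemma dz_reeb : dzOf J α (ι R) = Complex.I := by
  rw [dzOf_apply, h.tangent, h.reeb]; simp

/-- On the contact plane `A` vanishes, so `B` is imaginary there; since `B(J·, J·, J·) = iB`, it
vanishes as well. -/
lemma restrict_horizontal {A B : V [⋀^Fin 3]→L[ℝ] ℂ} (hA : HasWeight J 3 A) (hB : HasWeight J 1 B)
    (hre : ∀ a b c, ((A + B) ![ι a, ι b, ι c]).re = 0) {a b c : V}
    (ha : dzOf J α a = 0) (hb : dzOf J α b = 0) (hc : dzOf J α c = 0) : B ![a, b, c] = 0 := by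
  have hA0 : ∀ {a b c : V}, dzOf J α a = 0 → dzOf J α b = 0 → dzOf J α c = 0 →
    A ![a, b, c] = 0 := h.clin_three_horizontal (hA.clin_three h.sq)
  have hB0 : ∀ {a b c : V}, dzOf J α a = 0 → dzOf J α b = 0 → dzOf J α c = 0 →
      (B ![a, b, c]).re = 0 := by
    intro a b c ha hb hc
    obtain ⟨a', rfl⟩ := h.surj a ((dz_eq_zero_iff _).1 ha).1
    obtain ⟨b', rfl⟩ := h.surj b ((dz_eq_zero_iff _).1 hb).1
    obtain ⟨c', rfl⟩ := h.surj c ((dz_eq_zero_iff _).1 hc).1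
    have := hre a' b' c'
    rwa [ContinuousAlternatingMap.add_apply, hA0 ha hb hc, zero_add] at this
  have hJH : ∀ {a : V}, dzOf J α a = 0 → dzOf J α (J a) = 0 := fun {a} ha => by
    rw [dzOf_J' h.sq, ha, mul_zero]
  have h1 := hB.apply (Real.pi / 2) ![a, b, c]
  have h2 : (fun i => rot J (Real.pi / 2) (![a, b, c] i)) = ![J a, J b, J c] := by
    ext i; fin_cases i <;> simp [rot_pi_div_two]
  rw [h2, exp_weight_half_pi, one_mul, Complex.exp_pi_div_two_mul_I] at h1
  have h3 := hB0 (hJH ha) (hJH hb) (hJH hc)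
  rw [h1] at h3
  refine Complex.ext (hB0 ha hb hc) ?_
  simpa using h3

/-- The restriction of `χ` to the boundary, contracted with the Reeb field, is of type `(1,1)`
on the contact planes. -/
lemma reeb_contraction_invariant {A B : V [⋀^Fin 3]→L[ℝ] ℂ} (hA : HasWeight J 3 A)
    (hB : HasWeight J 1 B) (hre : ∀ a b c, ((A + B) ![ι a, ι b, ι c]).re = 0) {a b : V}
    (ha : dzOf J α a = 0) (hb : dzOf J α b = 0) :
    (A + B) ![ι R, J a, J b] = (A + B) ![ι R, a, b] := by
  have hJH : ∀ {a : V}, dzOf J α a = 0 → dzOf J α (J a) = 0 := fun {a} ha => by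
    rw [dzOf_J' h.sq, ha, mul_zero]
  have hre0 : ∀ {a b : V}, dzOf J α a = 0 → dzOf J α b = 0 →
      ((A + B) ![ι R, a, b]).re = 0 := by
    intro a b ha hb
    obtain ⟨a', rfl⟩ := h.surj a ((dz_eq_zero_iff _).1 ha).1
    obtain ⟨b', rfl⟩ := h.surj b ((dz_eq_zero_iff _).1 hb).1
    exact hre R a' b'
  have hAc := hA.clin_three h.sq
  have hA1 : ∀ a b, A ![ι R, J a, b] = Complex.I * A ![ι R, a, b] := by
    intro a b
    rw [form_swap₀, form_swap₀ A a (ι R)]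
    have := hAc a ![ι R, b]
    rw [this]; ring
  have hA2 : ∀ a b, A ![ι R, a, J b] = Complex.I * A ![ι R, a, b] := by
    intro a b
    rw [form_swap₁, hA1, form_swap₁ A _ a b]; ring
  -- `B` has no part which is antilinear in two arguments
  have hE : B ![ι R, a, J b] + Complex.I * B ![ι R, J a, J b] =
      Complex.I * B ![ι R, a, b] - B ![ι R, J a, b] := by
    have h2 : HasWeight J 2 (ins01 J B a) := by
      have := hB.ins01 h.sq a
      rwa [show (1 : ℂ) + 1 = 2 by norm_num] at this
    have h3 := h2.clin_two h.sq b ![ι R]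
    rw [ins01_apply, ins01_apply] at h3
    have e : ∀ x y, B ![x, y, ι R] = B ![ι R, x, y] := by
      intro x y
      rw [form_swap₁, form_swap₀]; ring
    simp only [e] at h3
    linear_combination h3 + B ![ι R, J a, b] * Complex.I_sq
  have hE' : (A + B) ![ι R, a, J b] + (A + B) ![ι R, J a, b] =
      Complex.I * ((A + B) ![ι R, a, b] - (A + B) ![ι R, J a, J b]) := by
    simp only [ContinuousAlternatingMap.add_apply, hA1, hA2]
    linear_combination hE + Complex.I * A ![ι R, a, b] * Complex.I_sq
  -- the values of `A + B` in `hE'` are imaginary, so that its two sides vanish separately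
  have h1 := congrArg Complex.re hE'
  have r1 := hre0 ha (hJH hb)
  have r2 := hre0 (hJH ha) hb
  have r3 := hre0 ha hb
  have r4 := hre0 (hJH ha) (hJH hb)
  rw [Complex.add_re, r1, r2, Complex.I_mul_re, Complex.sub_im] at h1
  exact Complex.ext (by rw [r3, r4]) (by linarith)

/-- If the real part of `χ = A + B` vanishes on the boundary, then `2 B` represents the
contraction of the imaginary part of `2 χ` with the Reeb field. -/
lemma representsAt {A B : V [⋀^Fin 3]→L[ℝ] ℂ} (hA : HasWeight J 3 A)
    (hB : HasWeight J 1 B) (hre : ∀ a b c, ((A + B) ![ι a, ι b, ι c]).re = 0)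
    {γ : W [⋀^Fin 2]→L[ℝ] ℝ} (hγ : ∀ u v, γ ![u, v] = 2 * ((A + B) ![ι R, ι u, ι v]).im) :
    RepresentsAt J α ι ((2 : ℂ) • B) γ := by
  obtain ⟨π, hπJ, hπ0, hπ1, hπ2⟩ := h.exists_horizontal_projection
  -- the contraction with the Reeb field, extended by the horizontal projection
  set g : V [⋀^Fin 2]→L[ℝ] ℂ :=
    (-2 * Complex.I) • ((A + B).curryLeft (ι R)).compContinuousLinearMap π with hg
  have hga : ∀ u v, g ![u, v] = -2 * Complex.I * (A + B) ![ι R, π u, π v] := by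
    intro u v
    change -2 * Complex.I * (A + B) (Matrix.vecCons (ι R) (fun i => π (![u, v] i))) = _
    congr 2
    ext i; fin_cases i <;> rfl
  have hg0 : HasWeight J 0 g := hasWeight_zero_of_invariant h.sq fun u v => by
    rw [hga, hga, hπJ, hπJ, h.reeb_contraction_invariant hA hB hre (hπ0 u) (hπ0 v)]
  have hν : HasWeight J 1 ((2 : ℂ) • B - wedge (dzOf J α) g) := by
    refine (hB.smul 2).sub ?_
    have := HasWeight.wedge (Or.inl rfl) (dzOf_J (α := α) h.sq) hg0
    rwa [show (0 : ℂ) + ((1 : ℤ) : ℂ) = 1 by push_cast; norm_num] at this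
  have hB0 := fun {a b c : V} => h.restrict_horizontal (a := a) (b := b) (c := c) hA hB hre
  -- the contractions of `2B - dz ∧ g` with `(0,1)`-vectors of the contact plane are complex linear
  -- `2`-forms, so it suffices that they vanish on vectors tangent to the boundary
  obtain ⟨μ, hμ, hνμ⟩ := exists_normal_three h.sq h.normal_apply h.normal_J_apply hν
    (fun u hu hu' => by
      have hu0 : dzOf J α u = 0 := (dz_eq_zero_iff u).2 ⟨hu, hu'⟩
      have hJu0 : dzOf J α (J u) = 0 := by rw [dzOf_J' h.sq, hu0, mul_zero]
      have h2 : HasWeight J 2 (ins01 J ((2 : ℂ) • B - wedge (dzOf J α) g) u) := by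
        have := hν.ins01 h.sq u
        rwa [show (1 : ℂ) + 1 = 2 by norm_num] at this
      set f := ins01 J ((2 : ℂ) • B - wedge (dzOf J α) g) u with hf
      have hfa : ∀ a b, f ![a, b] = 2 * (B ![u, a, b] + Complex.I * B ![J u, a, b]) +
          (dzOf J α a * (g ![u, b] + Complex.I * g ![J u, b]) -
            dzOf J α b * (g ![u, a] + Complex.I * g ![J u, a])) := by
        intro a b
        rw [hf, ins01_apply, ContinuousAlternatingMap.sub_apply,
          ContinuousAlternatingMap.sub_apply, wedge_two_apply, wedge_two_apply, hu0, hJu0]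
        simp only [ContinuousAlternatingMap.smul_apply, smul_eq_mul]
        ring
      have hff : ∀ a b, dzOf J α a = 0 → dzOf J α b = 0 → f ![a, b] = 0 := by
        intro a b ha hb
        rw [hfa, ha, hb, hB0 hu0 ha hb, hB0 hJu0 ha hb]
        ring
      have hfT : ∀ b, dzOf J α b = 0 → f ![ι R, b] = 0 := by
        intro b hb
        have hAJ : A ![ι R, J u, b] = Complex.I * A ![ι R, u, b] := by
          rw [form_swap₀, form_swap₀ A u (ι R), hA.clin_three h.sq]; ring
        rw [hfa, hb, h.dz_reeb, hga, hga, hπ1 u hu0, hπ1 _ hJu0, hπ1 b hb, form_swap₀ B (ι R) u,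
          form_swap₀ B (ι R) (J u)]
        simp only [ContinuousAlternatingMap.add_apply, hAJ]
        linear_combination (-2 * (A ![ι R, u, b] + B ![ι R, u, b]) -
          2 * Complex.I * (Complex.I * A ![ι R, u, b] + B ![ι R, J u, b]) +
          2 * A ![ι R, u, b]) * Complex.I_sq
      refine h.clin_two_eq_zero (h2.clin_two h.sq) fun a b => ?_
      have ea := hπ2 (ι a)
      have eb := hπ2 (ι b)
      rw [h.tangent, neg_zero, zero_smul, add_zero] at ea eb
      have hTT : f ![ι R, ι R] = 0 := by
        have := form_swap₀ f (ι R) (ι R) ![]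
        linear_combination (1 / 2) * this
      rw [ea, eb, form_add₀, form_add₁, form_smul₀, form_add₁, form_smul₁, form_smul₁,
        hff _ _ (hπ0 _) (hπ0 _), form_swap₀ f (ι R), hfT _ (hπ0 _), hfT _ (hπ0 _), hTT]
      simp)
  refine ⟨g, μ, hg0, hμ, fun u v hu hv => ?_, ?_⟩
  · have hu0 : dzOf J α (ι u) = 0 := (dz_eq_zero_iff _).2 ⟨h.tangent u, hu⟩
    have hv0 : dzOf J α (ι v) = 0 := (dz_eq_zero_iff _).2 ⟨h.tangent v, hv⟩
    rw [hga, hπ1 _ hu0, hπ1 _ hv0, hγ]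
    have := hre R u v
    apply Complex.ext
    · simp
    · simpa using this
  · rw [← hνμ]; abel

end IsBoundaryFrame

end Frame

/-! ### Restriction to the boundary at a point -/

section Frame

variable {V : Type*} [NormedAddCommGroup V] [NormedSpace ℝ V]
  {W : Type*} [NormedAddCommGroup W] [NormedSpace ℝ W]
variable {J : V →L[ℝ] V} {α : V →L[ℝ] ℝ} {ι : W →L[ℝ] V} {R : W}

lemma wedge_one_apply (ζ : V →L[ℝ] ℂ) (μ : V [⋀^Fin 1]→L[ℝ] ℂ) (a b : V) :
    wedge ζ μ ![a, b] = ζ a * μ ![b] - ζ b * μ ![a] := by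
  rw [wedge_apply, wedgeCovector, Fin.sum_univ_two]
  have h0 : (0 : Fin 2).removeNth ![a, b] = ![b] := by ext i; fin_cases i; rfl
  have h1 : (1 : Fin 2).removeNth ![a, b] = ![a] := by ext i; fin_cases i; rfl
  rw [h0, h1]
  simp
  ring

lemma RepresentsAt.add {σ₁ σ₂ : V [⋀^Fin 3]→L[ℝ] ℂ} {γ₁ γ₂ : W [⋀^Fin 2]→L[ℝ] ℝ}
    (h₁ : RepresentsAt J α ι σ₁ γ₁) (h₂ : RepresentsAt J α ι σ₂ γ₂) :
    RepresentsAt J α ι (σ₁ + σ₂) (γ₁ + γ₂) := by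
  obtain ⟨g₁, μ₁, a₁, b₁, c₁, d₁⟩ := h₁
  obtain ⟨g₂, μ₂, a₂, b₂, c₂, d₂⟩ := h₂
  refine ⟨g₁ + g₂, μ₁ + μ₂, a₁.add a₂, b₁.add b₂, fun u u' hu hu' => ?_, ?_⟩
  · rw [ContinuousAlternatingMap.add_apply, ContinuousAlternatingMap.add_apply, c₁ u u' hu hu',
      c₂ u u' hu hu']
    push_cast; rfl
  · rw [d₁, d₂, wedge_add, wedge_add]; abel

lemma RepresentsAt.smul (c : ℝ) {σ : V [⋀^Fin 3]→L[ℝ] ℂ} {γ : W [⋀^Fin 2]→L[ℝ] ℝ}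
    (h : RepresentsAt J α ι σ γ) : RepresentsAt J α ι ((c : ℂ) • σ) (c • γ) := by
  obtain ⟨g, μ, a, b, e, d⟩ := h
  refine ⟨(c : ℂ) • g, (c : ℂ) • μ, a.smul _, b.smul _, fun u u' hu hu' => ?_, ?_⟩
  · rw [ContinuousAlternatingMap.smul_apply, ContinuousAlternatingMap.smul_apply, e u u' hu hu']
    simp
  · rw [d, wedge_smul, wedge_smul, smul_add]

namespace IsBoundaryFrame

variable (h : IsBoundaryFrame J α ι R)
include h

lemma dz_tangent (u : W) : dzOf J α (ι u) = Complex.I * (-α (J (ι u)) : ℝ) := by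
  rw [dzOf_apply, h.tangent]; push_cast; ring

lemma dzbar_tangent (u : W) : dzbarOf J α (ι u) = -(Complex.I * (-α (J (ι u)) : ℝ)) := by
  rw [dzbarOf_apply, h.tangent]; push_cast; ring

/-- The restriction to the boundary of a form representing `γ` is `i θ ∧ γ` up to a multiple of
the holomorphic volume form. -/
lemma exists_restrict_eq {θ : W →L[ℝ] ℝ} (hθ : ∀ u, θ u = -α (J (ι u)))
    {Φ : V [⋀^Fin 3]→L[ℝ] ℂ} (hΦ : CLin J Φ) (hΦ0 : Φ ≠ 0)
    {σ : V [⋀^Fin 3]→L[ℝ] ℂ} {γ : W [⋀^Fin 2]→L[ℝ] ℝ} (hσ : RepresentsAt J α ι σ γ) :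
    ∃ f : ℂ, σ.compContinuousLinearMap ι =
      Complex.I • complexify (wedge θ γ) + f • Φ.compContinuousLinearMap ι := by
  obtain ⟨g, μ, hg, hμ, hγ, rfl⟩ := hσ
  have hθR : θ R = 1 := by rw [hθ, h.reeb, neg_neg]
  -- on vectors tangent to the boundary `dz̄ = -dz`, so `dz̄ ∧ μ` may be replaced by the complex
  -- linear form `-dz ∧ μ`, a multiple of `Φ`
  have h3 : HasWeight J 3 (wedge (dzOf J α) μ) := by
    have := HasWeight.wedge (Or.inl rfl) (dzOf_J (α := α) h.sq) hμ
    rwa [show (2 : ℂ) + ((1 : ℤ) : ℂ) = 3 by push_cast; norm_num] at this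
  obtain ⟨c, hc⟩ := CLin.exists_eq_smul hΦ hΦ0 (h3.clin_three h.sq) h.sq h.finrank
  have h4 : wedge (toC θ) (g.compContinuousLinearMap ι - complexify γ) = 0 := by
    refine wedge_eq_zero_of_ker hθR (fun u => rfl) fun w hw => ?_
    have hw' : w = ![w 0, w 1] := by ext i; fin_cases i <;> rfl
    have h5 := hγ (w 0) (w 1) (by have := hw 0; rw [hθ] at this; linarith)
      (by have := hw 1; rw [hθ] at this; linarith)
    rw [hw', ContinuousAlternatingMap.sub_apply, sub_eq_zero]
    refine Eq.trans ?_ h5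
    change g (fun i => ι (![w 0, w 1] i)) = _
    congr 1
    ext i; fin_cases i <;> rfl
  refine ⟨-c, ?_⟩
  ext v
  have hv : v = ![v 0, v 1, v 2] := by ext i; fin_cases i <;> rfl
  rw [hv]
  have e3 : ∀ ψ : V [⋀^Fin 3]→L[ℝ] ℂ, ψ.compContinuousLinearMap ι ![v 0, v 1, v 2] =
      ψ ![ι (v 0), ι (v 1), ι (v 2)] := by
    intro ψ
    change ψ (fun i => ι (![v 0, v 1, v 2] i)) = _
    congr 1; ext i; fin_cases i <;> rfl
  have e2 : ∀ (ψ : V [⋀^Fin 2]→L[ℝ] ℂ) (a b : W), ψ.compContinuousLinearMap ι ![a, b] =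
      ψ ![ι a, ι b] := by
    intro ψ a b
    change ψ (fun i => ι (![a, b] i)) = _
    congr 1; ext i; fin_cases i <;> rfl
  have h6 := congrArg (fun ψ => ψ ![v 0, v 1, v 2]) h4
  have h7 := congrArg (fun ψ => ψ ![ι (v 0), ι (v 1), ι (v 2)]) hc
  have hco : ∀ {k : ℕ} (ψ : W [⋀^Fin k]→L[ℝ] ℝ) (w : Fin k → W), complexify ψ w = (ψ w : ℂ) :=
    fun _ _ => rfl
  simp only [wedge_two_apply, ContinuousAlternatingMap.sub_apply, e2, hco, toC_apply, hθ,
    ContinuousAlternatingMap.coe_zero, Pi.zero_apply] at h6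
  simp only [wedge_two_apply, ContinuousAlternatingMap.smul_apply, h.dz_tangent,
    smul_eq_mul] at h7
  rw [e3]
  simp only [ContinuousAlternatingMap.add_apply, ContinuousAlternatingMap.smul_apply, e3, hco,
    wedge_two_apply, h.dz_tangent, h.dzbar_tangent, hθ, smul_eq_mul]
  push_cast at h6 h7 ⊢
  linear_combination Complex.I * h6 - h7

/-- A form representing zero is normal. -/
lemma exists_normal_of_representsAt_zero {σ : V [⋀^Fin 3]→L[ℝ] ℂ}
    (hσ : RepresentsAt J α ι σ (0 : W [⋀^Fin 2]→L[ℝ] ℝ)) :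
    ∃ μ : V [⋀^Fin 2]→L[ℝ] ℂ, HasWeight J 2 μ ∧ σ = wedge (dzbarOf J α) μ := by
  obtain ⟨g, μ, hg, hμ, hγ, rfl⟩ := hσ
  obtain ⟨π, hπJ, hπ0, hπ1, hπ2⟩ := h.exists_horizontal_projection
  have h1 : HasWeight J 1 (wedge (dzOf J α) g) := by
    have := HasWeight.wedge (Or.inl rfl) (dzOf_J (α := α) h.sq) hg
    rwa [show (0 : ℂ) + ((1 : ℤ) : ℂ) = 1 by push_cast; norm_num] at this
  have hgH : ∀ a b, dzOf J α a = 0 → dzOf J α b = 0 → g ![a, b] = 0 := by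
    intro a b ha hb
    obtain ⟨a', rfl⟩ := h.surj a ((dz_eq_zero_iff _).1 ha).1
    obtain ⟨b', rfl⟩ := h.surj b ((dz_eq_zero_iff _).1 hb).1
    rw [hγ a' b' ((dz_eq_zero_iff _).1 ha).2 ((dz_eq_zero_iff _).1 hb).2]
    simp
  obtain ⟨μ', hμ', he⟩ := exists_normal_three h.sq h.normal_apply h.normal_J_apply h1
    (fun u hu hu' => by
      have hu0 : dzOf J α u = 0 := (dz_eq_zero_iff u).2 ⟨hu, hu'⟩
      have hJu0 : dzOf J α (J u) = 0 := by rw [dzOf_J' h.sq, hu0, mul_zero]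
      have h2 : HasWeight J 2 (ins01 J (wedge (dzOf J α) g) u) := by
        have := h1.ins01 h.sq u
        rwa [show (1 : ℂ) + 1 = 2 by norm_num] at this
      refine h.clin_two_eq_zero (h2.clin_two h.sq) fun a b => ?_
      have hq : ∀ a, ∃ q : ℝ, dzOf J α (ι a) = q * Complex.I ∧
          ins01 J g u ![ι a] = q * ins01 J g u ![ι R] := by
        intro a
        refine ⟨-α (J (ι a)), by rw [h.dz_tangent, mul_comm], ?_⟩
        have ea := hπ2 (ι a)
        rw [h.tangent, neg_zero, zero_smul, add_zero] at ea
        conv_lhs => rw [ea]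
        rw [form_add₀, form_smul₀, ins01_apply, hgH _ _ hu0 (hπ0 _), hgH _ _ hJu0 (hπ0 _)]
        simp
      obtain ⟨qa, ha1, ha2⟩ := hq a
      obtain ⟨qb, hb1, hb2⟩ := hq b
      rw [ins01_wedge, hu0, hJu0, ContinuousAlternatingMap.sub_apply,
        ContinuousAlternatingMap.smul_apply, wedge_one_apply, ha1, ha2, hb1, hb2]
      simp only [smul_eq_mul]
      ring)
  exact ⟨μ' + μ, hμ'.add hμ, by rw [he, wedge_add]⟩

/-- If the restriction to the boundary of a `4`-form with components of weights `2` and `0` is a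
multiple of the holomorphic volume form, the component of weight `0` is normal. -/
lemma exists_normal_of_restrict_eq {Φ : V [⋀^Fin 3]→L[ℝ] ℂ} (hΦ : CLin J Φ)
    {D₂ D₀ : V [⋀^Fin 4]→L[ℝ] ℂ} (h2 : HasWeight J 2 D₂) (h0 : HasWeight J 0 D₀)
    {ζ : W →L[ℝ] ℂ}
    (hD : (D₂ + D₀).compContinuousLinearMap ι = wedge ζ (Φ.compContinuousLinearMap ι)) :
    ∃ μ : V [⋀^Fin 3]→L[ℝ] ℂ, HasWeight J 1 μ ∧ D₀ = wedge (dzbarOf J α) μ := by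
  refine exists_normal_four h.sq h.normal_apply h.normal_J_apply h0 fun u v hu hu' hv hv' => ?_
  have e0 : ins01 J (ins01 J D₀ u) v = ins01 J (ins01 J (D₂ + D₀) u) v := by
    have h3 : HasWeight J 3 (ins01 J D₂ u) := by
      have := h2.ins01 h.sq u
      rwa [show (2 : ℂ) + 1 = 3 by norm_num] at this
    rw [ins01_add, ins01_add, clin_iff.1 (h3.clin_three h.sq) v, zero_add]
  have hw : HasWeight J 2 (ins01 J (ins01 J D₀ u) v) := by
    have := (h0.ins01 h.sq u).ins01 h.sq v
    rwa [show (0 : ℂ) + 1 + 1 = 2 by norm_num] at this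
  refine h.clin_two_eq_zero (hw.clin_two h.sq) fun a b => ?_
  rw [e0]
  obtain ⟨u₁, hu₁⟩ := h.surj u hu
  obtain ⟨u₂, hu₂⟩ := h.surj (J u) hu'
  obtain ⟨v₁, hv₁⟩ := h.surj v hv
  obtain ⟨v₂, hv₂⟩ := h.surj (J v) hv'
  have hDa : ∀ a b c d, (D₂ + D₀) ![ι a, ι b, ι c, ι d] =
      ζ a * Φ ![ι b, ι c, ι d] - ζ b * Φ ![ι a, ι c, ι d] + ζ c * Φ ![ι a, ι b, ι d]
        - ζ d * Φ ![ι a, ι b, ι c] := by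
    intro a b c d
    have e3 : ∀ a b c, Φ.compContinuousLinearMap ι ![a, b, c] = Φ ![ι a, ι b, ι c] := by
      intro a b c
      change Φ (fun i => ι (![a, b, c] i)) = _
      congr 1; ext i; fin_cases i <;> rfl
    have := congrArg (fun ψ => ψ ![a, b, c, d]) hD
    simp only [wedge_three_apply, e3] at this
    rw [← this]
    change _ = (D₂ + D₀) (fun i => ι (![a, b, c, d] i))
    congr 1; ext i; fin_cases i <;> rfl
  have hΦ1 : ∀ c d, Φ ![J u, c, d] = Complex.I * Φ ![u, c, d] := fun c d => hΦ u ![c, d]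
  have hΦ2 : ∀ c d, Φ ![J v, c, d] = Complex.I * Φ ![v, c, d] := fun c d => hΦ v ![c, d]
  have hΦ3 : ∀ c d, Φ ![c, J v, d] = Complex.I * Φ ![c, v, d] := fun c d => by
    rw [form_swap₀, hΦ2, form_swap₀]; ring
  -- expand the double contraction of `ζ ∧ Φ`; the terms cancel by the complex linearity of `Φ`
  rw [ins01_apply, ins01_apply, ins01_apply]
  rw [← hu₂, ← hv₂, ← hu₁, ← hv₁]
  simp only [hDa]
  simp only [hu₁, hu₂, hv₁, hv₂, hΦ1, hΦ2, hΦ3]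
  linear_combination ((ζ a * Φ ![u, v, ι b] - ζ b * Φ ![u, v, ι a]) * (1 + Complex.I ^ 2) +
    ζ u₁ * Φ ![v, ι a, ι b] + Complex.I * ζ u₂ * Φ ![v, ι a, ι b] - ζ v₁ * Φ ![u, ι a, ι b]
    - Complex.I * ζ v₂ * Φ ![u, ι a, ι b]) * Complex.I_sq

omit h in
/-- If `ζ ∧ Φ = 0` on the image of `ι`, then `ζ` is complex linear there. -/
lemma _root_.CYBoundary.covector_clin_of_wedge_eq_zero {Φ : V [⋀^Fin 3]→L[ℝ] ℂ} (hΦ : CLin J Φ)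
    {ζ : W →L[ℝ] ℂ} (h0 : wedge ζ (Φ.compContinuousLinearMap ι) = 0)
    (hnd : ∀ u, (∀ a b, Φ ![ι u, ι a, ι b] = 0) → u = 0) {u u' : W} (hu : ι u' = J (ι u)) :
    ζ u' = Complex.I * ζ u := by
  by_cases hu0 : u = 0
  · subst hu0
    rw [map_zero, map_zero] at hu
    have : u' = 0 := hnd u' fun a b => by
      rw [hu]
      have := form_smul₀ Φ 0 (0 : V) ![ι a, ι b]
      rw [zero_smul, zero_smul] at this
      exact this
    rw [this]; simp
  · by_contra hne
    refine hu0 (hnd u fun a b => ?_)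
    have e3 : ∀ a b c, Φ.compContinuousLinearMap ι ![a, b, c] = Φ ![ι a, ι b, ι c] := by
      intro a b c
      change Φ (fun i => ι (![a, b, c] i)) = _
      congr 1; ext i; fin_cases i <;> rfl
    have h1 := wedge_three_apply ζ (Φ.compContinuousLinearMap ι) u u' a b
    rw [h0] at h1
    have hΦ1 : ∀ c d, Φ ![J (ι u), c, d] = Complex.I * Φ ![ι u, c, d] := fun c d => hΦ _ ![c, d]
    have hΦ2 : ∀ d, Φ ![ι u, J (ι u), d] = 0 := fun d => by
      rw [form_swap₀, hΦ1]
      have := form_swap₀ Φ (ι u) (ι u) ![d]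
      have h2 : Φ ![ι u, ι u, d] = 0 := by linear_combination (1 / 2) * this
      rw [h2]; simp
    simp only [e3, hu, hΦ1, hΦ2, ContinuousAlternatingMap.coe_zero, Pi.zero_apply] at h1
    have h3 : (ζ u' - Complex.I * ζ u) * Φ ![ι u, ι a, ι b] = 0 := by
      linear_combination h1
    exact (mul_eq_zero.1 h3).resolve_left (sub_ne_zero.2 hne)

/-- The restriction of the volume form to the boundary is nondegenerate. -/
lemma volume_nondegenerate {Φ : V [⋀^Fin 3]→L[ℝ] ℂ} (hΦ : CLin J Φ) (hΦ0 : Φ ≠ 0) (u : W)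
    (hu : ∀ a b, Φ ![ι u, ι a, ι b] = 0) : u = 0 := by
  have hc : CLin J (Φ.curryLeft (ι u)) := by
    intro x w
    change Φ (Matrix.vecCons (ι u) (Matrix.vecCons (J x) w)) =
      Complex.I * Φ (Matrix.vecCons (ι u) (Matrix.vecCons x w))
    rw [form_swap₀, hΦ, form_swap₀]; ring
  have h1 := h.clin_two_eq_zero hc hu
  have hu' := CLin.existsUnique_contraction hΦ hΦ0 (ν := (0 : V [⋀^Fin 2]→L[ℝ] ℂ))
    (fun _ _ => by change (0 : ℂ) = _ * 0; simp) h.sq h.finrank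
  obtain ⟨w, _, huniq⟩ := hu'
  have e1 := huniq (ι u) fun a b => congrArg (fun ψ => ψ ![a, b]) h1
  have e2 := huniq 0 fun a b => by
    have := form_smul₀ Φ 0 (0 : V) ![a, b]
    rw [zero_smul, zero_smul] at this
    exact this
  exact h.inj (by rw [e1, map_zero]; exact e2.symm)

end IsBoundaryFrame

end Frame

/-! ### The contact structure of the boundary -/

section Covectors

variable {E : Type*} [NormedAddCommGroup E] [NormedSpace ℝ E]
  {H : Type*} [TopologicalSpace H] {I : ModelWithCorners ℝ E H}
  {X : Type*} [TopologicalSpace X] [ChartedSpace H X]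
  {E' : Type*} [NormedAddCommGroup E'] [NormedSpace ℝ E']
  {H' : Type*} [TopologicalSpace H'] {I' : ModelWithCorners ℝ E' H'}
  {Y : Type*} [TopologicalSpace Y] [ChartedSpace H' Y]
  {F : Type*} [NormedAddCommGroup F] [NormedSpace ℝ F]

lemma isSmoothCov_of_isSmoothForm {c : X → E →L[ℝ] F} (h : IsSmoothForm (Form.ofCov I c)) :
    IsSmoothCov I c := by
  intro x₀ p hp
  have h1 := h.contDiffWithinAt hp
  have h2 : ContDiffWithinAt ℝ ∞ (fun q => (ContinuousAlternatingMap.ofSubsingletonLIE (𝕜 := ℝ)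
      (E := E) (F := F) (0 : Fin 1)).symm (chartRep x₀ (Form.ofCov I c) q)) (range I) p :=
    (ContinuousAlternatingMap.ofSubsingletonLIE (𝕜 := ℝ) (E := E) (F := F)
      (0 : Fin 1)).symm.contDiff.comp_contDiffWithinAt h1
  have h3 : ∀ q, covRep I x₀ c q = (ContinuousAlternatingMap.ofSubsingletonLIE (𝕜 := ℝ)
      (E := E) (F := F) (0 : Fin 1)).symm (chartRep x₀ (Form.ofCov I c) q) := fun q =>
    ((ContinuousAlternatingMap.ofSubsingletonLIE (𝕜 := ℝ) (E := E) (F := F)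
      (0 : Fin 1)).symm_apply_apply (covRep I x₀ c q)).symm
  exact h2.congr_of_eventuallyEq (Filter.Eventually.of_forall h3) (h3 p)

lemma pullback_ofCov (f : Y → X) (c : X → E →L[ℝ] F) :
    (pullback f (Form.ofCov I c) : Form I' Y F 1) =
      Form.ofCov I' (fun y => c (f y) ∘L dMap I' I f y) := rfl

/-- Covector fields pull back to smooth covector fields. -/
lemma IsSmoothCov.pullback [IsManifold I ∞ X] [IsManifold I' ∞ Y] [FiniteDimensional ℝ E']
    [FiniteDimensional ℝ F] {f : Y → X} (hf : ContMDiff I' I ∞ f) {c : X → E →L[ℝ] F}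
    (hc : IsSmoothCov I c) : IsSmoothCov I' (fun y => c (f y) ∘L dMap I' I f y) := by
  refine isSmoothCov_of_isSmoothForm ?_
  rw [← pullback_ofCov]
  exact (isSmoothForm_ofCov hc).pullback hf

end Covectors

namespace StronglyPseudoconvexBoundary

variable {Z : Type*} [TopologicalSpace Z] [ChartedSpace (EuclideanHalfSpace 6) Z]
  [IsManifold (𝓡∂ 6) ∞ Z]
  {M : Type*} [TopologicalSpace M] [ChartedSpace (EuclideanSpace ℝ (Fin 5)) M]
  [IsManifold (𝓡 5) ∞ M] {C : CalabiYau Z} (B : StronglyPseudoconvexBoundary C M)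

/-- The differential of the inclusion of the boundary, between the model spaces. -/
def ι (y : M) : EuclideanSpace ℝ (Fin 5) →L[ℝ] EuclideanSpace ℝ (Fin 6) :=
  dMap (𝓡 5) (𝓡∂ 6) B.incl y

/-- The covector `dr`, on the model space. -/
def α (x : Z) : EuclideanSpace ℝ (Fin 6) →L[ℝ] ℝ := dFun (𝓡∂ 6) B.r x

/-- The contact form, on the model space. -/
def θv (y : M) : EuclideanSpace ℝ (Fin 5) →L[ℝ] ℝ := B.θ y

lemma θv_apply (y : M) (u : EuclideanSpace ℝ (Fin 5)) :
    B.θv y u = -B.α (B.incl y) (C.Jv (B.incl y) (B.ι y u)) := rfl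

lemma restrict_val {F : Type*} [NormedAddCommGroup F] [NormedSpace ℝ F] {k : ℕ}
    (φ : Form (𝓡∂ 6) Z F k) (y : M) :
    (B.restrict φ).val y = (φ.val (B.incl y)).compContinuousLinearMap (B.ι y) := rfl

lemma incl_mem_boundary (y : M) : B.incl y ∈ (𝓡∂ 6).boundary Z :=
  B.range_incl ▸ mem_range_self y

lemma exists_incl_eq {x : Z} (hx : x ∈ (𝓡∂ 6).boundary Z) : ∃ y, B.incl y = x := by
  rw [← B.range_incl] at hx; exact hx

lemma isSmoothCov_α : IsSmoothCov (𝓡∂ 6) B.α := isSmoothCov_dFun B.r_smooth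

lemma α_ne_zero (y : M) : B.α (B.incl y) ≠ 0 := B.dr_ne_zero _ (B.incl_mem_boundary y)

lemma ι_injective (y : M) : Function.Injective (B.ι y) := B.incl_immersion y

lemma α_ι (y : M) (u : EuclideanSpace ℝ (Fin 5)) : B.α (B.incl y) (B.ι y u) = 0 := by
  have h1 : MDifferentiableAt (𝓡∂ 6) 𝓘(ℝ, ℝ) B.r (B.incl y) :=
    B.r_smooth.mdifferentiableAt (by simp)
  have h2 : MDifferentiableAt (𝓡 5) (𝓡∂ 6) B.incl y := B.incl_smooth.mdifferentiableAt (by simp)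
  have h3 := mfderiv_comp y h1 h2
  have h4 : B.r ∘ B.incl = fun _ => 0 := by
    funext y; exact (B.r_eq_zero_iff _).2 (B.incl_mem_boundary y)
  rw [h4, mfderiv_const] at h3
  exact (DFunLike.congr_fun h3 u).symm

lemma ι_surj (y : M) (v : EuclideanSpace ℝ (Fin 6)) (hv : B.α (B.incl y) v = 0) :
    ∃ u, B.ι y u = v := by
  have h1 : LinearMap.range (B.ι y).toLinearMap ≤ LinearMap.ker (B.α (B.incl y)).toLinearMap := by
    rintro _ ⟨u, rfl⟩
    exact B.α_ι y u
  have h2 : Module.finrank ℝ (LinearMap.range (B.ι y).toLinearMap) = 5 := by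
    rw [LinearMap.finrank_range_of_inj (B.ι_injective y)]; simp
  have h3 : Module.finrank ℝ (LinearMap.ker (B.α (B.incl y)).toLinearMap) = 5 := by
    have h := LinearMap.finrank_range_add_finrank_ker (B.α (B.incl y)).toLinearMap
    have hr : LinearMap.range (B.α (B.incl y)).toLinearMap = ⊤ := by
      refine LinearMap.range_eq_top.2 (LinearMap.surjective ?_)
      exact fun h => B.α_ne_zero y (ContinuousLinearMap.coe_injective h)
    rw [hr, finrank_top, Module.finrank_self, finrank_model] at h
    omega
  have h4 := Submodule.eq_of_le_of_finrank_eq h1 (h2.trans h3.symm)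
  have h5 : v ∈ LinearMap.ker (B.α (B.incl y)).toLinearMap := hv
  rw [← h4] at h5
  exact h5

lemma memH_iff' (y : M) (u : EuclideanSpace ℝ (Fin 5)) :
    B.MemH y u ↔ ∃ u', B.ι y u' = C.Jv (B.incl y) (B.ι y u) := Iff.rfl

lemma memH_iff (y : M) (u : EuclideanSpace ℝ (Fin 5)) : B.MemH y u ↔ B.θv y u = 0 := by
  rw [memH_iff']
  constructor
  · rintro ⟨u', h⟩
    rw [θv_apply, ← h, B.α_ι, neg_zero]
  · intro h
    rw [θv_apply, neg_eq_zero] at h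
    obtain ⟨u', hu'⟩ := B.ι_surj y _ h
    exact ⟨u', hu'⟩

lemma θv_of_isJPair {y : M} {u u' : EuclideanSpace ℝ (Fin 5)}
    (h : B.ι y u' = C.Jv (B.incl y) (B.ι y u)) : B.θv y u = 0 ∧ B.θv y u' = 0 := by
  constructor
  · rw [θv_apply, ← h, B.α_ι, neg_zero]
  · rw [θv_apply, h, C.Jv_sq, map_neg, B.α_ι, neg_zero, neg_zero]

/-- The contact form does not vanish, as the kernel of `dr` has odd dimension and so cannot be
invariant under `J`. -/
lemma θv_ne_zero (y : M) : B.θv y ≠ 0 := by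
  intro h0
  have h1 : ∀ v, B.α (B.incl y) v = 0 → B.α (B.incl y) (C.Jv (B.incl y) v) = 0 := by
    intro v hv
    obtain ⟨u, rfl⟩ := B.ι_surj y v hv
    have := DFunLike.congr_fun h0 u
    rw [θv_apply] at this
    exact neg_eq_zero.1 this
  obtain ⟨n, hn⟩ : ∃ n, B.α (B.incl y) n ≠ 0 := by
    by_contra! h
    exact B.α_ne_zero y (ContinuousLinearMap.ext h)
  set a := B.α (B.incl y) with ha
  have h2 := h1 (C.Jv (B.incl y) n - (a (C.Jv (B.incl y) n) / a n) • n) (by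
    rw [map_sub, map_smul, smul_eq_mul]; field_simp; ring)
  rw [map_sub, map_sub, map_smul, map_smul, C.Jv_sq, map_neg, smul_eq_mul] at h2
  have h3 : (a n) ^ 2 + (a (C.Jv (B.incl y) n)) ^ 2 = 0 := by
    field_simp at h2
    linarith
  have := pow_pos (abs_pos.2 hn) 2
  rw [sq_abs] at this
  nlinarith [sq_nonneg (a (C.Jv (B.incl y) n))]

lemma isSmoothCov_θv : IsSmoothCov (𝓡 5) B.θv := by
  have h := ((B.isSmoothCov_α.comp_end C.J_smooth).comp_left
    (-ContinuousLinearMap.id ℝ ℝ)).pullback B.incl_smooth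
  refine (congrArg (IsSmoothCov (𝓡 5)) ?_).mp h
  funext y
  ext u
  rfl

lemma isSmoothForm_dθ : IsSmoothForm B.dθ := by
  have h : B.dθ = extD (Form.ofCov (𝓡 5) B.θv) := rfl
  rw [h]
  exact (isSmoothForm_ofCov B.isSmoothCov_θv).extD

/-- The endomorphism `u ↦ θ(u) θ + dθ(u, ·)`, whose inverse sends `θ` to the Reeb field. -/
def reebOp (y : M) : EuclideanSpace ℝ (Fin 5) →L[ℝ] EuclideanSpace ℝ (Fin 5) [⋀^Fin 1]→L[ℝ] ℝ :=
  (B.θv y).smulRight ((Form.ofCov (𝓡 5) B.θv).val y) + (B.dθ.val y).curryLeft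

lemma reebOp_apply (y : M) (u v : EuclideanSpace ℝ (Fin 5)) :
    B.reebOp y u ![v] = B.θv y u * B.θv y v + B.dθ.val y ![u, v] := rfl

lemma levi (y : M) {u u' : EuclideanSpace ℝ (Fin 5)}
    (h : B.ι y u' = C.Jv (B.incl y) (B.ι y u)) (hu : u ≠ 0) : 0 < B.dθ.val y ![u, u'] :=
  B.levi_pos y u u' h hu

lemma form_self {V : Type*} [NormedAddCommGroup V] [NormedSpace ℝ V] (f : V [⋀^Fin 2]→L[ℝ] ℝ)
    (u : V) : f ![u, u] = 0 := by
  have := form_swap₀ f u u ![]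
  linarith

lemma reebOp_injective (y : M) : Function.Injective (B.reebOp y) := by
  refine (injective_iff_map_eq_zero _).2 fun u hu => ?_
  by_contra hne
  have h1 : ∀ v, B.θv y u * B.θv y v + B.dθ.val y ![u, v] = 0 := fun v => by
    rw [← reebOp_apply, hu]; rfl
  have h2 := h1 u
  rw [form_self, add_zero, mul_self_eq_zero] at h2
  obtain ⟨u', hu'⟩ := (B.memH_iff y u).2 h2
  have h3 := B.levi y hu' hne
  have h4 := h1 u'
  rw [h2, zero_mul, zero_add] at h4
  linarith

lemma finrank_oneForms : Module.finrank ℝ (EuclideanSpace ℝ (Fin 5)) =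
    Module.finrank ℝ (EuclideanSpace ℝ (Fin 5) [⋀^Fin 1]→L[ℝ] ℝ) := by
  rw [← (ContinuousAlternatingMap.ofSubsingletonLIE (𝕜 := ℝ) (E := EuclideanSpace ℝ (Fin 5))
    (F := ℝ) (0 : Fin 1)).toLinearEquiv.finrank_eq]
  rw [← (LinearMap.toContinuousLinearMap (𝕜 := ℝ) (E := EuclideanSpace ℝ (Fin 5))
    (F' := ℝ)).finrank_eq]
  exact Subspace.dual_finrank_eq.symm

lemma exists_reeb (y : M) : ∃ R, B.reebOp y R = (Form.ofCov (𝓡 5) B.θv).val y := by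
  have := finiteDimensional_alternating (EuclideanSpace ℝ (Fin 5)) ℝ 1
  exact (LinearMap.injective_iff_surjective_of_finrank_eq_finrank
    (f := (B.reebOp y).toLinearMap) finrank_oneForms).1 (B.reebOp_injective y) _

/-- The Reeb field of the contact form. -/
def reeb (y : M) : EuclideanSpace ℝ (Fin 5) := (B.exists_reeb y).choose

lemma reebOp_reeb (y : M) : B.reebOp y (B.reeb y) = (Form.ofCov (𝓡 5) B.θv).val y :=
  (B.exists_reeb y).choose_spec

lemma θv_reeb_mul (y : M) (v : EuclideanSpace ℝ (Fin 5)) :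
    B.θv y (B.reeb y) * B.θv y v + B.dθ.val y ![B.reeb y, v] = B.θv y v := by
  rw [← reebOp_apply, reebOp_reeb]; rfl

lemma θv_reeb (y : M) : B.θv y (B.reeb y) = 1 := by
  have h1 := B.θv_reeb_mul y (B.reeb y)
  rw [form_self, add_zero] at h1
  by_contra hne
  have h2 : B.θv y (B.reeb y) = 0 := by
    by_contra h0
    exact hne (mul_left_cancel₀ h0 (by rw [h1, mul_one]))
  obtain ⟨u', hu'⟩ := (B.memH_iff y _).2 h2
  have h3 := B.θv_reeb_mul y u'
  rw [h2, zero_mul, zero_add, (B.θv_of_isJPair hu').2] at h3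
  have h4 : B.reeb y = 0 := by
    by_contra h0
    exact absurd h3 (B.levi y hu' h0).ne'
  have h5 := B.reebOp_reeb y
  rw [h4, map_zero] at h5
  refine B.θv_ne_zero y (ContinuousLinearMap.ext fun u => ?_)
  exact (DFunLike.congr_fun h5 ![u]).symm

lemma dθ_reeb (y : M) (v : EuclideanSpace ℝ (Fin 5)) : B.dθ.val y ![B.reeb y, v] = 0 := by
  have h := B.θv_reeb_mul y v
  rw [θv_reeb] at h
  linarith

lemma eq_reeb {y : M} {v : EuclideanSpace ℝ (Fin 5)} (h : B.θv y v = 1)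
    (h' : ∀ u, B.dθ.val y ![v, u] = 0) : v = B.reeb y := by
  refine B.reebOp_injective y ?_
  ext w
  have hw : w = ![w 0] := by ext i; fin_cases i; rfl
  rw [hw, reebOp_apply, reebOp_apply, h, h', θv_reeb, dθ_reeb]

lemma frame (y : M) : IsBoundaryFrame (C.Jv (B.incl y)) (B.α (B.incl y)) (B.ι y) (B.reeb y) where
  sq := C.Jv_sq _
  finrank := finrank_model
  tangent := B.α_ι y
  surj := B.ι_surj y
  inj := B.ι_injective y
  reeb := by
    have h := B.θv_reeb y
    rw [θv_apply] at h
    linarith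

lemma contDiffWithinAt_reeb (y : M) :
    ContDiffWithinAt ℝ ∞ (vecRep (𝓡 5) y B.reeb) (range (𝓡 5)) (extChartAt (𝓡 5) y y) := by
  have hp := mem_extChartAt_target (I := 𝓡 5) y
  have hθ := B.isSmoothCov_θv y _ hp
  have hθ' := (isSmoothForm_ofCov B.isSmoothCov_θv).contDiffWithinAt hp
  have hd := contDiffWithinAt_curryLeft (B.isSmoothForm_dθ.contDiffWithinAt hp)
  have := finiteDimensional_alternating (EuclideanSpace ℝ (Fin 5)) ℝ 1
  refine contDiffWithinAt_of_injective (extChartAt_target_subset_range _ hp)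
    ((hθ.smulRight hθ').add hd) hθ' ?_ ?_
  · have e1 : covRep (𝓡 5) y B.θv (extChartAt (𝓡 5) y y) = B.θv y := by
      rw [covRep, dChartSymm_self, extChartAt_to_inv]; rfl
    rw [e1, chartRep_self, chartRep_self]
    exact B.reebOp_injective y
  · refine (eventually_mem_target hp).mono fun q hq => ?_
    have e1 : covRep (𝓡 5) y B.θv q (vecRep (𝓡 5) y B.reeb q) = 1 := by
      have h := DFunLike.congr_fun (dChartSymm_comp_dChart hq)
        (B.reeb ((extChartAt (𝓡 5) y).symm q))
      have h' : dChartSymm (𝓡 5) y q (vecRep (𝓡 5) y B.reeb q) =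
        B.reeb ((extChartAt (𝓡 5) y).symm q) := h
      change B.θv _ (dChartSymm (𝓡 5) y q (vecRep (𝓡 5) y B.reeb q)) = 1
      rw [h', θv_reeb]
    have e2 : insForm B.reeb B.dθ = 0 := Form.ext_val fun z => by
      ext w
      have hw : w = ![w 0] := by ext i; fin_cases i; rfl
      rw [hw]
      exact B.dθ_reeb z _
    have e3 := chartRep_insForm B.reeb B.dθ hq
    rw [e2] at e3
    simp only [add_apply, ContinuousLinearMap.smulRight_apply]
    rw [e1, one_smul, ← e3, chartRep_zero]
    exact add_zero _

/-! #### Pointwise conditions on forms in terms of the model spaces -/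

lemma isNormal_succ_iff {y : M} {p q : ℕ}
    {φ : EuclideanSpace ℝ (Fin 6) [⋀^Fin (p + (q + 1))]→L[ℝ] ℂ} :
    B.IsNormal (B.incl y) p (q + 1) φ ↔
      ∃ μ : EuclideanSpace ℝ (Fin 6) [⋀^Fin (p + q)]→L[ℝ] ℂ,
        HasWeight (C.Jv (B.incl y)) ((p : ℂ) - q) μ ∧
          φ = wedge (dzbarOf (C.Jv (B.incl y)) (B.α (B.incl y))) μ := by
  have h0 : B.IsNormal (B.incl y) p (q + 1) φ ↔
      ∃ μ : EuclideanSpace ℝ (Fin 6) [⋀^Fin (p + q)]→L[ℝ] ℂ, IsOfType (C.Jv (B.incl y)) p q μ ∧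
        ∀ v, φ v = wedgeCovector (dzbarOf (C.Jv (B.incl y)) (B.α (B.incl y))) μ v := Iff.rfl
  rw [h0]
  refine exists_congr fun μ => ?_
  rw [isOfType_iff]
  refine and_congr ⟨fun h => h.2, fun h => ⟨rfl, h⟩⟩ ⟨fun h => ?_, fun h v => ?_⟩
  · ext v
    rw [wedge_apply]
    exact h v
  · rw [h]
    exact wedge_apply _ _ _

lemma represents_iff {σ : C.Omega 2 1} {γ : Form (𝓡 5) M ℝ 2} :
    B.Represents σ γ ↔ ∀ y, RepresentsAt (C.Jv (B.incl y)) (B.α (B.incl y)) (B.ι y)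
      (Form.val σ.1 (B.incl y)) (γ.val y) := by
  have hH : ∀ y u, B.α (B.incl y) (C.Jv (B.incl y) (B.ι y u)) = 0 ↔ B.MemH y u := by
    intro y u
    rw [memH_iff, θv_apply, neg_eq_zero]
  refine forall_congr' fun y => ?_
  have h0 : (∃ (g : EuclideanSpace ℝ (Fin 6) [⋀^Fin 2]→L[ℝ] ℂ)
      (ν : EuclideanSpace ℝ (Fin 6) [⋀^Fin (2 + 1)]→L[ℝ] ℂ), IsOfType (C.Jv (B.incl y)) 1 1 g ∧
      (∀ u u' : EuclideanSpace ℝ (Fin 5), B.MemH y u → B.MemH y u' →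
        g ![B.ι y u, B.ι y u'] = ((γ.val y ![u, u'] : ℝ) : ℂ)) ∧ B.IsNormal (B.incl y) 2 1 ν ∧
      ∀ v, (Form.val σ.1 (B.incl y)) v =
        wedgeCovector (dzOf (C.Jv (B.incl y)) (B.α (B.incl y))) g v + ν v) ↔
      RepresentsAt (C.Jv (B.incl y)) (B.α (B.incl y)) (B.ι y) (Form.val σ.1 (B.incl y))
        (γ.val y) := by
    have e11 : ((1 : ℕ) : ℂ) - (1 : ℕ) = 0 := by norm_num
    have e21 : ((2 : ℕ) : ℂ) - (0 : ℕ) = 2 := by norm_num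
    constructor
    · rintro ⟨g, ν, h1, h2, h3, h4⟩
      obtain ⟨μ, hμ, rfl⟩ := B.isNormal_succ_iff.1 h3
      rw [isOfType_iff, e11] at h1
      rw [e21] at hμ
      refine ⟨g, μ, h1.2, hμ, fun u u' hu hu' => h2 u u' ((hH y u).1 hu) ((hH y u').1 hu'), ?_⟩
      ext v
      rw [ContinuousAlternatingMap.add_apply, wedge_apply]
      exact h4 v
    · rintro ⟨g, μ, h1, h2, h3, h4⟩
      refine ⟨g, _, isOfType_iff.2 ⟨rfl, by rw [e11]; exact h1⟩,
        fun u u' hu hu' => h3 u u' ((hH y u).2 hu) ((hH y u').2 hu'),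
        B.isNormal_succ_iff.2 ⟨μ, by rw [e21]; exact h2, rfl⟩, fun v => ?_⟩
      have := congrArg (fun ψ => ψ v) h4
      refine this.trans ?_
      rw [ContinuousAlternatingMap.add_apply, wedge_apply]
  exact h0

end StronglyPseudoconvexBoundary

/-! ### Types of forms on a Calabi-Yau threefold -/

section Conjugation

variable {V : Type*} [NormedAddCommGroup V] [NormedSpace ℝ V] {J : V →L[ℝ] V}

/-- The complex conjugate of a form. -/
def conjForm {k : ℕ} (φ : V [⋀^Fin k]→L[ℝ] ℂ) : V [⋀^Fin k]→L[ℝ] ℂ :=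
  (Complex.conjCLE : ℂ →L[ℝ] ℂ).compContinuousAlternatingMap φ

lemma conjForm_apply {k : ℕ} (φ : V [⋀^Fin k]→L[ℝ] ℂ) (v : Fin k → V) :
    conjForm φ v = starRingEnd ℂ (φ v) := rfl

lemma HasWeight.conj {k : ℕ} {m : ℤ} {φ : V [⋀^Fin k]→L[ℝ] ℂ} (h : HasWeight J m φ) :
    HasWeight J (-m : ℤ) (conjForm φ) := by
  refine hasWeight_of_apply fun t v => ?_
  rw [conjForm_apply, conjForm_apply, h.apply, map_mul, ← Complex.exp_conj]
  congr 2
  simp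

lemma HasWeight.isOfType {p q k : ℕ} {m : ℂ} {φ : V [⋀^Fin k]→L[ℝ] ℂ} (h : HasWeight J m φ)
    (hk : p + q = k) (hm : m = (p : ℂ) - q) : IsOfType J p q φ := by
  subst hm; exact isOfType_iff.2 ⟨hk, h⟩

/-- The components of a sum of forms of the four types in degree three. -/
lemma typeProj_sum_four {a b c d : V [⋀^Fin 3]→L[ℝ] ℂ} (ha : HasWeight J (3 : ℤ) a)
    (hb : HasWeight J (1 : ℤ) b) (hc : HasWeight J (-1 : ℤ) c) (hd : HasWeight J (-3 : ℤ) d) :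
    typeProj J 3 0 (a + b + c + d) = a ∧ typeProj J 2 1 (a + b + c + d) = b ∧
      typeProj J 1 2 (a + b + c + d) = c ∧ typeProj J 0 3 (a + b + c + d) = d := by
  have ha' : IsOfType J 3 0 a := ha.isOfType rfl (by norm_num)
  have hb' : IsOfType J 2 1 b := hb.isOfType rfl (by norm_num)
  have hc' : IsOfType J 1 2 c := hc.isOfType rfl (by norm_num)
  have hd' : IsOfType J 0 3 d := hd.isOfType rfl (by norm_num)
  simp only [typeProj_add]
  refine ⟨?_, ?_, ?_, ?_⟩
  · rw [typeProj_of_isOfType ha', typeProj_of_isOfType_ne hb' rfl (by norm_num),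
      typeProj_of_isOfType_ne hc' rfl (by norm_num),
      typeProj_of_isOfType_ne hd' rfl (by norm_num)]
    simp
  · rw [typeProj_of_isOfType hb', typeProj_of_isOfType_ne ha' rfl (by norm_num),
      typeProj_of_isOfType_ne hc' rfl (by norm_num),
      typeProj_of_isOfType_ne hd' rfl (by norm_num)]
    simp
  · rw [typeProj_of_isOfType hc', typeProj_of_isOfType_ne ha' rfl (by norm_num),
      typeProj_of_isOfType_ne hb' rfl (by norm_num),
      typeProj_of_isOfType_ne hd' rfl (by norm_num)]
    simp
  · rw [typeProj_of_isOfType hd', typeProj_of_isOfType_ne ha' rfl (by norm_num),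
      typeProj_of_isOfType_ne hb' rfl (by norm_num),
      typeProj_of_isOfType_ne hc' rfl (by norm_num)]
    simp

/-- The type components of `2 Re (a + b)`, for `a` of type `(3,0)` and `b` of type `(2,1)`. -/
lemma typeProj_two_re {a b : V [⋀^Fin 3]→L[ℝ] ℂ} {ρ : V [⋀^Fin 3]→L[ℝ] ℝ}
    (ha : HasWeight J 3 a) (hb : HasWeight J 1 b) (hρ : ∀ v, ρ v = 2 * (a v + b v).re) :
    typeProj J 3 0 (complexify ρ) = a ∧ typeProj J 2 1 (complexify ρ) = b ∧
      ∀ v, opJ J ρ v = 2 * (a v + b v).im := by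
  have ha' : HasWeight J (3 : ℤ) a := by exact_mod_cast ha
  have hb' : HasWeight J (1 : ℤ) b := by exact_mod_cast hb
  have h1 : complexify ρ = a + b + conjForm b + conjForm a := by
    ext v
    simp only [ContinuousAlternatingMap.add_apply, conjForm_apply]
    change ((ρ v : ℝ) : ℂ) = _
    rw [hρ]
    apply Complex.ext
    · simp; ring
    · simp
  obtain ⟨h2, h3, h4, h5⟩ := typeProj_sum_four ha' hb' hb'.conj ha'.conj
  rw [← h1] at h2 h3 h4 h5
  refine ⟨h2, h3, fun v => ?_⟩
  rw [opJ, h2, h3, h4, h5]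
  change (((-Complex.I) • a + (-Complex.I) • b + Complex.I • conjForm b +
    Complex.I • conjForm a) v).re = _
  simp only [ContinuousAlternatingMap.add_apply, ContinuousAlternatingMap.smul_apply,
    conjForm_apply]
  simp
  ring

/-- A real `3`-form is twice the real part of the sum of its components of types `(3,0)` and
`(2,1)`. -/
lemma eq_two_re_typeProj (hJ : ∀ v, J (J v) = -v) (ρ : V [⋀^Fin 3]→L[ℝ] ℝ) (v : Fin 3 → V) :
    ρ v = 2 * (typeProj J 3 0 (complexify ρ) v + typeProj J 2 1 (complexify ρ) v).re := by
  set A := typeProj J 3 0 (complexify ρ) with hA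
  set b := typeProj J 2 1 (complexify ρ) with hb
  have w3 : HasWeight J (3 : ℤ) A := by
    have := (isOfType_iff.1 (isOfType_typeProj_three hJ (p := 3) (q := 0) rfl (complexify ρ))).2
    simpa using this
  have w1 : HasWeight J (1 : ℤ) b := by
    have := (isOfType_iff.1 (isOfType_typeProj_three hJ (p := 2) (q := 1) rfl (complexify ρ))).2
    have e : (((2 : ℕ) : ℂ) - ((1 : ℕ) : ℂ)) = ((1 : ℤ) : ℂ) := by norm_num
    rwa [e] at this
  have w2 : HasWeight J (-1 : ℤ) (typeProj J 1 2 (complexify ρ)) := by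
    have := (isOfType_iff.1 (isOfType_typeProj_three hJ (p := 1) (q := 2) rfl (complexify ρ))).2
    have e : (((1 : ℕ) : ℂ) - ((2 : ℕ) : ℂ)) = ((-1 : ℤ) : ℂ) := by norm_num
    rwa [e] at this
  have w0 : HasWeight J (-3 : ℤ) (typeProj J 0 3 (complexify ρ)) := by
    have := (isOfType_iff.1 (isOfType_typeProj_three hJ (p := 0) (q := 3) rfl (complexify ρ))).2
    have e : (((0 : ℕ) : ℂ) - ((3 : ℕ) : ℂ)) = ((-3 : ℤ) : ℂ) := by norm_num
    rwa [e] at this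
  have hs := sum_typeProj_three (J := J) (complexify ρ)
  have w2' := w2.conj
  have w0' := w0.conj
  rw [neg_neg] at w2' w0'
  have h1 : complexify ρ = conjForm (typeProj J 0 3 (complexify ρ)) +
      conjForm (typeProj J 1 2 (complexify ρ)) + conjForm b + conjForm A := by
    ext v
    have := congrArg (fun ψ => starRingEnd ℂ (ψ v)) hs
    simp only [ContinuousAlternatingMap.add_apply, map_add] at this
    simp only [ContinuousAlternatingMap.add_apply, conjForm_apply]
    have hc : starRingEnd ℂ (complexify ρ v) = complexify ρ v := Complex.conj_ofReal _
    rw [hc] at this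
    rw [← this]
    ring
  obtain ⟨e1, e2, -, -⟩ := typeProj_sum_four w0' w2' w1.conj w3.conj
  rw [← h1] at e1 e2
  have h2 := congrArg (fun ψ => (ψ v).re) hs
  have h3 : (complexify ρ v).re = ρ v := Complex.ofReal_re _
  simp only [ContinuousAlternatingMap.add_apply, h3] at h2
  have e1' := congrArg (fun ψ => (ψ v).re) e1
  have e2' := congrArg (fun ψ => (ψ v).re) e2
  simp only [conjForm_apply, Complex.conj_re] at e1' e2'
  simp only [Complex.add_re] at h2 ⊢
  rw [hA, hb]
  linarith

end Conjugation

section Manifold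

variable {E : Type*} [NormedAddCommGroup E] [NormedSpace ℝ E]
  {H : Type*} [TopologicalSpace H] {I : ModelWithCorners ℝ E H}
  {X : Type*} [TopologicalSpace X] [ChartedSpace H X] [IsManifold I ∞ X]
  {F : Type*} [NormedAddCommGroup F] [NormedSpace ℝ F]

omit [IsManifold I ∞ X] in
lemma Form.mapL_zero {k : ℕ} {F' : Type*} [NormedAddCommGroup F'] [NormedSpace ℝ F']
    (L : F →L[ℝ] F') : (0 : Form I X F k).mapL L = 0 := Form.ext_val fun x => by
  ext v
  exact L.map_zero

/-- The composition of a form with a field of endomorphisms in each slot. -/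
def Form.compEnd {k : ℕ} (A : ∀ x : X, TangentSpace I x →L[ℝ] TangentSpace I x)
    (φ : Form I X F k) : Form I X F k :=
  Form.ofVal fun x => (φ.val x).compContinuousLinearMap (endVal A x)

lemma IsSmoothForm.compEnd [FiniteDimensional ℝ E] [FiniteDimensional ℝ F] {k : ℕ}
    {A : ∀ x : X, TangentSpace I x →L[ℝ] TangentSpace I x} (hA : IsSmoothEnd A)
    {φ : Form I X F k} (hφ : IsSmoothForm φ) : IsSmoothForm (φ.compEnd A) := by
  rw [isSmoothForm_iff]
  intro x₀ p hp
  have h1 : ∀ q ∈ (extChartAt I x₀).target, chartRep x₀ (φ.compEnd A) q =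
      (chartRep x₀ φ q).compContinuousLinearMap (endRep A x₀ q) := by
    intro q hq
    ext v
    change φ.val _ (fun i => endVal A _ (dChartSymm I x₀ q (v i))) =
      φ.val _ (fun i => dChartSymm I x₀ q (endRep A x₀ q (v i)))
    congr 1
    ext1 i
    exact endRep_comm hq (v i)
  exact (contDiffWithinAt_compContinuousLinearMap (hφ.contDiffWithinAt hp)
    (hA.contDiffWithinAt hp)).congr_of_eventuallyEq
      ((eventually_mem_target hp).mono fun q hq => h1 q hq) (h1 p hp)

/-- The coefficient of a smooth form with respect to a nowhere zero smooth form is smooth. -/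
lemma contMDiff_of_smulForm [FiniteDimensional ℝ E] {k : ℕ} {f : X → ℂ} {φ : Form I X ℂ k}
    (hφ : IsSmoothForm φ) (h0 : ∀ x, φ.val x ≠ 0) (h : IsSmoothForm (smulForm f φ)) :
    ContMDiff I 𝓘(ℝ, ℂ) ∞ f := by
  refine contMDiff_of_chart fun x => ?_
  have hp := mem_extChartAt_target (I := I) x
  have := finiteDimensional_alternating E ℂ k
  let S : (E [⋀^Fin k]→L[ℝ] ℂ) →L[ℝ] ℂ →L[ℝ] (E [⋀^Fin k]→L[ℝ] ℂ) :=
    (ContinuousLinearMap.lsmul ℝ ℂ : ℂ →L[ℝ] (E [⋀^Fin k]→L[ℝ] ℂ) →L[ℝ] _).flip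
  have hS : ContDiff ℝ ∞ S := ContinuousLinearMap.contDiff (𝕜 := ℝ)
    (E := E [⋀^Fin k]→L[ℝ] ℂ) (F := ℂ →L[ℝ] (E [⋀^Fin k]→L[ℝ] ℂ)) S
  refine contDiffWithinAt_of_injective (extChartAt_target_subset_range _ hp)
    (hS.comp_contDiffWithinAt (hφ.contDiffWithinAt hp)) (h.contDiffWithinAt hp) ?_ ?_
  · change Function.Injective fun z : ℂ => z • chartRep x φ (extChartAt I x x)
    rw [chartRep_self]
    exact smul_left_injective ℂ (h0 x)
  · exact Filter.Eventually.of_forall fun q => (chartRep_smulForm f φ x q).symm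

end Manifold

namespace CalabiYau

variable {Z : Type*} [TopologicalSpace Z] [ChartedSpace (EuclideanHalfSpace 6) Z]
  [IsManifold (𝓡∂ 6) ∞ Z] (C : CalabiYau Z)

/-- The component of type `(p,q)` of a form. -/
def proj (p q : ℕ) {k : ℕ} (φ : Form (𝓡∂ 6) Z ℂ k) : Form (𝓡∂ 6) Z ℂ k :=
  Form.ofVal fun x => typeProj (C.Jv x) p q (φ.val x)

lemma isSmoothForm_proj (p q : ℕ) {k : ℕ} {φ : Form (𝓡∂ 6) Z ℂ k} (hφ : IsSmoothForm φ) :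
    IsSmoothForm (C.proj p q φ) := by
  intro x₀
  refine (contDiffOn_typeProj (hφ x₀) (C.J_smooth x₀) p q).congr fun s hs => ?_
  exact typeProj_comp (fun w => endRep_comm (A := C.J) hs w) p q _

lemma Omega_smooth {p q : ℕ} (σ : C.Omega p q) : IsSmoothForm σ.1 := σ.2.1

lemma Omega_weight {p q : ℕ} (σ : C.Omega p q) (x : Z) :
    HasWeight (C.Jv x) ((p : ℂ) - q) (Form.val σ.1 x) := (isOfType_iff.1 (σ.2.2 x)).2

/-- A smooth form of the right weight, as an element of `Ω^{p,q}`. -/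
def mkOmega (p q : ℕ) (φ : Form (𝓡∂ 6) Z ℂ (p + q)) (h : IsSmoothForm φ)
    (hw : ∀ x, HasWeight (C.Jv x) ((p : ℂ) - q) (φ.val x)) : C.Omega p q :=
  ⟨φ, h, fun x => isOfType_iff.2 ⟨rfl, hw x⟩⟩

lemma dbar_val {p q : ℕ} (σ : C.Omega p q) (x : Z) :
    Form.val (C.dbar p q σ) x = typeProj (C.Jv x) p (q + 1) ((extD σ.1).val x) := rfl

/-- On a form of type `(p,q)`, `∂̄` is the component of lower weight of the exterior
derivative. -/
lemma dbar_val_of_decomp {p q : ℕ} {σ : C.Omega p q} {x : Z}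
    {a b : EuclideanSpace ℝ (Fin 6) [⋀^Fin (p + q + 1)]→L[ℝ] ℂ}
    (h : (extD σ.1).val x = a + b) (ha : HasWeight (C.Jv x) ((p : ℂ) - q + 1) a)
    (hb : HasWeight (C.Jv x) ((p : ℂ) - q - 1) b) : Form.val (C.dbar p q σ) x = b := by
  rw [dbar_val, h]
  refine (typeProj_add _ _ _ _ _).trans ?_
  have ha' : IsOfType (C.Jv x) (p + 1) q a := ha.isOfType (by omega) (by push_cast; ring)
  have hb' : IsOfType (C.Jv x) p (q + 1) b := hb.isOfType (by omega) (by push_cast; ring)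
  rw [typeProj_of_isOfType_ne ha' (by omega) (by omega), typeProj_of_isOfType hb', zero_add]

/-- The components of `dσ`, for `σ` of type `(p,q)`. -/
lemma exists_extD_eq {p q : ℕ} (σ : C.Omega p q) (x : Z) :
    ∃ a, (extD σ.1).val x = a + Form.val (C.dbar p q σ) x ∧
      HasWeight (C.Jv x) ((p : ℂ) - q + 1) a ∧
        HasWeight (C.Jv x) ((p : ℂ) - q - 1) (Form.val (C.dbar p q σ) x) := by
  obtain ⟨a, b, h, ha, hb⟩ := C.exists_weight_decomp_extD (C.Omega_smooth σ) (C.Omega_weight σ) x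
  have hd := C.dbar_val_of_decomp h ha hb
  refine ⟨a, ?_, ha, ?_⟩
  · rw [hd]; exact h
  · rw [hd]; exact hb

lemma dbar_smooth {p q : ℕ} (σ : C.Omega p q) : IsSmoothForm (C.dbar p q σ) :=
  C.isSmoothForm_proj p (q + 1) (C.Omega_smooth σ).extD

/-- `∂̄` as an operator from `Ω^{p,q}` to `Ω^{p,q+1}`. -/
def dbarOmega {p q : ℕ} (σ : C.Omega p q) : C.Omega p (q + 1) :=
  C.mkOmega p (q + 1) (C.dbar p q σ) (C.dbar_smooth σ) fun x => by
    obtain ⟨a, -, -, h⟩ := C.exists_extD_eq σ x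
    rwa [show (p : ℂ) - ((q + 1 : ℕ) : ℂ) = (p : ℂ) - q - 1 by push_cast; ring]

lemma dbarOmega_coe {p q : ℕ} (σ : C.Omega p q) : (C.dbarOmega σ).1 = C.dbar p q σ := rfl

/-- `∂̄ ∂̄ = 0`. -/
lemma dbar_dbar {p q : ℕ} (σ : C.Omega p q) : C.dbar p (q + 1) (C.dbarOmega σ) = 0 := by
  have hs : IsSmoothForm (C.dbarOmega σ).1 := C.dbar_smooth σ
  have hd : IsSmoothForm (extD σ.1) := (C.Omega_smooth σ).extD
  set α' : Form (𝓡∂ 6) Z ℂ (p + q + 1) := extD σ.1 - (C.dbarOmega σ).1 with hα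
  have hα' : IsSmoothForm α' := hd.sub hs
  have hw : ∀ x, HasWeight (C.Jv x) ((p : ℂ) - q + 1) (α'.val x) := by
    intro x
    obtain ⟨a, h1, h2, -⟩ := C.exists_extD_eq σ x
    have : α'.val x = a := by
      rw [hα, Form.val_sub, h1, dbarOmega_coe]
      exact add_sub_cancel_right _ _
    rw [this]; exact h2
  refine Form.ext_val fun x => ?_
  obtain ⟨a, b, e, ha, hb⟩ := C.exists_weight_decomp_extD hα' hw x
  have h2 : extD (C.dbarOmega σ).1 = -extD α' := by
    have h1 : extD α' = extD (extD σ.1) - extD (C.dbarOmega σ).1 := extD_sub hd hs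
    rw [extD_extD (C.Omega_smooth σ), zero_sub] at h1
    rw [h1, neg_neg]
  rw [dbar_val, h2]
  have ha' : IsOfType (C.Jv x) (p + 2) q a := ha.isOfType (by omega) (by push_cast; ring)
  have hb' : IsOfType (C.Jv x) (p + 1) (q + 1) b := hb.isOfType (by omega) (by push_cast; ring)
  have h3 : (-extD α').val x = (-1 : ℝ) • (a + b) := by
    rw [Form.val_neg, e, neg_one_smul]
  have h4 : typeProj (C.Jv x) p (q + 1 + 1) ((-1 : ℝ) • (a + b)) = 0 := by
    rw [typeProj_smul, typeProj_add, typeProj_of_isOfType_ne ha' (by omega) (by omega),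
      typeProj_of_isOfType_ne hb' (by omega) (by omega), add_zero]
    ext v
    simp
  refine Eq.trans ?_ h4
  exact congrArg _ h3

/-! #### The complex form attached to a real three-form -/

/-- The form `½ (ρ + i Jρ)`, the sum of the components of types `(3,0)` and `(2,1)` of `ρ`. -/
def chi (ρ : Form (𝓡∂ 6) Z ℝ 3) : Form (𝓡∂ 6) Z ℂ 3 :=
  ρ.mapL ((1 / 2 : ℝ) • Complex.ofRealCLM) +
    Form.mapL ((1 / 2 : ℂ) • Complex.I • Complex.ofRealCLM) (C.opJForm ρ)

lemma opJForm_val (ρ : Form (𝓡∂ 6) Z ℝ 3) (x : Z) :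
    Form.val (C.opJForm ρ) x = opJ (C.Jv x) (ρ.val x) := rfl

lemma opJForm_smooth {ρ : Form (𝓡∂ 6) Z ℝ 3} (h : IsSmoothForm ρ) :
    IsSmoothForm (C.opJForm ρ) := isSmoothForm_opJ C.J_smooth h

lemma chi_apply (ρ : Form (𝓡∂ 6) Z ℝ 3) (x : Z) (v : Fin 3 → EuclideanSpace ℝ (Fin 6)) :
    (C.chi ρ).val x v = (1 / 2 : ℂ) * (ρ.val x v + Complex.I * (Form.val (C.opJForm ρ) x v)) := by
  change (1 / 2 : ℝ) • ((ρ.val x v : ℝ) : ℂ) +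
    (1 / 2 : ℂ) • Complex.I • ((Form.val (C.opJForm ρ) x v : ℝ) : ℂ) = _
  rw [Complex.real_smul, smul_eq_mul, smul_eq_mul]
  push_cast
  ring

lemma extD_chi {ρ : Form (𝓡∂ 6) Z ℝ 3} (h : IsSmoothForm ρ) (h1 : extD ρ = 0)
    (h2 : extD (C.opJForm ρ) = 0) : extD (C.chi ρ) = 0 := by
  rw [chi, extD_add (h.mapL _) ((C.opJForm_smooth h).mapL _), extD_mapL _ h,
    extD_mapL _ (C.opJForm_smooth h), h1, h2, Form.mapL_zero, Form.mapL_zero, add_zero]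

/-- The component of type `(2,1)` of a real three-form. -/
def rho21 (ρ : Form (𝓡∂ 6) Z ℝ 3) : Form (𝓡∂ 6) Z ℂ 3 :=
  C.proj 2 1 (ρ.mapL Complex.ofRealCLM)

/-- The component of type `(3,0)` of a real three-form. -/
def rho30 (ρ : Form (𝓡∂ 6) Z ℝ 3) : Form (𝓡∂ 6) Z ℂ 3 :=
  C.proj 3 0 (ρ.mapL Complex.ofRealCLM)

lemma rho21_val (ρ : Form (𝓡∂ 6) Z ℝ 3) (x : Z) :
    (C.rho21 ρ).val x = typeProj (C.Jv x) 2 1 (complexify (ρ.val x)) := rfl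

lemma rho30_val (ρ : Form (𝓡∂ 6) Z ℝ 3) (x : Z) :
    (C.rho30 ρ).val x = typeProj (C.Jv x) 3 0 (complexify (ρ.val x)) := rfl

lemma rho21_smooth {ρ : Form (𝓡∂ 6) Z ℝ 3} (h : IsSmoothForm ρ) : IsSmoothForm (C.rho21 ρ) :=
  C.isSmoothForm_proj 2 1 (h.mapL _)

lemma rho30_smooth {ρ : Form (𝓡∂ 6) Z ℝ 3} (h : IsSmoothForm ρ) : IsSmoothForm (C.rho30 ρ) :=
  C.isSmoothForm_proj 3 0 (h.mapL _)

lemma rho21_weight (ρ : Form (𝓡∂ 6) Z ℝ 3) (x : Z) : HasWeight (C.Jv x) 1 ((C.rho21 ρ).val x) := by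
  have h := (isOfType_iff.1 (isOfType_typeProj_three (C.Jv_sq x) (p := 2) (q := 1) rfl
    (complexify (ρ.val x)))).2
  rwa [show (((2 : ℕ) : ℂ) - ((1 : ℕ) : ℂ)) = 1 by norm_num] at h

lemma rho30_weight (ρ : Form (𝓡∂ 6) Z ℝ 3) (x : Z) : HasWeight (C.Jv x) 3 ((C.rho30 ρ).val x) := by
  have h := (isOfType_iff.1 (isOfType_typeProj_three (C.Jv_sq x) (p := 3) (q := 0) rfl
    (complexify (ρ.val x)))).2
  rwa [show (((3 : ℕ) : ℂ) - ((0 : ℕ) : ℂ)) = 3 by norm_num] at h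

lemma chi_eq (ρ : Form (𝓡∂ 6) Z ℝ 3) : C.chi ρ = C.rho30 ρ + C.rho21 ρ := by
  refine Form.ext_val fun x => ?_
  ext v
  have h1 := eq_two_re_typeProj (C.Jv_sq x) (ρ.val x)
  have h2 := (typeProj_two_re (C.rho30_weight ρ x) (C.rho21_weight ρ x) h1).2.2 v
  rw [chi_apply, opJForm_val, h2, h1 v, Form.val_add, ContinuousAlternatingMap.add_apply,
    rho30_val, rho21_val]
  rw [rho30_val, rho21_val] at *
  apply Complex.ext <;> simp

/-- The real three-form `2 Re χ`. -/
def twoRe (χ : Form (𝓡∂ 6) Z ℂ 3) : Form (𝓡∂ 6) Z ℝ 3 := χ.mapL ((2 : ℝ) • Complex.reCLM)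

omit [IsManifold (𝓡∂ 6) ∞ Z] in
lemma twoRe_apply (χ : Form (𝓡∂ 6) Z ℂ 3) (x : Z) (v : Fin 3 → EuclideanSpace ℝ (Fin 6)) :
    (twoRe χ).val x v = 2 * (χ.val x v).re := rfl

lemma opJForm_twoRe {a b : Form (𝓡∂ 6) Z ℂ 3} (ha : ∀ x, HasWeight (C.Jv x) 3 (a.val x))
    (hb : ∀ x, HasWeight (C.Jv x) 1 (b.val x)) :
    C.opJForm (twoRe (a + b)) = (a + b).mapL ((2 : ℝ) • Complex.imCLM) :=
  Form.ext_val fun x => by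
    ext v
    exact (typeProj_two_re (ρ := (twoRe (a + b)).val x) (ha x) (hb x) fun _ => rfl).2.2 v

lemma rho21_twoRe {a b : Form (𝓡∂ 6) Z ℂ 3} (ha : ∀ x, HasWeight (C.Jv x) 3 (a.val x))
    (hb : ∀ x, HasWeight (C.Jv x) 1 (b.val x)) : C.rho21 (twoRe (a + b)) = b :=
  Form.ext_val fun x =>
    (typeProj_two_re (ρ := (twoRe (a + b)).val x) (ha x) (hb x) fun _ => rfl).2.1

/-- If `χ` has components of types `(3,0)` and `(2,1)` only and is closed, `ρ = 2 Re χ` satisfies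
`dρ = 0` and `dJρ = 0`. -/
lemma extD_twoRe {χ : Form (𝓡∂ 6) Z ℂ 3} (h : IsSmoothForm χ) (hd : extD χ = 0) :
    extD (twoRe χ) = 0 ∧ extD (χ.mapL ((2 : ℝ) • Complex.imCLM)) = 0 := by
  rw [twoRe, extD_mapL _ h, extD_mapL _ h, hd, Form.mapL_zero, Form.mapL_zero]
  exact ⟨rfl, rfl⟩

/-- If `a + b` is closed, with `a` of type `(3,0)` and `b` of type `(2,1)`, then `∂̄b = 0`. -/
lemma dbar_eq_zero_of_closed {a : Form (𝓡∂ 6) Z ℂ 3} {b : C.Omega 2 1} (ha : IsSmoothForm a)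
    (hw : ∀ x, HasWeight (C.Jv x) 3 (a.val x)) (hd : extD (a + b.1) = 0) :
    C.dbar 2 1 b = 0 := by
  refine Form.ext_val fun x => ?_
  obtain ⟨c, d, e, hc, hd'⟩ := C.exists_weight_decomp_extD ha hw x
  have h1 : extD b.1 = -extD a := by
    have := extD_add ha (C.Omega_smooth b)
    rw [hd] at this
    exact (neg_eq_of_add_eq_zero_right this.symm).symm
  have hc' : IsOfType (C.Jv x) 4 0 c := hc.isOfType rfl (by norm_num)
  have hd'' : IsOfType (C.Jv x) 3 1 d := hd'.isOfType rfl (by norm_num)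
  rw [dbar_val, h1]
  have h3 : (-extD a).val x = (-1 : ℝ) • (c + d) := by
    rw [Form.val_neg, e, neg_one_smul]
  have h4 : typeProj (C.Jv x) 2 (1 + 1) ((-1 : ℝ) • (c + d)) = 0 := by
    rw [typeProj_smul, typeProj_add,
      typeProj_of_isOfType_ne (p := 2) (q := 1 + 1) hc' (by norm_num) (by omega),
      typeProj_of_isOfType_ne (p := 2) (q := 1 + 1) hd'' (by norm_num) (by omega), add_zero]
    ext v
    simp
  exact (congrArg _ h3).trans h4

/-! #### Multiples of the holomorphic volume form -/

/-- Forms of type `(3,0)` are multiples of the volume form. -/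
lemma exists_smulForm {a : Form (𝓡∂ 6) Z ℂ 3} (ha : IsSmoothForm a)
    (hw : ∀ x, HasWeight (C.Jv x) 3 (a.val x)) :
    ∃ h : Z → ℂ, ContMDiff (𝓡∂ 6) 𝓘(ℝ, ℂ) ∞ h ∧ a = smulForm h C.Φ := by
  have h1 : ∀ x, ∃ c : ℂ, a.val x = c • C.Φ.val x := fun x =>
    CLin.exists_eq_smul (C.Φ_clin x) (C.Φ_ne_zero x) ((hw x).clin_three (C.Jv_sq x)) (C.Jv_sq x)
      finrank_model
  choose h hh using h1
  have e : a = smulForm h C.Φ := Form.ext_val hh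
  exact ⟨h, contMDiff_of_smulForm C.Φ_smooth C.Φ_ne_zero (e ▸ ha), e⟩

lemma extD_smul_Φ {h : Z → ℂ} (hh : ContMDiff (𝓡∂ 6) 𝓘(ℝ, ℂ) ∞ h) :
    extD (smulForm h C.Φ) = wedgeForm (dFun (𝓡∂ 6) h) C.Φ := by
  rw [extD_smulForm hh C.Φ_smooth, C.Φ_closed]
  refine Form.ext_val fun x => ?_
  ext v
  change (wedgeForm (dFun (𝓡∂ 6) h) C.Φ).val x v + h x * 0 = _
  rw [mul_zero, add_zero]

/-- The wedge product of any covector with the volume form has type `(3,1)`. -/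
lemma hasWeight_wedge_Φ (ζ : EuclideanSpace ℝ (Fin 6) →L[ℝ] ℂ) (x : Z) :
    HasWeight (C.Jv x) 2 (wedge ζ (C.Φ.val x)) := by
  -- the component of type `(1,0)` of `ζ` does not contribute
  set ζ₁ : EuclideanSpace ℝ (Fin 6) →L[ℝ] ℂ :=
    (1 / 2 : ℂ) • (ζ - Complex.I • ζ ∘L C.Jv x) with h1
  set ζ₂ : EuclideanSpace ℝ (Fin 6) →L[ℝ] ℂ :=
    (1 / 2 : ℂ) • (ζ + Complex.I • ζ ∘L C.Jv x) with h2
  have e1 : ∀ v, ζ₁ (C.Jv x v) = Complex.I * ζ₁ v := by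
    intro v
    simp only [h1, smul_apply, sub_apply, ContinuousLinearMap.comp_apply, C.Jv_sq, map_neg,
      smul_eq_mul]
    linear_combination (1 / 2 * ζ (C.Jv x v)) * Complex.I_sq
  have e2 : ∀ v, ζ₂ (C.Jv x v) = ((-1 : ℤ) : ℂ) * Complex.I * ζ₂ v := by
    intro v
    simp only [h2, smul_apply, add_apply, ContinuousLinearMap.comp_apply, C.Jv_sq, map_neg,
      smul_eq_mul]
    push_cast
    linear_combination (1 / 2 * ζ (C.Jv x v)) * Complex.I_sq
  have e3 : wedge ζ (C.Φ.val x) = wedge ζ₁ (C.Φ.val x) + wedge ζ₂ (C.Φ.val x) := by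
    ext v
    have e4 : ∀ u, ζ u = ζ₁ u + ζ₂ u := by
      intro u
      simp only [h1, h2, smul_apply, add_apply, sub_apply, smul_eq_mul]
      ring
    rw [ContinuousAlternatingMap.add_apply, wedge_apply, wedge_apply, wedge_apply, wedgeCovector,
      wedgeCovector, wedgeCovector, ← Finset.sum_add_distrib]
    exact Finset.sum_congr rfl fun i _ => by rw [e4]; ring
  rw [e3, (CLin.wedge e1 (C.Φ_clin x)).eq_zero_of_four (C.Jv_sq x) finrank_model, zero_add]
  have := HasWeight.wedge (Or.inr rfl) e2 (C.Φ_weight x)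
  rwa [show (3 : ℂ) + ((-1 : ℤ) : ℂ) = 2 by norm_num] at this

/-- Multiples of the volume form have no component `∂`. -/
lemma extD_eq_dbar (a : C.Omega 3 0) : extD a.1 = C.dbar 3 0 a := by
  have hw : ∀ x, HasWeight (C.Jv x) 3 (Form.val a.1 x) := fun x => by
    have := C.Omega_weight a x
    rwa [show (((3 : ℕ) : ℂ) - ((0 : ℕ) : ℂ)) = 3 by norm_num] at this
  obtain ⟨h, hh, e⟩ := C.exists_smulForm (C.Omega_smooth a) hw
  refine Form.ext_val fun x => ?_
  have h2 : HasWeight (C.Jv x) 2 ((extD a.1).val x) := by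
    have e' : extD a.1 = wedgeForm (dFun (𝓡∂ 6) h) C.Φ := by rw [← C.extD_smul_Φ hh, ← e]
    rw [e']
    exact C.hasWeight_wedge_Φ _ x
  have h3 := C.dbar_val_of_decomp (σ := a) (x := x) (a := 0) (b := (extD a.1).val x)
    (by rw [zero_add]) (hasWeight_of_apply fun t v => by simp)
    (by rwa [show ((3 : ℕ) : ℂ) - ((0 : ℕ) : ℂ) - 1 = 2 by norm_num])
  exact h3.symm

/-- If `hΦ` is closed, `h` is holomorphic. -/
lemma isHolomorphic_of_closed {h : Z → ℂ} (hh : ContMDiff (𝓡∂ 6) 𝓘(ℝ, ℂ) ∞ h)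
    (hd : extD (smulForm h C.Φ) = 0) : C.IsHolomorphic h := by
  refine ⟨hh, fun x v => ?_⟩
  rw [C.extD_smul_Φ hh] at hd
  have h0 : wedge (dFun (𝓡∂ 6) h x) (C.Φ.val x) = 0 := congrArg (fun φ => φ.val x) hd
  refine covector_clin_of_wedge_eq_zero (J := C.Jv x)
    (ι := ContinuousLinearMap.id ℝ (EuclideanSpace ℝ (Fin 6))) (C.Φ_clin x) h0 (fun u hu => ?_)
    (u := v) (u' := C.Jv x v) rfl
  have hu' := CLin.existsUnique_contraction (C.Φ_clin x) (C.Φ_ne_zero x)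
    (ν := (0 : EuclideanSpace ℝ (Fin 6) [⋀^Fin 2]→L[ℝ] ℂ))
    (fun _ _ => by change (0 : ℂ) = _ * 0; simp) (C.Jv_sq x) finrank_model
  refine hu'.unique hu fun a b => ?_
  have := form_smul₀ (C.Φ.val x) 0 (0 : EuclideanSpace ℝ (Fin 6)) ![a, b]
  rw [zero_smul, zero_smul] at this
  exact this

/-- If `h` is holomorphic, `hΦ` is closed. -/
lemma closed_of_isHolomorphic {h : Z → ℂ} (hh : C.IsHolomorphic h) :
    extD (smulForm h C.Φ) = 0 := by
  rw [C.extD_smul_Φ hh.1]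
  refine Form.ext_val fun x => ?_
  have h1 : ∀ v : EuclideanSpace ℝ (Fin 6),
      dFun (𝓡∂ 6) h x (C.Jv x v) = Complex.I * dFun (𝓡∂ 6) h x v := hh.2 x
  exact (CLin.wedge h1 (C.Φ_clin x)).eq_zero_of_four (C.Jv_sq x) finrank_model

lemma smul_Φ_weight (h : Z → ℂ) (x : Z) :
    HasWeight (C.Jv x) 3 ((smulForm h C.Φ).val x) := (C.Φ_weight x).smul _

end CalabiYau

/-! ### Restriction to the boundary -/

section Evaluation

variable {V W F : Type*} [NormedAddCommGroup V] [NormedSpace ℝ V] [NormedAddCommGroup W]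
  [NormedSpace ℝ W] [NormedAddCommGroup F] [NormedSpace ℝ F]

lemma comp_apply_three (φ : V [⋀^Fin 3]→L[ℝ] F) (D : W →L[ℝ] V) (a b c : W) :
    φ.compContinuousLinearMap D ![a, b, c] = φ ![D a, D b, D c] := by
  change φ (fun i => D (![a, b, c] i)) = _
  congr 1; ext i; fin_cases i <;> rfl

lemma eq_vec_two {α : Type*} (v : Fin 2 → α) : v = ![v 0, v 1] := by
  ext i; fin_cases i <;> rfl

lemma eq_vec_three {α : Type*} (v : Fin 3 → α) : v = ![v 0, v 1, v 2] := by
  ext i; fin_cases i <;> rfl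

end Evaluation

namespace StronglyPseudoconvexBoundary

variable {Z : Type*} [TopologicalSpace Z] [ChartedSpace (EuclideanHalfSpace 6) Z]
  [IsManifold (𝓡∂ 6) ∞ Z]
  {M : Type*} [TopologicalSpace M] [ChartedSpace (EuclideanSpace ℝ (Fin 5)) M]
  [IsManifold (𝓡 5) ∞ M] {C : CalabiYau Z} (B : StronglyPseudoconvexBoundary C M)

/-- The form `γ` with `Jρ|_M = θ ∧ γ`, obtained by contracting `Jρ|_M` with the Reeb field. -/
def bdry (ρ : Form (𝓡∂ 6) Z ℝ 3) : Form (𝓡 5) M ℝ 2 :=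
  insForm B.reeb (B.restrict (C.opJForm ρ))

lemma restrict_smooth {F : Type*} [NormedAddCommGroup F] [NormedSpace ℝ F]
    [FiniteDimensional ℝ F] {k : ℕ} {φ : Form (𝓡∂ 6) Z F k} (h : IsSmoothForm φ) :
    IsSmoothForm (B.restrict φ) := h.pullback B.incl_smooth

lemma extD_restrict {F : Type*} [NormedAddCommGroup F] [NormedSpace ℝ F] {k : ℕ}
    {φ : Form (𝓡∂ 6) Z F k} (h : IsSmoothForm φ) :
    extD (B.restrict φ) = B.restrict (extD φ) := extD_pullback B.incl_smooth h

lemma bdry_smooth {ρ : Form (𝓡∂ 6) Z ℝ 3} (h : IsSmoothForm ρ) : IsSmoothForm (B.bdry ρ) :=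
  isSmoothForm_insForm B.contDiffWithinAt_reeb (B.restrict_smooth (C.opJForm_smooth h))

lemma bdry_apply (ρ : Form (𝓡∂ 6) Z ℝ 3) (y : M) (u v : EuclideanSpace ℝ (Fin 5)) :
    (B.bdry ρ).val y ![u, v] = (B.restrict (C.opJForm ρ)).val y ![B.reeb y, u, v] := rfl

section

variable {ρ : Form (𝓡∂ 6) Z ℝ 3} (h0 : B.restrict ρ = 0)
include h0

lemma chi_tangent (y : M) (a b c : EuclideanSpace ℝ (Fin 5)) :
    (C.chi ρ).val (B.incl y) ![B.ι y a, B.ι y b, B.ι y c] =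
      (Complex.I / 2) * (B.restrict (C.opJForm ρ)).val y ![a, b, c] := by
  have h1 : ρ.val (B.incl y) ![B.ι y a, B.ι y b, B.ι y c] = 0 := by
    rw [← comp_apply_three, ← restrict_val, h0]; rfl
  rw [CalabiYau.chi_apply, h1, restrict_val, comp_apply_three]
  push_cast
  ring

lemma re_chi_tangent (y : M) (a b c : EuclideanSpace ℝ (Fin 5)) :
    (((C.rho30 ρ).val (B.incl y) + (C.rho21 ρ).val (B.incl y))
      ![B.ι y a, B.ι y b, B.ι y c]).re = 0 := by
  have h1 := B.chi_tangent h0 y a b c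
  rw [CalabiYau.chi_eq, Form.val_add] at h1
  rw [h1]
  simp

lemma bdry_eq_im (y : M) (u v : EuclideanSpace ℝ (Fin 5)) : (B.bdry ρ).val y ![u, v] =
    2 * (((C.rho30 ρ).val (B.incl y) + (C.rho21 ρ).val (B.incl y))
      ![B.ι y (B.reeb y), B.ι y u, B.ι y v]).im := by
  have h1 := B.chi_tangent h0 y (B.reeb y) u v
  rw [CalabiYau.chi_eq, Form.val_add] at h1
  rw [h1, bdry_apply]
  simp

omit h0 in
lemma dz_of_mem {y : M} {u : EuclideanSpace ℝ (Fin 5)} (hu : B.θv y u = 0) :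
    dzOf (C.Jv (B.incl y)) (B.α (B.incl y)) (B.ι y u) = 0 := by
  rw [IsBoundaryFrame.dz_eq_zero_iff]
  exact ⟨B.α_ι y u, by rw [θv_apply] at hu; exact neg_eq_zero.1 hu⟩

/-- `Jρ|_M = θ ∧ γ`. -/
lemma restrict_opJForm : B.restrict (C.opJForm ρ) = wedgeForm B.θv (B.bdry ρ) := by
  refine Form.ext_val fun y => ?_
  refine eq_wedge_of_ker (B.θv_reeb y) (fun _ => rfl) fun w hw => ?_
  have h1 := B.chi_tangent h0 y (w 0) (w 1) (w 2)
  have hz := fun i => B.dz_of_mem (hw i)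
  rw [CalabiYau.chi_eq, Form.val_add, ContinuousAlternatingMap.add_apply,
    (B.frame y).clin_three_horizontal ((C.rho30_weight ρ _).clin_three (C.Jv_sq _))
      (hz 0) (hz 1) (hz 2),
    (B.frame y).restrict_horizontal (C.rho30_weight ρ _) (C.rho21_weight ρ _)
      (B.re_chi_tangent h0 y) (hz 0) (hz 1) (hz 2), add_zero, ← eq_vec_three] at h1
  have h2 : ((B.restrict (C.opJForm ρ)).val y w : ℂ) = 0 := by
    refine (mul_eq_zero.1 h1.symm).resolve_left ?_
    simp
  exact_mod_cast h2

lemma representsAt_bdry (y : M) : RepresentsAt (C.Jv (B.incl y)) (B.α (B.incl y)) (B.ι y)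
    ((2 : ℂ) • (C.rho21 ρ).val (B.incl y)) ((B.bdry ρ).val y) :=
  (B.frame y).representsAt (C.rho30_weight ρ _) (C.rho21_weight ρ _) (B.re_chi_tangent h0 y)
    (B.bdry_eq_im h0 y)

end

lemma wedgeTwo_reeb {γ : Form (𝓡 5) M ℝ 2} (hγ : ∀ y u, γ.val y ![B.reeb y, u] = 0) (y : M)
    (a b c : EuclideanSpace ℝ (Fin 5)) :
    wedgeTwo (B.dθ.val y) (γ.val y) ![B.reeb y, a, b, c] = 0 := by
  rw [wedgeTwo_apply, dθ_reeb, dθ_reeb, dθ_reeb, hγ, hγ, hγ]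
  ring

lemma extD_wedge_θ {γ : Form (𝓡 5) M ℝ 2} (h : IsSmoothForm γ) (y : M)
    (v : Fin 4 → EuclideanSpace ℝ (Fin 5)) : (extD (wedgeForm B.θv γ)).val y v =
      wedgeTwo (B.dθ.val y) (γ.val y) v - wedge (B.θv y) ((extD γ).val y) v :=
  extD_wedgeForm B.isSmoothCov_θv h y v

lemma mem_HSpace_iff {γ : Form (𝓡 5) M ℝ 2} : γ ∈ B.HSpace ↔ IsSmoothForm γ ∧
    (∀ y u, γ.val y ![B.reeb y, u] = 0) ∧
    (∀ y u₁ u₁' u₂ u₂', B.ι y u₁' = C.Jv (B.incl y) (B.ι y u₁) →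
      B.ι y u₂' = C.Jv (B.incl y) (B.ι y u₂) → γ.val y ![u₁', u₂'] = γ.val y ![u₁, u₂]) ∧
    (∀ y u, (∀ j, B.θv y (u j) = 0) → (extD γ).val y u = 0) ∧
    ∀ y u, wedgeTwo (B.dθ.val y) (γ.val y) u = 0 := by
  constructor
  · rintro ⟨h1, h2, h3, h4, h5⟩
    exact ⟨h1, fun y => h2 y (B.reeb y) (B.θv_reeb y) (B.dθ_reeb y),
      fun y u₁ u₁' u₂ u₂' e e' => h3 y u₁ u₁' u₂ u₂' e e',
      fun y u hu => h4 y u fun j => (B.memH_iff y (u j)).2 (hu j), h5⟩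
  · rintro ⟨h1, h2, h3, h4, h5⟩
    refine ⟨h1, fun y v hv hv' u => ?_, fun y u₁ u₁' u₂ u₂' e e' => h3 y u₁ u₁' u₂ u₂' e e',
      fun y u hu => h4 y u fun j => (B.memH_iff y (u j)).1 (hu j), h5⟩
    have hvR : v = B.reeb y := B.eq_reeb (v := v) hv hv'
    exact (congrArg (fun w => γ.val y ![w, u]) hvR).trans (h2 y u)

/-- If `θ ∧ γ` is closed and `γ` is annihilated by the Reeb field, then `d_H γ = 0` and
`dθ ∧ γ = 0`. -/
lemma of_extD_wedge_eq_zero {γ : Form (𝓡 5) M ℝ 2} (hs : IsSmoothForm γ)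
    (hγ : ∀ y u, γ.val y ![B.reeb y, u] = 0) (hd : extD (wedgeForm B.θv γ) = 0) (y : M) :
    (∀ u, (∀ j, B.θv y (u j) = 0) → (extD γ).val y u = 0) ∧
      ∀ u, wedgeTwo (B.dθ.val y) (γ.val y) u = 0 := by
  have h1 : ∀ v, wedgeTwo (B.dθ.val y) (γ.val y) v - wedge (B.θv y) ((extD γ).val y) v = 0 := by
    intro v
    rw [← B.extD_wedge_θ hs, hd]; rfl
  have h2 : ∀ u, (∀ j, B.θv y (u j) = 0) → (extD γ).val y u = 0 := by
    intro u hu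
    have h3 := h1 ![B.reeb y, u 0, u 1, u 2]
    rw [B.wedgeTwo_reeb hγ, wedge_three_apply, B.θv_reeb, hu, hu, hu, ← eq_vec_three] at h3
    linarith
  refine ⟨h2, fun u => ?_⟩
  have h3 := h1 u
  rw [wedge_eq_zero_of_ker (B.θv_reeb y) (fun _ => rfl) h2] at h3
  have h4 : (0 : EuclideanSpace ℝ (Fin 5) [⋀^Fin 4]→L[ℝ] ℝ) u = 0 := rfl
  rw [h4, sub_zero] at h3
  exact h3

lemma extD_wedge_eq_zero {γ : Form (𝓡 5) M ℝ 2} (hγ : γ ∈ B.HSpace) :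
    extD (wedgeForm B.θv γ) = 0 := by
  obtain ⟨h1, h2, h3, h4, h5⟩ := B.mem_HSpace_iff.1 hγ
  refine Form.ext_val fun y => ?_
  ext v
  rw [B.extD_wedge_θ h1, h5, wedge_eq_zero_of_ker (B.θv_reeb y) (fun _ => rfl) (h4 y)]
  exact sub_zero _

lemma bdry_mem {ρ : Form (𝓡∂ 6) Z ℝ 3} (h : ρ ∈ B.infDef) : B.bdry ρ ∈ B.HSpace := by
  obtain ⟨hs, hd, hJ, h0⟩ := h
  have hR : ∀ y u, (B.bdry ρ).val y ![B.reeb y, u] = 0 := by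
    intro y u
    have := form_swap₀ ((B.restrict (C.opJForm ρ)).val y) (B.reeb y) (B.reeb y) ![u]
    rw [bdry_apply]
    linarith
  have hd' : extD (wedgeForm B.θv (B.bdry ρ)) = 0 := by
    rw [← B.restrict_opJForm h0, B.extD_restrict (C.opJForm_smooth hs), hJ]; rfl
  have h2 := B.of_extD_wedge_eq_zero (B.bdry_smooth hs) hR hd'
  refine B.mem_HSpace_iff.2 ⟨B.bdry_smooth hs, hR, fun y u₁ u₁' u₂ u₂' e e' => ?_,
    fun y => (h2 y).1, fun y => (h2 y).2⟩
  rw [B.bdry_eq_im h0, B.bdry_eq_im h0, e, e']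
  congr 2
  refine (B.frame y).reeb_contraction_invariant (C.rho30_weight ρ _) (C.rho21_weight ρ _)
    (B.re_chi_tangent h0 y) ?_ ?_
  · exact B.dz_of_mem (B.θv_of_isJPair e).1
  · exact B.dz_of_mem (B.θv_of_isJPair e').1

/-! #### The volume form along the boundary -/

lemma restrict_Φ_nondegenerate (y : M) (u : EuclideanSpace ℝ (Fin 5))
    (hu : ∀ a b, C.Φ.val (B.incl y) ![B.ι y u, B.ι y a, B.ι y b] = 0) : u = 0 :=
  (B.frame y).volume_nondegenerate (C.Φ_clin _) (C.Φ_ne_zero _) u hu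

lemma restrict_Φ_ne_zero (y : M) : (B.restrict C.Φ).val y ≠ 0 := by
  intro h
  refine C.Φ_ne_zero (B.incl y) ((B.frame y).clin_three_eq_zero (C.Φ_clin _) fun a b c => ?_)
  have e := comp_apply_three (C.Φ.val (B.incl y)) (B.ι y) a b c
  rw [← restrict_val, h] at e
  exact e.symm

lemma extD_smul_restrict_Φ {f : M → ℂ} (hf : ContMDiff (𝓡 5) 𝓘(ℝ, ℂ) ∞ f) :
    extD (smulForm f (B.restrict C.Φ)) = wedgeForm (dFun (𝓡 5) f) (B.restrict C.Φ) := by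
  rw [extD_smulForm hf (B.restrict_smooth C.Φ_smooth), B.extD_restrict C.Φ_smooth, C.Φ_closed]
  refine Form.ext_val fun x => ?_
  ext v
  change (wedgeForm (dFun (𝓡 5) f) (B.restrict C.Φ)).val x v + f x * 0 = _
  rw [mul_zero, add_zero]

/-- If `f Φ|_M` is closed, then `f` is a CR function. -/
lemma isCR_of_closed {f : M → ℂ} (hf : ContMDiff (𝓡 5) 𝓘(ℝ, ℂ) ∞ f)
    (hd : extD (smulForm f (B.restrict C.Φ)) = 0) : B.IsCR f := by
  refine ⟨hf, fun y u u' h => ?_⟩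
  rw [B.extD_smul_restrict_Φ hf] at hd
  have h0 : wedge (dFun (𝓡 5) f y) ((C.Φ.val (B.incl y)).compContinuousLinearMap (B.ι y)) = 0 :=
    congrArg (fun φ => φ.val y) hd
  exact covector_clin_of_wedge_eq_zero (J := C.Jv (B.incl y)) (ι := B.ι y) (C.Φ_clin _) h0
    (B.restrict_Φ_nondegenerate y) (u := u) (u' := u') h

/-- The restriction to the boundary of a form of type `(2,1)` representing `γ ∧ dz`. -/
lemma exists_restrict_eq {σ : C.Omega 2 1} {γ : Form (𝓡 5) M ℝ 2} (hγ : IsSmoothForm γ)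
    (h : B.Represents σ γ) : ∃ f : M → ℂ, ContMDiff (𝓡 5) 𝓘(ℝ, ℂ) ∞ f ∧
      B.restrict σ.1 = (wedgeForm B.θv γ).mapL (Complex.I • Complex.ofRealCLM) +
        smulForm f (B.restrict C.Φ) := by
  rw [represents_iff] at h
  have h1 := fun y => (B.frame y).exists_restrict_eq (fun u => B.θv_apply y u) (C.Φ_clin _)
    (C.Φ_ne_zero _) (h y)
  choose f hf using h1
  have e : B.restrict σ.1 = (wedgeForm B.θv γ).mapL (Complex.I • Complex.ofRealCLM) +
      smulForm f (B.restrict C.Φ) := Form.ext_val fun y => hf y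
  refine ⟨f, ?_, e⟩
  refine contMDiff_of_smulForm (B.restrict_smooth C.Φ_smooth) B.restrict_Φ_ne_zero ?_
  rw [← sub_eq_iff_eq_add'.2 e]
  exact (B.restrict_smooth (C.Omega_smooth σ)).sub
    ((IsSmoothForm.wedgeForm B.isSmoothCov_θv hγ).mapL _)

/-- If `γ ∈ ℋ` and `σ` represents `γ ∧ dz`, then `∂̄σ` is normal along the boundary. -/
lemma dbar_normal {σ : C.Omega 2 1} {γ : Form (𝓡 5) M ℝ 2} (hγ : γ ∈ B.HSpace)
    (h : B.Represents σ γ) (x : Z) (hx : x ∈ (𝓡∂ 6).boundary Z) :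
    B.IsNormal x 2 2 (C.dbar 2 1 σ x) := by
  obtain ⟨y, rfl⟩ := B.exists_incl_eq hx
  have hs := (B.mem_HSpace_iff.1 hγ).1
  obtain ⟨f, hf, e⟩ := B.exists_restrict_eq hs h
  have h1 : B.restrict (extD σ.1) = wedgeForm (dFun (𝓡 5) f) (B.restrict C.Φ) := by
    have hw := IsSmoothForm.wedgeForm B.isSmoothCov_θv hs
    rw [← B.extD_restrict (C.Omega_smooth σ), e, extD_add (hw.mapL _)
      ((B.restrict_smooth C.Φ_smooth).smulForm hf), extD_mapL _ hw, B.extD_wedge_eq_zero hγ,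
      B.extD_smul_restrict_Φ hf, Form.mapL_zero, zero_add]
  obtain ⟨a, e1, e2, e3⟩ := C.exists_extD_eq σ (B.incl y)
  have w2 : HasWeight (C.Jv (B.incl y)) 2 a := by
    rwa [show ((2 : ℕ) : ℂ) - ((1 : ℕ) : ℂ) + 1 = 2 by norm_num] at e2
  have w0 : HasWeight (C.Jv (B.incl y)) 0 (Form.val (C.dbar 2 1 σ) (B.incl y)) := by
    rwa [show ((2 : ℕ) : ℂ) - ((1 : ℕ) : ℂ) - 1 = 0 by norm_num] at e3
  have h2 : (a + Form.val (C.dbar 2 1 σ) (B.incl y)).compContinuousLinearMap (B.ι y) =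
      wedge (dFun (𝓡 5) f y) ((C.Φ.val (B.incl y)).compContinuousLinearMap (B.ι y)) := by
    have := congrArg (fun φ => φ.val y) h1
    refine Eq.trans ?_ this
    change _ = ((extD σ.1).val (B.incl y)).compContinuousLinearMap (B.ι y)
    rw [e1]
  obtain ⟨μ, hμ, e4⟩ := (B.frame y).exists_normal_of_restrict_eq (C.Φ_clin _) w2 w0 h2
  refine (B.isNormal_succ_iff (p := 2) (q := 1)).2 ⟨μ, ?_, e4⟩
  rwa [show ((2 : ℕ) : ℂ) - ((1 : ℕ) : ℂ) = 1 by norm_num]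

end StronglyPseudoconvexBoundary

/-! ### The strong maximum principle for holomorphic functions -/

section Flat

open Filter Topology

variable {E : Type*} [NormedAddCommGroup E] [InnerProductSpace ℝ E]

/-- At a local maximum the second derivative is not positive: otherwise the point would also be a
local minimum, and the function locally constant. -/
lemma second_deriv_nonpos_of_isLocalMax {φ φ' : ℝ → ℝ} {c : ℝ}
    (h : ∀ᶠ t in 𝓝 (0 : ℝ), HasDerivAt φ (φ' t) t) (h' : HasDerivAt φ' c 0)
    (hmax : IsLocalMax φ 0) : c ≤ 0 := by
  by_contra! hc
  have e1 : deriv φ =ᶠ[𝓝 0] φ' := h.mono fun t ht => ht.deriv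
  have h1 : deriv (deriv φ) 0 = c := by rw [e1.deriv_eq, h'.deriv]
  have h2 : deriv φ 0 = 0 := hmax.deriv_eq_zero
  have hmin := isLocalMin_of_deriv_deriv_pos (by rwa [h1]) h2 h.self_of_nhds.continuousAt
  have h3 : φ =ᶠ[𝓝 0] fun _ => φ 0 := by
    filter_upwards [hmax, hmin] with t h4 h5 using le_antisymm h4 h5
  have h4 : deriv φ =ᶠ[𝓝 0] fun _ => 0 := by
    have := h3.deriv
    simpa using this
  have h5 := h4.deriv_eq
  rw [h1] at h5
  simp at h5
  exact hc.ne' h5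

lemma fderiv_fderiv_nonpos_of_isLocalMax {v : E → ℝ} {v' : E → E →L[ℝ] ℝ} {v'' : E →L[ℝ] E →L[ℝ] ℝ}
    {p : E} (h : ∀ᶠ q in 𝓝 p, HasFDerivAt v (v' q) q) (h' : HasFDerivAt v' v'' p)
    (hmax : IsLocalMax v p) (a : E) : v'' a a ≤ 0 := by
  have hl : ∀ t : ℝ, HasDerivAt (fun t : ℝ => p + t • a) a t := fun t => by
    simpa using ((hasDerivAt_id t).smul_const a).const_add p
  have hc : Tendsto (fun t : ℝ => p + t • a) (𝓝 0) (𝓝 p) := by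
    have := (hl 0).continuousAt.tendsto
    simpa using this
  refine second_deriv_nonpos_of_isLocalMax (φ := fun t => v (p + t • a))
    (φ' := fun t => v' (p + t • a) a) ?_ ?_ ?_
  · filter_upwards [hc.eventually h] with t ht
    exact ht.comp_hasDerivAt t (hl t)
  · have h0 : HasFDerivAt v' v'' (p + (0 : ℝ) • a) := by simpa using h'
    have h1 := h0.comp_hasDerivAt (0 : ℝ) (hl 0)
    exact h1.clm_apply (hasDerivAt_const _ a) |>.congr_deriv (by simp)
  · have h1 : IsLocalMax v (p + (0 : ℝ) • a) := by simpa using hmax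
    have : ∀ᶠ t in 𝓝 (0 : ℝ), v (p + t • a) ≤ v p := hc.eventually hmax
    refine this.mono fun t ht => ?_
    simpa using ht

/-- A function `w` with `dw ∘ A = i dw` satisfies a second order equation without zeroth order
term: the trace of its Hessian over the pair of vectors `a`, `Aa` is a first derivative. -/
lemma hessian_identity {w : E → ℂ} {A : E → E →L[ℝ] E} {U : Set E} (hU : IsOpen U)
    (hw : ContDiffOn ℝ ∞ w U) (hA : ContDiffOn ℝ ∞ A U)
    (hhol : ∀ p ∈ U, ∀ a, fderiv ℝ w p (A p a) = Complex.I * fderiv ℝ w p a) {p : E} (hp : p ∈ U)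
    (a : E) : fderiv ℝ (fderiv ℝ w) p a a + fderiv ℝ (fderiv ℝ w) p (A p a) (A p a) =
      -fderiv ℝ w p (fderiv ℝ A p (A p a) a + A p (fderiv ℝ A p a a)) := by
  have hwp : ContDiffAt ℝ ∞ w p := hw.contDiffAt (hU.mem_nhds hp)
  have hAp : ContDiffAt ℝ ∞ A p := hA.contDiffAt (hU.mem_nhds hp)
  have hsymm := hwp.isSymmSndFDerivAt minSmoothness_two_le_infty
  have h1 : HasFDerivAt (fderiv ℝ w) (fderiv ℝ (fderiv ℝ w) p) p :=
    ((hwp.fderiv_right (m := ∞) (by simp)).differentiableAt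
      (by simp)).hasFDerivAt
  have h2 : HasFDerivAt A (fderiv ℝ A p) p := (hAp.differentiableAt (by simp)).hasFDerivAt
  have key : ∀ b, fderiv ℝ (fderiv ℝ w) p b (A p a) + fderiv ℝ w p (fderiv ℝ A p b a) =
      Complex.I * fderiv ℝ (fderiv ℝ w) p b a := by
    intro b
    have h3 := h1.clm_apply (h2.clm_apply (hasFDerivAt_const a p))
    have h4 := (h1.clm_apply (hasFDerivAt_const a p)).const_mul Complex.I
    have e : (fun q => fderiv ℝ w q (A q a)) =ᶠ[𝓝 p] fun q => Complex.I * fderiv ℝ w q a := by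
      filter_upwards [hU.mem_nhds hp] with q hq using hhol q hq a
    have h5 := DFunLike.congr_fun (h3.unique (h4.congr_of_eventuallyEq e)) b
    simp at h5
    rw [add_comm]
    exact h5
  have k1 := key (A p a)
  have k2 := key a
  have k3 := hhol p hp (fderiv ℝ A p a a)
  rw [map_add, k3, hsymm.eq a (A p a)] at *
  linear_combination k1 + Complex.I * k2 +
    (fderiv ℝ (fderiv ℝ w) p a a) * Complex.I_sq

variable (E) in
/-- The real inner product, as a bilinear map. -/
def innerBilin : E →L[ℝ] E →L[ℝ] ℝ := innerSL ℝ

lemma innerBilin_apply (a b : E) : innerBilin E a b = inner ℝ a b := rfl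

/-- The derivative of the barrier function. -/
lemma hasFDerivAt_barrier (α : ℝ) (y p : E) :
    HasFDerivAt (fun q => Real.exp (-α * ‖q - y‖ ^ 2))
      ((-2 * α * Real.exp (-α * ‖p - y‖ ^ 2)) • innerBilin E (p - y)) p := by
  have h1 : HasFDerivAt (fun q => ‖q - y‖ ^ 2) (2 • innerBilin E (p - y)) p := by
    exact ((hasFDerivAt_id p).sub_const y).norm_sq
  have h2 := (h1.const_mul (-α)).exp
  refine h2.congr_fderiv ?_
  ext a
  simp only [smul_apply, smul_eq_mul, nsmul_eq_mul]
  push_cast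
  ring

lemma hasFDerivAt_barrier_deriv (α : ℝ) (y p : E) :
    HasFDerivAt (fun q => (-2 * α * Real.exp (-α * ‖q - y‖ ^ 2)) • innerBilin E (q - y))
      ((-2 * α * Real.exp (-α * ‖p - y‖ ^ 2)) • innerBilin E +
        ((-2 * α) • (-2 * α * Real.exp (-α * ‖p - y‖ ^ 2)) • innerBilin E (p - y)).smulRight
          (innerBilin E (p - y))) p := by
  have h1 : HasFDerivAt (fun q => innerBilin E (q - y)) (innerBilin E) p := by
    have := (innerBilin E).hasFDerivAt.comp p ((hasFDerivAt_id p).sub_const y)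
    exact this
  exact ((hasFDerivAt_barrier α y p).const_mul (-2 * α)).smul h1

/-- A solution plus a multiple of a steep barrier has no interior maximum. -/
lemma no_local_max_add_barrier {w : E → ℂ} {A : E → E →L[ℝ] E} {U : Set E} (hU : IsOpen U)
    (hw : ContDiffOn ℝ ∞ w U) (hA : ContDiffOn ℝ ∞ A U)
    (hhol : ∀ p ∈ U, ∀ a, fderiv ℝ w p (A p a) = Complex.I * fderiv ℝ w p a) {p y : E} (hp : p ∈ U)
    {L N α ε : ℝ} (hL : ‖A p‖ ≤ L) (hN : ‖fderiv ℝ A p‖ ≤ N) (hα : 0 < α) (hε : 0 < ε)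
    (hρ : 0 < ‖p - y‖) (hlarge : 1 + L ^ 2 + 2 * N * L * ‖p - y‖ < 2 * α * ‖p - y‖ ^ 2)
    (hmax : IsLocalMax (fun q => (w q).re + ε * Real.exp (-α * ‖q - y‖ ^ 2)) p) : False := by
  have hwp : ContDiffAt ℝ ∞ w p := hw.contDiffAt (hU.mem_nhds hp)
  set a := p - y with ha
  set ρ := ‖a‖ with hρ'
  set e := Real.exp (-α * ρ ^ 2) with he
  have he0 : 0 < e := Real.exp_pos _
  set v' : E → E →L[ℝ] ℝ := fun q => Complex.reCLM ∘L fderiv ℝ w q +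
    ε • ((-2 * α * Real.exp (-α * ‖q - y‖ ^ 2)) • innerBilin E (q - y)) with hv'
  have h1 : ∀ᶠ q in 𝓝 p, HasFDerivAt
      (fun q => (w q).re + ε * Real.exp (-α * ‖q - y‖ ^ 2)) (v' q) q := by
    filter_upwards [hU.mem_nhds hp] with q hq
    have hwq : HasFDerivAt w (fderiv ℝ w q) q :=
      ((hw.contDiffAt (hU.mem_nhds hq)).differentiableAt (by simp)).hasFDerivAt
    exact (Complex.reCLM.hasFDerivAt.comp q hwq).add ((hasFDerivAt_barrier α y q).const_mul ε)
  have h2 : HasFDerivAt (fderiv ℝ w) (fderiv ℝ (fderiv ℝ w) p) p :=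
    ((hwp.fderiv_right (m := ∞) (by simp)).differentiableAt
      (by simp)).hasFDerivAt
  set R := ContinuousLinearMap.compL ℝ E ℂ ℝ Complex.reCLM with hR
  have h3 := (R.hasFDerivAt.comp p h2).add ((hasFDerivAt_barrier_deriv α y p).const_smul ε)
  have h4 := fderiv_fderiv_nonpos_of_isLocalMax h1 h3 hmax
  have h5 : v' p = 0 := hmax.hasFDerivAt_eq_zero h1.self_of_nhds
  have hval : ∀ b, (fderiv ℝ (fderiv ℝ w) p b b).re +
      ε * (e * (4 * α ^ 2 * (inner ℝ a b) ^ 2 - 2 * α * ‖b‖ ^ 2)) ≤ 0 := by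
    intro b
    have := h4 b
    refine le_trans (le_of_eq ?_) this
    simp only [hR, add_apply, smul_apply, ContinuousLinearMap.comp_apply,
      ContinuousLinearMap.compL_apply, ContinuousLinearMap.smulRight_apply, innerBilin_apply,
      smul_eq_mul, Complex.reCLM_apply, real_inner_self_eq_norm_sq]
    rw [← ha, ← hρ', ← he]
    ring
  have hfirst : ∀ b, (fderiv ℝ w p b).re = ε * (2 * α * e * inner ℝ a b) := by
    intro b
    have := DFunLike.congr_fun h5 b
    simp only [hv', add_apply, smul_apply, ContinuousLinearMap.comp_apply, innerBilin_apply,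
      smul_eq_mul, Complex.reCLM_apply, zero_apply] at this
    rw [← ha, ← hρ', ← he] at this
    linarith
  -- test the Hessian on `a = p - y` and on `A p a`: by `hessian_identity` the two second
  -- derivatives of `Re w` add up to a first derivative, which `hfirst` expresses by the barrier
  have h6 := hval a
  have h7 := hval (A p a)
  have hid := congrArg Complex.re (hessian_identity hU hw hA hhol hp a)
  rw [Complex.add_re, Complex.neg_re, hfirst] at hid
  set Q := fderiv ℝ A p (A p a) a + A p (fderiv ℝ A p a a) with hQ
  have hL0 : 0 ≤ L := (norm_nonneg _).trans hL
  have hN0 : 0 ≤ N := le_trans (norm_nonneg (fderiv ℝ A p)) hN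
  have hAa : ‖A p a‖ ≤ L * ρ := ((A p).le_opNorm a).trans (by gcongr)
  have hK : ∀ b c, ‖fderiv ℝ A p b c‖ ≤ N * ‖b‖ * ‖c‖ := fun b c =>
    ((fderiv ℝ A p b).le_opNorm c).trans
      (mul_le_mul_of_nonneg_right (((fderiv ℝ A p).le_opNorm b).trans (by gcongr)) (norm_nonneg _))
  have hQn : ‖Q‖ ≤ 2 * N * L * ρ ^ 2 := by
    have q1 : ‖fderiv ℝ A p (A p a) a‖ ≤ N * (L * ρ) * ρ :=
      (hK _ _).trans (by gcongr)
    have q2 : ‖A p (fderiv ℝ A p a a)‖ ≤ L * (N * ρ * ρ) :=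
      ((A p).le_opNorm _).trans (mul_le_mul hL (hK a a) (norm_nonneg _) hL0)
    refine (norm_add_le _ _).trans ?_
    linarith
  have hin : inner ℝ a Q ≤ ρ * (2 * N * L * ρ ^ 2) :=
    (real_inner_le_norm a Q).trans (by gcongr)
  rw [real_inner_self_eq_norm_sq, ← hρ'] at h6
  have h8 : ε * e * (4 * α ^ 2 * (ρ ^ 2) ^ 2 - 2 * α * ρ ^ 2 - 2 * α * (L * ρ) ^ 2
      - 2 * α * (ρ * (2 * N * L * ρ ^ 2))) ≤ 0 := by
    have k1 : ‖A p a‖ ^ 2 ≤ (L * ρ) ^ 2 := by gcongr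
    have k2 : 0 ≤ (inner ℝ a (A p a) : ℝ) ^ 2 := sq_nonneg _
    have k3 : 0 ≤ ε * e * (4 * α ^ 2) * (inner ℝ a (A p a) : ℝ) ^ 2 := by positivity
    have k4 : ε * e * (2 * α) * ‖A p a‖ ^ 2 ≤ ε * e * (2 * α) * (L * ρ) ^ 2 := by gcongr
    have k5 : ε * e * (2 * α) * inner ℝ a Q ≤ ε * e * (2 * α) * (ρ * (2 * N * L * ρ ^ 2)) := by
      gcongr
    linarith
  have h9 : 0 < ε * e * (2 * α * ρ ^ 2) * (2 * α * ρ ^ 2 - (1 + L ^ 2 + 2 * N * L * ρ)) := by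
    have : 0 < 2 * α * ρ ^ 2 - (1 + L ^ 2 + 2 * N * L * ρ) := by linarith
    positivity
  linarith

/-- The strong maximum principle: the set where the real part attains its maximum is open. If not,
some ball in the complement touches this set in a single point, and adding a small multiple of a
steep barrier centred at the centre of the ball to the real part produces an interior maximum near
the point of contact. -/
lemma eventually_re_eq_of_max [FiniteDimensional ℝ E] {w : E → ℂ} {A : E → E →L[ℝ] E} {U : Set E}
    (hU : IsOpen U) (hw : ContDiffOn ℝ ∞ w U) (hA : ContDiffOn ℝ ∞ A U)
    (hhol : ∀ p ∈ U, ∀ a, fderiv ℝ w p (A p a) = Complex.I * fderiv ℝ w p a) {p₀ : E}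
    (hp₀ : p₀ ∈ U) {m : ℝ} (hle : ∀ p ∈ U, (w p).re ≤ m) (hm : (w p₀).re = m) :
    ∀ᶠ p in 𝓝 p₀, (w p).re = m := by
  have hU0 := hU.mem_nhds hp₀
  set L := ‖A p₀‖ + 1 with hL
  set N := ‖fderiv ℝ A p₀‖ + 1 with hN
  have hAc : ContinuousAt A p₀ := (hA.contDiffAt hU0).continuousAt
  have hAc' : ContinuousAt (fderiv ℝ A) p₀ :=
    ((hA.contDiffAt hU0).fderiv_right (m := ∞) (by simp)).continuousAt
  have hAn : ContinuousAt (fun p => ‖fderiv ℝ A p‖) p₀ :=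
    ContinuousAt.comp (g := fun T : E →L[ℝ] E →L[ℝ] E => ‖T‖) 
      (continuous_norm (E := E →L[ℝ] E →L[ℝ] E)).continuousAt hAc'
  obtain ⟨δ', hδ', hball⟩ : ∃ δ' > 0, Metric.ball p₀ δ' ⊆
      {p | p ∈ U ∧ ‖A p‖ < L ∧ ‖fderiv ℝ A p‖ < N} := by
    refine Metric.mem_nhds_iff.1 ?_
    exact Filter.inter_mem hU0 (Filter.inter_mem
      (hAc.norm.eventually_lt continuousAt_const (lt_add_one _))
      (hAn.eventually_lt continuousAt_const (lt_add_one _)))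
  obtain ⟨δ, hδ, hδ4⟩ : ∃ δ > 0, δ' = 4 * δ := ⟨δ' / 4, by positivity, by ring⟩
  rw [hδ4] at hball
  have hcont : ContinuousOn (fun p => (w p).re) (Metric.ball p₀ (4 * δ)) :=
    Complex.continuous_re.comp_continuousOn (hw.continuousOn.mono fun p hp => (hball hp).1)
  refine Filter.mem_of_superset (Metric.ball_mem_nhds p₀ hδ) fun q hq => ?_
  rw [Metric.mem_ball] at hq
  by_contra hne
  -- the nearest point `p₁` to `q` where the maximum is attained
  have h3sub : Metric.closedBall p₀ (3 * δ) ⊆ Metric.ball p₀ (4 * δ) :=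
    Metric.closedBall_subset_ball (by linarith)
  set S := Metric.closedBall p₀ (3 * δ) ∩ (fun p => (w p).re) ⁻¹' {m} with hS
  have hSc : IsCompact S := (isCompact_closedBall p₀ (3 * δ)).of_isClosed_subset
    ((hcont.mono h3sub).preimage_isClosed_of_isClosed Metric.isClosed_closedBall
      isClosed_singleton) inter_subset_left
  have hpS : p₀ ∈ S := ⟨Metric.mem_closedBall_self (by positivity), hm⟩
  obtain ⟨p₁, hp₁, hd⟩ := hSc.exists_infDist_eq_dist ⟨p₀, hpS⟩ q
  have hR1 : dist q p₁ < δ := by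
    rw [← hd]
    exact (Metric.infDist_le_dist_of_mem hpS).trans_lt hq
  have hqp : q ≠ p₁ := by
    rintro rfl
    exact hne hp₁.2
  obtain ⟨r, hr, hr2⟩ : ∃ r > 0, dist q p₁ = 2 * r :=
    ⟨dist q p₁ / 2, by have := dist_pos.2 hqp; positivity, by ring⟩
  set y := midpoint ℝ q p₁ with hy
  have hyq : dist q y = r := by
    rw [hy, dist_left_midpoint, hr2]; norm_num; ring
  have hyp : dist y p₁ = r := by
    rw [hy, dist_midpoint_right, hr2]; norm_num; ring
  have htouch : ∀ p ∈ Metric.closedBall y r, p ≠ p₁ → (w p).re < m := by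
    intro p hp hpp
    rw [Metric.mem_closedBall] at hp
    have hdp : dist p p₀ ≤ 3 * δ := by
      have h1 := dist_triangle p y p₀
      have h2 := dist_triangle y q p₀
      rw [dist_comm y q] at h2
      linarith
    refine lt_of_le_of_ne (hle p (hball (h3sub hdp)).1) fun he => hpp ?_
    have h1 : 2 * r ≤ dist q p := by
      rw [← hr2, ← hd]
      exact Metric.infDist_le_dist_of_mem ⟨hdp, he⟩
    have h2 := dist_triangle q y p
    rw [dist_comm y p] at h2
    have h3 : y = midpoint ℝ q p := by
      refine eq_midpoint_of_dist_eq_half ?_ ?_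
      · linarith
      · rw [dist_comm y p]; linarith
    rw [hy, midpoint_eq_smul_add, midpoint_eq_smul_add] at h3
    have h4 := smul_right_injective E (invertibleInvOf.ne_zero : (⅟2 : ℝ) ≠ 0) h3
    exact (add_left_cancel h4).symm
  -- the size of the barrier
  have hL1 : 0 < L := by positivity
  have hN1 : 0 < N := by positivity
  -- the steepness required by `no_local_max_add_barrier` at distances between `r / 2` and `2 * r`
  -- from `y`
  obtain ⟨α, hα, hαr⟩ : ∃ α > 0, α * r ^ 2 = 2 * (2 + L ^ 2 + 4 * N * L * r) :=
    ⟨2 * (2 + L ^ 2 + 4 * N * L * r) / r ^ 2, by positivity, by field_simp⟩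
  have hAsub : Metric.closedBall p₁ (r / 2) ⊆ Metric.ball p₀ (4 * δ) := by
    intro p hp
    rw [Metric.mem_closedBall] at hp
    rw [Metric.mem_ball]
    have h1 := dist_triangle p p₁ p₀
    have h2 := dist_triangle p₁ q p₀
    rw [dist_comm p₁ q] at h2
    linarith
  -- the part of the sphere inside the touching ball is compact and away from `p₁`, so the maximum
  -- `m` is missed there by a definite amount
  obtain ⟨ε, hε, hεK⟩ : ∃ ε > 0, ∀ p ∈ Metric.sphere p₁ (r / 2) ∩ Metric.closedBall y r,
      (w p).re + ε < m := by
    have hK : IsCompact (Metric.sphere p₁ (r / 2) ∩ Metric.closedBall y r) :=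
      (isCompact_sphere p₁ (r / 2)).inter_right Metric.isClosed_closedBall
    rcases (Metric.sphere p₁ (r / 2) ∩ Metric.closedBall y r).eq_empty_or_nonempty with h0 | h0
    · exact ⟨1, one_pos, by simp [h0]⟩
    · obtain ⟨k, hk, hkmax⟩ := hK.exists_isMaxOn h0
        (hcont.mono (inter_subset_left.trans (Metric.sphere_subset_closedBall.trans hAsub)))
      have hkm : (w k).re < m := htouch k hk.2 fun he => by
        have h1 : dist k p₁ = r / 2 := hk.1
        rw [he, dist_self] at h1
        linarith
      refine ⟨(m - (w k).re) / 2, by linarith, fun p hp => ?_⟩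
      have h1 : (w p).re ≤ (w k).re := hkmax hp
      linarith
  have hbar : Continuous fun q : E => Real.exp (-α * ‖q - y‖ ^ 2) := by fun_prop
  obtain ⟨p₂, hp₂, hmax⟩ := (isCompact_closedBall p₁ (r / 2)).exists_isMaxOn
    ⟨p₁, Metric.mem_closedBall_self (by positivity)⟩
    ((hcont.mono hAsub).add (hbar.const_smul ε).continuousOn)
  have hmax1 : (w p₁).re + ε * Real.exp (-α * ‖p₁ - y‖ ^ 2) ≤
      (w p₂).re + ε * Real.exp (-α * ‖p₂ - y‖ ^ 2) :=
    hmax (Metric.mem_closedBall_self (by positivity))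
  have hw1 : (w p₁).re = m := hp₁.2
  rw [hw1, ← dist_eq_norm, dist_comm p₁ y, hyp] at hmax1
  -- the maximum of the sum is not on the sphere: inside the touching ball by the choice of `ε`,
  -- outside of it because the barrier is smaller than at `p₁`
  have hp₂' : dist p₂ p₁ < r / 2 := by
    refine lt_of_le_of_ne hp₂ fun hs => ?_
    by_cases hin : dist p₂ y ≤ r
    · have h1 := hεK p₂ ⟨hs, hin⟩
      have h2 : Real.exp (-α * ‖p₂ - y‖ ^ 2) ≤ 1 :=
        Real.exp_le_one_iff.2 (by nlinarith [sq_nonneg ‖p₂ - y‖])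
      have h3 : ε * Real.exp (-α * ‖p₂ - y‖ ^ 2) ≤ ε * 1 := by gcongr
      have h4 : 0 < ε * Real.exp (-α * r ^ 2) := by positivity
      linarith
    · push Not at hin
      rw [dist_eq_norm] at hin
      have h1 : Real.exp (-α * ‖p₂ - y‖ ^ 2) < Real.exp (-α * r ^ 2) := by
        refine Real.exp_lt_exp.2 ?_
        have : r ^ 2 < ‖p₂ - y‖ ^ 2 := by gcongr
        nlinarith
      have h2 : ε * Real.exp (-α * ‖p₂ - y‖ ^ 2) < ε * Real.exp (-α * r ^ 2) := by gcongr
      have h3 := hle p₂ (hball (hAsub hp₂)).1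
      linarith
  have hloc : IsLocalMax (fun q => (w q).re + ε * Real.exp (-α * ‖q - y‖ ^ 2)) p₂ :=
    hmax.isLocalMax (Filter.mem_of_superset (Metric.isOpen_ball.mem_nhds hp₂')
      Metric.ball_subset_closedBall)
  have hb2 := hball (hAsub hp₂)
  have hρ1 : r / 2 < ‖p₂ - y‖ := by
    rw [← dist_eq_norm]
    have h1 := dist_triangle y p₂ p₁
    rw [dist_comm y p₂] at h1
    linarith
  have hρ2 : ‖p₂ - y‖ < 2 * r := by
    rw [← dist_eq_norm]
    have h1 := dist_triangle p₂ p₁ y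
    rw [dist_comm p₁ y] at h1
    linarith
  refine no_local_max_add_barrier hU hw hA hhol hb2.1 hb2.2.1.le hb2.2.2.le hα hε
    (by linarith) ?_ hloc
  have h1 : 2 * α * (r / 2) ^ 2 ≤ 2 * α * ‖p₂ - y‖ ^ 2 := by gcongr
  have h2 : 2 * N * L * ‖p₂ - y‖ ≤ 2 * N * L * (2 * r) := by gcongr
  nlinarith

end Flat

section Global

variable {Z : Type*} [TopologicalSpace Z] [ChartedSpace (EuclideanHalfSpace 6) Z]
  [IsManifold (𝓡∂ 6) ∞ Z] {C : CalabiYau Z}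

lemma CalabiYau.IsHolomorphic.const_mul {f : Z → ℂ} (hf : C.IsHolomorphic f) (c : ℂ) :
    C.IsHolomorphic fun x => c * f x := by
  refine ⟨((ContinuousLinearMap.mul ℝ ℂ c).contDiff.contMDiff).comp hf.1, fun x v => ?_⟩
  have h1 : MDifferentiableAt (𝓡∂ 6) 𝓘(ℝ, ℂ) f x := hf.1.mdifferentiableAt (by simp)
  have h2 : ∀ v, dComplex (𝓡∂ 6) (fun x => c * f x) x v = c * dComplex (𝓡∂ 6) f x v := by
    intro v
    let L : ℂ →L[ℝ] ℂ := ContinuousLinearMap.mul ℝ ℂ c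
    have h3 : MDifferentiableAt 𝓘(ℝ, ℂ) 𝓘(ℝ, ℂ) L (f x) := L.differentiableAt.mdifferentiableAt
    have h4 := mfderiv_comp x h3 h1
    rw [mfderiv_eq_fderiv, L.fderiv] at h4
    exact DFunLike.congr_fun h4 v
  rw [h2, h2, hf.2 x v]
  ring

/-- Near an interior maximum point of the real part of a holomorphic function, the real part is
constant. -/
lemma eventually_re_eq {f : Z → ℂ} (hf : C.IsHolomorphic f) {m : ℝ} (hle : ∀ x, (f x).re ≤ m)
    {x : Z} (hx : (𝓡∂ 6).IsInteriorPoint x) (hm : (f x).re = m) :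
    ∀ᶠ z in nhds x, (f z).re = m := by
  set e := extChartAt (𝓡∂ 6) x with he
  have hp0 : e.target ∈ nhds (e x) := by
    have h1 : e.target ∈ nhdsWithin (e x) (range (𝓡∂ 6)) :=
      extChartAt_target_mem_nhdsWithin x
    rwa [nhdsWithin_eq_nhds.2 (mem_interior_iff_mem_nhds.1 hx)] at h1
  have hU : IsOpen (interior e.target) := isOpen_interior
  have hUt : ∀ q ∈ interior e.target, q ∈ e.target := fun q hq => interior_subset hq
  have hUr : ∀ q ∈ interior e.target, range (𝓡∂ 6) ∈ nhds q := fun q hq =>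
    Filter.mem_of_superset (mem_interior_iff_mem_nhds.1 hq) (extChartAt_target_subset_range x)
  have hw : ContDiffOn ℝ ∞ (f ∘ e.symm) (interior e.target) := fun q hq =>
    ((contDiffWithinAt_comp_symm hf.1 (hUt q hq)).contDiffAt (hUr q hq)).contDiffWithinAt
  have hA : ContDiffOn ℝ ∞ (endRep C.J x) (interior e.target) := fun q hq =>
    ((C.J_smooth.contDiffWithinAt (hUt q hq)).contDiffAt (hUr q hq)).contDiffWithinAt
  have hhol : ∀ q ∈ interior e.target, ∀ a, fderiv ℝ (f ∘ e.symm) q (endRep C.J x q a) =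
      Complex.I * fderiv ℝ (f ∘ e.symm) q a := by
    intro q hq a
    rw [← fderivWithin_of_mem_nhds (hUr q hq),
      fderivWithin_comp_symm (hf.1.mdifferentiable (by simp)) (hUt q hq)]
    change dFun (𝓡∂ 6) f _ (dChartSymm (𝓡∂ 6) x q (endRep C.J x q a)) =
      Complex.I * dFun (𝓡∂ 6) f _ (dChartSymm (𝓡∂ 6) x q a)
    rw [← endRep_comm (hUt q hq)]
    exact hf.2 _ _
  have h1 := eventually_re_eq_of_max hU hw hA hhol (mem_interior_iff_mem_nhds.2 hp0)
    (fun p _ => hle _) (m := m) (by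
      change (f (e.symm (e x))).re = m
      rw [he, extChartAt_to_inv, hm])
  have h2 := (continuousAt_extChartAt (I := 𝓡∂ 6) x).eventually h1
  filter_upwards [h2, extChartAt_source_mem_nhds (I := 𝓡∂ 6) x] with z hz hzs
  change (f (e.symm (e z))).re = m at hz
  rwa [he, (extChartAt (𝓡∂ 6) x).left_inv hzs] at hz

variable {M : Type*} [TopologicalSpace M] [ChartedSpace (EuclideanSpace ℝ (Fin 5)) M]
  [IsManifold (𝓡 5) ∞ M] (B : StronglyPseudoconvexBoundary C M)

/-- If the maximum of the real part were positive, it would be attained in the interior only, on an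
open and closed set; but every component of `Z` meets the boundary. -/
lemma re_nonpos_of_boundary [CompactSpace Z]
    (hmeet : ∀ x : Z, ∃ y : M, B.incl y ∈ connectedComponent x) {f : Z → ℂ}
    (hf : C.IsHolomorphic f) (h0 : ∀ y, f (B.incl y) = 0) (x : Z) : (f x).re ≤ 0 := by
  have hc : Continuous fun x => (f x).re := Complex.continuous_re.comp hf.1.continuous
  obtain ⟨z, -, hz⟩ := isCompact_univ.exists_isMaxOn ⟨x, mem_univ x⟩ hc.continuousOn
  have hle : ∀ x, (f x).re ≤ (f z).re := fun x => hz (mem_univ x)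
  refine (hle x).trans ?_
  by_contra! hpos
  have hclopen : IsClopen {x | (f x).re = (f z).re} := by
    refine ⟨isClosed_eq hc continuous_const, isOpen_iff_mem_nhds.2 fun p hp => ?_⟩
    refine eventually_re_eq hf hle ?_ hp
    rcases (𝓡∂ 6).isInteriorPoint_or_isBoundaryPoint p with h | h
    · exact h
    · obtain ⟨y, rfl⟩ := B.exists_incl_eq h
      have hp' : (f (B.incl y)).re = (f z).re := hp
      rw [h0] at hp'
      exact absurd hp' hpos.ne
  obtain ⟨y, hy⟩ := hmeet z
  have h1 : (f (B.incl y)).re = (f z).re :=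
    hclopen.connectedComponent_subset (show z ∈ {x | (f x).re = (f z).re} from rfl) hy
  rw [h0] at h1
  exact hpos.ne h1

/-- A holomorphic function vanishing on the boundary vanishes. -/
lemma eq_zero_of_boundary [CompactSpace Z]
    (hmeet : ∀ x : Z, ∃ y : M, B.incl y ∈ connectedComponent x) {f : Z → ℂ}
    (hf : C.IsHolomorphic f) (h0 : ∀ y, f (B.incl y) = 0) (x : Z) : f x = 0 := by
  -- multiply by `1, -1, i, -i` to bound the real and imaginary parts on both sides
  have h : ∀ c : ℂ, (c * f x).re ≤ 0 := fun c =>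
    re_nonpos_of_boundary B hmeet (hf.const_mul c) (fun y => by rw [h0, mul_zero]) x
  have h1 := h 1
  have h2 := h (-1)
  have h3 := h Complex.I
  have h4 := h (-Complex.I)
  simp at h1 h2 h3 h4
  exact Complex.ext (le_antisymm h1 h2) (le_antisymm h4 h3)

end Global

/-! ### Infinitesimal diffeomorphisms -/

namespace CalabiYau

variable {Z : Type*} [TopologicalSpace Z] [ChartedSpace (EuclideanHalfSpace 6) Z]
  [IsManifold (𝓡∂ 6) ∞ Z] (C : CalabiYau Z)

lemma Omega20_weight (ν : C.Omega 2 0) (x : Z) : HasWeight (C.Jv x) 2 (Form.val ν.1 x) := by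
  have := C.Omega_weight ν x
  rwa [show (((2 : ℕ) : ℂ) - ((0 : ℕ) : ℂ)) = 2 by norm_num] at this

lemma Omega21_weight (σ : C.Omega 2 1) (x : Z) : HasWeight (C.Jv x) 1 (Form.val σ.1 x) := by
  have := C.Omega_weight σ x
  rwa [show (((2 : ℕ) : ℂ) - ((1 : ℕ) : ℂ)) = 1 by norm_num] at this

/-- The exterior derivative of a `(2,0)`-form as a sum of forms of types `(3,0)` and `(2,1)`. -/
lemma exists_extD_Omega20 (ν : C.Omega 2 0) : ∃ a : Form (𝓡∂ 6) Z ℂ 3,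
    (∀ x, HasWeight (C.Jv x) 3 (a.val x)) ∧ IsSmoothForm a ∧
      extD ν.1 = a + C.dbar 2 0 ν := by
  have hs : IsSmoothForm (C.dbar 2 0 ν) := C.dbar_smooth ν
  refine ⟨extD ν.1 - C.dbar 2 0 ν, fun x => ?_, (C.Omega_smooth ν).extD.sub hs,
    (sub_add_cancel (extD ν.1 : Form (𝓡∂ 6) Z ℂ 3) (C.dbar 2 0 ν)).symm⟩
  obtain ⟨a, h1, h2, -⟩ := C.exists_extD_eq ν x
  have e : (extD ν.1 - C.dbar 2 0 ν : Form (𝓡∂ 6) Z ℂ 3).val x = a := by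
    rw [Form.val_sub]
    exact sub_eq_of_eq_add h1
  rw [e]
  rwa [show (((2 : ℕ) : ℂ) - ((0 : ℕ) : ℂ)) + 1 = 3 by norm_num] at h2

lemma dbar20_weight (ν : C.Omega 2 0) (x : Z) :
    HasWeight (C.Jv x) 1 (Form.val (C.dbar 2 0 ν) x) := C.Omega21_weight (C.dbarOmega ν) x

lemma rho21_twoRe_extD (ν : C.Omega 2 0) : C.rho21 (twoRe (extD ν.1)) = C.dbar 2 0 ν := by
  obtain ⟨a, h1, -, h3⟩ := C.exists_extD_Omega20 ν
  rw [h3]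
  exact C.rho21_twoRe h1 (C.dbar20_weight ν)

lemma opJForm_twoRe_extD (ν : C.Omega 2 0) :
    C.opJForm (twoRe (extD ν.1)) = Form.mapL ((2 : ℝ) • Complex.imCLM) (extD ν.1) := by
  obtain ⟨a, h1, -, h3⟩ := C.exists_extD_Omega20 ν
  rw [h3]
  exact C.opJForm_twoRe h1 (C.dbar20_weight ν)

lemma Φ_curry_injective (x : Z) : Function.Injective (C.Φ.val x).curryLeft := by
  refine (injective_iff_map_eq_zero _).2 fun u hu => ?_
  have hu' := CLin.existsUnique_contraction (C.Φ_clin x) (C.Φ_ne_zero x)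
    (ν := (0 : EuclideanSpace ℝ (Fin 6) [⋀^Fin 2]→L[ℝ] ℂ))
    (fun _ _ => by change (0 : ℂ) = _ * 0; simp) (C.Jv_sq x) finrank_model
  refine hu'.unique (fun a b => congrArg (fun ψ => ψ ![a, b]) hu) fun a b => ?_
  have := form_smul₀ (C.Φ.val x) 0 (0 : EuclideanSpace ℝ (Fin 6)) ![a, b]
  rw [zero_smul, zero_smul] at this
  exact this

lemma insForm_Φ_weight (w : Z → EuclideanSpace ℝ (Fin 6)) (x : Z) :
    HasWeight (C.Jv x) 2 ((insForm w C.Φ).val x) := by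
  have h : CLin (C.Jv x) ((insForm w C.Φ).val x) := by
    intro a v
    change C.Φ.val x (Matrix.vecCons (w x) (Matrix.vecCons (C.Jv x a) v)) =
      Complex.I * C.Φ.val x (Matrix.vecCons (w x) (Matrix.vecCons a v))
    rw [form_swap₀, C.Φ_clin, form_swap₀]
    ring
  have := h.hasWeight (C.Jv_sq x)
  rwa [show (((1 + 1 : ℕ) : ℂ)) = 2 by norm_num] at this

/-- The Lie derivative of `Ψ` along `w`, in terms of the `(2,0)`-form `ν = ½ i_w Φ`. -/
lemma lieDeriv_Ψ (w : ∀ x : Z, TangentSpace (𝓡∂ 6) x) (ν : C.Omega 2 0)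
    (h : insForm w C.Φ = (2 : ℝ) • ν.1) : lieDeriv w C.Ψ = twoRe (extD ν.1) := by
  have hΨ : C.Ψ = C.Φ.mapL Complex.reCLM := rfl
  have h1 : extD C.Ψ = 0 := by
    rw [hΨ, extD_mapL _ C.Φ_smooth, C.Φ_closed, Form.mapL_zero]
  have h2 : interiorProd w C.Ψ = Form.mapL Complex.reCLM ((2 : ℝ) • ν.1) := by
    rw [← h]; rfl
  have h3 : interiorProd w (0 : Form (𝓡∂ 6) Z ℝ 4) = 0 := rfl
  rw [lieDeriv, h1, h3, add_zero, h2, extD_mapL _ ((C.Omega_smooth ν).smul 2),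
    extD_smul 2 (C.Omega_smooth ν)]
  refine Form.ext_val fun x => ?_
  ext v
  change Complex.re ((2 : ℝ) • (extD ν.1).val x v) = 2 * ((extD ν.1).val x v).re
  rw [Complex.smul_re, smul_eq_mul]

/-- Every `(2,0)`-form vanishing along the boundary is the contraction of the volume form with a
vector field vanishing along the boundary. -/
lemma twoRe_extD_mem_gauge (ν : C.Omega 2 0)
    (h0 : ∀ x ∈ (𝓡∂ 6).boundary Z, Form.val ν.1 x = 0) :
    twoRe (extD ν.1) ∈ StronglyPseudoconvexBoundary.gauge C := by
  have h1 : ∀ x, ∃! w : EuclideanSpace ℝ (Fin 6), ∀ u v, C.Φ.val x ![w, u, v] =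
      ((2 : ℝ) • Form.val ν.1 x) ![u, v] := by
    intro x
    refine CLin.existsUnique_contraction (C.Φ_clin x) (C.Φ_ne_zero x) ?_ (C.Jv_sq x) finrank_model
    exact HasWeight.clin_two (C.Jv_sq x) ((C.Omega20_weight ν x).smul (2 : ℝ))
  choose w hw using h1
  have hins : insForm w C.Φ = (2 : ℝ) • ν.1 := Form.ext_val fun x => by
    ext v
    rw [eq_vec_two v]
    exact (hw x).1 _ _
  have hsm : ∀ x, ContDiffWithinAt ℝ ∞ (vecRep (𝓡∂ 6) x w) (range (𝓡∂ 6))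
      (extChartAt (𝓡∂ 6) x x) := by
    refine contDiffWithinAt_vecRep_of_insForm C.Φ_smooth C.Φ_curry_injective ?_
    rw [hins]
    exact (C.Omega_smooth ν).smul 2
  have : IsManifold (𝓡∂ 6) 1 Z := IsManifold.of_le (n := ∞) (by simp)
  refine Submodule.subset_span ⟨w, contMDiff_section_iff.2 hsm, fun x hx => ?_,
    (C.lieDeriv_Ψ w ν hins).symm⟩
  refine C.Φ_curry_injective x ?_
  have h2 : (C.Φ.val x).curryLeft (w x) = (2 : ℝ) • Form.val ν.1 x :=
    congrArg (fun φ => φ.val x) hins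
  have h3 : (C.Φ.val x).curryLeft (0 : EuclideanSpace ℝ (Fin 6)) = 0 := map_zero _
  rw [h2, h0 x hx]
  refine Eq.trans ?_ h3.symm
  ext v
  simp

end CalabiYau

namespace StronglyPseudoconvexBoundary

variable {Z : Type*} [TopologicalSpace Z] [ChartedSpace (EuclideanHalfSpace 6) Z]
  [IsManifold (𝓡∂ 6) ∞ Z]
  {M : Type*} [TopologicalSpace M] [ChartedSpace (EuclideanSpace ℝ (Fin 5)) M]
  [IsManifold (𝓡 5) ∞ M] {C : CalabiYau Z} (B : StronglyPseudoconvexBoundary C M)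

/-- Elements of the gauge space come from `(2,0)`-forms vanishing along the boundary. -/
lemma exists_of_mem_gauge {ρ : Form (𝓡∂ 6) Z ℝ 3} (h : ρ ∈ gauge C) :
    ∃ ν : C.Omega 2 0, (∀ x ∈ (𝓡∂ 6).boundary Z, Form.val ν.1 x = 0) ∧
      ρ = CalabiYau.twoRe (extD ν.1) := by
  have htw : ∀ φ ψ : Form (𝓡∂ 6) Z ℂ 3, CalabiYau.twoRe (φ + ψ) = CalabiYau.twoRe φ + CalabiYau.twoRe ψ := by
    intro φ ψ
    refine Form.ext_val fun x => ?_
    ext v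
    rw [Form.val_add, ContinuousAlternatingMap.add_apply, CalabiYau.twoRe_apply,
      CalabiYau.twoRe_apply, CalabiYau.twoRe_apply, Form.val_add,
      ContinuousAlternatingMap.add_apply, Complex.add_re]
    ring
  have hts : ∀ (c : ℝ) (φ : Form (𝓡∂ 6) Z ℂ 3), CalabiYau.twoRe (c • φ) = c • CalabiYau.twoRe φ := by
    intro c φ
    refine Form.ext_val fun x => ?_
    ext v
    rw [Form.val_smul, ContinuousAlternatingMap.smul_apply, CalabiYau.twoRe_apply,
      CalabiYau.twoRe_apply, Form.val_smul, ContinuousAlternatingMap.smul_apply, Complex.smul_re,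
      smul_eq_mul, smul_eq_mul]
    ring
  refine Submodule.span_induction ?_ ?_ ?_ ?_ h
  · rintro _ ⟨w, hw, hw0, rfl⟩
    have : IsManifold (𝓡∂ 6) 1 Z := IsManifold.of_le (n := ∞) (by simp)
    have hs : IsSmoothForm ((1 / 2 : ℝ) • insForm w C.Φ) :=
      (isSmoothForm_insForm (contMDiff_section_iff.1 hw) C.Φ_smooth).smul _
    -- `L_w Ψ = Re d(i_w Φ)`, which is twice the real part of `d(½ i_w Φ)`
    refine ⟨C.mkOmega 2 0 ((1 / 2 : ℝ) • insForm w C.Φ) hs fun x => ?_, fun x hx => ?_, ?_⟩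
    · rw [show (((2 : ℕ) : ℂ) - ((0 : ℕ) : ℂ)) = 2 by norm_num]
      exact (C.insForm_Φ_weight w x).smul (1 / 2 : ℝ)
    · have h1 : (insForm w C.Φ).val x = 0 := by
        have h2 : (insForm w C.Φ).val x = (C.Φ.val x).curryLeft (w x) := rfl
        rw [h2, hw0 x hx]
        exact map_zero _
      change (1 / 2 : ℝ) • (insForm w C.Φ).val x = 0
      rw [h1]
      ext v
      simp
    · refine C.lieDeriv_Ψ w _ ?_
      change insForm w C.Φ = (2 : ℝ) • (1 / 2 : ℝ) • insForm w C.Φ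
      rw [smul_smul]
      norm_num
  · refine ⟨0, fun x hx => rfl, ?_⟩
    have h0 : extD (0 : Form (𝓡∂ 6) Z ℂ 2) = 0 := (extDₗ (𝓡∂ 6) Z ℂ 2).map_zero
    have h1 := hts 0 0
    rw [zero_smul, zero_smul] at h1
    exact h1.symm.trans (congrArg CalabiYau.twoRe h0.symm)
  · rintro _ _ - - ⟨ν₁, h₁, rfl⟩ ⟨ν₂, h₂, rfl⟩
    refine ⟨ν₁ + ν₂, fun x hx => ?_, ?_⟩
    · have : Form.val (ν₁ + ν₂).1 x = Form.val ν₁.1 x + Form.val ν₂.1 x := rfl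
      rw [this, h₁ x hx, h₂ x hx]
      ext v
      simp
    · rw [← htw]
      exact congrArg _ (extD_add (C.Omega_smooth ν₁) (C.Omega_smooth ν₂)).symm
  · rintro c _ - ⟨ν, h₁, rfl⟩
    refine ⟨c • ν, fun x hx => ?_, ?_⟩
    · have : Form.val (c • ν).1 x = c • Form.val ν.1 x := rfl
      rw [this, h₁ x hx]
      ext v
      simp
    · rw [← hts]
      exact congrArg _ (extD_smul c (C.Omega_smooth ν)).symm

/-- The boundary map vanishes on the gauge space. -/
lemma bdry_of_mem_gauge {ρ : Form (𝓡∂ 6) Z ℝ 3} (h : ρ ∈ gauge C) : B.bdry ρ = 0 := by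
  obtain ⟨ν, h0, rfl⟩ := exists_of_mem_gauge h
  have h1 : B.restrict ν.1 = 0 := Form.ext_val fun y => by
    rw [restrict_val, h0 _ (B.incl_mem_boundary y)]; rfl
  have h2 : B.restrict (extD ν.1) = 0 := by
    rw [← B.extD_restrict (C.Omega_smooth ν), h1]
    exact (extDₗ (𝓡 5) M ℂ 2).map_zero
  have h3 : B.restrict (C.opJForm (CalabiYau.twoRe (extD ν.1))) = 0 := by
    rw [C.opJForm_twoRe_extD]
    have : B.restrict (Form.mapL ((2 : ℝ) • Complex.imCLM) (extD ν.1)) =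
        Form.mapL ((2 : ℝ) • Complex.imCLM) (B.restrict (extD ν.1)) := rfl
    rw [this, h2, Form.mapL_zero]
  refine Form.ext_val fun y => ?_
  ext v
  rw [eq_vec_two v, bdry_apply, h3]
  rfl

end StronglyPseudoconvexBoundary

/-! ### Extension of forms from the boundary -/

/-- An immersion of finite-dimensional spaces has, near any point, a smooth retraction onto its
image, defined on an open subset of the target. -/
lemma exists_local_retraction {V W : Type*} [NormedAddCommGroup V] [NormedSpace ℝ V]
    [FiniteDimensional ℝ V] [NormedAddCommGroup W] [NormedSpace ℝ W] [FiniteDimensional ℝ W]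
    {j : V → W} {D : Set V} (hD : IsOpen D) {a₀ : V} (ha₀ : a₀ ∈ D)
    (hj : ∀ a ∈ D, ContDiffAt ℝ ∞ j a) (hinj : Function.Injective (fderiv ℝ j a₀)) :
    ∃ (A : Set V) (O : Set W) (ret : W → V), IsOpen A ∧ a₀ ∈ A ∧ A ⊆ D ∧ IsOpen O ∧
      (∀ a ∈ A, j a ∈ O ∧ ret (j a) = a) ∧ ∀ q ∈ O, ret q ∈ A ∧ ContDiffAt ℝ ∞ ret q := by
  have : CompleteSpace V := FiniteDimensional.complete ℝ V
  obtain ⟨l, hl⟩ := LinearMap.exists_leftInverse_of_injective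
    (fderiv ℝ j a₀ : V →ₗ[ℝ] W) (LinearMap.ker_eq_bot.2 hinj)
  let L : W →L[ℝ] V := LinearMap.toContinuousLinearMap l
  have hL : ∀ u, L (fderiv ℝ j a₀ u) = u := fun u => LinearMap.congr_fun hl u
  let h : V → V := fun a => L (j a)
  have hh : ∀ a ∈ D, ContDiffAt ℝ ∞ h a := fun a ha => L.contDiff.contDiffAt.comp a (hj a ha)
  have hd : HasFDerivAt h ((ContinuousLinearEquiv.refl ℝ V : V ≃L[ℝ] V) : V →L[ℝ] V) a₀ := by
    have h1 := L.hasFDerivAt.comp a₀ ((hj a₀ ha₀).differentiableAt (by simp)).hasFDerivAt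
    have h2 : L ∘L fderiv ℝ j a₀ = ContinuousLinearMap.id ℝ V := by ext1 u; exact hL u
    rw [h2] at h1
    exact h1
  have hn : (∞ : WithTop ℕ∞) ≠ 0 := by simp
  let e := (hh a₀ ha₀).toOpenPartialHomeomorph h hd hn
  have he : ∀ a, e a = h a := fun a => rfl
  -- the derivative of `h` is invertible near `a₀`
  have hinv : ∀ᶠ a in nhds a₀, fderiv ℝ h a ∈
      range ((↑) : (V ≃L[ℝ] V) → V →L[ℝ] V) := by
    have h1 : ContinuousAt (fderiv ℝ h) a₀ :=
      ((hh a₀ ha₀).fderiv_right (m := ∞) (by simp)).continuousAt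
    refine h1 ?_
    rw [hd.fderiv]
    exact ContinuousLinearEquiv.nhds _
  have hev : ∀ᶠ a in nhds a₀, a ∈ D ∧ a ∈ e.source ∧ fderiv ℝ h a ∈
      range ((↑) : (V ≃L[ℝ] V) → V →L[ℝ] V) :=
    Filter.Eventually.and (hD.mem_nhds ha₀) (Filter.Eventually.and (e.open_source.mem_nhds
      ((hh a₀ ha₀).mem_toOpenPartialHomeomorph_source hd hn)) hinv)
  obtain ⟨A, hA, hAo, haA⟩ := eventually_nhds_iff.1 hev
  refine ⟨A, L ⁻¹' (e.target ∩ e.symm ⁻¹' A), fun q => e.symm (L q), hAo, haA,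
    fun a ha => (hA a ha).1, (e.symm.isOpen_inter_preimage hAo).preimage L.continuous,
    fun a ha => ?_, fun q hq => ⟨hq.2, ?_⟩⟩
  · have h1 : e.symm (L (j a)) = a := e.left_inv (hA a ha).2.1
    refine ⟨⟨e.map_source (hA a ha).2.1, ?_⟩, h1⟩
    change e.symm (L (j a)) ∈ A
    rwa [h1]
  · have h1 : e.symm (L q) ∈ A := hq.2
    obtain ⟨f', hf'⟩ := (hA _ h1).2.2
    have h2 := hh _ (hA _ h1).1
    refine (e.contDiffAt_symm (f₀' := f') hq.1 ?_ h2).comp q L.contDiff.contDiffAt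
    rw [hf']
    exact (h2.differentiableAt (by simp)).hasFDerivAt

section Local

variable {E : Type*} [NormedAddCommGroup E] [NormedSpace ℝ E]
  {H : Type*} [TopologicalSpace H] {I : ModelWithCorners ℝ E H}
  {X : Type*} [TopologicalSpace X] [ChartedSpace H X] [IsManifold I ∞ X]
  {F : Type*} [NormedAddCommGroup F] [NormedSpace ℝ F]

/-- Smoothness of a form at a point may be tested in any one chart. -/
lemma isSmoothForm_of_exists_chart [FiniteDimensional ℝ E] [FiniteDimensional ℝ F] {k : ℕ}
    {φ : Form I X F k}
    (h : ∀ x : X, ∃ x₀ : X, x ∈ (extChartAt I x₀).source ∧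
      ContDiffWithinAt ℝ ∞ (chartRep x₀ φ) (range I) (extChartAt I x₀ x)) :
    IsSmoothForm φ := by
  refine isSmoothForm_iff.2 fun x₁ p hp => ?_
  obtain ⟨x₀, hx₀, hs⟩ := h ((extChartAt I x₁).symm p)
  have h1 := contDiffWithinAt_mapRep (I := I) (I' := I) (contMDiff_id (M := X)) hp
    (x₀ := x₀) hx₀
  have hpr := extChartAt_target_subset_range x₁ hp
  have h2 : ContDiffWithinAt ℝ ∞ (fun q => (chartRep x₀ φ
      (mapRep I I x₁ x₀ id q)).compContinuousLinearMap
        (fderivWithin ℝ (mapRep I I x₁ x₀ id) (range I) q)) (range I) p :=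
    contDiffWithinAt_compContinuousLinearMap
      (ContDiffWithinAt.comp (g := chartRep x₀ φ) p hs h1 (mapRep_mapsTo x₁ x₀ id))
      (h1.fderivWithin_right I.uniqueDiffOn (by simp) hpr)
  have h3 : ∀ q, q ∈ (extChartAt I x₁).target ∧
      (extChartAt I x₁).symm q ∈ (extChartAt I x₀).source →
      chartRep x₁ φ q = (chartRep x₀ φ (mapRep I I x₁ x₀ id q)).compContinuousLinearMap
        (fderivWithin ℝ (mapRep I I x₁ x₀ id) (range I) q) := fun q hq => by
    have h4 := chartRep_pullback (I := I) (I' := I) (f := (id : X → X)) mdifferentiable_id φ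
      hq.1 (x₀ := x₀) hq.2
    rwa [pullback_id] at h4
  refine h2.congr_of_eventuallyEq ?_ (h3 p ⟨hp, hx₀⟩)
  filter_upwards [eventually_mapRep_mem (I := I) (I' := I) (continuous_id (X := X)) hp
    (x₀ := x₀) hx₀] with q hq
  exact h3 q hq

end Local

namespace StronglyPseudoconvexBoundary

variable {Z : Type*} [TopologicalSpace Z] [ChartedSpace (EuclideanHalfSpace 6) Z]
  [IsManifold (𝓡∂ 6) ∞ Z]
  {M : Type*} [TopologicalSpace M] [ChartedSpace (EuclideanSpace ℝ (Fin 5)) M]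
  [IsManifold (𝓡 5) ∞ M] {C : CalabiYau Z} (B : StronglyPseudoconvexBoundary C M)

/-- Near a boundary point, a form on the boundary is the restriction of its pull-back under a
smooth retraction. -/
lemma exists_local_extension {k : ℕ} {γ : Form (𝓡 5) M ℝ k} (hγ : IsSmoothForm γ) (y₀ : M) :
    ∃ (U : Set Z) (φ : Form (𝓡∂ 6) Z ℝ k), IsOpen U ∧ B.incl y₀ ∈ U ∧
      (∀ x ∈ U, ∃ x₀ : Z, x ∈ (extChartAt (𝓡∂ 6) x₀).source ∧
        ContDiffWithinAt ℝ ∞ (chartRep x₀ φ) (range (𝓡∂ 6)) (extChartAt (𝓡∂ 6) x₀ x)) ∧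
      ∀ y, B.incl y ∈ U → (B.restrict φ).val y = γ.val y := by
  let x₀ := B.incl y₀
  -- the inclusion in the charts centred at `y₀` and at its image
  let j := mapRep (𝓡 5) (𝓡∂ 6) y₀ x₀ B.incl
  let a₀ := extChartAt (𝓡 5) y₀ y₀
  have ha₀ : a₀ ∈ (extChartAt (𝓡 5) y₀).target := mem_extChartAt_target y₀
  have hx₀ : B.incl ((extChartAt (𝓡 5) y₀).symm a₀) ∈ (extChartAt (𝓡∂ 6) x₀).source := by
    rw [extChartAt_to_inv]; exact mem_extChartAt_source x₀
  have hr : range (𝓡 5) = univ := (𝓡 5).range_eq_univ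
  have hev := eventually_mapRep_mem B.incl_smooth.continuous ha₀ hx₀
  rw [hr, nhdsWithin_univ] at hev
  obtain ⟨D, hD, hDo, haD⟩ := eventually_nhds_iff.1 hev
  have hj : ∀ a ∈ D, ContDiffAt ℝ ∞ j a := fun a ha => by
    have := contDiffWithinAt_mapRep B.incl_smooth (hD a ha).1 (hD a ha).2
    rwa [hr, contDiffWithinAt_univ] at this
  have hmd := B.incl_smooth.mdifferentiable (by simp)
  have hinj : Function.Injective (fderiv ℝ j a₀) := by
    have h1 := fderivWithin_mapRep hmd ha₀ hx₀
    rw [hr, fderivWithin_univ, dChartSymm_self, extChartAt_to_inv, dChart_self] at h1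
    rw [h1]
    exact B.incl_immersion y₀
  obtain ⟨A, O, ret, hAo, haA, hAD, hO, hret, hO'⟩ := exists_local_retraction hDo haD hj hinj
  -- the pull-back under `ret` of the coordinate expression of `γ`
  let G : EuclideanSpace ℝ (Fin 6) → EuclideanSpace ℝ (Fin 6) [⋀^Fin k]→L[ℝ] ℝ := fun q =>
    (chartRep y₀ γ (ret q)).compContinuousLinearMap (fderiv ℝ ret q)
  have hG : ∀ q ∈ O, ContDiffAt ℝ ∞ G q := fun q hq => by
    obtain ⟨h1, h2⟩ := hO' q hq
    have h3 := hγ.contDiffWithinAt (hD _ (hAD h1)).1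
    rw [hr] at h3
    exact contDiffWithinAt_compContinuousLinearMap (s := univ)
      (h3.comp q h2.contDiffWithinAt (mapsTo_univ _ _))
      (h2.fderiv_right (m := ∞) (by simp)).contDiffWithinAt
  let φ : Form (𝓡∂ 6) Z ℝ k := Form.ofVal fun x =>
    (G (extChartAt (𝓡∂ 6) x₀ x)).compContinuousLinearMap (dChart (𝓡∂ 6) x₀ x)
  have hφ : ∀ q ∈ (extChartAt (𝓡∂ 6) x₀).target, chartRep x₀ φ q = G q := fun q hq => by
    have h1 : φ.val ((extChartAt (𝓡∂ 6) x₀).symm q) = (G q).compContinuousLinearMap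
        (dChart (𝓡∂ 6) x₀ ((extChartAt (𝓡∂ 6) x₀).symm q)) := by
      change (G (extChartAt (𝓡∂ 6) x₀ ((extChartAt (𝓡∂ 6) x₀).symm q))).compContinuousLinearMap
        _ = _
      rw [(extChartAt (𝓡∂ 6) x₀).right_inv hq]
    rw [chartRep_eq, h1]
    ext v
    have h2 := dChart_comp_dChartSymm hq
    change G q (fun i => (dChart (𝓡∂ 6) x₀ ((extChartAt (𝓡∂ 6) x₀).symm q) ∘L
      dChartSymm (𝓡∂ 6) x₀ q) (v i)) = _
    rw [h2]; rfl
  have hopen : IsOpen ((extChartAt (𝓡 5) y₀).source ∩ extChartAt (𝓡 5) y₀ ⁻¹' A) :=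
    (continuousOn_extChartAt y₀).isOpen_inter_preimage (isOpen_extChartAt_source y₀) hAo
  obtain ⟨U₁, hU₁, hU₁'⟩ := B.incl_embedding.isInducing.isOpen_iff.1 hopen
  refine ⟨U₁ ∩ ((extChartAt (𝓡∂ 6) x₀).source ∩ extChartAt (𝓡∂ 6) x₀ ⁻¹' O), φ,
    hU₁.inter ((continuousOn_extChartAt x₀).isOpen_inter_preimage
      (isOpen_extChartAt_source x₀) hO), ⟨?_, mem_extChartAt_source x₀, ?_⟩,
    fun x hx => ⟨x₀, hx.2.1, ?_⟩, fun y hy => ?_⟩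
  · change y₀ ∈ B.incl ⁻¹' U₁
    rw [hU₁']
    exact ⟨mem_extChartAt_source y₀, haA⟩
  · have h1 := (hret a₀ haA).1
    have h2 : j a₀ = extChartAt (𝓡∂ 6) x₀ x₀ := by
      change extChartAt (𝓡∂ 6) x₀ (B.incl ((extChartAt (𝓡 5) y₀).symm a₀)) = _
      rw [extChartAt_to_inv]
    rwa [h2] at h1
  · have hx' := (extChartAt (𝓡∂ 6) x₀).map_source hx.2.1
    refine (hG _ hx.2.2).contDiffWithinAt.congr_of_eventuallyEq ?_ (hφ _ hx')
    filter_upwards [extChartAt_target_mem_nhdsWithin_of_mem hx'] with q hq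
    exact hφ q hq
  · have hy1 : y ∈ (extChartAt (𝓡 5) y₀).source ∩ extChartAt (𝓡 5) y₀ ⁻¹' A := by
      rw [← hU₁']; exact hy.1
    obtain ⟨hys, hyA⟩ := hy1
    have ht := hD _ (hAD hyA)
    have h1 := chartRep_pullback hmd φ ht.1 ht.2
    have hja : mapRep (𝓡 5) (𝓡∂ 6) y₀ x₀ B.incl (extChartAt (𝓡 5) y₀ y) ∈
        (extChartAt (𝓡∂ 6) x₀).target := (extChartAt (𝓡∂ 6) x₀).map_source ht.2
    rw [hφ _ hja, hr, fderivWithin_univ] at h1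
    -- the differential of `ret ∘ j = id`
    have h2 : fderiv ℝ ret (j (extChartAt (𝓡 5) y₀ y)) ∘L fderiv ℝ j (extChartAt (𝓡 5) y₀ y) =
        ContinuousLinearMap.id ℝ _ := by
      rw [← fderiv_comp _ ((hO' _ (hret _ hyA).1).2.differentiableAt (by simp))
        ((hj _ (hAD hyA)).differentiableAt (by simp))]
      have h3 : ret ∘ j =ᶠ[nhds (extChartAt (𝓡 5) y₀ y)] id := by
        filter_upwards [hAo.mem_nhds hyA] with a ha
        exact (hret a ha).2
      rw [h3.fderiv_eq, fderiv_id]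
    have h4 : chartRep y₀ (B.restrict φ) (extChartAt (𝓡 5) y₀ y) =
        chartRep y₀ γ (extChartAt (𝓡 5) y₀ y) := by
      refine h1.trans ?_
      ext v
      change chartRep y₀ γ (ret (j (extChartAt (𝓡 5) y₀ y))) (fun i =>
        (fderiv ℝ ret (j (extChartAt (𝓡 5) y₀ y)) ∘L
          fderiv ℝ j (extChartAt (𝓡 5) y₀ y)) (v i)) = _
      rw [h2, (hret _ hyA).2]; rfl
    rw [val_eq_chartRep (B.restrict φ) hys, h4, ← val_eq_chartRep γ hys]

/-- Every smooth form on the boundary is the restriction of a smooth form on `Z`. -/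
lemma exists_extension [T2Space Z] [CompactSpace Z] {k : ℕ} {γ : Form (𝓡 5) M ℝ k}
    (hγ : IsSmoothForm γ) :
    ∃ G : Form (𝓡∂ 6) Z ℝ k, IsSmoothForm G ∧ B.restrict G = γ := by
  have hloc : ∀ x : Z, ∃ (U : Set Z) (φ : Form (𝓡∂ 6) Z ℝ k), IsOpen U ∧ x ∈ U ∧
      (∀ x ∈ U, ∃ x₀ : Z, x ∈ (extChartAt (𝓡∂ 6) x₀).source ∧
        ContDiffWithinAt ℝ ∞ (chartRep x₀ φ) (range (𝓡∂ 6)) (extChartAt (𝓡∂ 6) x₀ x)) ∧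
      ∀ y, B.incl y ∈ U → (B.restrict φ).val y = γ.val y := by
    intro x
    by_cases hx : x ∈ (𝓡∂ 6).boundary Z
    · obtain ⟨y₀, rfl⟩ := B.exists_incl_eq hx
      exact B.exists_local_extension hγ y₀
    · refine ⟨{x | B.r x ≠ 0}, 0, isOpen_ne.preimage B.r_smooth.continuous,
        fun h => hx ((B.r_eq_zero_iff x).1 h), fun x _ => ⟨x, mem_extChartAt_source x, ?_⟩,
        fun y hy => absurd ((B.r_eq_zero_iff _).2 (B.incl_mem_boundary y)) hy⟩
      rw [chartRep_zero]
      exact contDiffWithinAt_const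
  choose U φ hU hxU hs hres using hloc
  -- glue the local extensions by a partition of unity subordinate to a finite subcover
  obtain ⟨t, ht⟩ := CompactSpace.elim_nhds_subcover U fun x => (hU x).mem_nhds (hxU x)
  obtain ⟨f, hf⟩ := SmoothPartitionOfUnity.exists_isSubordinate (𝓡∂ 6)
    (isClosed_univ (X := Z)) (fun i : t => U i) (fun i => hU i) fun x _ => by
      have : x ∈ ⋃ i ∈ t, U i := by rw [ht]; trivial
      simpa using this
  have hsum : ∀ x, ∑ i : t, f i x = 1 := fun x => by
    rw [← finsum_eq_sum_of_fintype]
    exact f.sum_eq_one (mem_univ x)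
  have hsm : ∀ i : t, IsSmoothForm (smulForm (f i) (φ i)) := by
    intro i
    refine isSmoothForm_of_exists_chart fun x => ?_
    by_cases hx : x ∈ tsupport (f i)
    · obtain ⟨x₀, h1, h2⟩ := hs i x (hf i hx)
      refine ⟨x₀, h1, ?_⟩
      exact (contDiffWithinAt_comp_symm (f i).contMDiff
        ((extChartAt (𝓡∂ 6) x₀).map_source h1)).smul h2
    · refine ⟨x, mem_extChartAt_source x, ?_⟩
      have h1 : ContinuousWithinAt (extChartAt (𝓡∂ 6) x).symm (range (𝓡∂ 6))
          (extChartAt (𝓡∂ 6) x x) :=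
        (mdifferentiableWithinAt_extChartAt_symm (I := 𝓡∂ 6)
          (mem_extChartAt_target x)).continuousWithinAt
      have h0 : ∀ x' ∈ (tsupport (f i))ᶜ, f i x' = 0 := fun x' hx' => by
        by_contra h
        exact hx' (subset_tsupport _ h)
      have h2 : ∀ᶠ q in nhdsWithin (extChartAt (𝓡∂ 6) x x) (range (𝓡∂ 6)),
          chartRep x (smulForm (f i) (φ i)) q = 0 := by
        have h3 := h1 ((isClosed_tsupport (f i)).isOpen_compl.mem_nhds
          (by rw [extChartAt_to_inv]; exact hx))
        filter_upwards [h3] with q hq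
        rw [chartRep_smulForm, Function.comp_apply, h0 _ hq, zero_smul]
      refine (contDiffWithinAt_const (c := 0)).congr_of_eventuallyEq h2 ?_
      rw [chartRep_smulForm, Function.comp_apply, extChartAt_to_inv, h0 _ hx, zero_smul]
  refine ⟨∑ i : t, smulForm (f i) (φ i),
    (SmoothForm (𝓡∂ 6) Z ℝ k).sum_mem fun i _ => hsm i, Form.ext_val fun y => ?_⟩
  -- along the boundary every summand is a multiple of `γ`
  have h1 : ∀ s : Finset t, (B.restrict (∑ i ∈ s, smulForm (f i) (φ i))).val y =
      (∑ i ∈ s, f i (B.incl y)) • γ.val y := by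
    classical
    intro s
    induction s using Finset.induction_on with
    | empty =>
      rw [Finset.sum_empty, Finset.sum_empty, zero_smul]
      rfl
    | insert a s has ih =>
      rw [Finset.sum_insert has, Finset.sum_insert has, restrict_add, Form.val_add, ih, add_smul]
      congr 1
      by_cases ha : f a (B.incl y) = 0
      · have h2 : (B.restrict (smulForm (f a) (φ a))).val y =
            f a (B.incl y) • (B.restrict (φ a)).val y := rfl
        rw [h2, ha, zero_smul, zero_smul]
      · have h2 : (B.restrict (smulForm (f a) (φ a))).val y =
            f a (B.incl y) • (B.restrict (φ a)).val y := rfl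
        rw [h2, hres a y (hf a (subset_tsupport _ ha))]
  rw [h1, hsum, one_smul]

end StronglyPseudoconvexBoundary

/-! ### Deformations with prescribed boundary value -/

namespace StronglyPseudoconvexBoundary

variable {Z : Type*} [TopologicalSpace Z] [ChartedSpace (EuclideanHalfSpace 6) Z]
  [IsManifold (𝓡∂ 6) ∞ Z]
  {M : Type*} [TopologicalSpace M] [ChartedSpace (EuclideanSpace ℝ (Fin 5)) M]
  [IsManifold (𝓡 5) ∞ M] {C : CalabiYau Z} (B : StronglyPseudoconvexBoundary C M)

lemma isSmoothCov_dz : IsSmoothCov (𝓡∂ 6) (fun x => dzOf (C.Jv x) (B.α x)) := by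
  have h1 : (fun x => dzOf (C.Jv x) (B.α x)) = fun x =>
      Complex.ofRealCLM ∘L B.α x +
        (-(Complex.I • Complex.ofRealCLM) : ℝ →L[ℝ] ℂ) ∘L (B.α x ∘L endVal C.J x) := by
    funext x
    ext v
    change ((B.α x v : ℝ) : ℂ) - Complex.I * ((B.α x (C.Jv x v) : ℝ) : ℂ) =
      ((B.α x v : ℝ) : ℂ) + -(Complex.I * ((B.α x (C.Jv x v) : ℝ) : ℂ))
    ring
  rw [h1]
  exact (B.isSmoothCov_α.comp_left _).add ((B.isSmoothCov_α.comp_end C.J_smooth).comp_left _)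

/-- The section `γ ∧ dz` is represented by a form on `Z`: extend `γ` to `Z` and average the
extension over `J`. -/
lemma exists_represents [T2Space Z] [CompactSpace Z] {γ : Form (𝓡 5) M ℝ 2}
    (hγ : γ ∈ B.HSpace) : ∃ σ : C.Omega 2 1, B.Represents σ γ := by
  obtain ⟨hs, -, hJ, -, -⟩ := B.mem_HSpace_iff.1 hγ
  obtain ⟨G, hG, hGγ⟩ := B.exists_extension hs
  -- the average over `J` is of type `(1,1)` and still restricts to `γ` on the contact planes, as `γ`
  -- is invariant there
  let g : Form (𝓡∂ 6) Z ℂ 2 := ((1 / 2 : ℝ) • (G + G.compEnd C.J)).mapL Complex.ofRealCLM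
  have hg : IsSmoothForm g := ((hG.add (hG.compEnd C.J_smooth)).smul _).mapL _
  have hval : ∀ x u v, g.val x ![u, v] =
      (((1 / 2 : ℝ) * (G.val x ![u, v] + G.val x ![C.Jv x u, C.Jv x v]) : ℝ) : ℂ) := by
    intro x u v
    have h1 : (G.compEnd C.J).val x ![u, v] = G.val x ![C.Jv x u, C.Jv x v] := by
      change G.val x (fun i => C.Jv x (![u, v] i)) = _
      congr 1
      ext i; fin_cases i <;> rfl
    rw [← h1]
    rfl
  have hg0 : ∀ x, HasWeight (C.Jv x) 0 (g.val x) := fun x =>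
    hasWeight_zero_of_invariant (C.Jv_sq x) fun u v => by
      rw [hval, hval, C.Jv_sq, C.Jv_sq, form_neg₀, form_neg₁, neg_neg, add_comm]
  have hw : ∀ x, HasWeight (C.Jv x) (((2 : ℕ) : ℂ) - ((1 : ℕ) : ℂ))
      ((wedgeForm (fun x => dzOf (C.Jv x) (B.α x)) g).val x) := fun x => by
    have := HasWeight.wedge (Or.inl rfl) (dzOf_J (α := B.α x) (C.Jv_sq x)) (hg0 x)
    rwa [show (0 : ℂ) + ((1 : ℤ) : ℂ) = ((2 : ℕ) : ℂ) - ((1 : ℕ) : ℂ) by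
      push_cast; norm_num] at this
  refine ⟨C.mkOmega 2 1 _ (hg.wedgeForm B.isSmoothCov_dz) hw, B.represents_iff.2 fun y => ?_⟩
  refine ⟨g.val (B.incl y), 0, hg0 _, fun t => by ext v; simp, fun u u' hu hu' => ?_, ?_⟩
  · obtain ⟨w, hw⟩ := B.ι_surj y _ hu
    obtain ⟨w', hw'⟩ := B.ι_surj y _ hu'
    have h1 : ∀ a b, G.val (B.incl y) ![B.ι y a, B.ι y b] = γ.val y ![a, b] := fun a b => by
      rw [← hGγ]
      change _ = G.val (B.incl y) (fun i => B.ι y (![a, b] i))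
      congr 1
      ext i; fin_cases i <;> rfl
    rw [hval, ← hw, ← hw', h1, h1, hJ y u w u' w' hw hw']
    congr 1
    ring
  · have h1 : wedge (dzbarOf (C.Jv (B.incl y)) (B.α (B.incl y)))
        (0 : EuclideanSpace ℝ (Fin 6) [⋀^Fin 2]→L[ℝ] ℂ) = 0 := by
      ext v
      simp [wedge_apply, wedgeCovector]
    rw [h1, add_zero]
    rfl

/-- A closed `(2,1)`-form representing `γ ∧ dz` is the `(2,1)`-part of an infinitesimal
deformation: `dσ` is a closed form of type `(3,1)`, so it equals `dτ` with `τ` of type `(3,0)`,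
and on the boundary `σ - τ` differs from `iθ ∧ γ` by a CR multiple of `Φ`, which extends
holomorphically. -/
lemma exists_deformation (hH31 : Subsingleton (C.Dolbeault 3 1))
    (hCR : ∀ f : M → ℂ, B.IsCR f →
      ∃ F : Z → ℂ, C.IsHolomorphic F ∧ ∀ y, F (B.incl y) = f y)
    {γ : Form (𝓡 5) M ℝ 2} (hγ : γ ∈ B.HSpace) {σ : C.Omega 2 1} (hσ : C.dbar 2 1 σ = 0)
    (hrep : B.Represents σ γ) :
    ∃ ρ ∈ B.infDef, C.rho21 ρ = σ.1 ∧ B.bdry ρ = (2 : ℝ) • γ := by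
  have hsσ := C.Omega_smooth σ
  -- as `∂̄σ = 0`, only the `(3,1)`-part of `dσ` is left
  have hw2 : ∀ x, HasWeight (C.Jv x) (((3 : ℕ) : ℂ) - ((1 : ℕ) : ℂ)) ((extD σ.1).val x) := by
    intro x
    obtain ⟨a, h1, h2, -⟩ := C.exists_extD_eq σ x
    rw [hσ] at h1
    have h3 : (extD σ.1).val x = a := by
      rw [h1]
      ext v
      change a v + 0 = a v
      rw [add_zero]
    rw [h3]
    rwa [show (((2 : ℕ) : ℂ) - ((1 : ℕ) : ℂ)) + 1 = ((3 : ℕ) : ℂ) - ((1 : ℕ) : ℂ) by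
      push_cast; norm_num] at h2
  let D : C.Omega 3 1 := C.mkOmega 3 1 (extD σ.1) hsσ.extD hw2
  have hD : C.dbar 3 1 D = 0 := by
    refine Form.ext_val fun x => ?_
    refine C.dbar_val_of_decomp (a := 0) (b := 0) ?_ (fun t => by ext v; simp)
      (fun t => by ext v; simp)
    have h1 : extD D.1 = 0 := extD_extD hsσ
    rw [h1]
    ext v
    simp [Form.val_zero]
  obtain ⟨τ, hτ⟩ : ∃ τ : C.Omega 3 0, C.dbar 3 0 τ = D.1 := by
    have h1 : (Submodule.Quotient.mk (⟨D, hD⟩ : LinearMap.ker (C.dbar 3 1)) :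
        C.Dolbeault 3 1) = 0 := Subsingleton.elim _ _
    exact (Submodule.Quotient.mk_eq_zero _).1 h1
  have hτd : extD τ.1 = extD σ.1 := (C.extD_eq_dbar τ).trans hτ
  have hτw : ∀ x, HasWeight (C.Jv x) 3 (Form.val τ.1 x) := fun x => by
    have := C.Omega_weight τ x
    rwa [show (((3 : ℕ) : ℂ) - ((0 : ℕ) : ℂ)) = 3 by norm_num] at this
  have hsτ := C.Omega_smooth τ
  -- both `τ` and the `Φ`-part of `σ` along the boundary are multiples of `Φ`
  obtain ⟨h, hh, hτh⟩ := C.exists_smulForm (a := τ.1) hsτ hτw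
  obtain ⟨f, hf, hfσ⟩ := B.exists_restrict_eq (B.mem_HSpace_iff.1 hγ).1 hrep
  let f' : M → ℂ := fun y => f y - h (B.incl y)
  have hf' : ContMDiff (𝓡 5) 𝓘(ℝ, ℂ) ∞ f' := hf.sub (hh.comp B.incl_smooth)
  have hrτ : B.restrict τ.1 = smulForm (fun y => h (B.incl y)) (B.restrict C.Φ) := by
    refine (congrArg _ hτh).trans ?_
    rfl
  have hrf : B.restrict (σ.1 - τ.1) =
      (wedgeForm B.θv γ).mapL (Complex.I • Complex.ofRealCLM) + smulForm f' (B.restrict C.Φ) := by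
    have h1 : B.restrict (σ.1 - τ.1) = B.restrict σ.1 - B.restrict τ.1 := rfl
    rw [h1, hfσ, hrτ]
    refine Form.ext_val fun y => ?_
    ext v
    change (_ + f y * _) - h (B.incl y) * _ = _ + (f y - h (B.incl y)) * _
    ring
  have hθγ : IsSmoothForm (wedgeForm B.θv γ) :=
    (B.mem_HSpace_iff.1 hγ).1.wedgeForm B.isSmoothCov_θv
  have hsub : extD (σ.1 - τ.1) = 0 := by
    rw [extD_sub hsσ hsτ, hτd, sub_self]
  -- `σ - τ` and `θ ∧ γ` are closed, hence so is their difference on the boundary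
  have hcl : extD (smulForm f' (B.restrict C.Φ)) = 0 := by
    have h1 : smulForm f' (B.restrict C.Φ) = B.restrict (σ.1 - τ.1) -
        (wedgeForm B.θv γ).mapL (Complex.I • Complex.ofRealCLM) := by
      rw [hrf, add_sub_cancel_left]
    rw [h1, extD_sub (B.restrict_smooth (hsσ.sub hsτ)) (hθγ.mapL _),
      B.extD_restrict (hsσ.sub hsτ), hsub, extD_mapL _ hθγ, B.extD_wedge_eq_zero hγ,
      Form.mapL_zero, sub_zero]
    rfl
  obtain ⟨F, hF, hFf⟩ := hCR f' (B.isCR_of_closed hf' hcl)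
  have hsF : IsSmoothForm (smulForm F C.Φ) := C.Φ_smooth.smulForm hF.1
  -- the deformation is twice the real part of `χ = σ - τ - FΦ`, which restricts to `i θ ∧ γ`
  let a : Form (𝓡∂ 6) Z ℂ 3 := (-1 : ℝ) • (τ.1 + smulForm F C.Φ)
  have ha : ∀ x, HasWeight (C.Jv x) 3 (a.val x) := fun x =>
    HasWeight.smul ((hτw x).add (C.smul_Φ_weight F x)) (((-1 : ℝ) : ℝ) : ℂ)
  have hsa : IsSmoothForm a := (IsSmoothForm.add hsτ hsF).smul _
  have hb := C.Omega21_weight σ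
  have hdχ : extD (a + σ.1) = 0 := by
    have h0 : ∀ w : Form (𝓡∂ 6) Z ℂ 4, (-1 : ℝ) • (w + 0) + w = 0 := fun w => by
      rw [add_zero, neg_one_smul, neg_add_cancel]
    rw [extD_add hsa hsσ, extD_smul _ (IsSmoothForm.add hsτ hsF), extD_add hsτ hsF, hτd,
      C.closed_of_isHolomorphic hF]
    exact h0 _
  have hsχ : IsSmoothForm (a + σ.1) := IsSmoothForm.add hsa hsσ
  have hrχ : B.restrict (a + σ.1) =
      (wedgeForm B.θv γ).mapL (Complex.I • Complex.ofRealCLM) := by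
    have h1 : a + σ.1 = (σ.1 - τ.1) - smulForm F C.Φ := by
      change (-1 : ℝ) • (τ.1 + smulForm F C.Φ) + σ.1 = _
      rw [neg_one_smul]
      abel
    have h2 : B.restrict ((σ.1 - τ.1) - smulForm F C.Φ) =
        B.restrict (σ.1 - τ.1) - smulForm (fun y => F (B.incl y)) (B.restrict C.Φ) := rfl
    rw [h1, h2, hrf, funext hFf, add_sub_cancel_right]
  obtain ⟨d1, d2⟩ := CalabiYau.extD_twoRe hsχ hdχ
  have hJ := C.opJForm_twoRe ha hb
  refine ⟨CalabiYau.twoRe (a + σ.1), ⟨hsχ.mapL _, d1, by rw [hJ]; exact d2, ?_⟩,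
    C.rho21_twoRe ha hb, ?_⟩
  · have h1 : B.restrict (CalabiYau.twoRe (a + σ.1)) =
        (B.restrict (a + σ.1)).mapL ((2 : ℝ) • Complex.reCLM) := rfl
    rw [h1, hrχ]
    refine Form.ext_val fun y => ?_
    ext v
    change 2 * (Complex.I * (((wedgeForm B.θv γ).val y v : ℝ) : ℂ)).re = 0
    simp
  · refine Form.ext_val fun y => ?_
    ext v
    have h1 : B.restrict (C.opJForm (CalabiYau.twoRe (a + σ.1))) =
        (B.restrict (a + σ.1)).mapL ((2 : ℝ) • Complex.imCLM) := by rw [hJ]; rfl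
    rw [eq_vec_two v, bdry_apply, h1, hrχ]
    change 2 * (Complex.I * (((wedgeForm B.θv γ).val y ![B.reeb y, v 0, v 1] : ℝ) : ℂ)).im =
      2 * γ.val y ![v 0, v 1]
    have h2 : (wedgeForm B.θv γ).val y ![B.reeb y, v 0, v 1] = γ.val y ![v 0, v 1] := by
      have h3 : ∀ u, γ.val y ![B.reeb y, u] = 0 := (B.mem_HSpace_iff.1 hγ).2.1 y
      rw [wedgeForm_val, wedge_two_apply, B.θv_reeb, h3, h3]
      ring
    rw [h2]
    simp

/-- A deformation whose `(2,1)`-part and boundary value vanish is zero: it is the real part of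
`hΦ` with `h` holomorphic on `Z` and zero on the boundary. -/
lemma eq_zero_of_rho21_eq_zero [CompactSpace Z]
    (hmeet : ∀ x : Z, ∃ y : M, B.incl y ∈ connectedComponent x)
    {ρ : Form (𝓡∂ 6) Z ℝ 3} (h : ρ ∈ B.infDef) (hb : B.bdry ρ = 0) (h21 : C.rho21 ρ = 0) :
    ρ = 0 := by
  obtain ⟨hs, hd, hdJ, h0⟩ := h
  have hchi : C.chi ρ = C.rho30 ρ := by rw [C.chi_eq, h21, add_zero]
  obtain ⟨f, hf, hρf⟩ := C.exists_smulForm (C.rho30_smooth hs) (C.rho30_weight ρ)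
  have hdf : extD (smulForm f C.Φ) = 0 := by
    rw [← hρf, ← hchi]
    exact C.extD_chi hs hd hdJ
  have hfh := C.isHolomorphic_of_closed hf hdf
  have hf0 : ∀ y, f (B.incl y) = 0 := by
    intro y
    by_contra hne
    refine B.restrict_Φ_ne_zero y ?_
    ext v
    have h1 := B.chi_tangent h0 y (v 0) (v 1) (v 2)
    rw [B.restrict_opJForm h0, hb, hchi, hρf] at h1
    have h2 : (wedgeForm B.θv (0 : Form (𝓡 5) M ℝ 2)).val y ![v 0, v 1, v 2] = 0 := by
      rw [wedgeForm_val, wedge_two_apply]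
      simp [Form.val_zero]
    rw [h2] at h1
    have h3 : f (B.incl y) *
        C.Φ.val (B.incl y) ![B.ι y (v 0), B.ι y (v 1), B.ι y (v 2)] = 0 := by
      refine Eq.trans h1 ?_
      simp
    rw [eq_vec_three v, restrict_val, comp_apply_three]
    exact (mul_eq_zero.1 h3).resolve_left hne
  have hz := eq_zero_of_boundary B hmeet hfh hf0
  refine Form.ext_val fun x => ?_
  ext v
  have h1 := C.chi_apply ρ x v
  rw [hchi, hρf, smulForm_val, hz x] at h1
  have h2 : (0 : ℂ) = (1 / 2 : ℂ) * (ρ.val x v + Complex.I * (Form.val (C.opJForm ρ) x v)) := by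
    refine Eq.trans ?_ h1
    exact (zero_mul (C.Φ.val x v)).symm
  have h3 := congrArg Complex.re h2
  simp at h3
  exact h3

/-- The forms `2 Re dν`, with `ν` of type `(2,0)` vanishing along the boundary, are infinitesimal
deformations. -/
lemma twoRe_extD_mem_infDef (ν : C.Omega 2 0)
    (h0 : ∀ x ∈ (𝓡∂ 6).boundary Z, Form.val ν.1 x = 0) :
    CalabiYau.twoRe (extD ν.1) ∈ B.infDef := by
  have hs := (C.Omega_smooth ν).extD
  obtain ⟨d1, d2⟩ := CalabiYau.extD_twoRe hs (extD_extD (C.Omega_smooth ν))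
  have h1 : B.restrict ν.1 = 0 := Form.ext_val fun y => by
    rw [restrict_val, h0 _ (B.incl_mem_boundary y)]; rfl
  have h2 : B.restrict (extD ν.1) = 0 := by
    rw [← B.extD_restrict (C.Omega_smooth ν), h1]
    exact (extDₗ (𝓡 5) M ℂ 2).map_zero
  refine ⟨hs.mapL _, d1, by rw [C.opJForm_twoRe_extD]; exact d2, ?_⟩
  have h3 : B.restrict (CalabiYau.twoRe (extD ν.1)) =
      (B.restrict (extD ν.1)).mapL ((2 : ℝ) • Complex.reCLM) := rfl
  rw [h3, h2, Form.mapL_zero]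

end StronglyPseudoconvexBoundary

/-! ### The maps of the exact sequence -/

/-- Two linear surjections with the same kernel have isomorphic targets. -/
lemma exists_linearEquiv_of_ker_eq {R A P Q : Type*} [Ring R] [AddCommGroup A] [AddCommGroup P]
    [AddCommGroup Q] [Module R A] [Module R P] [Module R Q] {f : A →ₗ[R] P} {g : A →ₗ[R] Q}
    (hf : Function.Surjective f) (hg : Function.Surjective g)
    (h : LinearMap.ker f = LinearMap.ker g) : ∃ e : P ≃ₗ[R] Q, ∀ a, e (f a) = g a := by
  refine ⟨(f.quotKerEquivOfSurjective hf).symm ≪≫ₗ Submodule.quotEquivOfEq _ _ h ≪≫ₗ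
    g.quotKerEquivOfSurjective hg, fun a => ?_⟩
  have h1 : (f.quotKerEquivOfSurjective hf).symm (f a) = Submodule.Quotient.mk a :=
    (LinearEquiv.symm_apply_eq _).2 rfl
  simp only [LinearEquiv.trans_apply]
  rw [h1]
  rfl

namespace StronglyPseudoconvexBoundary

variable {Z : Type*} [TopologicalSpace Z] [ChartedSpace (EuclideanHalfSpace 6) Z]
  [IsManifold (𝓡∂ 6) ∞ Z]
  {M : Type*} [TopologicalSpace M] [ChartedSpace (EuclideanSpace ℝ (Fin 5)) M]
  [IsManifold (𝓡 5) ∞ M] {C : CalabiYau Z} (B : StronglyPseudoconvexBoundary C M)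

/-- The map `ρ ↦ γ`, `Jρ|_M = γ ∧ θ`, before passing to the quotient by the gauge space. -/
def bdryₗ : B.infDef →ₗ[ℝ] B.HSpace where
  toFun ρ := ⟨B.bdry ρ.1, B.bdry_mem ρ.2⟩
  map_add' ρ σ := by
    have hJ : C.opJForm (ρ.1 + σ.1) = C.opJForm ρ.1 + C.opJForm σ.1 :=
      funext fun x => opJ_add _ _ _
    refine Subtype.ext (Form.ext_val fun y => ?_)
    ext v
    change (B.bdry (ρ.1 + σ.1)).val y v = (B.bdry ρ.1).val y v + (B.bdry σ.1).val y v
    rw [eq_vec_two v, bdry_apply, bdry_apply, bdry_apply, hJ]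
    rfl
  map_smul' c ρ := by
    have hJ : C.opJForm (c • ρ.1) = c • C.opJForm ρ.1 := funext fun x => opJ_smul _ _ _
    refine Subtype.ext (Form.ext_val fun y => ?_)
    ext v
    change (B.bdry (c • ρ.1)).val y v = c * (B.bdry ρ.1).val y v
    rw [eq_vec_two v, bdry_apply, bdry_apply, hJ]
    rfl

lemma bdryₗ_eq_zero_iff {ρ : B.infDef} : B.bdryₗ ρ = 0 ↔ B.bdry ρ.1 = 0 :=
  ⟨fun h => congrArg Subtype.val h, fun h => Subtype.ext h⟩

/-- The map `b`. -/
def bMap : B.KHat →ₗ[ℝ] B.HSpace :=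
  Submodule.liftQ _ B.bdryₗ fun _ hρ => B.bdryₗ_eq_zero_iff.2 (B.bdry_of_mem_gauge hρ)

lemma bMap_mk (ρ : B.infDef) : B.bMap (Submodule.Quotient.mk ρ) = B.bdryₗ ρ := rfl

lemma isBoundaryMap_bMap : B.IsBoundaryMap B.bMap := by
  intro ρ y v
  rw [B.restrict_opJForm ρ.2.2.2.2]
  exact wedge_apply (B.θv y) ((B.bdry ρ.1).val y) v

/-- The map `ρ ↦ ρ_{2,1}`. -/
def rho21ₗ : B.infDef →ₗ[ℝ] C.Omega 2 1 where
  toFun ρ := C.mkOmega 2 1 (C.rho21 ρ.1) (C.rho21_smooth ρ.2.1) fun x => by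
    rw [show (((2 : ℕ) : ℂ) - ((1 : ℕ) : ℂ)) = 1 by push_cast; norm_num]
    exact C.rho21_weight ρ.1 x
  map_add' ρ σ := Subtype.ext (Form.ext_val fun x => by
    change typeProj (C.Jv x) 2 1 (complexify (Form.val ρ.1 x + Form.val σ.1 x)) = _
    rw [complexify_add, typeProj_add]
    rfl)
  map_smul' c ρ := Subtype.ext (Form.ext_val fun x => by
    change typeProj (C.Jv x) 2 1 (complexify (c • Form.val ρ.1 x)) = _
    rw [complexify_smul, typeProj_smul]
    rfl)

lemma rho21ₗ_coe (ρ : B.infDef) : (B.rho21ₗ ρ).1 = C.rho21 ρ.1 := rfl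

lemma dbar_rho21ₗ (ρ : B.infDef) : C.dbar 2 1 (B.rho21ₗ ρ) = 0 := by
  refine C.dbar_eq_zero_of_closed (C.rho30_smooth ρ.2.1) (C.rho30_weight ρ.1) ?_
  rw [rho21ₗ_coe, ← C.chi_eq]
  exact C.extD_chi ρ.2.1 ρ.2.2.1 ρ.2.2.2.1

/-- The boundary value of `ρ` is represented by `2 ρ_{2,1}`. -/
lemma represents_rho21ₗ (ρ : B.infDef) :
    B.Represents ((2 : ℝ) • B.rho21ₗ ρ) (B.bdry ρ.1) := by
  refine B.represents_iff.2 fun y => ?_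
  have h := B.representsAt_bdry ρ.2.2.2.2 y
  have h1 : Form.val ((2 : ℝ) • B.rho21ₗ ρ).1 (B.incl y) =
      (2 : ℂ) • (C.rho21 ρ.1).val (B.incl y) := by
    ext v
    change (2 : ℝ) • (C.rho21 ρ.1).val (B.incl y) v = (2 : ℂ) * (C.rho21 ρ.1).val (B.incl y) v
    simp
  rw [h1]
  exact h

lemma Represents.add {σ₁ σ₂ : C.Omega 2 1} {γ₁ γ₂ : Form (𝓡 5) M ℝ 2}
    (h₁ : B.Represents σ₁ γ₁) (h₂ : B.Represents σ₂ γ₂) : B.Represents (σ₁ + σ₂) (γ₁ + γ₂) :=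
  B.represents_iff.2 fun y => (B.represents_iff.1 h₁ y).add (B.represents_iff.1 h₂ y)

lemma Represents.smul (c : ℝ) {σ : C.Omega 2 1} {γ : Form (𝓡 5) M ℝ 2}
    (h : B.Represents σ γ) : B.Represents (c • σ) (c • γ) :=
  B.represents_iff.2 fun y => (B.represents_iff.1 h y).smul c

/-- The forms representing the zero section are the normal forms. -/
lemma represents_zero_iff {σ : C.Omega 2 1} : B.Represents σ 0 ↔ σ ∈ B.OmegaN 2 1 := by
  rw [B.represents_iff]
  constructor
  · intro h x hx
    obtain ⟨y, rfl⟩ := B.exists_incl_eq hx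
    obtain ⟨μ, hμ, hσ⟩ := (B.frame y).exists_normal_of_representsAt_zero (h y)
    refine B.isNormal_succ_iff.2 ⟨μ, ?_, hσ⟩
    rwa [show (((2 : ℕ) : ℂ) - ((0 + 0 : ℕ) : ℂ)) = 2 by push_cast; norm_num]
  · intro h y
    obtain ⟨μ, hμ, hσ⟩ := B.isNormal_succ_iff.1 (h _ (B.incl_mem_boundary y))
    rw [show (((2 : ℕ) : ℂ) - ((0 : ℕ) : ℂ)) = 2 by push_cast; norm_num] at hμ
    refine ⟨0, μ, fun t => by ext v; simp, hμ, fun u u' _ _ => ?_, ?_⟩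
    · simp [Form.val_zero]
    · have h1 : wedge (dzOf (C.Jv (B.incl y)) (B.α (B.incl y)))
          (0 : EuclideanSpace ℝ (Fin 6) [⋀^Fin 2]→L[ℝ] ℂ) = 0 := by
        ext v
        simp [wedge_apply, wedgeCovector]
      rw [h1, zero_add]
      exact hσ

/-- The difference of two forms representing the same section is normal. -/
lemma sub_mem_OmegaN {σ₁ σ₂ : C.Omega 2 1} {γ : Form (𝓡 5) M ℝ 2}
    (h₁ : B.Represents σ₁ γ) (h₂ : B.Represents σ₂ γ) : σ₁ - σ₂ ∈ B.OmegaN 2 1 := by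
  refine B.represents_zero_iff.1 ?_
  have h := h₁.add B (h₂.smul B (-1))
  rwa [neg_one_smul, neg_one_smul, ← sub_eq_add_neg, add_neg_cancel] at h

section Lambda

/-- The map `λ` on the deformations with vanishing boundary value. -/
def lambda₀ : LinearMap.ker B.bdryₗ →ₗ[ℝ] B.HN 2 1 :=
  (Submodule.mkQ _) ∘ₗ ((B.rho21ₗ ∘ₗ (LinearMap.ker B.bdryₗ).subtype).codRestrict
    (B.cocyclesN 2 1) fun ρ => ⟨B.dbar_rho21ₗ ρ.1, by
      refine B.represents_zero_iff.1 ?_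
      have h := (B.represents_rho21ₗ ρ.1).smul B (1 / 2)
      rw [smul_smul, B.bdryₗ_eq_zero_iff.1 ρ.2, smul_zero] at h
      norm_num at h
      exact h⟩)

/-- The projection of the deformations with vanishing boundary value to the kernel of `b`. -/
def kerProj : LinearMap.ker B.bdryₗ →ₗ[ℝ] LinearMap.ker B.bMap :=
  ((Submodule.mkQ _) ∘ₗ (LinearMap.ker B.bdryₗ).subtype).codRestrict _ fun ρ => ρ.2

lemma kerProj_surjective : Function.Surjective B.kerProj := by
  rintro ⟨q, hq⟩
  obtain ⟨ρ, rfl⟩ := Submodule.Quotient.mk_surjective _ q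
  exact ⟨⟨ρ, hq⟩, rfl⟩

lemma mem_ker_kerProj {ρ : LinearMap.ker B.bdryₗ} :
    ρ ∈ LinearMap.ker B.kerProj ↔ ρ.1.1 ∈ gauge C := by
  rw [LinearMap.mem_ker]
  constructor
  · intro h
    have h1 : (Submodule.Quotient.mk ρ.1 : B.KHat) = 0 := congrArg Subtype.val h
    exact (Submodule.Quotient.mk_eq_zero ((gauge C).submoduleOf B.infDef)).1 h1
  · intro h
    exact Subtype.ext ((Submodule.Quotient.mk_eq_zero _).2 h)

lemma mem_ker_lambda₀ {ρ : LinearMap.ker B.bdryₗ} :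
    ρ ∈ LinearMap.ker B.lambda₀ ↔
      ∃ ν ∈ B.OmegaN 2 0, C.dbar 2 0 ν = C.rho21 ρ.1.1 := by
  rw [LinearMap.mem_ker]
  exact Submodule.Quotient.mk_eq_zero _

/-- A deformation `ρ` with vanishing boundary value is a gauge deformation if and only if
`ρ_{2,1} = ∂̄ν` with `ν` zero along the boundary: in that case `ρ - 2 Re dν` has no `(2,1)`-part. -/
lemma ker_kerProj_eq [CompactSpace Z]
    (hmeet : ∀ x : Z, ∃ y : M, B.incl y ∈ connectedComponent x) :
    LinearMap.ker B.kerProj = LinearMap.ker B.lambda₀ := by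
  ext ρ
  rw [B.mem_ker_kerProj, B.mem_ker_lambda₀]
  constructor
  · intro h
    obtain ⟨ν, h0, hν⟩ := exists_of_mem_gauge h
    exact ⟨ν, h0, by rw [hν, C.rho21_twoRe_extD]⟩
  · rintro ⟨ν, h0, hν⟩
    let ρ' : B.infDef := ⟨_, B.twoRe_extD_mem_infDef ν h0⟩
    have hg := C.twoRe_extD_mem_gauge ν h0
    have hb : B.bdryₗ (ρ.1 - ρ') = 0 := by
      rw [map_sub, ρ.2, B.bdryₗ_eq_zero_iff.2 (B.bdry_of_mem_gauge hg), sub_zero]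
    have h21 : B.rho21ₗ (ρ.1 - ρ') = 0 := by
      rw [map_sub, sub_eq_zero]
      refine Subtype.ext ?_
      rw [rho21ₗ_coe, rho21ₗ_coe, ← hν]
      exact (C.rho21_twoRe_extD ν).symm
    have h := B.eq_zero_of_rho21_eq_zero hmeet (ρ.1 - ρ').2 (B.bdryₗ_eq_zero_iff.1 hb)
      (congrArg Subtype.val h21)
    have h1 : ρ.1.1 = CalabiYau.twoRe (extD ν.1) := sub_eq_zero.1 h
    rw [h1]
    exact hg

lemma lambda₀_surjective (hH31 : Subsingleton (C.Dolbeault 3 1))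
    (hCR : ∀ f : M → ℂ, B.IsCR f →
      ∃ F : Z → ℂ, C.IsHolomorphic F ∧ ∀ y, F (B.incl y) = f y) :
    Function.Surjective B.lambda₀ := by
  intro q
  obtain ⟨⟨σ, hσ, hN⟩, rfl⟩ := Submodule.Quotient.mk_surjective _ q
  obtain ⟨ρ, hρ, h21, hb⟩ := B.exists_deformation hH31 hCR (zero_mem _) hσ
    (B.represents_zero_iff.2 hN)
  rw [smul_zero] at hb
  refine ⟨⟨⟨ρ, hρ⟩, B.bdryₗ_eq_zero_iff.2 hb⟩, ?_⟩
  refine congrArg Submodule.Quotient.mk (Subtype.ext (Subtype.ext ?_))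
  exact h21

/-- The isomorphism `λ : ker b → H^{2,1}_N`, as the comparison of two surjections from the
deformations with vanishing boundary value. -/
lemma exists_lambda [CompactSpace Z]
    (hmeet : ∀ x : Z, ∃ y : M, B.incl y ∈ connectedComponent x)
    (hH31 : Subsingleton (C.Dolbeault 3 1))
    (hCR : ∀ f : M → ℂ, B.IsCR f →
      ∃ F : Z → ℂ, C.IsHolomorphic F ∧ ∀ y, F (B.incl y) = f y) :
    ∃ l : LinearMap.ker B.bMap ≃ₗ[ℝ] B.HN 2 1, B.IsLambda l.toLinearMap := by
  obtain ⟨l, hl⟩ := exists_linearEquiv_of_ker_eq B.kerProj_surjective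
    (B.lambda₀_surjective hH31 hCR) (B.ker_kerProj_eq hmeet)
  refine ⟨l, fun ρ h => ?_⟩
  let ρ' : LinearMap.ker B.bdryₗ := ⟨ρ, h⟩
  exact ⟨⟨B.rho21ₗ ρ, _⟩, fun x => rfl, hl ρ'⟩

end Lambda

section Iota

lemma mem_cocyclesT {σ : C.Omega 2 1} {γ : Form (𝓡 5) M ℝ 2} (hγ : γ ∈ B.HSpace)
    (h : B.Represents σ γ) : σ ∈ B.cocyclesT 2 1 :=
  ⟨C.dbarOmega σ, fun x hx => B.dbar_normal hγ h x hx, rfl⟩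

/-- The tangential cohomology class of `γ ∧ dz` does not depend on the representing form. -/
lemma mk_eq_mk_of_represents {σ₁ σ₂ : C.Omega 2 1} {γ : Form (𝓡 5) M ℝ 2} (hγ : γ ∈ B.HSpace)
    (h₁ : B.Represents σ₁ γ) (h₂ : B.Represents σ₂ γ) :
    (Submodule.Quotient.mk ⟨σ₁, B.mem_cocyclesT hγ h₁⟩ : B.HT 2 1) =
      Submodule.Quotient.mk ⟨σ₂, B.mem_cocyclesT hγ h₂⟩ :=
  (Submodule.Quotient.eq _).2 (Submodule.mem_sup_right (B.sub_mem_OmegaN h₁ h₂))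

lemma exists_iota [T2Space Z] [CompactSpace Z] :
    ∃ i : B.HSpace →ₗ[ℝ] B.HT 2 1, B.IsIota i := by
  choose s hs using fun γ : B.HSpace => B.exists_represents γ.2
  refine ⟨{
    toFun := fun γ => Submodule.Quotient.mk ⟨s γ, B.mem_cocyclesT γ.2 (hs γ)⟩
    map_add' := fun γ₁ γ₂ =>
      B.mk_eq_mk_of_represents (γ₁ + γ₂).2 (hs _) ((hs γ₁).add B (hs γ₂))
    map_smul' := fun c γ =>
      B.mk_eq_mk_of_represents (c • γ).2 (hs _) ((hs γ).smul B c) }, fun γ => ⟨_, hs γ⟩,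
    fun γ σ hσ => ⟨B.mem_cocyclesT γ.2 hσ, B.mk_eq_mk_of_represents γ.2 (hs γ) hσ⟩⟩

end Iota

section Coboundary

variable (p q : ℕ)

/-- `∂̄` from the tangential cocycles to the cocycles of the normal complex. -/
def dbarT : B.cocyclesT p q →ₗ[ℝ] B.cocyclesN p (q + 1) where
  toFun σ := ⟨C.dbarOmega σ.1, C.dbar_dbar σ.1, by
    obtain ⟨τ, hτ, h⟩ := σ.2
    have h1 : τ = C.dbarOmega σ.1 := Subtype.ext h
    rwa [← h1]⟩
  map_add' σ τ := Subtype.ext (Subtype.ext ((C.dbar p q).map_add σ.1 τ.1))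
  map_smul' c σ := Subtype.ext (Subtype.ext ((C.dbar p q).map_smul c σ.1))

lemma dbar_of_mem_exactForms {σ : C.Omega p q} (h : σ ∈ C.exactForms p q) :
    C.dbar p q σ = 0 := by
  cases q with
  | zero =>
    have h1 : σ = 0 := h
    rw [h1, map_zero]
  | succ q =>
    obtain ⟨τ, hτ⟩ := h
    have h1 : σ = C.dbarOmega τ := Subtype.ext hτ.symm
    rw [h1, C.dbar_dbar]

/-- The connecting map. -/
lemma exists_coboundary : ∃ δ : B.HT p q →ₗ[ℝ] B.HN p (q + 1), B.IsCoboundary p q δ := by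
  refine ⟨Submodule.liftQ _ ((Submodule.mkQ _) ∘ₗ B.dbarT p q) fun σ hσ => ?_,
    fun σ => ⟨B.dbarT p q σ, rfl, rfl⟩⟩
  refine (Submodule.Quotient.mk_eq_zero _).2 ?_
  obtain ⟨σ₁, h₁, σ₂, h₂, h⟩ := Submodule.mem_sup.1 hσ
  refine ⟨σ₂, h₂, ?_⟩
  have h3 : C.dbar p q σ.1 = C.dbar p q σ₂ := by
    have h4 : σ.1 = σ₁ + σ₂ := h.symm
    rw [h4, map_add, dbar_of_mem_exactForms p q h₁, zero_add]
  exact h3.symm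

end Coboundary

/-- The boundary values of infinitesimal deformations are the kernel of `δ ∘ ι`. -/
lemma range_bMap (hH31 : Subsingleton (C.Dolbeault 3 1))
    (hCR : ∀ f : M → ℂ, B.IsCR f →
      ∃ F : Z → ℂ, C.IsHolomorphic F ∧ ∀ y, F (B.incl y) = f y)
    {i : B.HSpace →ₗ[ℝ] B.HT 2 1} {δ : B.HT 2 1 →ₗ[ℝ] B.HN 2 2} (hi : B.IsIota i)
    (hδ : B.IsCoboundary 2 1 δ) : LinearMap.range B.bMap = LinearMap.ker (δ ∘ₗ i) := by
  ext γ
  rw [LinearMap.mem_range, LinearMap.mem_ker, LinearMap.comp_apply]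
  constructor
  · rintro ⟨k, rfl⟩
    obtain ⟨ρ, rfl⟩ := Submodule.Quotient.mk_surjective _ k
    obtain ⟨h1, h2⟩ := hi.2 (B.bMap (Submodule.Quotient.mk ρ)) _ (B.represents_rho21ₗ ρ)
    obtain ⟨τ, hτ, h3⟩ := hδ ⟨_, h1⟩
    rw [h2, h3]
    have h4 : τ = 0 := Subtype.ext (Subtype.ext (hτ.trans (by
      rw [map_smul, B.dbar_rho21ₗ, smul_zero]
      rfl)))
    rw [h4]
    rfl
  · intro h
    obtain ⟨σ, hσ⟩ := hi.1 γ
    obtain ⟨h1, h2⟩ := hi.2 γ σ hσ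
    obtain ⟨τ, hτ, h3⟩ := hδ ⟨σ, h1⟩
    rw [h2, h3] at h
    obtain ⟨ν, hν, h4⟩ := (Submodule.Quotient.mk_eq_zero _).1 h
    have h5 : C.dbar 2 1 (σ - ν) = 0 := by
      rw [map_sub, sub_eq_zero]
      exact hτ.symm.trans h4.symm
    have h6 : B.Represents (σ - ν) γ.1 := by
      have h7 := hσ.add B ((B.represents_zero_iff.2 hν).smul B (-1))
      rwa [smul_zero, add_zero, neg_one_smul, ← sub_eq_add_neg] at h7
    obtain ⟨ρ, hρ, -, hb⟩ := B.exists_deformation hH31 hCR γ.2 h5 h6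
    refine ⟨Submodule.Quotient.mk ((1 / 2 : ℝ) • ⟨ρ, hρ⟩), ?_⟩
    rw [bMap_mk, map_smul]
    refine Subtype.ext ?_
    change (1 / 2 : ℝ) • B.bdry ρ = γ.1
    rw [hb, smul_smul]
    norm_num

end StronglyPseudoconvexBoundary

end CYBoundary

end

open CYBoundary StronglyPseudoconvexBoundary in
theorem mainTheorem5
    {Z : Type*} [TopologicalSpace Z] [T2Space Z] [CompactSpace Z]
    [ChartedSpace (EuclideanHalfSpace 6) Z] [IsManifold (𝓡∂ 6) ∞ Z]
    {M : Type*} [TopologicalSpace M] [ChartedSpace (EuclideanSpace ℝ (Fin 5)) M]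
    [IsManifold (𝓡 5) ∞ M]
    (C : CalabiYau Z) (B : StronglyPseudoconvexBoundary C M)
    (hmeet : ∀ x : Z, ∃ y : M, B.incl y ∈ connectedComponent x)
    (hH31 : Subsingleton (C.Dolbeault 3 1))
    (hCR : ∀ f : M → ℂ, B.IsCR f →
      ∃ F : Z → ℂ, C.IsHolomorphic F ∧ ∀ y, F (B.incl y) = f y) :
    ∃ (b : B.KHat →ₗ[ℝ] B.HSpace) (l : LinearMap.ker b ≃ₗ[ℝ] B.HN 2 1)
      (i : B.HSpace →ₗ[ℝ] B.HT 2 1) (δ : B.HT 2 1 →ₗ[ℝ] B.HN 2 2),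
      B.IsBoundaryMap b ∧ B.IsLambda l.toLinearMap ∧ B.IsIota i ∧ B.IsCoboundary 2 1 δ ∧
      LinearMap.range b = LinearMap.ker (δ ∘ₗ i) ∧
      Function.Exact ((LinearMap.ker b).subtype ∘ₗ l.symm.toLinearMap) b ∧
      Function.Exact b (δ ∘ₗ i) := by
  obtain ⟨l, hl⟩ := B.exists_lambda hmeet hH31 hCR
  obtain ⟨i, hi⟩ := B.exists_iota
  obtain ⟨δ, hδ⟩ := B.exists_coboundary 2 1
  have hrange := B.range_bMap hH31 hCR hi hδ
  refine ⟨B.bMap, l, i, δ, B.isBoundaryMap_bMap, hl, hi, hδ, hrange, ?_,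
    LinearMap.exact_iff.2 hrange.symm⟩
  refine LinearMap.exact_iff.2 ?_
  rw [LinearMap.range_comp, LinearEquiv.range, Submodule.map_top, Submodule.range_subtype]
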